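/- Let $d\ge 1$ and let $\Delta=\{x\in\mathbb R^3_{\ge 0} : x_1+x_2+x_3=d\}$ be the Newton polygon of plane curves of degree $d$, with lattice points $\Delta\cap\mathbb Z^3=\{m\in\mathbb Z_{\ge0}^3: |m|=d\}$. Let $Z$ be a triangulation of $\Delta$ whose set of vertices is the set of all lattice points of $\Delta$, and let $w=(w_m)$ be real numbers indexed by the lattice points that satisfy the convexity condition $Z$: for every triangle $T$ of $Z$, the affine function that equals $w_m$ at the vertices $m$ of $T$ is strictly smaller than $w_m$ at all lattice points $m$ of $\Delta$ that are not vertices of $T$. Let $\Gamma_Z\subset\Delta$ be the graph dual to $Z$: the union, over the triangles $T$ of $Z$ and the edges $e$ of $T$, of the segment from the barycenter of $T$ to the midpoint of $e$. For $t>0$ let $p_d(z)=\sum_{|m|=d}t^{w_m}z^m$, let $C_{p_d}=\{p_d=0\}\subset\mathbb{CP}^2$, and let $$F_{t^w}:\mathbb{CP}^2\to\Delta,\qquad F_{t^w}([z])=\frac{\sum_{|m|=d}|t^{w_m}z^m|^2\,m}{\sum_{|m|=d}|t^{w_m}z^m|^2}$$ be the moment map of the toric Kähler form with potential $\log\sum_{|m|=d}|t^{w_m}z^m|^2$.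 Then for all sufficiently small $t>0$ the image $K=F_{t^w}(C_{p_d})$ is a fattening of $\Gamma_Z$, in the following sense: for every $\varepsilon>0$ there is $t_0>0$ such that for all $t\in(0,t_0)$ * $K$ is the closure of its interior in $\Delta$; and * there is a homeomorphism $h:\Delta\to\Delta$ that moves every point by less than $\varepsilon$ (in the sup norm of $\mathbb R^3$) and maps every simplex of $Z$ onto itself, such that $h(\Gamma_Z)\subset K$ is a strong deformation retract of $K$ and $K\cap\partial\Delta\subset h(\Gamma_Z)$. -/

import Mathlib

open scoped LinearAlgebra.Projectivization

noncomputable section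

namespace Fattening

/-- The exponents `m = (m₁, m₂, m₃)`, `|m| = d`, of the degree `d` monomials in three variables. -/
def exponents (d : ℕ) : Finset (Fin 3 → ℕ) := Finset.piAntidiag Finset.univ d

/-- An exponent, seen as a point of `ℝ³`. -/
def toReal (m : Fin 3 → ℕ) : Fin 3 → ℝ := fun i => (m i : ℝ)

/-- The Newton polygon `Δ_d = {x ∈ ℝ³ | xᵢ ≥ 0, x₁ + x₂ + x₃ = d}` of a degree `d` curve. -/
def newtonPolygon (d : ℕ) : Set (Fin 3 → ℝ) := {x | (∀ i, 0 ≤ x i) ∧ ∑ i, x i = d}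

/-- The boundary of the Newton polygon: the union of its three edges. -/
def polygonBoundary (d : ℕ) : Set (newtonPolygon d) := {x | ∃ i, (x : Fin 3 → ℝ) i = 0}

/-! ### The curve and the moment map -/

/-- The homogeneous polynomial `p_d(z) = ∑_{|m| = d} c_m z^m` with real coefficient set `c`. -/
def curvePoly (d : ℕ) (c : (Fin 3 → ℕ) → ℝ) : MvPolynomial (Fin 3) ℂ :=
  ∑ m ∈ exponents d, MvPolynomial.C (c m : ℂ) * ∏ i, MvPolynomial.X i ^ m i

/-- The curve `{p_d = 0}` in `ℂP²`. -/
def curve (d : ℕ) (c : (Fin 3 → ℕ) → ℝ) : Set (ℙ ℂ (Fin 3 → ℂ)) :=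
  {P | MvPolynomial.eval P.rep (curvePoly d c) = 0}

/-- The weight `|c_m z^m|²`. -/
def weight (c : (Fin 3 → ℕ) → ℝ) (z : Fin 3 → ℂ) (m : Fin 3 → ℕ) : ℝ :=
  ‖(c m : ℂ) * ∏ i, z i ^ m i‖ ^ 2

/-- The vector `∑_m |c_m z^m|² m / ∑_m |c_m z^m|²`. -/
def momentVec (d : ℕ) (c : (Fin 3 → ℕ) → ℝ) (z : Fin 3 → ℂ) : Fin 3 → ℝ :=
  (∑ m ∈ exponents d, weight c z m)⁻¹ • ∑ m ∈ exponents d, weight c z m • toReal m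

/-- The moment map `F_c : ℂP² → Δ_d`, `F_c([z]) = ∑_m |c_m z^m|² m / ∑_m |c_m z^m|²`, of the
toric Kähler form with potential `log ∑_m |c_m z^m|²`. -/
def momentMap (d : ℕ) (c : (Fin 3 → ℕ) → ℝ) (P : ℙ ℂ (Fin 3 → ℂ)) : Fin 3 → ℝ :=
  momentVec d c P.rep

/-- The moment map image `F_c(C)` of the curve, as a subset of `Δ_d`. -/
def momentImage (d : ℕ) (c : (Fin 3 → ℕ) → ℝ) : Set (newtonPolygon d) :=
  Subtype.val ⁻¹' (momentMap d c '' curve d c)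

/-! ### Triangulations, the convexity condition, and the dual graph -/

/-- `Z` is a triangulation of `Δ_d` whose set of vertices is the set of all lattice points. -/
structure IsFullTriangulation (d : ℕ) (Z : Geometry.SimplicialComplex ℝ (Fin 3 → ℝ)) : Prop where
  space_eq : Z.space = newtonPolygon d
  vertices_eq : Z.vertices = toReal '' (exponents d : Set (Fin 3 → ℕ))

/-- `w` is strictly convex with respect to `Z`: for every triangle of `Z` the affine function that
agrees with `w` at its vertices is strictly smaller than `w` at all other lattice points. -/
def ConvexityCondition (d : ℕ) (Z : Geometry.SimplicialComplex ℝ (Fin 3 → ℝ))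
    (w : (Fin 3 → ℕ) → ℝ) : Prop :=
  ∀ s ∈ Z.faces, s.card = 3 → ∃ l : (Fin 3 → ℝ) →ᵃ[ℝ] ℝ,
    ∀ m ∈ exponents d, (toReal m ∈ s → l (toReal m) = w m) ∧ (toReal m ∉ s → l (toReal m) < w m)

/-- The graph `Γ_Z` dual to `Z`: in each triangle of `Z`, the three segments from its barycenter to
the midpoints of its edges. (It is the union of those simplices of the barycentric subdivision of
`Z` that contain no vertex of `Z`.) -/
def dualGraph (d : ℕ) (Z : Geometry.SimplicialComplex ℝ (Fin 3 → ℝ)) : Set (newtonPolygon d) :=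
  {x | ∃ s ∈ Z.faces, ∃ e ∈ Z.faces, s.card = 3 ∧ e.card = 2 ∧ e ⊆ s ∧
    (x : Fin 3 → ℝ) ∈ segment ℝ (s.centroid ℝ id) (e.centroid ℝ id)}

/-! ### Fattenings -/

/-- `A` is a strong deformation retract of `K`. -/
def IsStrongDeformationRetract {X : Type*} [TopologicalSpace X] (A K : Set X) : Prop :=
  A ⊆ K ∧ ∃ r : C(K, K), (∀ x, (r x : X) ∈ A) ∧
    (ContinuousMap.id K).HomotopicRel r {x | (x : X) ∈ A}

/-- A homeomorphism of `Δ_d` that maps every simplex of `Z` onto itself. -/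
def PreservesSimplices {d : ℕ} (Z : Geometry.SimplicialComplex ℝ (Fin 3 → ℝ))
    (h : newtonPolygon d ≃ₜ newtonPolygon d) : Prop :=
  ∀ s ∈ Z.faces, ∀ x : newtonPolygon d,
    (h x : Fin 3 → ℝ) ∈ convexHull ℝ (s : Set (Fin 3 → ℝ)) ↔
      (x : Fin 3 → ℝ) ∈ convexHull ℝ (s : Set (Fin 3 → ℝ))

/-- `K ⊆ Δ_d` is a fattening of `Γ_Z`, up to `ε`: it is a two-dimensional region (the closure of its
interior), and it strongly deformation retracts onto a copy `h(Γ_Z)` of the graph, where the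
homeomorphism `h` of `Δ_d` moves every point by less than `ε` and preserves all simplices of `Z`;
moreover `K` touches the boundary of `Δ_d` only at the end points of the graph. -/
def IsFattening (d : ℕ) (Z : Geometry.SimplicialComplex ℝ (Fin 3 → ℝ)) (ε : ℝ)
    (K : Set (newtonPolygon d)) : Prop :=
  closure (interior K) = K ∧
  ∃ h : newtonPolygon d ≃ₜ newtonPolygon d,
    (∀ x, dist (h x) x < ε) ∧ PreservesSimplices Z h ∧
    IsStrongDeformationRetract (h '' dualGraph d Z) K ∧
    K ∩ polygonBoundary d ⊆ h '' dualGraph d Z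

/-! ### The curve and the moment map do not depend on the choice of homogeneous coordinates -/

theorem eval_curvePoly (d : ℕ) (c : (Fin 3 → ℕ) → ℝ) (z : Fin 3 → ℂ) :
    MvPolynomial.eval z (curvePoly d c) = ∑ m ∈ exponents d, (c m : ℂ) * ∏ i, z i ^ m i := by
  simp [curvePoly]

theorem prod_smul {d : ℕ} {m : Fin 3 → ℕ} (hm : m ∈ exponents d) (a : ℂ) (z : Fin 3 → ℂ) :
    ∏ i, (a • z) i ^ m i = a ^ d * ∏ i, z i ^ m i := by
  have h : ∑ i, m i = d := by
    simpa [exponents] using hm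
  simp only [Pi.smul_apply, smul_eq_mul, mul_pow, Finset.prod_mul_distrib,
    Finset.prod_pow_eq_pow_sum, h]

theorem mk_mem_curve (d : ℕ) (c : (Fin 3 → ℕ) → ℝ) (z : Fin 3 → ℂ) (hz : z ≠ 0) :
    Projectivization.mk ℂ z hz ∈ curve d c ↔ MvPolynomial.eval z (curvePoly d c) = 0 := by
  obtain ⟨a, ha⟩ := Projectivization.exists_smul_eq_mk_rep ℂ z hz
  have h : MvPolynomial.eval ((a : ℂ) • z) (curvePoly d c)
      = (a : ℂ) ^ d * MvPolynomial.eval z (curvePoly d c) := by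
    rw [eval_curvePoly, eval_curvePoly, Finset.mul_sum]
    refine Finset.sum_congr rfl fun m hm => ?_
    rw [prod_smul hm]
    ring
  rw [curve, Set.mem_ofPred_eq, ← ha, Units.smul_def, h]
  simp

theorem weight_smul {d : ℕ} {m : Fin 3 → ℕ} (hm : m ∈ exponents d) (c : (Fin 3 → ℕ) → ℝ) (a : ℂ)
    (z : Fin 3 → ℂ) : weight c (a • z) m = ‖a ^ d‖ ^ 2 * weight c z m := by
  rw [weight, weight, prod_smul hm]
  simp only [norm_mul]
  ring

theorem momentMap_mk (d : ℕ) (c : (Fin 3 → ℕ) → ℝ) (z : Fin 3 → ℂ) (hz : z ≠ 0) :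
    momentMap d c (Projectivization.mk ℂ z hz) = momentVec d c z := by
  obtain ⟨a, ha⟩ := Projectivization.exists_smul_eq_mk_rep ℂ z hz
  have hA : ‖(a : ℂ) ^ d‖ ^ 2 ≠ 0 := by simp
  rw [momentMap, ← ha, Units.smul_def, momentVec, momentVec,
    Finset.sum_congr rfl fun m hm => weight_smul hm c (a : ℂ) z,
    Finset.sum_congr rfl fun m hm =>
      congrArg (fun r : ℝ => r • toReal m) (weight_smul hm c (a : ℂ) z)]
  simp only [mul_smul]
  rw [← Finset.mul_sum, ← Finset.smul_sum, smul_smul, mul_inv, mul_right_comm,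
    inv_mul_cancel₀ hA, one_mul]

/-- For positive coefficients the moment map takes its values in the Newton polygon. -/
theorem momentMap_mem (d : ℕ) (c : (Fin 3 → ℕ) → ℝ) (hc : ∀ m ∈ exponents d, 0 < c m)
    (P : ℙ ℂ (Fin 3 → ℂ)) : momentMap d c P ∈ newtonPolygon d := by
  have hw : ∀ m, 0 ≤ weight c P.rep m := fun m => by unfold weight; positivity
  have hS : 0 < ∑ m ∈ exponents d, weight c P.rep m := by
    obtain ⟨i, hi⟩ : ∃ i, P.rep i ≠ 0 := by
      by_contra! h
      exact P.rep_nonzero (funext h)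
    have hm : Pi.single i d ∈ exponents d := by simp [exponents]
    refine Finset.sum_pos' (fun m _ => hw m) ⟨_, hm, ?_⟩
    have h1 : (c (Pi.single i d) : ℂ) ≠ 0 := by exact_mod_cast (hc _ hm).ne'
    have h2 : ∏ j, P.rep j ^ (Pi.single i d : Fin 3 → ℕ) j ≠ 0 := by
      refine Finset.prod_ne_zero_iff.2 fun j _ => ?_
      by_cases hj : j = i
      · subst hj; exact pow_ne_zero _ hi
      · simp [Pi.single_eq_of_ne hj]
    have := norm_pos_iff.2 (mul_ne_zero h1 h2)
    unfold weight
    positivity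
  constructor
  · intro i
    simp only [momentMap, momentVec, Pi.smul_apply, Finset.sum_apply, smul_eq_mul, toReal]
    exact mul_nonneg (inv_nonneg.2 hS.le)
      (Finset.sum_nonneg fun m _ => mul_nonneg (hw m) (Nat.cast_nonneg _))
  · simp only [momentMap, momentVec, Pi.smul_apply, Finset.sum_apply, smul_eq_mul, toReal]
    rw [← Finset.mul_sum, Finset.sum_comm]
    have : ∀ m ∈ exponents d, ∑ i, weight c P.rep m * (m i : ℝ) = weight c P.rep m * d := by
      intro m hm
      have h : ∑ i, m i = d := by simpa [exponents] using hm
      rw [← Finset.mul_sum, ← h]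
      push_cast
      rfl
    rw [Finset.sum_congr rfl this, ← Finset.sum_mul, inv_mul_cancel_left₀ hS.ne']

end Fattening

end

noncomputable section

namespace Fattening

/-! ### Amplitudes: the moment map in terms of normalised absolute values of monomials -/

/-! Every point `x` of `Δ` has a unique vector of normalised amplitudes `a_m = t^{w_m} r^m` whose
squares have mean `x`. Hence `x` lies in `K` exactly when the numbers `a_m`, multiplied by the
phases `e^{i⟨m,θ⟩}` of some torus element, sum to zero (`mem_momentImage_iff`). Convexity of `w`
makes the amplitudes at a point of a triangle concentrate on its vertices `v 0`, `v 1`, `v 2`: `a_{v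
i}²` is close to the barycentric coordinate `λ_i`, and all other amplitudes are small
(`IsFlag.sum_others_le`). The triangles are unimodular (`IsFlag.icoord_cast`), so after division by
the term of `v 0` the equation becomes `1 + y (1 + κ e^{iω}) + ρ = 0` with `|y| = a_{v 1} / a_{v
0}`, `κ = a_{v 2} / a_{v 1}` and `ρ` small: locally the curve is a perturbed line.

To describe `K`, cut every triangle into three sectors, one along each side, and foliate a sector by
broken lines (fibres) that join `v 0` to `v 1` through a point of the dual graph. Each half of a
fibre lies on a ray `λ₂ = l λ₁` through a vertex. Along such a ray `κ` and `ρ` vary slowly with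
`|y|` (`level_set_slope`, `exists_isTame`). A contraction argument then yields one root `y` for each
admissible `ω`, with modulus continuous in `ω`, so the moduli that occur form an interval
(`RootFamily.ordConnected_moduli`): `K` is connected on each half fibre.

Away from the sides of the triangle this interval contains the point of the dual graph
(`IsFlag.fibPoint_zero_mem`). Near a side `κ` can be smaller than `ρ` and the graph can miss `K`.
There a real point of the curve with one negative coordinate takes its place; on each fibre it is
unique and close to the graph (`IsFlag.exists_real`, `IsFlag.abs_real_le`). It depends only on the
edge when it lies on the side, so adjacent triangles agree, and on `∂Δ` it is the only point of `K`.
The homeomorphism `h` moves the graph along the fibres to these centres. On each fibre `K` is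
star-shaped about the centre (`Setup.star`), and sliding along the fibres is the retraction.

For the closure of the interior, logarithmic coordinates turn `K` inside `Δ` into the amoeba of an
exponential sum in `Y`, `W`. A branch `Y = g(W)` of zeros gives interior points wherever `g'` is not
real. If `g'` is real throughout, `g` is affine with real slope, and the groups of terms of equal
frequency vanish separately; but in some group a single vertex term dominates all the rest
(`mem_closure_interior_amoeba`). Boundary points of `K` are limits of interior points of `Δ` along
the moved graph. -/

theorem mem_exponents {d : ℕ} {m : Fin 3 → ℕ} : m ∈ exponents d ↔ ∑ i, m i = d := by
  simp [exponents]

theorem single_mem_exponents (d : ℕ) (i : Fin 3) : Pi.single i d ∈ exponents d := by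
  simp [exponents]

/-- `a` is the vector of normalised absolute values `c_m r^m` of the monomials at a point `r` of the
nonnegative octant whose moment vector is `x`. -/
structure IsAmplitude (d : ℕ) (c : (Fin 3 → ℕ) → ℝ) (x : Fin 3 → ℝ) (a : (Fin 3 → ℕ) → ℝ)
    (r : Fin 3 → ℝ) : Prop where
  nonneg : ∀ i, 0 ≤ r i
  eq_mul : ∀ m ∈ exponents d, a m = c m * ∏ i, r i ^ m i
  eq_zero : ∀ m ∉ exponents d, a m = 0
  sum_sq : ∑ m ∈ exponents d, a m ^ 2 = 1
  mean : ∀ i, ∑ m ∈ exponents d, a m ^ 2 * m i = x i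

/-! ### Existence of amplitudes, by maximisation -/

section Existence

variable {d : ℕ} {c : (Fin 3 → ℕ) → ℝ}

theorem sum_sq_pos (hc : ∀ m ∈ exponents d, 0 < c m) {r : Fin 3 → ℝ} (hr : ∀ i, 0 ≤ r i)
    (h0 : r ≠ 0) : 0 < ∑ m ∈ exponents d, (c m * ∏ i, r i ^ m i) ^ 2 := by
  obtain ⟨i, hi⟩ : ∃ i, r i ≠ 0 := by
    by_contra! h
    exact h0 (funext h)
  refine Finset.sum_pos' (fun m _ => sq_nonneg _) ⟨_, single_mem_exponents d i, ?_⟩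
  have h2 : ∏ j, r j ^ (Pi.single i d : Fin 3 → ℕ) j ≠ 0 := by
    refine Finset.prod_ne_zero_iff.2 fun j _ => ?_
    by_cases hj : j = i
    · subst hj; exact pow_ne_zero _ hi
    · simp [Pi.single_eq_of_ne hj]
  have h3 := (hc _ (single_mem_exponents d i)).ne'
  positivity

theorem prod_smul_real {m : Fin 3 → ℕ} (hm : m ∈ exponents d) (s : ℝ) (r : Fin 3 → ℝ) :
    ∏ i, (s * r i) ^ m i = s ^ d * ∏ i, r i ^ m i := by
  simp only [mul_pow, Finset.prod_mul_distrib, Finset.prod_pow_eq_pow_sum, mem_exponents.1 hm]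

/-- A positive multiple of a nonzero nonnegative vector has total weight one. -/
theorem exists_scale (hd : 1 ≤ d) (hc : ∀ m ∈ exponents d, 0 < c m) {r : Fin 3 → ℝ}
    (hr : ∀ i, 0 ≤ r i) (h0 : r ≠ 0) :
    ∃ s : ℝ, 0 < s ∧ (s ^ d) ^ 2 * ∑ m ∈ exponents d, (c m * ∏ i, r i ^ m i) ^ 2 = 1 := by
  have hW := sum_sq_pos hc hr h0
  set W := ∑ m ∈ exponents d, (c m * ∏ i, r i ^ m i) ^ 2
  -- The weight is homogeneous of degree `2 d` in the radii, hence the scale `W ^ (-1 / (2 d))`.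
  refine ⟨((Real.sqrt W)⁻¹) ^ ((d : ℝ)⁻¹), by positivity, ?_⟩
  rw [Real.rpow_inv_natCast_pow (by positivity) (by omega), inv_pow, Real.sq_sqrt hW.le,
    inv_mul_cancel₀ hW.ne']

/-- The moment condition is homogeneous in the radii, so it can be checked before normalisation. -/
theorem isAmplitude_of_scale (hc : ∀ m ∈ exponents d, 0 < c m) {r : Fin 3 → ℝ}
    (hr : ∀ i, 0 ≤ r i) {x : Fin 3 → ℝ} {s : ℝ} (hs : 0 < s)
    (h1 : (s ^ d) ^ 2 * ∑ m ∈ exponents d, (c m * ∏ i, r i ^ m i) ^ 2 = 1)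
    (hx : ∀ i, ∑ m ∈ exponents d, (c m * ∏ i, r i ^ m i) ^ 2 * m i =
      x i * ∑ m ∈ exponents d, (c m * ∏ i, r i ^ m i) ^ 2) :
    IsAmplitude d c x (fun m => if m ∈ exponents d then s ^ d * (c m * ∏ i, r i ^ m i) else 0)
      (fun i => s * r i) where
  nonneg i := mul_nonneg hs.le (hr i)
  eq_mul m hm := by rw [if_pos hm, prod_smul_real hm]; ring
  eq_zero m hm := by rw [if_neg hm]
  sum_sq := by
    rw [← h1, Finset.mul_sum]
    exact Finset.sum_congr rfl fun m hm => by rw [if_pos hm]; ring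
  mean i := by
    have : ∑ m ∈ exponents d,
        (if m ∈ exponents d then s ^ d * (c m * ∏ i, r i ^ m i) else 0) ^ 2 * (m i : ℝ) =
        (s ^ d) ^ 2 * ∑ m ∈ exponents d, (c m * ∏ i, r i ^ m i) ^ 2 * m i := by
      rw [Finset.mul_sum]
      exact Finset.sum_congr rfl fun m hm => by rw [if_pos hm]; ring
    rw [this, hx, mul_left_comm, h1, mul_one]

/-- The critical point equation at a maximum of `∏ r_i^{2 x_i} / ∑ (c_m r^m)²`. -/
theorem exists_moment (hd : 1 ≤ d) (hc : ∀ m ∈ exponents d, 0 < c m) {x : Fin 3 → ℝ}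
    (hx : x ∈ newtonPolygon d) :
    ∃ r : Fin 3 → ℝ, (∀ i, 0 ≤ r i) ∧ r ≠ 0 ∧
      ∀ i, ∑ m ∈ exponents d, (c m * ∏ i, r i ^ m i) ^ 2 * m i =
        x i * ∑ m ∈ exponents d, (c m * ∏ i, r i ^ m i) ^ 2 := by
  set W : (Fin 3 → ℝ) → ℝ := fun r => ∑ m ∈ exponents d, (c m * ∏ i, r i ^ m i) ^ 2 with hWdef
  set Q : (Fin 3 → ℝ) → ℝ := fun r => ∏ i, r i ^ (2 * x i) with hQdef
  have hne : ∀ r ∈ stdSimplex ℝ (Fin 3), r ≠ 0 := by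
    rintro r hr rfl
    simpa using hr.2
  have hWpos : ∀ r ∈ stdSimplex ℝ (Fin 3), 0 < W r := fun r hr => sum_sq_pos hc hr.1 (hne r hr)
  have hcont : ContinuousOn (fun r => Q r / W r) (stdSimplex ℝ (Fin 3)) := by
    refine ContinuousOn.div ?_ ?_ fun r hr => (hWpos r hr).ne'
    · refine Continuous.continuousOn ?_
      refine continuous_finsetProd _ fun i _ => ?_
      exact (Real.continuous_rpow_const (by have := hx.1 i; linarith)).comp (continuous_apply i)
    · exact Continuous.continuousOn (by fun_prop)
  obtain ⟨r, hr, hmax⟩ := (isCompact_stdSimplex ℝ (Fin 3)).exists_isMaxOn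
    ⟨_, single_mem_stdSimplex ℝ (0 : Fin 3)⟩ hcont
  -- Numerator and denominator have the same degree `2 d`, because `∑ x i = d`. The maximum over the
  -- simplex is therefore a maximum over all nonzero nonnegative vectors.
  have hcmp : ∀ r' : Fin 3 → ℝ, (∀ i, 0 ≤ r' i) → r' ≠ 0 → Q r' * W r ≤ Q r * W r' := by
    intro r' h' h0
    have hpos : 0 < ∑ i, r' i := by
      obtain ⟨i, hi⟩ : ∃ i, r' i ≠ 0 := by
        by_contra! h
        exact h0 (funext h)
      exact Finset.sum_pos' (fun i _ => h' i)
        ⟨i, Finset.mem_univ _, lt_of_le_of_ne (h' i) hi.symm⟩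
    set S := ∑ i, r' i
    have hmem : (fun i => S⁻¹ * r' i) ∈ stdSimplex ℝ (Fin 3) := by
      refine ⟨fun i => mul_nonneg (inv_nonneg.2 hpos.le) (h' i), ?_⟩
      rw [← Finset.mul_sum, inv_mul_cancel₀ hpos.ne']
    have h1 : Q (fun i => S⁻¹ * r' i) = (S⁻¹) ^ (2 * d) * Q r' := by
      simp only [hQdef]
      rw [Finset.prod_congr rfl fun i _ => Real.mul_rpow (inv_nonneg.2 hpos.le) (h' i),
        Finset.prod_mul_distrib]
      congr 1
      rw [← Real.rpow_sum_of_pos (inv_pos.2 hpos), ← Finset.mul_sum, hx.2]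
      exact_mod_cast Real.rpow_natCast _ _
    have h2 : W (fun i => S⁻¹ * r' i) = (S⁻¹) ^ (2 * d) * W r' := by
      simp only [hWdef]
      rw [Finset.mul_sum]
      refine Finset.sum_congr rfl fun m hm => ?_
      rw [prod_smul_real hm]
      ring
    have h3 : Q (fun i => S⁻¹ * r' i) / W (fun i => S⁻¹ * r' i) ≤ Q r / W r := hmax hmem
    rw [h1, h2, mul_div_mul_left _ _ (by positivity),
      div_le_div_iff₀ (sum_sq_pos hc h' h0) (hWpos r hr)] at h3
    exact h3
  -- Comparison with the vector `(1, 1, 1)`, where `Q` is one.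
  have hQ : 0 < Q r := by
    have h1 := hcmp (fun _ => 1) (fun _ => zero_le_one) (by
      intro h; simpa using congrFun h 0)
    have h2 : 0 < W (fun _ => 1) := sum_sq_pos hc (fun _ => zero_le_one) (by
      intro h; simpa using congrFun h 0)
    have h3 : Q (fun _ => 1) = 1 := by simp [hQdef]
    rw [h3, one_mul] at h1
    exact pos_of_mul_pos_left ((hWpos r hr).trans_le h1) h2.le
  refine ⟨r, hr.1, hne r hr, fun i => ?_⟩
  -- In `Q` the convention `0 ^ 0 = 1` is in force: as `Q r > 0`, a coordinate of `r` can vanish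
  -- only where that of `x` does, and then both sides of the moment equation are zero.
  rcases (hr.1 i).eq_or_lt with h0 | hpos
  · have hxi : x i = 0 := by
      by_contra hxi
      refine hQ.ne' (Finset.prod_eq_zero (Finset.mem_univ i) ?_)
      rw [← h0, Real.zero_rpow (by simpa using hxi)]
    rw [hxi, zero_mul]
    refine Finset.sum_eq_zero fun m _ => ?_
    by_cases hm : m i = 0
    · simp [hm]
    · rw [Finset.prod_eq_zero (Finset.mem_univ i) (by rw [← h0, zero_pow hm])]
      simp
  -- Otherwise multiply `r i` by `exp s`. The inequality of maximality is an equality at `s = 0`,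
  -- and its derivative there is the moment equation in coordinate `i`.
  · have hupd : ∀ (s : ℝ) (m : Fin 3 → ℕ),
        ∏ j, (Function.update r i (Real.exp s * r i)) j ^ m j =
          Real.exp (s * m i) * ∏ j, r j ^ m j := by
      intro s m
      rw [← Finset.mul_prod_erase _ _ (Finset.mem_univ i),
        ← Finset.mul_prod_erase Finset.univ (fun j => r j ^ m j) (Finset.mem_univ i),
        Finset.prod_congr rfl fun j hj => by
          rw [Function.update_of_ne (Finset.ne_of_mem_erase hj)]]
      rw [Function.update_self, mul_pow, mul_comm s, Real.exp_nat_mul]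
      ring
    have hupdQ : ∀ s : ℝ, Q (Function.update r i (Real.exp s * r i)) =
        Real.exp (s * (2 * x i)) * Q r := by
      intro s
      simp only [hQdef]
      rw [← Finset.mul_prod_erase _ _ (Finset.mem_univ i),
        ← Finset.mul_prod_erase Finset.univ (fun j => r j ^ (2 * x j)) (Finset.mem_univ i),
        Finset.prod_congr rfl fun j hj => by
          rw [Function.update_of_ne (Finset.ne_of_mem_erase hj)]]
      rw [Function.update_self, Real.mul_rpow (Real.exp_pos s).le hpos.le, ← Real.exp_mul]
      ring
    have hineq : ∀ s : ℝ, Real.exp (s * (2 * x i)) * W r ≤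
        ∑ m ∈ exponents d, Real.exp (s * (2 * m i)) * (c m * ∏ i, r i ^ m i) ^ 2 := by
      intro s
      have h1 := hcmp (Function.update r i (Real.exp s * r i))
        (fun j => by
          by_cases hj : j = i
          · subst hj; rw [Function.update_self]; positivity
          · rw [Function.update_of_ne hj]; exact hr.1 j)
        (fun h => by
          have := congrFun h i
          rw [Function.update_self] at this
          have h4 : 0 < Real.exp s * r i := by positivity
          exact h4.ne' this)
      rw [hupdQ] at h1
      have h2 : W (Function.update r i (Real.exp s * r i)) =
          ∑ m ∈ exponents d, Real.exp (s * (2 * m i)) * (c m * ∏ i, r i ^ m i) ^ 2 := by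
        refine Finset.sum_congr rfl fun m _ => ?_
        rw [hupd, show s * (2 * (m i : ℝ)) = s * m i + s * m i by ring, Real.exp_add]
        ring
      rw [h2] at h1
      have h3 : Q r * (Real.exp (s * (2 * x i)) * W r) ≤ Q r * ∑ m ∈ exponents d,
          Real.exp (s * (2 * m i)) * (c m * ∏ i, r i ^ m i) ^ 2 := by
        calc _ = Real.exp (s * (2 * x i)) * Q r * W r := by ring
          _ ≤ _ := h1
      exact le_of_mul_le_mul_left h3 hQ
    have hmin : IsLocalMin (fun s : ℝ => ∑ m ∈ exponents d, Real.exp (s * (2 * m i)) *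
        (c m * ∏ i, r i ^ m i) ^ 2 - Real.exp (s * (2 * x i)) * W r) 0 := by
      refine Filter.Eventually.of_forall fun s => ?_
      simp only [zero_mul, Real.exp_zero, one_mul]
      have := hineq s
      simp only [hWdef] at this ⊢
      linarith
    have hexp : ∀ k : ℝ, HasDerivAt (fun s : ℝ => Real.exp (s * k)) k 0 := by
      intro k
      simpa using ((hasDerivAt_id (0 : ℝ)).mul_const k).exp
    have hder : HasDerivAt (fun s : ℝ => ∑ m ∈ exponents d, Real.exp (s * (2 * m i)) *
        (c m * ∏ i, r i ^ m i) ^ 2 - Real.exp (s * (2 * x i)) * W r)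
        (∑ m ∈ exponents d, (2 * m i) * (c m * ∏ i, r i ^ m i) ^ 2 - (2 * x i) * W r) 0 :=
      (HasDerivAt.fun_sum fun m _ => (hexp _).mul_const _).sub ((hexp _).mul_const _)
    have h0 := hmin.hasDerivAt_eq_zero hder
    have h5 : ∑ m ∈ exponents d, (2 * (m i : ℝ)) * (c m * ∏ i, r i ^ m i) ^ 2 =
        2 * ∑ m ∈ exponents d, (c m * ∏ i, r i ^ m i) ^ 2 * m i := by
      rw [Finset.mul_sum]
      exact Finset.sum_congr rfl fun m _ => by ring
    rw [h5] at h0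
    simp only [hWdef] at h0 ⊢
    linarith

theorem exists_isAmplitude (hd : 1 ≤ d) (hc : ∀ m ∈ exponents d, 0 < c m) {x : Fin 3 → ℝ}
    (hx : x ∈ newtonPolygon d) : ∃ a r, IsAmplitude d c x a r := by
  obtain ⟨r, hr, h0, h⟩ := exists_moment hd hc hx
  obtain ⟨s, hs, h1⟩ := exists_scale hd hc hr h0
  exact ⟨_, _, isAmplitude_of_scale hc hr hs h1 h⟩

end Existence

/-! ### Support and uniqueness of amplitudes -/

namespace IsAmplitude

variable {d : ℕ} {c : (Fin 3 → ℕ) → ℝ} {x : Fin 3 → ℝ} {a a' : (Fin 3 → ℕ) → ℝ}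
  {r r' : Fin 3 → ℝ}

theorem amp_nonneg (h : IsAmplitude d c x a r) (hc : ∀ m ∈ exponents d, 0 < c m)
    (m : Fin 3 → ℕ) : 0 ≤ a m := by
  by_cases hm : m ∈ exponents d
  · rw [h.eq_mul m hm]
    exact mul_nonneg (hc m hm).le (Finset.prod_nonneg fun i _ => pow_nonneg (h.nonneg i) _)
  · rw [h.eq_zero m hm]

/-- The monomial `z_i^d` enters the mean with the factor `d > 0`, so `x i = 0` forces its weight,
hence `r i`, to vanish. -/
theorem eq_zero_iff (h : IsAmplitude d c x a r) (hd : 1 ≤ d) (hc : ∀ m ∈ exponents d, 0 < c m)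
    (i : Fin 3) : r i = 0 ↔ x i = 0 := by
  constructor
  · intro hi
    rw [← h.mean i]
    refine Finset.sum_eq_zero fun m hm => ?_
    by_cases h0 : m i = 0
    · simp [h0]
    · rw [h.eq_mul m hm, Finset.prod_eq_zero (Finset.mem_univ i) (by rw [hi, zero_pow h0])]
      simp
  · intro hi
    rw [← h.mean i] at hi
    have h1 := (Finset.sum_eq_zero_iff_of_nonneg fun m _ => by positivity).1 hi _
      (single_mem_exponents d i)
    have hd' : (d : ℝ) ≠ 0 := by positivity
    simp only [Pi.single_eq_same, mul_eq_zero, hd', or_false] at h1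
    rw [sq_eq_zero_iff, h.eq_mul _ (single_mem_exponents d i), mul_eq_zero,
      or_iff_right (hc _ (single_mem_exponents d i)).ne', Finset.prod_eq_zero_iff] at h1
    obtain ⟨j, -, hj⟩ := h1
    by_cases hji : j = i
    · subst hji
      exact eq_zero_of_pow_eq_zero hj
    · simp [Pi.single_eq_of_ne hji] at hj

theorem amp_pos (h : IsAmplitude d c x a r) (hd : 1 ≤ d) (hc : ∀ m ∈ exponents d, 0 < c m)
    {m : Fin 3 → ℕ} (hm : m ∈ exponents d) (hx : ∀ i, m i ≠ 0 → x i ≠ 0) : 0 < a m := by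
  rw [h.eq_mul m hm]
  refine mul_pos (hc m hm) (Finset.prod_pos fun i _ => ?_)
  by_cases h0 : m i = 0
  · simp [h0]
  · have := (h.eq_zero_iff hd hc i).not.2 (hx i h0)
    exact pow_pos (lt_of_le_of_ne (h.nonneg i) (Ne.symm this)) _

theorem amp_eq_zero (h : IsAmplitude d c x a r) (hd : 1 ≤ d) (hc : ∀ m ∈ exponents d, 0 < c m)
    {m : Fin 3 → ℕ} {i : Fin 3} (hm : m i ≠ 0) (hx : x i = 0) : a m = 0 := by
  by_cases h0 : m ∈ exponents d
  · rw [h.eq_mul m h0, Finset.prod_eq_zero (Finset.mem_univ i), mul_zero]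
    rw [(h.eq_zero_iff hd hc i).2 hx, zero_pow hm]
  · exact h.eq_zero m h0

theorem log_amp (h : IsAmplitude d c x a r) (hc : ∀ m ∈ exponents d, 0 < c m)
    {m : Fin 3 → ℕ} (hm : m ∈ exponents d) (ha : a m ≠ 0) :
    Real.log (a m) = Real.log (c m) + ∑ i, m i * Real.log (r i) := by
  rw [h.eq_mul m hm] at ha ⊢
  have h1 := right_ne_zero_of_mul ha
  rw [Real.log_mul (hc m hm).ne' h1, Real.log_prod fun i hi => (Finset.prod_ne_zero_iff.1 h1) i hi]
  simp [Real.log_pow]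

/-- Both amplitudes have the same support, which depends only on `x`. On it `log a - log a'` is
linear in the exponent, since `log c` cancels, while `a²` and `a'²` have the same mean. So `∑ (a² -
a'²) (log a - log a')` is zero, and each of its terms is nonnegative. -/
theorem unique (h : IsAmplitude d c x a r) (h' : IsAmplitude d c x a' r') (hd : 1 ≤ d)
    (hc : ∀ m ∈ exponents d, 0 < c m) : a = a' := by
  have hsupp : ∀ m ∈ exponents d, (0 < a m ∧ 0 < a' m) ∨ (a m = 0 ∧ a' m = 0) := by
    intro m hm
    by_cases hx : ∀ i, m i ≠ 0 → x i ≠ 0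
    · exact Or.inl ⟨h.amp_pos hd hc hm hx, h'.amp_pos hd hc hm hx⟩
    · push Not at hx
      obtain ⟨i, hi, hxi⟩ := hx
      exact Or.inr ⟨h.amp_eq_zero hd hc hi hxi, h'.amp_eq_zero hd hc hi hxi⟩
  have hterm : ∀ m ∈ exponents d, (a m ^ 2 - a' m ^ 2) * (Real.log (a m) - Real.log (a' m)) =
      ∑ i, (a m ^ 2 * m i - a' m ^ 2 * m i) * (Real.log (r i) - Real.log (r' i)) := by
    intro m hm
    rcases hsupp m hm with ⟨h1, h2⟩ | ⟨h1, h2⟩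
    · rw [h.log_amp hc hm h1.ne', h'.log_amp hc hm h2.ne', add_sub_add_left_eq_sub,
        ← Finset.sum_sub_distrib, Finset.mul_sum]
      exact Finset.sum_congr rfl fun i _ => by ring
    · simp [h1, h2]
  have hzero : ∑ m ∈ exponents d,
      (a m ^ 2 - a' m ^ 2) * (Real.log (a m) - Real.log (a' m)) = 0 := by
    rw [Finset.sum_congr rfl hterm, Finset.sum_comm]
    refine Finset.sum_eq_zero fun i _ => ?_
    rw [← Finset.sum_mul, Finset.sum_sub_distrib, h.mean, h'.mean, sub_self, zero_mul]
  have hnn : ∀ m ∈ exponents d,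
      0 ≤ (a m ^ 2 - a' m ^ 2) * (Real.log (a m) - Real.log (a' m)) := by
    intro m hm
    rcases hsupp m hm with ⟨h1, h2⟩ | ⟨h1, h2⟩
    · rcases le_total (a m) (a' m) with hle | hle
      · exact mul_nonneg_of_nonpos_of_nonpos (by nlinarith)
          (sub_nonpos.2 (Real.log_le_log h1 hle))
      · exact mul_nonneg (by nlinarith) (sub_nonneg.2 (Real.log_le_log h2 hle))
    · simp [h1, h2]
  ext m
  by_cases hm : m ∈ exponents d
  · have h0 := (Finset.sum_eq_zero_iff_of_nonneg hnn).1 hzero m hm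
    rcases hsupp m hm with ⟨h1, h2⟩ | ⟨h1, h2⟩
    · rcases mul_eq_zero.1 h0 with h3 | h3
      · nlinarith
      · exact Real.log_injOn_pos h1 h2 (sub_eq_zero.1 h3)
    · rw [h1, h2]
  · rw [h.eq_zero m hm, h'.eq_zero m hm]

end IsAmplitude

open Classical in
/-- The normalised absolute values of the monomials at the point of the positive real toric variety
that the moment map sends to `x`. -/
def amp (d : ℕ) (c : (Fin 3 → ℕ) → ℝ) (x : Fin 3 → ℝ) : (Fin 3 → ℕ) → ℝ :=
  if h : ∃ a r, IsAmplitude d c x a r then h.choose else 0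

/-! ### Continuity of amplitudes, and the image in terms of phases -/

section Amp

variable {d : ℕ} {c : (Fin 3 → ℕ) → ℝ}

theorem exists_isAmplitude_amp (hd : 1 ≤ d) (hc : ∀ m ∈ exponents d, 0 < c m) {x : Fin 3 → ℝ}
    (hx : x ∈ newtonPolygon d) : ∃ r, IsAmplitude d c x (amp d c x) r := by
  have h := exists_isAmplitude hd hc hx
  rw [amp, dif_pos h]
  exact h.choose_spec

theorem IsAmplitude.amp_eq (hd : 1 ≤ d) (hc : ∀ m ∈ exponents d, 0 < c m) {x : Fin 3 → ℝ}
    {a : (Fin 3 → ℕ) → ℝ} {r : Fin 3 → ℝ} (h : IsAmplitude d c x a r) : amp d c x = a := by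
  have h0 : ∃ a r, IsAmplitude d c x a r := ⟨a, r, h⟩
  rw [amp, dif_pos h0]
  exact h0.choose_spec.choose_spec.unique h hd hc

/-- The radii of total weight one form a compact set that maps onto `Δ`, so `Δ` carries the quotient
topology. Composed with the quotient map, an amplitude is a monomial, which is continuous;
uniqueness is what identifies the two. -/
theorem continuousOn_amp (hd : 1 ≤ d) (hc : ∀ m ∈ exponents d, 0 < c m) (m : Fin 3 → ℕ) :
    ContinuousOn (fun x => amp d c x m) (newtonPolygon d) := by
  by_cases hm : m ∈ exponents d
  swap
  · refine (continuousOn_const (c := (0 : ℝ))).congr fun x hx => ?_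
    obtain ⟨r, hr⟩ := exists_isAmplitude_amp hd hc hx
    exact hr.eq_zero m hm
  set R : Set (Fin 3 → ℝ) :=
    {r | (∀ i, 0 ≤ r i) ∧ ∑ m ∈ exponents d, (c m * ∏ i, r i ^ m i) ^ 2 = 1} with hR
  set φ : (Fin 3 → ℝ) → (Fin 3 → ℝ) :=
    fun r i => ∑ m ∈ exponents d, (c m * ∏ i, r i ^ m i) ^ 2 * m i with hφ
  have hφc : Continuous φ := by fun_prop
  have hamp : ∀ r ∈ R, IsAmplitude d c (φ r)
      (fun m => if m ∈ exponents d then c m * ∏ i, r i ^ m i else 0) r := by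
    intro r hr
    refine ⟨hr.1, fun m hm => if_pos hm, fun m hm => if_neg hm, ?_, fun i => ?_⟩
    · rw [← hr.2]
      exact Finset.sum_congr rfl fun m hm => by rw [if_pos hm]
    · exact Finset.sum_congr rfl fun m hm => by rw [if_pos hm]
  have hRcl : IsClosed R := by
    have : R = (⋂ i, {r : Fin 3 → ℝ | 0 ≤ r i}) ∩
        {r | ∑ m ∈ exponents d, (c m * ∏ i, r i ^ m i) ^ 2 = 1} := by
      ext r; simp [hR]
    rw [this]
    exact (isClosed_iInter fun i => isClosed_le continuous_const (continuous_apply i)).inter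
      (isClosed_eq (by fun_prop) continuous_const)
  have hRK : IsCompact R := by
    refine Metric.isCompact_of_isClosed_isBounded hRcl ?_
    refine (Metric.isBounded_Icc (0 : Fin 3 → ℝ)
      (fun i => max 1 (c (Pi.single i d))⁻¹)).subset fun r hr => ⟨hr.1, fun i => ?_⟩
    -- A radius larger than both `1` and `c⁻¹` would give the single monomial `z_i^d` a weight
    -- greater than one.
    by_contra! hlt
    obtain ⟨h1, h2⟩ := max_lt_iff.1 hlt
    have hci := hc _ (single_mem_exponents d i)
    have h3 : (c (Pi.single i d) * ∏ j, r j ^ (Pi.single i d : Fin 3 → ℕ) j) ^ 2 ≤ 1 := by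
      rw [← hr.2]
      exact Finset.single_le_sum (f := fun m => (c m * ∏ i, r i ^ m i) ^ 2)
        (fun m _ => sq_nonneg _) (single_mem_exponents d i)
    have h4 : ∏ j, r j ^ (Pi.single i d : Fin 3 → ℕ) j = r i ^ d := by
      rw [Finset.prod_eq_single i (fun j _ hj => by simp [Pi.single_eq_of_ne hj]) (by simp)]
      simp
    rw [h4] at h3
    have h5 : r i ≤ r i ^ d := le_self_pow₀ h1.le (by omega)
    have h6 : 1 < c (Pi.single i d) * r i := by
      rw [inv_lt_iff_one_lt_mul₀ hci] at h2
      linarith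
    have h7 : 1 < c (Pi.single i d) * r i ^ d := h6.trans_le (mul_le_mul_of_nonneg_left h5 hci.le)
    nlinarith
  have hmaps : ∀ r ∈ R, φ r ∈ newtonPolygon d := by
    intro r hr
    refine ⟨fun i => Finset.sum_nonneg fun m _ => by positivity, ?_⟩
    simp only [hφ]
    rw [Finset.sum_comm]
    rw [Finset.sum_congr rfl fun m hm => by
      rw [← Finset.mul_sum, ← Nat.cast_sum, mem_exponents.1 hm], ← Finset.sum_mul, hr.2, one_mul]
  have : CompactSpace R := isCompact_iff_compactSpace.1 hRK
  let F : R → newtonPolygon d := fun r => ⟨φ r, hmaps r r.2⟩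
  have hFc : Continuous F := by
    exact Continuous.subtype_mk (hφc.comp continuous_subtype_val) _
  have hFs : Function.Surjective F := by
    rintro ⟨x, hx⟩
    obtain ⟨a, r, h⟩ := exists_isAmplitude hd hc hx
    have h1 : r ∈ R := by
      refine ⟨h.nonneg, ?_⟩
      rw [← h.sum_sq]
      exact Finset.sum_congr rfl fun m hm => by rw [h.eq_mul m hm]
    refine ⟨⟨r, h1⟩, Subtype.ext (funext fun i => ?_)⟩
    simp only [F, hφ]
    rw [← h.mean i]
    exact Finset.sum_congr rfl fun m hm => by rw [h.eq_mul m hm]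
  have hq := hFc.isClosedMap.isQuotientMap hFc hFs
  rw [continuousOn_iff_continuous_domRestrict, hq.continuous_iff]
  have : (Set.domRestrict (newtonPolygon d) fun x => amp d c x m) ∘ F =
      fun r : R => c m * ∏ i, (r : Fin 3 → ℝ) i ^ m i := by
    ext r
    simp only [Function.comp_apply, Set.domRestrict_apply, F]
    rw [(hamp r r.2).amp_eq hd hc]
    exact if_pos hm
  rw [this]
  have h8 : Continuous fun r : Fin 3 → ℝ => c m * ∏ i, r i ^ m i := by fun_prop
  exact h8.comp continuous_subtype_val

/-- Membership in the image of the curve, in terms of amplitudes and phases. -/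
theorem mem_momentImage_iff (hd : 1 ≤ d) (hc : ∀ m ∈ exponents d, 0 < c m)
    (x : newtonPolygon d) : x ∈ momentImage d c ↔ ∃ θ : Fin 3 → ℝ,
      ∑ m ∈ exponents d, (amp d c x m : ℂ) * Complex.exp ((∑ i, m i * θ i : ℝ) * Complex.I) = 0 := by
  have hexp : ∀ (θ : Fin 3 → ℝ) (m : Fin 3 → ℕ), Complex.exp ((∑ i, m i * θ i : ℝ) * Complex.I) =
      ∏ i, Complex.exp (θ i * Complex.I) ^ m i := by
    intro θ m
    simp only [← Complex.exp_nat_mul]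
    rw [← Complex.exp_sum]
    push_cast
    rw [Finset.sum_mul]
    simp only [mul_assoc]
  constructor
  · rintro ⟨P, hP, hPx⟩
    set z := P.rep with hz
    have hz0 : z ≠ 0 := P.rep_nonzero
    have hr0 : (fun i => ‖z i‖) ≠ 0 := by
      intro h
      exact hz0 (funext fun i => by simpa using congrFun h i)
    have hr : ∀ i, 0 ≤ (fun i => ‖z i‖) i := fun i => norm_nonneg _
    have hwt : ∀ m ∈ exponents d, weight c z m = (c m * ∏ i, ‖z i‖ ^ m i) ^ 2 := by
      intro m hm
      rw [weight, norm_mul, norm_prod]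
      simp [abs_of_pos (hc m hm)]
    have hW := sum_sq_pos hc hr hr0
    obtain ⟨s, hs, h1⟩ := exists_scale hd hc hr hr0
    have hx : ∀ i, ∑ m ∈ exponents d, (c m * ∏ i, ‖z i‖ ^ m i) ^ 2 * m i =
        (x : Fin 3 → ℝ) i * ∑ m ∈ exponents d, (c m * ∏ i, ‖z i‖ ^ m i) ^ 2 := by
      intro i
      rw [← hPx]
      simp only [momentMap, momentVec, Pi.smul_apply, Finset.sum_apply, smul_eq_mul, toReal]
      have h2 : ∑ m ∈ exponents d, weight c z m * (m i : ℝ) =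
          ∑ m ∈ exponents d, (c m * ∏ i, ‖z i‖ ^ m i) ^ 2 * m i :=
        Finset.sum_congr rfl fun m hm => by rw [hwt m hm]
      rw [← hz, Finset.sum_congr rfl hwt, h2, mul_right_comm, inv_mul_cancel₀ hW.ne', one_mul]
    have hA := isAmplitude_of_scale hc hr hs h1 hx
    refine ⟨fun i => Complex.arg (z i), ?_⟩
    rw [hA.amp_eq hd hc]
    have hP' : MvPolynomial.eval z (curvePoly d c) = 0 := hP
    rw [eval_curvePoly] at hP'
    rw [← mul_zero ((s : ℂ) ^ d), ← hP', Finset.mul_sum]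
    refine Finset.sum_congr rfl fun m hm => ?_
    simp only [if_pos hm]
    rw [hexp]
    push_cast
    rw [mul_assoc, mul_assoc, ← Finset.prod_mul_distrib]
    congr 2
    refine Finset.prod_congr rfl fun i _ => ?_
    rw [← mul_pow, Complex.norm_mul_exp_arg_mul_I]
  · rintro ⟨θ, hθ⟩
    obtain ⟨r, hr⟩ := exists_isAmplitude_amp hd hc x.2
    set z : Fin 3 → ℂ := fun i => r i * Complex.exp (θ i * Complex.I) with hz
    have hnorm : ∀ i, ‖z i‖ = r i := by
      intro i
      rw [hz]
      simp only [norm_mul, Complex.norm_real, Real.norm_eq_abs, Complex.norm_exp_ofReal_mul_I,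
        mul_one, abs_of_nonneg (hr.nonneg i)]
    have hwt : ∀ m ∈ exponents d, weight c z m = amp d c x m ^ 2 := by
      intro m hm
      rw [weight, norm_mul, norm_prod, hr.eq_mul m hm]
      simp [abs_of_pos (hc m hm), hnorm]
    have hz0 : z ≠ 0 := by
      intro h
      have h0 : ∀ m ∈ exponents d, amp d c x m ^ 2 = 0 := by
        intro m hm
        rw [← hwt m hm, h, weight]
        have : ∏ i, (0 : Fin 3 → ℂ) i ^ m i = 0 := by
          have hm' := mem_exponents.1 hm
          obtain ⟨i, hi⟩ : ∃ i, m i ≠ 0 := by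
            by_contra! h0
            rw [Finset.sum_eq_zero fun i _ => h0 i] at hm'
            omega
          exact Finset.prod_eq_zero (Finset.mem_univ i) (by simp [hi])
        rw [this]; simp
      have := hr.sum_sq
      rw [Finset.sum_eq_zero h0] at this
      exact zero_ne_one this
    refine ⟨Projectivization.mk ℂ z hz0, ?_, ?_⟩
    · rw [mk_mem_curve, eval_curvePoly, ← hθ]
      refine Finset.sum_congr rfl fun m hm => ?_
      rw [hr.eq_mul m hm, hexp, hz]
      push_cast
      rw [mul_assoc, ← Finset.prod_mul_distrib]
      simp only [mul_pow]
    · rw [momentMap_mk, momentVec, Finset.sum_congr rfl hwt, hr.sum_sq, inv_one, one_smul]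
      ext i
      rw [Finset.sum_apply, ← hr.mean i]
      refine Finset.sum_congr rfl fun m hm => ?_
      rw [Pi.smul_apply, hwt m hm, smul_eq_mul, toReal]

end Amp

/-! ### Triangles of a full triangulation -/

theorem toReal_injective : Function.Injective toReal := by
  intro m n h
  funext i
  have := congrFun h i
  simpa [toReal] using this

theorem sum_toReal {d : ℕ} {m : Fin 3 → ℕ} (hm : m ∈ exponents d) : ∑ i, toReal m i = d := by
  simp only [toReal]
  rw [← Nat.cast_sum, mem_exponents.1 hm]

theorem toReal_mem {d : ℕ} {m : Fin 3 → ℕ} (hm : m ∈ exponents d) :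
    toReal m ∈ newtonPolygon d :=
  ⟨fun _ => Nat.cast_nonneg _, sum_toReal hm⟩

theorem isCompact_newtonPolygon (d : ℕ) : IsCompact (newtonPolygon d) := by
  refine Metric.isCompact_of_isClosed_isBounded ?_ ?_
  · have : newtonPolygon d = (⋂ i, {x : Fin 3 → ℝ | 0 ≤ x i}) ∩ {x | ∑ i, x i = d} := by
      ext x; simp [newtonPolygon]
    rw [this]
    exact (isClosed_iInter fun i => isClosed_le continuous_const (continuous_apply i)).inter
      (isClosed_eq (by fun_prop) continuous_const)
  · refine (Metric.isBounded_Icc (0 : Fin 3 → ℝ) (fun _ => d)).subset fun x hx => ⟨hx.1, fun i => ?_⟩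
    rw [← hx.2]
    exact Finset.single_le_sum (fun i _ => hx.1 i) (Finset.mem_univ i)

instance (d : ℕ) : CompactSpace (newtonPolygon d) :=
  isCompact_iff_compactSpace.1 (isCompact_newtonPolygon d)

theorem convex_newtonPolygon (d : ℕ) : Convex ℝ (newtonPolygon d) := by
  intro x hx y hy a b ha hb hab
  refine ⟨fun i => ?_, ?_⟩
  · simp only [Pi.add_apply, Pi.smul_apply, smul_eq_mul]
    exact add_nonneg (mul_nonneg ha (hx.1 i)) (mul_nonneg hb (hy.1 i))
  · simp only [Pi.add_apply, Pi.smul_apply, smul_eq_mul]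
    rw [Finset.sum_add_distrib, ← Finset.mul_sum, ← Finset.mul_sum, hx.2, hy.2, ← add_mul, hab,
      one_mul]

/-- `v` enumerates the vertices of a triangle of `Z`. -/
structure IsFlag (d : ℕ) (Z : Geometry.SimplicialComplex ℝ (Fin 3 → ℝ))
    (v : Fin 3 → Fin 3 → ℕ) : Prop where
  inj : Function.Injective v
  mem : ∀ i, v i ∈ exponents d
  face : ∃ s ∈ Z.faces, (s : Set (Fin 3 → ℝ)) = Set.range fun i => toReal (v i)

/-- Barycentric coordinates with respect to three vertices. -/
def bary (v : Fin 3 → Fin 3 → ℕ) : (Fin 3 → ℝ) →ₗ[ℝ] (Fin 3 → ℝ) :=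
  open Classical in
  if h : LinearIndependent ℝ fun i => toReal (v i) then
    ((basisOfLinearIndependentOfCardEqFinrank h (by simp)).equivFun : _ →ₗ[ℝ] _)
  else 0

/-- Barycentric coordinates of exponents, rounded to integers. -/
def icoord (v : Fin 3 → Fin 3 → ℕ) (m : Fin 3 → ℕ) (i : Fin 3) : ℤ :=
  round (bary v (toReal m) i)

section

variable {d : ℕ} {Z : Geometry.SimplicialComplex ℝ (Fin 3 → ℝ)}

theorem sum_of_mem_face (hZ : IsFullTriangulation d Z) {s : Finset (Fin 3 → ℝ)}
    (hs : s ∈ Z.faces) {x : Fin 3 → ℝ} (hx : x ∈ s) : ∃ m ∈ exponents d, toReal m = x := by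
  have : x ∈ Z.vertices := by
    rw [Geometry.SimplicialComplex.vertices_eq]
    exact Set.mem_biUnion hs hx
  rw [hZ.vertices_eq] at this
  obtain ⟨m, hm, h⟩ := this
  exact ⟨m, hm, h⟩

/-- The vertices lie in the plane `∑ x i = d`, which misses the origin as `d ≠ 0`, so affine
independence becomes linear independence. This is why barycentric coordinates can be handled as
linear functions on `ℝ³`. -/
theorem linearIndependent_face (hd : 1 ≤ d) (hZ : IsFullTriangulation d Z)
    {s : Finset (Fin 3 → ℝ)} (hs : s ∈ Z.faces) :
    LinearIndependent ℝ ((↑) : s → Fin 3 → ℝ) := by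
  rw [linearIndependent_iff']
  intro t g hg
  refine affineIndependent_iff.1 (Z.indep hs) t g ?_ hg
  have h1 := congrArg (fun x : Fin 3 → ℝ => ∑ i, x i) hg
  simp only [Finset.sum_apply, Pi.smul_apply, smul_eq_mul, Pi.zero_apply,
    Finset.sum_const_zero] at h1
  rw [Finset.sum_comm] at h1
  have h2 : ∀ x ∈ t, ∑ i, g x * (x : Fin 3 → ℝ) i = g x * d := by
    intro x _
    obtain ⟨m, hm, hx⟩ := sum_of_mem_face hZ hs x.2
    rw [← Finset.mul_sum, ← hx, sum_toReal hm]
  rw [Finset.sum_congr rfl h2, ← Finset.sum_mul] at h1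
  have hd' : (d : ℝ) ≠ 0 := by positivity
  exact (mul_eq_zero.1 h1).resolve_right hd'

namespace IsFlag

variable {v : Fin 3 → Fin 3 → ℕ}

theorem linearIndependent (hv : IsFlag d Z v) (hd : 1 ≤ d) (hZ : IsFullTriangulation d Z) :
    LinearIndependent ℝ fun i => toReal (v i) := by
  obtain ⟨s, hs, hsv⟩ := hv.face
  have hmem : ∀ i, toReal (v i) ∈ s := fun i => by
    rw [← Finset.mem_coe, hsv]; exact ⟨i, rfl⟩
  have h := (linearIndependent_face hd hZ hs).comp (fun i : Fin 3 => (⟨toReal (v i), hmem i⟩ : s))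
    (fun i j hij => hv.inj (toReal_injective (by simpa using hij)))
  exact h

theorem sum_bary (hv : IsFlag d Z v) (hd : 1 ≤ d) (hZ : IsFullTriangulation d Z)
    (x : Fin 3 → ℝ) : ∑ i, bary v x i • toReal (v i) = x := by
  rw [bary, dif_pos (hv.linearIndependent hd hZ)]
  have := (basisOfLinearIndependentOfCardEqFinrank (hv.linearIndependent hd hZ)
    (by simp)).sum_equivFun x
  simpa using this

theorem bary_sum (hv : IsFlag d Z v) (hd : 1 ≤ d) (hZ : IsFullTriangulation d Z)
    (g : Fin 3 → ℝ) : bary v (∑ i, g i • toReal (v i)) = g := by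
  have h1 := hv.sum_bary hd hZ (∑ i, g i • toReal (v i))
  have h2 := linearIndependent_iff'.1 (hv.linearIndependent hd hZ) Finset.univ
    (fun i => bary v (∑ i, g i • toReal (v i)) i - g i) (by
      simp only [sub_smul]
      rw [Finset.sum_sub_distrib, h1, sub_self])
  funext i
  exact sub_eq_zero.1 (h2 i (Finset.mem_univ i))

theorem sum_bary_eq_one (hv : IsFlag d Z v) (hd : 1 ≤ d) (hZ : IsFullTriangulation d Z)
    {x : Fin 3 → ℝ} (hx : ∑ i, x i = d) : ∑ i, bary v x i = 1 := by
  have h1 := congrArg (fun x : Fin 3 → ℝ => ∑ i, x i) (hv.sum_bary hd hZ x)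
  simp only [Finset.sum_apply, Pi.smul_apply, smul_eq_mul] at h1
  rw [Finset.sum_comm, hx] at h1
  simp only [← Finset.mul_sum] at h1
  rw [Finset.sum_congr rfl fun i _ => by rw [sum_toReal (hv.mem i)], ← Finset.sum_mul] at h1
  have hd' : (d : ℝ) ≠ 0 := by positivity
  exact mul_right_cancel₀ hd' (by rw [h1, one_mul])

theorem sum_mem (hv : IsFlag d Z v) {g : Fin 3 → ℝ} (h0 : ∀ i, 0 ≤ g i) (h1 : ∑ i, g i = 1) :
    ∑ i, g i • toReal (v i) ∈ newtonPolygon d :=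
  (convex_newtonPolygon d).sum_mem (fun i _ => h0 i) h1 fun i _ => toReal_mem (hv.mem i)

theorem bary_vertex (hv : IsFlag d Z v) (hd : 1 ≤ d) (hZ : IsFullTriangulation d Z)
    (i : Fin 3) : bary v (toReal (v i)) = Pi.single i 1 := by
  rw [← hv.bary_sum hd hZ (Pi.single i 1)]
  congr 1
  simp [Pi.single_apply]

theorem perm (hv : IsFlag d Z v) (σ : Equiv.Perm (Fin 3)) : IsFlag d Z (v ∘ σ) where
  inj := hv.inj.comp σ.injective
  mem i := hv.mem _
  face := by
    obtain ⟨s, hs, h⟩ := hv.face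
    refine ⟨s, hs, h.trans ?_⟩
    exact (σ.surjective.range_comp fun i => toReal (v i)).symm

theorem bary_perm (hv : IsFlag d Z v) (hd : 1 ≤ d) (hZ : IsFullTriangulation d Z)
    (σ : Equiv.Perm (Fin 3)) (x : Fin 3 → ℝ) (i : Fin 3) :
    bary (v ∘ σ) x i = bary v x (σ i) := by
  have h := (hv.perm σ).bary_sum hd hZ fun i => bary v x (σ i)
  have h2 : ∑ i, bary v x (σ i) • toReal ((v ∘ σ) i) = x :=
    (Equiv.sum_comp σ fun i => bary v x i • toReal (v i)).trans (hv.sum_bary hd hZ x)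
  rw [h2] at h
  exact congrFun h i

/-- Membership in the convex hull of a subset of the vertices of a triangle. -/
theorem mem_convexHull_iff (hv : IsFlag d Z v) (hd : 1 ≤ d) (hZ : IsFullTriangulation d Z)
    {x : Fin 3 → ℝ} {s : Set (Fin 3 → ℝ)} (hs : s ⊆ Set.range fun i => toReal (v i)) :
    x ∈ convexHull ℝ s ↔ x ∈ newtonPolygon d ∧ (∀ i, 0 ≤ bary v x i) ∧
      ∀ i, bary v x i ≠ 0 → toReal (v i) ∈ s := by
  constructor
  · intro hx
    have hconv : Convex ℝ {x | x ∈ newtonPolygon d ∧ (∀ i, 0 ≤ bary v x i) ∧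
        ∀ i, bary v x i ≠ 0 → toReal (v i) ∈ s} := by
      intro x hx y hy a b ha hb hab
      refine ⟨convex_newtonPolygon d hx.1 hy.1 ha hb hab, fun i => ?_, fun i hi => ?_⟩
      · simp only [map_add, map_smul, Pi.add_apply, Pi.smul_apply, smul_eq_mul]
        exact add_nonneg (mul_nonneg ha (hx.2.1 i)) (mul_nonneg hb (hy.2.1 i))
      · by_contra h
        have h1 : bary v x i = 0 := by
          by_contra h2; exact h (hx.2.2 i h2)
        have h3 : bary v y i = 0 := by
          by_contra h2; exact h (hy.2.2 i h2)
        apply hi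
        simp [h1, h3]
    refine convexHull_min ?_ hconv hx
    intro y hy
    obtain ⟨i, rfl⟩ := hs hy
    refine ⟨toReal_mem (hv.mem i), ?_⟩
    simp only [hv.bary_vertex hd hZ]
    refine ⟨fun j => ?_, fun j hj => ?_⟩
    · by_cases h : j = i
      · subst h; simp
      · simp [Pi.single_eq_of_ne h]
    · by_cases h : j = i
      · subst h; exact hy
      · simp [Pi.single_eq_of_ne h] at hj
  · rintro ⟨hx, h0, h1⟩
    rw [← hv.sum_bary hd hZ x]
    rw [← Finset.sum_filter_of_ne (p := fun i => bary v x i ≠ 0)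
      (fun i _ h => by intro h'; exact h (by rw [h', zero_smul]))]
    refine (convex_convexHull ℝ s).sum_mem (fun i _ => h0 i) ?_ fun i hi => ?_
    · rw [Finset.sum_filter_of_ne (fun i _ h => h)]
      exact hv.sum_bary_eq_one hd hZ hx.2
    · exact subset_convexHull ℝ s (h1 i (Finset.mem_filter.1 hi).2)

/-- A lattice point in a triangle of a full triangulation is one of its vertices. -/
theorem eq_vertex (hv : IsFlag d Z v) (hd : 1 ≤ d) (hZ : IsFullTriangulation d Z)
    {m : Fin 3 → ℕ} (hm : m ∈ exponents d) (h0 : ∀ i, 0 ≤ bary v (toReal m) i) :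
    ∃ i, m = v i := by
  obtain ⟨s, hs, hsv⟩ := hv.face
  have h1 : toReal m ∈ convexHull ℝ (s : Set (Fin 3 → ℝ)) := by
    rw [hsv, hv.mem_convexHull_iff hd hZ subset_rfl]
    exact ⟨toReal_mem hm, h0, fun i _ => ⟨i, rfl⟩⟩
  have h2 : {toReal m} ∈ Z.faces := by
    rw [← Geometry.SimplicialComplex.mem_vertices, hZ.vertices_eq]
    exact ⟨m, hm, rfl⟩
  -- The lattice point is itself a face of `Z`, so it meets the triangle in the hull of common
  -- vertices.
  have h3 := Z.inter_subset_convexHull hs h2 ⟨h1, by simp⟩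
  have h4 := convexHull_nonempty_iff.1 ⟨_, h3⟩
  obtain ⟨y, hy1, hy2⟩ := h4
  rw [hsv] at hy1
  obtain ⟨i, hi⟩ := hy1
  refine ⟨i, toReal_injective ?_⟩
  have : y = toReal m := by simpa using hy2
  rw [← this, ← hi]

/-- Triangles of a full triangulation are unimodular. -/
theorem icoord_cast (hv : IsFlag d Z v) (hd : 1 ≤ d) (hZ : IsFullTriangulation d Z)
    {m : Fin 3 → ℕ} (hm : m ∈ exponents d) (i : Fin 3) :
    (icoord v m i : ℝ) = bary v (toReal m) i := by
  set g := bary v (toReal m) with hg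
  have hg1 : ∑ i, g i = 1 := hv.sum_bary_eq_one hd hZ (sum_toReal hm)
  -- A convex combination of the vertices with integer coordinates is a lattice point of the
  -- triangle, hence a vertex.
  have key : ∀ f : Fin 3 → ℝ, (∀ i, 0 ≤ f i) → ∑ i, f i = 1 →
      (∀ j, ∃ n : ℤ, ∑ i, f i * v i j = n) → ∃ i, f = Pi.single i 1 := by
    intro f hf0 hf1 hfn
    have hmem := hv.sum_mem hf0 hf1
    choose n hn using hfn
    have hn' : ∀ j, (∑ i, f i • toReal (v i)) j = n j := by
      intro j
      rw [← hn j]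
      simp [toReal]
    have hn0 : ∀ j, 0 ≤ n j := by
      intro j
      have := hmem.1 j
      rw [hn' j] at this
      exact_mod_cast this
    have hm' : toReal (fun j => (n j).toNat) = ∑ i, f i • toReal (v i) := by
      funext j
      rw [hn' j, toReal]
      have := Int.toNat_of_nonneg (hn0 j)
      exact_mod_cast this
    have hme : (fun j => (n j).toNat) ∈ exponents d := by
      rw [mem_exponents]
      have h1 := hmem.2
      rw [← hm'] at h1
      simp only [toReal] at h1
      exact_mod_cast h1
    have hb := hv.bary_sum hd hZ f
    obtain ⟨i, hi⟩ := hv.eq_vertex hd hZ hme (by rw [hm', hb]; exact hf0)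
    refine ⟨i, ?_⟩
    rw [← hb, ← hm', hi, hv.bary_vertex hd hZ]
  have hint : ∀ j, ∑ i, g i * v i j = m j := by
    intro j
    have := congrFun (hv.sum_bary hd hZ (toReal m)) j
    simpa [toReal] using this
  have hfr : ∀ j, ∃ n : ℤ, ∑ i, Int.fract (g i) * v i j = n := by
    intro j
    refine ⟨m j - ∑ i, ⌊g i⌋ * v i j, ?_⟩
    push_cast
    rw [← hint j, ← Finset.sum_sub_distrib]
    exact Finset.sum_congr rfl fun i _ => by rw [Int.fract]; ring
  -- The fractional parts of the coordinates again combine to an integer vector, and their sum is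
  -- `0`, `1` or `2`. Sum `1` would give a vertex, although no fractional part equals one. Sum `2`
  -- makes the complements `1 - fract` sum to one, and a vertex would have two complements equal to
  -- zero.
  have hfz : ∀ i, Int.fract (g i) = 0 := by
    have hsum : ∃ n : ℤ, ∑ i, Int.fract (g i) = n := by
      refine ⟨1 - ∑ i, ⌊g i⌋, ?_⟩
      push_cast
      rw [← hg1, ← Finset.sum_sub_distrib]
      rfl
    obtain ⟨n, hn⟩ := hsum
    have hlt : ∑ i, Int.fract (g i) < 3 := by
      rw [Fin.sum_univ_three]
      have h0 := Int.fract_lt_one (g 0)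
      have h1 := Int.fract_lt_one (g 1)
      have h2 := Int.fract_lt_one (g 2)
      linarith
    have hge : 0 ≤ ∑ i, Int.fract (g i) := Finset.sum_nonneg fun i _ => Int.fract_nonneg _
    rw [hn] at hlt hge
    have hlt' : n < 3 := by exact_mod_cast hlt
    have hge' : 0 ≤ n := by exact_mod_cast hge
    interval_cases n
    · intro i
      exact (Finset.sum_eq_zero_iff_of_nonneg fun i _ => Int.fract_nonneg _).1
        (by rw [hn]; simp) i (Finset.mem_univ i)
    · exfalso
      obtain ⟨i, hi⟩ := key (fun i => Int.fract (g i)) (fun i => Int.fract_nonneg _)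
        (by rw [hn]; simp) hfr
      have h1 := Int.fract_lt_one (g i)
      have h2 := congrFun hi i
      simp only [Pi.single_eq_same] at h2
      linarith
    · exfalso
      obtain ⟨i, hi⟩ := key (fun i => 1 - Int.fract (g i))
        (fun i => by have := Int.fract_lt_one (g i); linarith)
        (by rw [Finset.sum_sub_distrib, hn]; simp; norm_num)
        (fun j => by
          obtain ⟨n, hn⟩ := hfr j
          refine ⟨∑ i, (v i j : ℤ) - n, ?_⟩
          push_cast
          rw [← hn, ← Finset.sum_sub_distrib]
          exact Finset.sum_congr rfl fun i _ => by ring)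
      have h2 := congrFun hi (i + 1)
      have h3 : i + 1 ≠ i := by simp
      simp only [Pi.single_eq_of_ne h3] at h2
      have h1 := Int.fract_lt_one (g (i + 1))
      linarith
  rw [icoord, ← hg]
  have h1 := Int.floor_add_fract (g i)
  rw [hfz i, add_zero] at h1
  rw [← h1, round_intCast]

end IsFlag

/-! ### The triangles cover the polygon -/

theorem finite_faces (hZ : IsFullTriangulation d Z) : Z.faces.Finite := by
  have hfin : (toReal '' (exponents d : Set (Fin 3 → ℕ))).Finite :=
    (exponents d).finite_toSet.image _
  refine (hfin.toFinset.powerset.finite_toSet).subset fun s hs => ?_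
  rw [Finset.mem_coe, Finset.mem_powerset]
  intro x hx
  rw [Set.Finite.mem_toFinset]
  obtain ⟨m, hm, rfl⟩ := sum_of_mem_face hZ hs hx
  exact ⟨m, hm, rfl⟩

theorem exists_flag_of_card (hZ : IsFullTriangulation d Z) {s : Finset (Fin 3 → ℝ)}
    (hs : s ∈ Z.faces) (h3 : s.card = 3) :
    ∃ v, IsFlag d Z v ∧ (s : Set (Fin 3 → ℝ)) = Set.range fun i => toReal (v i) := by
  have e : Fin 3 ≃ s := (Fintype.equivFinOfCardEq (by simpa using h3)).symm
  choose f hf hfe using fun i : Fin 3 => sum_of_mem_face hZ hs (e i).2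
  have hr : (s : Set (Fin 3 → ℝ)) = Set.range fun i => toReal (f i) := by
    ext x
    constructor
    · intro hx
      exact ⟨e.symm ⟨x, hx⟩, by simp only [hfe, Equiv.apply_symm_apply]⟩
    · rintro ⟨i, rfl⟩
      simp only [hfe]
      exact (e i).2
  refine ⟨f, ⟨fun i j hij => ?_, hf, s, hs, hr⟩, hr⟩
  refine e.injective (Subtype.ext ?_)
  rw [← hfe, ← hfe, hij]

/-- A face with at most two vertices lies in the kernel of a nonzero linear form. -/
theorem exists_form_of_card (hd : 1 ≤ d) (hZ : IsFullTriangulation d Z) {s : Finset (Fin 3 → ℝ)}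
    (hs : s ∈ Z.faces) (h3 : s.card ≠ 3) :
    ∃ f : (Fin 3 → ℝ) →ₗ[ℝ] ℝ, f ≠ 0 ∧ ∀ x ∈ convexHull ℝ (s : Set (Fin 3 → ℝ)), f x = 0 := by
  have hlt : Submodule.span ℝ (s : Set (Fin 3 → ℝ)) < ⊤ := by
    refine lt_top_iff_ne_top.2 fun h => h3 ?_
    have h1 := finrank_span_finset_eq_card (R := ℝ) (linearIndependent_face hd hZ hs)
    rw [h, finrank_top] at h1
    simpa using h1.symm
  obtain ⟨f, hf0, hf⟩ := Submodule.exists_le_ker_of_lt_top _ hlt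
  refine ⟨f, hf0, fun x hx => ?_⟩
  have : x ∈ Submodule.span ℝ (s : Set (Fin 3 → ℝ)) :=
    convexHull_min Submodule.subset_span (Submodule.convex _) hx
  exact hf this

theorem isClosed_convexHull_face (s : Finset (Fin 3 → ℝ)) :
    IsClosed (convexHull ℝ (s : Set (Fin 3 → ℝ))) :=
  (s.finite_toSet.isCompact_convexHull (𝕜 := ℝ)).isClosed

-- Push `x` into `Δ` along a curve with increments `η`, `η²`, `η³` in the three coordinates. A
-- nonzero linear form restricts to a nonzero cubic polynomial up to a positive factor, so for small
-- `η > 0` the curve avoids the finitely many faces with fewer than three vertices. If `x` were in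
-- no triangle, then, triangles being closed, nearby points of the curve would be covered by no face
-- at all.
open Polynomial in
theorem exists_flag (hd : 1 ≤ d) (hZ : IsFullTriangulation d Z) {x : Fin 3 → ℝ}
    (hx : x ∈ newtonPolygon d) : ∃ v, IsFlag d Z v ∧ ∀ i, 0 ≤ bary v x i := by
  suffices h : ∃ s ∈ Z.faces, s.card = 3 ∧ x ∈ convexHull ℝ (s : Set (Fin 3 → ℝ)) by
    obtain ⟨s, hs, h3, hxs⟩ := h
    obtain ⟨v, hv, hr⟩ := exists_flag_of_card hZ hs h3
    rw [hr, hv.mem_convexHull_iff hd hZ subset_rfl] at hxs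
    exact ⟨v, hv, hxs.2.1⟩
  by_contra! hcon
  -- Division by `D` restores the coordinate sum `d`.
  set D : ℝ → ℝ := fun η => 1 + η + η ^ 2 + η ^ 3 with hD
  set y : ℝ → Fin 3 → ℝ := fun η j => (x j + d * η ^ ((j : ℕ) + 1)) / D η with hy
  have hDpos : ∀ η : ℝ, 0 ≤ η → 0 < D η := fun η hη => by simp only [hD]; positivity
  have hymem : ∀ η : ℝ, 0 ≤ η → y η ∈ newtonPolygon d := by
    intro η hη
    refine ⟨fun j => ?_, ?_⟩
    · have := hx.1 j
      have := hDpos η hη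
      simp only [hy]
      positivity
    · simp only [hy]
      rw [← Finset.sum_div, Finset.sum_add_distrib, hx.2, div_eq_iff (hDpos η hη).ne']
      simp only [Fin.sum_univ_three, hD]
      simp
      ring
  have hycont : ContinuousAt y 0 := by
    have hD0 : D 0 ≠ 0 := (hDpos 0 le_rfl).ne'
    refine continuousAt_pi.2 fun j => ContinuousAt.div ?_ ?_ hD0
    · fun_prop
    · simp only [hD]; fun_prop
  have hy0 : y 0 = x := by
    funext j
    simp [hy, hD]
  have hfin := finite_faces hZ
  have hev1 : ∀ᶠ η in nhdsWithin (0 : ℝ) (Set.Ioi 0), ∀ s ∈ Z.faces, s.card = 3 →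
      y η ∉ convexHull ℝ (s : Set (Fin 3 → ℝ)) := by
    rw [Filter.eventually_all_finite hfin]
    intro s hs
    by_cases h3 : s.card = 3
    · have h1 : ∀ᶠ z in nhds (y 0), z ∉ convexHull ℝ (s : Set (Fin 3 → ℝ)) := by
        rw [hy0]
        exact (isClosed_convexHull_face s).isOpen_compl.mem_nhds (hcon s hs h3)
      exact ((hycont.eventually h1).filter_mono nhdsWithin_le_nhds).mono fun η h _ => h
    · exact Filter.Eventually.of_forall fun η h => absurd h h3
  have hev2 : ∀ᶠ η in nhdsWithin (0 : ℝ) (Set.Ioi 0), ∀ s ∈ Z.faces, s.card ≠ 3 →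
      y η ∉ convexHull ℝ (s : Set (Fin 3 → ℝ)) := by
    rw [Filter.eventually_all_finite hfin]
    intro s hs
    by_cases h3 : s.card = 3
    · exact Filter.Eventually.of_forall fun η h => absurd h3 h
    obtain ⟨f, hf0, hf⟩ := exists_form_of_card hd hZ hs h3
    set P : ℝ[X] := C (f x) + C (d * f (Pi.single 0 1)) * X + C (d * f (Pi.single 1 1)) * X ^ 2 +
      C (d * f (Pi.single 2 1)) * X ^ 3 with hP
    have hd' : (d : ℝ) ≠ 0 := by positivity
    have hP0 : P ≠ 0 := by
      intro h
      apply hf0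
      refine LinearMap.pi_ext' fun j => LinearMap.ext_ring ?_
      have h1 : P.coeff 1 = 0 := by rw [h]; simp
      have h2 : P.coeff 2 = 0 := by rw [h]; simp
      have h3 : P.coeff 3 = 0 := by rw [h]; simp
      simp only [hP, coeff_add, coeff_C_mul, coeff_X_pow, coeff_X, coeff_C] at h1 h2 h3
      simp [hd'] at h1 h2 h3
      fin_cases j <;> simp [h1, h2, h3]
    have hroots : ∀ᶠ η in nhdsWithin (0 : ℝ) (Set.Ioi 0), P.eval η ≠ 0 := by
      have hcl : IsClosed (((P.roots.toFinset.erase 0 : Finset ℝ)) : Set ℝ) :=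
        (Finset.finite_toSet _).isClosed
      have h1 : ∀ᶠ η in nhds (0 : ℝ), η ∉ ((P.roots.toFinset.erase 0 : Finset ℝ) : Set ℝ) :=
        hcl.isOpen_compl.mem_nhds (by simp)
      filter_upwards [h1.filter_mono nhdsWithin_le_nhds, self_mem_nhdsWithin] with η h2 h3 h4
      apply h2
      rw [Finset.mem_coe, Finset.mem_erase, Multiset.mem_toFinset, mem_roots hP0]
      exact ⟨(ne_of_gt h3), h4⟩
    filter_upwards [hroots, self_mem_nhdsWithin] with η h1 h2 _ h4
    apply h1
    have h5 := hf _ h4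
    have h6 : y η = (D η)⁻¹ • (x + (d * η) • Pi.single 0 1 + (d * η ^ 2) • Pi.single 1 1 +
        (d * η ^ 3) • Pi.single 2 1) := by
      funext j
      simp only [hy, Pi.smul_apply, Pi.add_apply, smul_eq_mul]
      fin_cases j <;> simp <;> ring
    rw [h6, map_smul, smul_eq_mul] at h5
    have h7 := (mul_eq_zero.1 h5).resolve_left (inv_ne_zero (hDpos η (le_of_lt h2)).ne')
    simp only [map_add, map_smul, smul_eq_mul] at h7
    rw [hP]
    simp only [eval_add, eval_mul, eval_C, eval_pow, eval_X]
    linarith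
  obtain ⟨η, h1, h2, h3⟩ := (hev1.and (hev2.and self_mem_nhdsWithin)).exists
  have h4 := hymem η (le_of_lt h3)
  rw [← hZ.space_eq, Geometry.SimplicialComplex.mem_space_iff] at h4
  obtain ⟨s, hs, hys⟩ := h4
  by_cases h5 : s.card = 3
  · exact h1 s hs h5 hys
  · exact h2 s hs h5 hys

/-- Every point lies in a triangle whose vertices are sorted by barycentric coordinate. -/
theorem exists_sorted_flag (hd : 1 ≤ d) (hZ : IsFullTriangulation d Z) {x : Fin 3 → ℝ}
    (hx : x ∈ newtonPolygon d) : ∃ v, IsFlag d Z v ∧ (∀ i, 0 ≤ bary v x i) ∧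
      bary v x 1 ≤ bary v x 0 ∧ bary v x 2 ≤ bary v x 1 := by
  obtain ⟨v, hv, h0⟩ := exists_flag hd hZ hx
  have hs := Tuple.monotone_sort fun i => - bary v x i
  set σ := Tuple.sort fun i => - bary v x i
  refine ⟨v ∘ σ, hv.perm σ, fun i => ?_, ?_, ?_⟩
  · rw [hv.bary_perm hd hZ]; exact h0 _
  · rw [hv.bary_perm hd hZ, hv.bary_perm hd hZ]
    have := hs (show (0 : Fin 3) ≤ 1 by decide)
    simpa using this
  · rw [hv.bary_perm hd hZ, hv.bary_perm hd hZ]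
    have := hs (show (1 : Fin 3) ≤ 2 by decide)
    simpa using this

end

/-! ### Hat functions of the triangulation -/

/-- The barycentric coordinates with respect to `v`, indexed by exponents. -/
def hatOf (v : Fin 3 → Fin 3 → ℕ) (x : Fin 3 → ℝ) (m : Fin 3 → ℕ) : ℝ :=
  ∑ i, if v i = m then bary v x i else 0

open Classical in
/-- The piecewise linear function on the polygon that is one at the lattice point `m` and zero at
all other lattice points. -/
def hat (d : ℕ) (Z : Geometry.SimplicialComplex ℝ (Fin 3 → ℝ)) (x : Fin 3 → ℝ) :
    (Fin 3 → ℕ) → ℝ :=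
  if h : ∃ v, IsFlag d Z v ∧ ∀ i, 0 ≤ bary v x i then hatOf h.choose x else 0

variable {d : ℕ} {Z : Geometry.SimplicialComplex ℝ (Fin 3 → ℝ)} {v v' : Fin 3 → Fin 3 → ℕ}

theorem finite_flags (d : ℕ) (Z : Geometry.SimplicialComplex ℝ (Fin 3 → ℝ)) :
    {v | IsFlag d Z v}.Finite :=
  (Set.Finite.pi' fun _ : Fin 3 => (exponents d).finite_toSet).subset fun _ hv i => hv.mem i

instance : Finite {v // IsFlag d Z v} := (finite_flags d Z).to_subtype

namespace IsFlag

theorem hatOf_vertex (hv : IsFlag d Z v) (x : Fin 3 → ℝ) (i : Fin 3) :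
    hatOf v x (v i) = bary v x i := by
  rw [hatOf, Finset.sum_eq_single i (fun j _ hj => if_neg fun h => hj (hv.inj h)) (by simp)]
  simp

theorem sum_exponents {E : Type*} [AddCommMonoid E] (hv : IsFlag d Z v)
    {f : (Fin 3 → ℕ) → E} (hf : ∀ m ∈ exponents d, m ∉ Set.range v → f m = 0) :
    ∑ m ∈ exponents d, f m = ∑ i, f (v i) := by
  classical
  rw [← Finset.sum_image (s := Finset.univ) (g := v) (f := f) hv.inj.injOn]
  refine (Finset.sum_subset (fun m hm => ?_) fun m hm h => hf m hm ?_).symm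
  · obtain ⟨i, -, rfl⟩ := Finset.mem_image.1 hm
    exact hv.mem i
  · rintro ⟨i, rfl⟩
    exact h (Finset.mem_image_of_mem _ (Finset.mem_univ i))

end IsFlag

theorem hatOf_eq_zero {x : Fin 3 → ℝ} {m : Fin 3 → ℕ} (hm : m ∉ Set.range v) :
    hatOf v x m = 0 :=
  Finset.sum_eq_zero fun i _ => if_neg fun h => hm ⟨i, h⟩

/-- Two triangles meet in the hull of their common vertices. So the coordinate of a common point at
a vertex of only one of them vanishes, and uniqueness of barycentric coordinates does the rest. -/
theorem hatOf_eq (hd : 1 ≤ d) (hZ : IsFullTriangulation d Z) (hv : IsFlag d Z v)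
    (hv' : IsFlag d Z v') {x : Fin 3 → ℝ} (hx : x ∈ newtonPolygon d) (h : ∀ i, 0 ≤ bary v x i)
    (h' : ∀ i, 0 ≤ bary v' x i) : hatOf v x = hatOf v' x := by
  obtain ⟨s, hs, hsv⟩ := hv.face
  obtain ⟨s', hs', hsv'⟩ := hv'.face
  have h1 : x ∈ convexHull ℝ (s : Set (Fin 3 → ℝ)) := by
    rw [hsv, hv.mem_convexHull_iff hd hZ subset_rfl]
    exact ⟨hx, h, fun i _ => ⟨i, rfl⟩⟩
  have h2 : x ∈ convexHull ℝ (s' : Set (Fin 3 → ℝ)) := by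
    rw [hsv', hv'.mem_convexHull_iff hd hZ subset_rfl]
    exact ⟨hx, h', fun i _ => ⟨i, rfl⟩⟩
  have h3 := Z.inter_subset_convexHull hs hs' ⟨h1, h2⟩
  rw [hv.mem_convexHull_iff hd hZ (by rw [hsv]; exact Set.inter_subset_left)] at h3
  have hoff : ∀ m ∈ exponents d, m ∉ Set.range v' → hatOf v x m = 0 := by
    intro m _ hm
    refine Finset.sum_eq_zero fun i _ => ?_
    split_ifs with hi
    · by_contra h0
      have h4 := (h3.2.2 i h0).2
      rw [hsv'] at h4
      obtain ⟨j, hj⟩ := h4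
      exact hm ⟨j, (toReal_injective hj).trans hi⟩
    · rfl
  have h5 : ∑ m ∈ exponents d, hatOf v x m • toReal m = x := by
    rw [hv.sum_exponents fun m _ hm => by rw [hatOf_eq_zero hm, zero_smul]]
    simp only [hv.hatOf_vertex]
    exact hv.sum_bary hd hZ x
  rw [hv'.sum_exponents fun m hm h0 => by rw [hoff m hm h0, zero_smul]] at h5
  have h6 := hv'.bary_sum hd hZ fun i => hatOf v x (v' i)
  rw [h5] at h6
  funext m
  by_cases hm : m ∈ exponents d
  · by_cases hmr : m ∈ Set.range v'
    · obtain ⟨i, rfl⟩ := hmr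
      rw [hv'.hatOf_vertex, h6]
    · rw [hoff m hm hmr, hatOf_eq_zero hmr]
  · rw [hatOf_eq_zero fun ⟨i, hi⟩ => hm (hi ▸ hv.mem i),
      hatOf_eq_zero fun ⟨i, hi⟩ => hm (hi ▸ hv'.mem i)]

theorem hat_eq_hatOf (hd : 1 ≤ d) (hZ : IsFullTriangulation d Z) (hv : IsFlag d Z v)
    {x : Fin 3 → ℝ} (hx : x ∈ newtonPolygon d) (h : ∀ i, 0 ≤ bary v x i) :
    hat d Z x = hatOf v x := by
  have h0 : ∃ v, IsFlag d Z v ∧ ∀ i, 0 ≤ bary v x i := ⟨v, hv, h⟩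
  rw [hat, dif_pos h0]
  exact hatOf_eq hd hZ h0.choose_spec.1 hv hx h0.choose_spec.2 h

theorem hat_vertex (hd : 1 ≤ d) (hZ : IsFullTriangulation d Z) (hv : IsFlag d Z v)
    {x : Fin 3 → ℝ} (hx : x ∈ newtonPolygon d) (h : ∀ i, 0 ≤ bary v x i) (i : Fin 3) :
    hat d Z x (v i) = bary v x i := by
  rw [hat_eq_hatOf hd hZ hv hx h, hv.hatOf_vertex]

theorem hat_eq_zero (hd : 1 ≤ d) (hZ : IsFullTriangulation d Z) (hv : IsFlag d Z v)
    {x : Fin 3 → ℝ} (hx : x ∈ newtonPolygon d) (h : ∀ i, 0 ≤ bary v x i) {m : Fin 3 → ℕ}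
    (hm : m ∉ Set.range v) : hat d Z x m = 0 := by
  rw [hat_eq_hatOf hd hZ hv hx h, hatOf_eq_zero hm]

theorem hat_nonneg (hd : 1 ≤ d) (hZ : IsFullTriangulation d Z)
    {x : Fin 3 → ℝ} (hx : x ∈ newtonPolygon d) (m : Fin 3 → ℕ) : 0 ≤ hat d Z x m := by
  obtain ⟨v, hv, h⟩ := exists_flag hd hZ hx
  by_cases hm : m ∈ Set.range v
  · obtain ⟨i, rfl⟩ := hm
    rw [hat_vertex hd hZ hv hx h]; exact h i
  · rw [hat_eq_zero hd hZ hv hx h hm]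

/-- Linear on each of finitely many closed triangles that cover `Δ`. -/
theorem continuous_hat (hd : 1 ≤ d) (hZ : IsFullTriangulation d Z) (m : Fin 3 → ℕ) :
    Continuous fun x : newtonPolygon d => hat d Z x m := by
  have hcont : ∀ v : Fin 3 → Fin 3 → ℕ, Continuous fun x : newtonPolygon d => bary v (x : Fin 3 → ℝ) :=
    fun v => (LinearMap.continuous_of_finiteDimensional (bary v)).comp continuous_subtype_val
  refine LocallyFinite.continuous (ι := {v // IsFlag d Z v})
    (f := fun v => {x : newtonPolygon d | ∀ i, 0 ≤ bary v.1 (x : Fin 3 → ℝ) i})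
    (locallyFinite_of_finite _) ?_ ?_ ?_
  · refine Set.eq_univ_of_forall fun x => ?_
    obtain ⟨v, hv, h⟩ := exists_flag hd hZ x.2
    exact Set.mem_iUnion.2 ⟨⟨v, hv⟩, h⟩
  · intro v
    have : {x : newtonPolygon d | ∀ i, 0 ≤ bary v.1 (x : Fin 3 → ℝ) i} =
        ⋂ i, {x : newtonPolygon d | 0 ≤ bary v.1 (x : Fin 3 → ℝ) i} := by
      ext x; simp
    rw [this]
    exact isClosed_iInter fun i =>
      isClosed_le continuous_const ((continuous_apply i).comp (hcont v.1))
  · intro v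
    have h1 : Continuous fun x : newtonPolygon d => hatOf v.1 (x : Fin 3 → ℝ) m := by
      refine continuous_finsetSum _ fun i _ => ?_
      split_ifs
      · exact (continuous_apply i).comp (hcont v.1)
      · exact continuous_const
    refine h1.continuousOn.congr fun x hx => ?_
    exact congrFun (hat_eq_hatOf hd hZ v.2 x.2 hx) m

/-- Reduces the preservation of simplices by a map to the preservation of zeros of hat functions. -/
theorem mem_convexHull_face_iff (hd : 1 ≤ d) (hZ : IsFullTriangulation d Z)
    {s : Finset (Fin 3 → ℝ)} (hs : s ∈ Z.faces) {x : Fin 3 → ℝ} (hx : x ∈ newtonPolygon d) :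
    x ∈ convexHull ℝ (s : Set (Fin 3 → ℝ)) ↔
      ∀ m ∈ exponents d, hat d Z x m ≠ 0 → toReal m ∈ s := by
  obtain ⟨v, hv, h⟩ := exists_flag hd hZ hx
  obtain ⟨s', hs', hsv'⟩ := hv.face
  have hxs' : x ∈ convexHull ℝ (s' : Set (Fin 3 → ℝ)) := by
    rw [hsv', hv.mem_convexHull_iff hd hZ subset_rfl]
    exact ⟨hx, h, fun i _ => ⟨i, rfl⟩⟩
  constructor
  · intro hxs m _ hm
    have h3 := Z.inter_subset_convexHull hs hs' ⟨hxs, hxs'⟩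
    rw [hv.mem_convexHull_iff hd hZ (by rw [hsv']; exact Set.inter_subset_right)] at h3
    by_cases hmr : m ∈ Set.range v
    · obtain ⟨i, rfl⟩ := hmr
      rw [hat_vertex hd hZ hv hx h] at hm
      exact (h3.2.2 i hm).1
    · exact absurd (hat_eq_zero hd hZ hv hx h hmr) hm
  · intro h0
    have h3 : x ∈ convexHull ℝ ((s : Set (Fin 3 → ℝ)) ∩ s') := by
      rw [hv.mem_convexHull_iff hd hZ (by rw [hsv']; exact Set.inter_subset_right)]
      refine ⟨hx, h, fun i hi => ⟨h0 _ (hv.mem i) ?_, ?_⟩⟩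
      · rwa [hat_vertex hd hZ hv hx h]
      · rw [hsv']; exact ⟨i, rfl⟩
    exact convexHull_mono Set.inter_subset_left h3

/-! ### The dual graph in barycentric coordinates -/

theorem centroid_eq {n : ℕ} (hn : n ≠ 0) {u : Fin n → Fin 3 → ℝ} (hu : Function.Injective u)
    {s : Finset (Fin 3 → ℝ)} (hs : (s : Set (Fin 3 → ℝ)) = Set.range u) :
    s.centroid ℝ id = ∑ i, (n : ℝ)⁻¹ • u i := by
  have h1 : s = Finset.univ.map ⟨u, hu⟩ := by
    apply Finset.coe_injective
    rw [hs]; simp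
  have hc : s.card = n := by rw [h1]; simp
  rw [Finset.centroid_def, Finset.affineCombination_eq_linear_combination _ _ _
    (Finset.sum_centroidWeights_eq_one_of_card_ne_zero ℝ s (by rwa [hc]))]
  simp only [Finset.centroidWeights_apply, hc, id]
  rw [h1, Finset.sum_map]
  rfl

/-- With the vertices numbered so that the edge consists of the first two, the segment from
barycenter to midpoint is the set `λ₀ = λ₁ ≥ λ₂` of the triangle. -/
theorem mem_dualGraph_iff (hd : 1 ≤ d) (hZ : IsFullTriangulation d Z) (x : newtonPolygon d) :
    x ∈ dualGraph d Z ↔ ∃ v, IsFlag d Z v ∧ (∀ i, 0 ≤ bary v (x : Fin 3 → ℝ) i) ∧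
      bary v (x : Fin 3 → ℝ) 0 = bary v (x : Fin 3 → ℝ) 1 ∧
      bary v (x : Fin 3 → ℝ) 2 ≤ bary v (x : Fin 3 → ℝ) 1 := by
  have hinj2 : ∀ {v}, IsFlag d Z v → Function.Injective ![toReal (v 0), toReal (v 1)] := by
    intro v hv i j hij
    have h01 : toReal (v 0) ≠ toReal (v 1) := fun h =>
      absurd (hv.inj (toReal_injective h)) (by decide)
    fin_cases i <;> fin_cases j <;> simp [h01, h01.symm] at hij ⊢
  constructor
  · rintro ⟨s, hs, e, he, hs3, he2, hes, hx⟩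
    obtain ⟨u, hu, hus⟩ := exists_flag_of_card hZ hs hs3
    obtain ⟨v, hv, hvs, hve⟩ : ∃ v, IsFlag d Z v ∧
        (s : Set (Fin 3 → ℝ)) = Set.range (fun i => toReal (v i)) ∧
        (e : Set (Fin 3 → ℝ)) = Set.range ![toReal (v 0), toReal (v 1)] := by
      -- The vertex of the triangle that is missing from the edge is moved to the last place.
      obtain ⟨y, hys, hye⟩ := Finset.exists_mem_notMem_of_card_lt_card (s := e) (t := s) (by omega)
      have hy : y ∈ Set.range fun i => toReal (u i) := by rw [← hus]; exact hys
      obtain ⟨i, rfl⟩ := hy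
      set σ := Equiv.swap i 2
      have hr : (s : Set (Fin 3 → ℝ)) = Set.range fun j => toReal ((u ∘ σ) j) := by
        rw [hus]
        exact (σ.surjective.range_comp fun i => toReal (u i)).symm
      have hf := hu.perm σ
      refine ⟨u ∘ σ, hf, hr, ?_⟩
      have h2 : (u ∘ σ) 2 = u i := by simp [σ]
      have hsub : e ⊆ Finset.univ.map ⟨_, hinj2 hf⟩ := by
        intro z hz
        have hz' : z ∈ (s : Set (Fin 3 → ℝ)) := hes hz
        rw [hr] at hz'
        obtain ⟨j, rfl⟩ := hz'
        rw [Finset.mem_map]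
        fin_cases j
        · exact ⟨0, Finset.mem_univ _, rfl⟩
        · exact ⟨1, Finset.mem_univ _, rfl⟩
        · exfalso
          apply hye
          have h3 : toReal ((u ∘ σ) 2) ∈ e := hz
          rwa [h2] at h3
      have := Finset.eq_of_subset_of_card_le hsub (by simp [he2])
      rw [this]; simp
    have hc3 := centroid_eq (n := 3) (by norm_num)
      (fun i j hij => hv.inj (toReal_injective hij)) hvs
    have hc2 := centroid_eq (n := 2) (by norm_num) (hinj2 hv) hve
    rw [hc3, hc2] at hx
    obtain ⟨a, b, ha, hb, hab, hx⟩ := hx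
    have hx' : (x : Fin 3 → ℝ) = ∑ i, (![a / 3 + b / 2, a / 3 + b / 2, a / 3] : Fin 3 → ℝ) i •
        toReal (v i) := by
      rw [← hx]
      simp only [Fin.sum_univ_three, Fin.sum_univ_two]
      funext j
      simp
      ring
    have hb := hv.bary_sum hd hZ (![a / 3 + b / 2, a / 3 + b / 2, a / 3] : Fin 3 → ℝ)
    rw [← hx'] at hb
    refine ⟨v, hv, fun i => ?_, ?_, ?_⟩
    · rw [hb]; fin_cases i <;> simp <;> positivity
    · rw [hb]; simp
    · rw [hb]; simp; positivity
  · rintro ⟨v, hv, h0, h01, h21⟩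
    obtain ⟨s, hs, hvs⟩ := hv.face
    have hes : Finset.univ.map ⟨_, hinj2 hv⟩ ⊆ s := by
      intro z hz
      rw [← Finset.mem_coe, hvs]
      obtain ⟨j, -, rfl⟩ := Finset.mem_map.1 hz
      fin_cases j
      · exact ⟨0, rfl⟩
      · exact ⟨1, rfl⟩
    have hs' : s = Finset.univ.map ⟨fun i => toReal (v i),
        fun i j hij => hv.inj (toReal_injective hij)⟩ := by
      apply Finset.coe_injective
      rw [hvs, Finset.coe_map, Finset.coe_univ, Set.image_univ]; rfl
    refine ⟨s, hs, Finset.univ.map ⟨_, hinj2 hv⟩, Z.down_closed hs hes (by simp), ?_, by simp,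
      hes, ?_⟩
    · rw [hs']; simp
    rw [centroid_eq (n := 3) (by norm_num)
      (fun i j hij => hv.inj (toReal_injective hij)) hvs,
      centroid_eq (n := 2) (by norm_num) (hinj2 hv) (by simp)]
    have hsum := hv.sum_bary_eq_one hd hZ x.2.2
    rw [Fin.sum_univ_three] at hsum
    have h2 := h0 2
    -- The barycenter alone contributes to the last coordinate, by a third of its weight.
    refine ⟨3 * bary v x 2, 1 - 3 * bary v x 2, by linarith, by linarith, by ring, ?_⟩
    nth_rw 3 [← hv.sum_bary hd hZ x]
    simp only [Fin.sum_univ_three, Fin.sum_univ_two]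
    have h3 : bary v (x : Fin 3 → ℝ) 1 = (1 - bary v (x : Fin 3 → ℝ) 2) / 2 := by linarith
    rw [h01, h3]
    funext j
    simp
    ring

/-! ### The convexity condition in barycentric coordinates -/

/-- The height of `w` at `m` above the affine function that agrees with `w` on the triangle `v`. -/
def heightGap (w : (Fin 3 → ℕ) → ℝ) (v : Fin 3 → Fin 3 → ℕ) (m : Fin 3 → ℕ) : ℝ :=
  w m - ∑ i, bary v (toReal m) i * w (v i)

/-- The barycentric coordinates sum to one on `Δ`, so they interpolate the affine function of the
convexity condition from its values at the vertices. -/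
theorem heightGap_pos (hd : 1 ≤ d) (hZ : IsFullTriangulation d Z) {w : (Fin 3 → ℕ) → ℝ}
    (hw : ConvexityCondition d Z w) (hv : IsFlag d Z v) {m : Fin 3 → ℕ} (hm : m ∈ exponents d)
    (hmv : m ∉ Set.range v) : 0 < heightGap w v m := by
  obtain ⟨s, hs, hvs⟩ := hv.face
  have hs' : s = Finset.univ.map ⟨fun i => toReal (v i),
      fun i j hij => hv.inj (toReal_injective hij)⟩ := by
    apply Finset.coe_injective
    rw [hvs, Finset.coe_map, Finset.coe_univ, Set.image_univ]; rfl
  obtain ⟨l, hl⟩ := hw s hs (by rw [hs']; simp)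
  have h1 : ∀ i, l (toReal (v i)) = w (v i) := fun i =>
    (hl (v i) (hv.mem i)).1 (by rw [← Finset.mem_coe, hvs]; exact ⟨i, rfl⟩)
  have h2 := (hl m hm).2 (by
    rw [← Finset.mem_coe, hvs]
    rintro ⟨i, hi⟩
    exact hmv ⟨i, toReal_injective hi⟩)
  have h3 : l (toReal m) = ∑ i, bary v (toReal m) i * w (v i) := by
    conv_lhs => rw [← hv.sum_bary hd hZ (toReal m)]
    have h4 := hv.sum_bary_eq_one hd hZ (sum_toReal hm)
    have h5 : ∀ x, l x = l.linear x + l 0 := fun x => by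
      have := l.map_vadd 0 x
      simpa using this
    rw [h5, map_sum]
    simp only [map_smul, smul_eq_mul]
    have h6 : l 0 = ∑ i, bary v (toReal m) i * l 0 := by
      rw [← Finset.sum_mul, h4, one_mul]
    conv_lhs => rw [h6]
    rw [← Finset.sum_add_distrib]
    exact Finset.sum_congr rfl fun i _ => by rw [← h1 i, h5 (toReal (v i))]; ring
  rw [heightGap, ← h3]
  linarith

/-! ### A quantitative implicit function estimate along logarithmically straight paths -/

theorem exp_sub_exp_le (a b : ℝ) : |Real.exp a - Real.exp b| ≤ Real.exp (max a b) * |a - b| := by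
  wlog h : b ≤ a generalizing a b
  · rw [abs_sub_comm, max_comm, abs_sub_comm a b]
    exact this b a (le_of_not_ge h)
  rw [max_eq_left h, abs_of_nonneg (sub_nonneg.2 h),
    abs_of_nonneg (sub_nonneg.2 (Real.exp_le_exp.2 h))]
  have h1 := Real.add_one_le_exp (b - a)
  have h2 : Real.exp b = Real.exp a * Real.exp (b - a) := by rw [← Real.exp_add]; ring_nf
  have h3 := Real.exp_pos a
  rw [h2]
  nlinarith

theorem lerp_le_max {a b θ : ℝ} (h0 : 0 ≤ θ) (h1 : θ ≤ 1) : a + θ * (b - a) ≤ max a b := by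
  rcases le_total a b with h | h
  · rw [max_eq_right h]; nlinarith
  · rw [max_eq_left h]; nlinarith

theorem min_le_lerp {a b θ : ℝ} (h0 : 0 ≤ θ) (h1 : θ ≤ 1) : min a b ≤ a + θ * (b - a) := by
  rcases le_total a b with h | h
  · rw [min_eq_left h]; nlinarith
  · rw [min_eq_right h]; nlinarith

/-- At a zero of the function in `level_set_slope`, the main term is bounded below. -/
theorem level_set_low {ι : Type*} {C L N M δ l X V : ℝ} (hC : 1 ≤ C)
    (hM : M = Real.exp (2 * L * (2 * C + 1) + 2 * C)) (hδ0 : 0 < δ)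
    (hb3 : C * N * M * δ ≤ 1 / 2) (hb4 : C * N * δ ≤ 1 / 2) {E : Finset ι} {D : ι → ℝ}
    {j k : ι → ℤ} (hE : (E.card : ℝ) ≤ N) (hD : ∀ m ∈ E, 0 ≤ D m ∧ D m ≤ δ)
    (hjk : ∀ m ∈ E, |(j m : ℝ)| ≤ C ∧ |(k m : ℝ)| ≤ C) (hl0 : 0 ≤ l) (hX : |X| ≤ L) (hV : V ≤ 1)
    (hT : ∀ m ∈ E, D m * Real.exp (2 * ((j m + k m - 1) * X + k m * V)) ≤ δ)
    (hF : Real.exp (2 * V) - l + ∑ m ∈ E, (k m - l * j m) *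
      (D m * Real.exp (2 * ((j m + k m - 1) * X + k m * V))) = 0) :
    l ≤ 3 * Real.exp (2 * V) := by
  have hL : 0 ≤ L := (abs_nonneg X).trans hX
  have hM0 : 0 < M := by rw [hM]; exact Real.exp_pos _
  have hterm : ∀ m ∈ E, (k m - l * j m) *
      (D m * Real.exp (2 * ((j m + k m - 1) * X + k m * V))) ≤
      l * (C * δ) + C * (δ * M * Real.exp (2 * V)) := by
    intro m hm
    obtain ⟨hj, hk⟩ := hjk m hm
    have hj' := abs_le.1 hj
    have hk' := abs_le.1 hk
    have hT0 : 0 ≤ D m * Real.exp (2 * ((j m + k m - 1) * X + k m * V)) :=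
      mul_nonneg (hD m hm).1 (Real.exp_pos _).le
    set T := D m * Real.exp (2 * ((j m + k m - 1) * X + k m * V)) with hTdef
    have h1 : -(l * j m) * T ≤ l * (C * δ) := by
      have h2 : -(j m : ℝ) * T ≤ C * δ := by
        calc -(j m : ℝ) * T ≤ C * T := mul_le_mul_of_nonneg_right (by linarith) hT0
          _ ≤ C * δ := mul_le_mul_of_nonneg_left (hT m hm) (by linarith)
      calc -(l * j m) * T = l * (-(j m : ℝ) * T) := by ring
        _ ≤ _ := mul_le_mul_of_nonneg_left h2 hl0
    -- Terms with `k ≤ 0` only help. For `k ≥ 1` the exponential is at most `M exp (2 V)`, because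
    -- `V ≤ 1` bounds the surplus `(k - 1) V`.
    have h2 : (k m : ℝ) * T ≤ C * (δ * M * Real.exp (2 * V)) := by
      by_cases hk0 : k m ≤ 0
      · have hk0' : (k m : ℝ) ≤ 0 := by exact_mod_cast hk0
        have : (k m : ℝ) * T ≤ 0 := mul_nonpos_of_nonpos_of_nonneg hk0' hT0
        have : 0 ≤ C * (δ * M * Real.exp (2 * V)) := by positivity
        linarith
      · have hk1 : (1 : ℝ) ≤ k m := by exact_mod_cast (by omega : 1 ≤ k m)
        have hexp : Real.exp (2 * ((j m + k m - 1) * X + k m * V)) ≤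
            M * Real.exp (2 * V) := by
          rw [hM, ← Real.exp_add]
          apply Real.exp_le_exp.2
          have h3 : (j m + k m - 1 : ℝ) * X ≤ (2 * C + 1) * L := by
            calc (j m + k m - 1 : ℝ) * X ≤ |(j m + k m - 1 : ℝ) * X| := le_abs_self _
              _ = |(j m + k m - 1 : ℝ)| * |X| := abs_mul _ _
              _ ≤ (2 * C + 1) * L := by
                  refine mul_le_mul ?_ hX (abs_nonneg _) (by linarith)
                  rw [abs_le]; constructor <;> linarith
          have h4 : ((k m : ℝ) - 1) * V ≤ C := by nlinarith
          nlinarith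
        calc (k m : ℝ) * T ≤ C * T := mul_le_mul_of_nonneg_right hk'.2 hT0
          _ ≤ C * (δ * (M * Real.exp (2 * V))) := by
              refine mul_le_mul_of_nonneg_left ?_ (by linarith)
              exact mul_le_mul (hD m hm).2 hexp (Real.exp_pos _).le hδ0.le
          _ = _ := by ring
    calc (k m - l * j m) * T = (k m : ℝ) * T + -(l * j m) * T := by ring
      _ ≤ _ := by linarith
  have hsum := Finset.sum_le_sum hterm
  rw [Finset.sum_const, nsmul_eq_mul] at hsum
  have h5 : (E.card : ℝ) * (l * (C * δ) + C * (δ * M * Real.exp (2 * V))) ≤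
      N * (l * (C * δ) + C * (δ * M * Real.exp (2 * V))) :=
    mul_le_mul_of_nonneg_right hE (by positivity)
  have h6 : N * (l * (C * δ)) ≤ l / 2 := by
    have : C * N * δ ≤ 1 / 2 := by linarith
    nlinarith
  have h7 : N * (C * (δ * M * Real.exp (2 * V))) ≤ Real.exp (2 * V) / 2 := by
    have : C * N * M * δ ≤ 1 / 2 := by linarith
    have := Real.exp_pos (2 * V)
    nlinarith
  linarith

/-- This concerns half the partial derivative in `V`. Integrality gives `k² ≥ 1` unless `k = 0`, so
the terms `k² T` add up to at least the sum over `k ≠ 0`. The terms containing `l` are absorbed by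
half of `K`, because `l ≤ 3 K`. -/
theorem level_set_denominator {ι : Type*} {C N δ l K : ℝ} {E : Finset ι} {j k : ι → ℤ}
    {T : ι → ℝ} (hC : 1 ≤ C) (hjk : ∀ m ∈ E, |(j m : ℝ)| ≤ C ∧ |(k m : ℝ)| ≤ C) (hl0 : 0 ≤ l)
    (hT0 : ∀ m ∈ E, 0 ≤ T m) (hK0 : 0 < K) (hlK : l ≤ 3 * K) (hb2 : C ^ 2 * (N * δ) ≤ 1 / 6)
    (hS₀δ : ∑ m ∈ E, T m ≤ N * δ) :
    (K + ∑ m ∈ E, if k m = 0 then 0 else T m) / 2 ≤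
      K + ∑ m ∈ E, (k m - l * j m) * k m * T m := by
  set S := ∑ m ∈ E, if k m = 0 then 0 else T m with hS
  set S₀ := ∑ m ∈ E, T m with hS₀
  have hS₀0 : 0 ≤ S₀ := Finset.sum_nonneg hT0
  have hS0 : 0 ≤ S := Finset.sum_nonneg fun m hm => by
    split_ifs
    · exact le_rfl
    · exact hT0 m hm
  have h1 : S - l * C ^ 2 * S₀ ≤ ∑ m ∈ E, (k m - l * j m) * k m * T m := by
    rw [hS, hS₀, Finset.mul_sum, ← Finset.sum_sub_distrib]
    refine Finset.sum_le_sum fun m hm => ?_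
    obtain ⟨hj, hk⟩ := hjk m hm
    have hjk' : (j m : ℝ) * k m ≤ C ^ 2 := by
      calc (j m : ℝ) * k m ≤ |(j m : ℝ) * k m| := le_abs_self _
        _ = |(j m : ℝ)| * |(k m : ℝ)| := abs_mul _ _
        _ ≤ C * C := mul_le_mul hj hk (abs_nonneg _) (by linarith)
        _ = C ^ 2 := by ring
    have hTm := hT0 m hm
    have h2 : l * (j m * k m) * T m ≤ l * C ^ 2 * T m :=
      mul_le_mul_of_nonneg_right (mul_le_mul_of_nonneg_left hjk' hl0) hTm
    split_ifs with hk0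
    · rw [hk0]
      have : 0 ≤ l * C ^ 2 * T m := by positivity
      simp
      linarith
    · have h3 : (1 : ℝ) ≤ (k m : ℝ) * k m := by
        have : 1 ≤ k m * k m := by
          rcases lt_or_gt_of_ne hk0 with h | h <;> nlinarith
        exact_mod_cast this
      nlinarith
  have h4 : l * C ^ 2 * S₀ ≤ K / 2 := by
    have h5 : C ^ 2 * S₀ ≤ C ^ 2 * (N * δ) := mul_le_mul_of_nonneg_left hS₀δ (by positivity)
    calc l * C ^ 2 * S₀ = l * (C ^ 2 * S₀) := by ring
      _ ≤ 3 * K * (1 / 6) := mul_le_mul hlK (by linarith) (by positivity) (by positivity)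
      _ = K / 2 := by ring
  linarith

/-- This concerns half the partial derivative in `X`. Terms with `k = 0` carry the factor `l ≤ 3 K`,
which makes them small compared with `K`; the remaining ones are bounded by their sum. -/
theorem level_set_numerator {ι : Type*} {C N δ l K : ℝ} {E : Finset ι} {j k : ι → ℤ}
    {T : ι → ℝ} (hC : 1 ≤ C) (hjk : ∀ m ∈ E, |(j m : ℝ)| ≤ C ∧ |(k m : ℝ)| ≤ C) (hl0 : 0 ≤ l)
    (hT0 : ∀ m ∈ E, 0 ≤ T m) (hK0 : 0 < K) (hlK : l ≤ 3 * K)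
    (hS₀δ : ∑ m ∈ E, T m ≤ N * δ) :
    |∑ m ∈ E, (k m - l * j m) * (j m + k m - 1) * T m| ≤
      C * (2 * C + 1) * ((∑ m ∈ E, if k m = 0 then 0 else T m) + 3 * N * δ * K) := by
  set S := ∑ m ∈ E, if k m = 0 then 0 else T m with hS
  set S₀ := ∑ m ∈ E, T m with hS₀
  have hS₀0 : 0 ≤ S₀ := Finset.sum_nonneg hT0
  set C₃ : ℝ := C * (2 * C + 1) with hC₃
  have hC₃1 : 0 ≤ C₃ := by rw [hC₃]; positivity
  set N₁ := ∑ m ∈ E, (k m - l * j m) * (j m + k m - 1) * T m with hN₁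
  have h1 : |N₁| ≤ ∑ m ∈ E, (C₃ * (if k m = 0 then 0 else T m) + l * C₃ * T m) := by
    rw [hN₁]
    refine (Finset.abs_sum_le_sum_abs _ _).trans (Finset.sum_le_sum fun m hm => ?_)
    obtain ⟨hj, hk⟩ := hjk m hm
    have hj' := abs_le.1 hj
    have hk' := abs_le.1 hk
    have hTm := hT0 m hm
    rw [abs_mul, abs_mul, abs_of_nonneg hTm]
    have h2 : |(j m + k m - 1 : ℝ)| ≤ 2 * C + 1 := by
      rw [abs_le]; constructor <;> linarith
    have h3 : |(k m - l * j m : ℝ)| ≤ (if k m = 0 then 0 else C) + l * C := by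
      have h4 : |l * (j m : ℝ)| ≤ l * C := by
        rw [abs_mul, abs_of_nonneg hl0]
        exact mul_le_mul_of_nonneg_left hj hl0
      refine (abs_sub _ _).trans (add_le_add ?_ h4)
      split_ifs with hk0
      · rw [hk0]; simp
      · exact hk
    have h5 : 0 ≤ (if k m = 0 then 0 else C) + l * C := by
      have : 0 ≤ l * C := by positivity
      split_ifs <;> linarith
    calc |(k m - l * j m : ℝ)| * |(j m + k m - 1 : ℝ)| * T m ≤
        ((if k m = 0 then 0 else C) + l * C) * (2 * C + 1) * T m :=
          mul_le_mul_of_nonneg_right (mul_le_mul h3 h2 (abs_nonneg _) h5) hTm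
      _ = _ := by
          rw [hC₃]
          split_ifs <;> ring
  rw [Finset.sum_add_distrib, ← Finset.mul_sum, ← Finset.mul_sum] at h1
  have h6 : l * C₃ * S₀ ≤ C₃ * (3 * N * δ * K) := by
    calc l * C₃ * S₀ = C₃ * (l * S₀) := by ring
      _ ≤ C₃ * (3 * K * (N * δ)) := by
          refine mul_le_mul_of_nonneg_left ?_ hC₃1
          exact mul_le_mul hlK hS₀δ hS₀0 (by positivity)
      _ = _ := by ring
  calc |N₁| ≤ C₃ * S + l * C₃ * S₀ := h1
    _ ≤ _ := by linarith

/-- Division by `K + S` bounds the slope of `V`. For `κ = exp V` at the intermediate point, where `K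
= κ²`, one needs `κ S ≤ σ (K + S)`. This is clear if `κ ≤ σ`; otherwise `S ≤ σ² ≤ σ κ`, whence `κ S
≤ σ K`. -/
theorem level_set_finish {N δ σ ε C₃ L K S X₁ X₂ V₁ V₂ θ : ℝ} (hσ0 : 0 < σ) (hε : 0 < ε)
    (hC₃1 : 1 ≤ C₃) (hL : 0 ≤ L) (hσε : Real.exp (4 * C₃ * L) * (2 * C₃) * (10 * σ) ≤ ε)
    (hN0 : 0 ≤ N) (h3Nδ : 3 * N * δ ≤ 1) (hb5 : 3 * N * δ ≤ σ) (hb6 : N * δ ≤ σ ^ 2)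
    (hδ0 : 0 < δ) (hX₁ : |X₁| ≤ L) (hX₂ : |X₂| ≤ L) (hV₁ : V₁ ≤ 1) (hV₂ : V₂ ≤ 1)
    (hθ0 : 0 < θ) (hθ1 : θ < 1) (hK : K = Real.exp (2 * (V₁ + θ * (V₂ - V₁)))) (hS0 : 0 ≤ S)
    (hSδ : S ≤ N * δ)
    (hmain : |V₂ - V₁| * (K + S) ≤ 2 * C₃ * (S + 3 * N * δ * K) * |X₂ - X₁|) :
    |V₂ - V₁| ≤ 2 * C₃ * |X₂ - X₁| ∧ |Real.exp V₂ - Real.exp V₁| ≤ ε * |X₂ - X₁| := by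
  have hK0 : 0 < K := by rw [hK]; exact Real.exp_pos _
  have hKS : 0 < K + S := by linarith
  set Q : ℝ := Real.exp (4 * C₃ * L) with hQ
  have hQ0 : 0 < Q := Real.exp_pos _
  set Vθ := V₁ + θ * (V₂ - V₁) with hVθ
  have hB : |V₂ - V₁| ≤ 2 * C₃ * |X₂ - X₁| := by
    have h1 : 2 * C₃ * (S + 3 * N * δ * K) * |X₂ - X₁| ≤ 2 * C₃ * |X₂ - X₁| * (K + S) := by
      have h2 : S + 3 * N * δ * K ≤ K + S := by
        have := mul_le_mul_of_nonneg_right h3Nδ hK0.le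
        linarith
      have h3 : 0 ≤ 2 * C₃ * |X₂ - X₁| := by positivity
      calc _ = 2 * C₃ * |X₂ - X₁| * (S + 3 * N * δ * K) := by ring
        _ ≤ _ := mul_le_mul_of_nonneg_left h2 h3
    exact le_of_mul_le_mul_right (hmain.trans h1) hKS
  refine ⟨hB, ?_⟩
  set κ := Real.exp Vθ with hκ
  have hκ0 : 0 < κ := Real.exp_pos _
  have hKκ : K = κ * κ := by rw [hK, hκ, ← Real.exp_add]; ring_nf
  have hκ3 : κ ≤ 3 := by
    have h1 : Vθ ≤ 1 := by
      have := lerp_le_max (a := V₁) (b := V₂) hθ0.le hθ1.le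
      exact this.trans (max_le hV₁ hV₂)
    have h2 : κ ≤ Real.exp 1 := Real.exp_le_exp.2 h1
    have h3 := Real.exp_one_lt_d9
    linarith
  have hκS : κ * S ≤ σ * (K + S) := by
    have hSσ : S ≤ σ ^ 2 := by linarith
    have hσK : 0 ≤ σ * K := by positivity
    by_cases hle : κ ≤ σ
    · have := mul_le_mul_of_nonneg_right hle hS0
      linarith
    · push Not at hle
      have h1 : S ≤ σ * κ := by nlinarith
      have h2 : κ * S ≤ σ * K := by
        calc κ * S ≤ κ * (σ * κ) := mul_le_mul_of_nonneg_left h1 hκ0.le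
          _ = σ * K := by rw [hKκ]; ring
      have h3 : 0 ≤ σ * S := by positivity
      linarith
  have hκV : κ * |V₂ - V₁| ≤ 2 * C₃ * (4 * σ) * |X₂ - X₁| := by
    have h1 : κ * (S + 3 * N * δ * K) ≤ 4 * σ * (K + S) := by
      have h2 : κ * (3 * N * δ * K) ≤ 3 * (σ * K) := by
        have h3 : 3 * N * δ * K ≤ σ * K := mul_le_mul_of_nonneg_right hb5 hK0.le
        exact mul_le_mul hκ3 h3 (by positivity) (by norm_num)
      have h5 : 0 ≤ σ * S := by positivity
      have h6 : 0 ≤ σ * K := by positivity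
      linarith
    refine le_of_mul_le_mul_right ?_ hKS
    calc κ * |V₂ - V₁| * (K + S) = κ * (|V₂ - V₁| * (K + S)) := by ring
      _ ≤ κ * (2 * C₃ * (S + 3 * N * δ * K) * |X₂ - X₁|) :=
          mul_le_mul_of_nonneg_left hmain hκ0.le
      _ = 2 * C₃ * |X₂ - X₁| * (κ * (S + 3 * N * δ * K)) := by ring
      _ ≤ 2 * C₃ * |X₂ - X₁| * (4 * σ * (K + S)) :=
          mul_le_mul_of_nonneg_left h1 (by positivity)
      _ = _ := by ring
  -- Going from the intermediate point to the end points costs at most a factor `Q`, since `V`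
  -- changes by at most `4 C₃ L`.
  have hmax : Real.exp (max V₂ V₁) ≤ κ * Q := by
    rw [hκ, hQ, ← Real.exp_add]
    apply Real.exp_le_exp.2
    have h1 := abs_sub X₂ X₁
    have h2 : |V₂ - V₁| ≤ 4 * C₃ * L := by
      calc |V₂ - V₁| ≤ 2 * C₃ * |X₂ - X₁| := hB
        _ ≤ 2 * C₃ * (2 * L) := mul_le_mul_of_nonneg_left (by linarith) (by linarith)
        _ = _ := by ring
    have h6 : ∀ b : ℝ, |b| ≤ 1 → b * (V₂ - V₁) ≤ 4 * C₃ * L := fun b hb => by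
      calc b * (V₂ - V₁) ≤ |b| * |V₂ - V₁| := by rw [← abs_mul]; exact le_abs_self _
        _ ≤ 1 * (4 * C₃ * L) := mul_le_mul hb h2 (abs_nonneg _) zero_le_one
        _ = _ := one_mul _
    have h7 := h6 (1 - θ) (abs_le.2 ⟨by linarith, by linarith⟩)
    have h8 := h6 (-θ) (abs_le.2 ⟨by linarith, by linarith⟩)
    refine max_le ?_ ?_ <;> rw [hVθ] <;> linarith
  calc |Real.exp V₂ - Real.exp V₁| ≤ Real.exp (max V₂ V₁) * |V₂ - V₁| := exp_sub_exp_le _ _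
    _ ≤ κ * Q * |V₂ - V₁| := mul_le_mul_of_nonneg_right hmax (abs_nonneg _)
    _ = Q * (κ * |V₂ - V₁|) := by ring
    _ ≤ Q * (2 * C₃ * (4 * σ) * |X₂ - X₁|) := mul_le_mul_of_nonneg_left hκV hQ0.le
    _ = Q * (2 * C₃) * (4 * σ) * |X₂ - X₁| := by ring
    _ ≤ ε * |X₂ - X₁| := by
        refine mul_le_mul_of_nonneg_right (le_trans ?_ hσε) (abs_nonneg _)
        exact mul_le_mul_of_nonneg_left (by linarith) (by positivity)

/-- The level sets of `V ↦ exp (2 V) + ∑ (k - λ j) D exp (2 ((j + k - 1) X + k V))` are graphs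
`V = V(X)` with controlled slope, when all terms of the sum are small. The exponents `k` are
integers, so that `|k| ≤ k²`. -/
theorem level_set_slope {ι : Type*} (C L N : ℝ) (hC : 1 ≤ C) (hL : 0 ≤ L) (hN : 1 ≤ N) :
    ∃ B : ℝ, 0 < B ∧ ∀ ε : ℝ, 0 < ε → ∃ δ : ℝ, 0 < δ ∧
    ∀ (E : Finset ι) (D : ι → ℝ) (j k : ι → ℤ) (X₁ X₂ V₁ V₂ l : ℝ),
      (E.card : ℝ) ≤ N → (∀ m ∈ E, 0 ≤ D m ∧ D m ≤ δ) → (∀ m ∈ E, |(j m : ℝ)| ≤ C ∧ |(k m : ℝ)| ≤ C) →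
      |X₁| ≤ L → |X₂| ≤ L → V₁ ≤ 1 → V₂ ≤ 1 → 0 ≤ l → l ≤ 1 →
      (∀ m ∈ E, D m * Real.exp (2 * ((j m + k m - 1) * X₁ + k m * V₁)) ≤ δ) →
      (∀ m ∈ E, D m * Real.exp (2 * ((j m + k m - 1) * X₂ + k m * V₂)) ≤ δ) →
      (Real.exp (2 * V₁) - l + ∑ m ∈ E, (k m - l * j m) *
        (D m * Real.exp (2 * ((j m + k m - 1) * X₁ + k m * V₁))) = 0) →
      (Real.exp (2 * V₂) - l + ∑ m ∈ E, (k m - l * j m) *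
        (D m * Real.exp (2 * ((j m + k m - 1) * X₂ + k m * V₂))) = 0) →
      |V₂ - V₁| ≤ B * |X₂ - X₁| ∧ |Real.exp V₂ - Real.exp V₁| ≤ ε * |X₂ - X₁| := by
  set C₃ : ℝ := C * (2 * C + 1) with hC₃
  have hC₃1 : 1 ≤ C₃ := by rw [hC₃]; nlinarith
  set M : ℝ := Real.exp (2 * L * (2 * C + 1) + 2 * C) with hM
  have hM1 : 1 ≤ M := by rw [hM]; exact Real.one_le_exp (by positivity)
  have hN0 : 0 ≤ N := by linarith
  refine ⟨2 * C₃, by positivity, fun ε hε => ?_⟩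
  set Q : ℝ := Real.exp (4 * C₃ * L) with hQ
  have hQ0 : 0 < Q := Real.exp_pos _
  obtain ⟨σ, hσ0, hσ1, hσε⟩ : ∃ σ : ℝ, 0 < σ ∧ σ ≤ 1 ∧ Q * (2 * C₃) * (10 * σ) ≤ ε := by
    refine ⟨min 1 (ε / (Q * (2 * C₃) * 10)), by positivity, min_le_left _ _, ?_⟩
    have h1 := min_le_right 1 (ε / (Q * (2 * C₃) * 10))
    rw [le_div_iff₀ (by positivity)] at h1
    linarith
  -- One choice that serves all smallness conditions: `P δ ≤ σ²` for every `P ≤ 6 C² N M`.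
  set δ : ℝ := σ ^ 2 / (6 * C ^ 2 * N * M) with hδ
  have hδ0 : 0 < δ := by rw [hδ]; positivity
  have hδeq : δ * (6 * C ^ 2 * N * M) = σ ^ 2 := by rw [hδ]; field_simp
  have hδb : ∀ P : ℝ, P ≤ 6 * C ^ 2 * N * M → P * δ ≤ σ ^ 2 := by
    intro P hP
    rw [← hδeq]
    nlinarith
  have hσ2 : σ ^ 2 ≤ 1 := by nlinarith
  have hσ2' : σ ^ 2 ≤ σ := by nlinarith
  have hC2 : C ≤ C ^ 2 := by nlinarith
  have hC21 : 1 ≤ C ^ 2 := by nlinarith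
  have hNM : N ≤ N * M := by nlinarith
  have hCN : C * N ≤ C ^ 2 * N := by nlinarith
  have hCNM : C ^ 2 * N ≤ C ^ 2 * N * M := by
    have : 0 ≤ C ^ 2 * N := by positivity
    nlinarith
  have hNC : N ≤ C ^ 2 * N := by nlinarith
  have hb1 : 3 * N * δ ≤ σ ^ 2 := hδb _ (by nlinarith)
  have hb2 : 6 * (C ^ 2 * N) * δ ≤ σ ^ 2 := hδb _ (by nlinarith)
  have hb3 : 2 * (C * N * M) * δ ≤ σ ^ 2 := hδb _ (by
    have : C * N * M ≤ C ^ 2 * N * M := by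
      have : 0 ≤ N * M := by positivity
      nlinarith
    nlinarith)
  have hb4 : 2 * (C * N) * δ ≤ σ ^ 2 := hδb _ (by nlinarith)
  have hb2' : C ^ 2 * (N * δ) ≤ 1 / 6 := by linarith
  have hb3' : C * N * M * δ ≤ 1 / 2 := by linarith
  have hb4' : C * N * δ ≤ 1 / 2 := by linarith
  have hb5 : 3 * N * δ ≤ σ := by linarith
  have hb6 : N * δ ≤ σ ^ 2 := by
    have : 0 ≤ N * δ := by positivity
    linarith
  refine ⟨δ, hδ0, ?_⟩
  clear_value δ C₃
  clear hb1 hb2 hb3 hb4 hδb hδeq hδ hC2 hC21 hNM hCN hCNM hNC hσ2'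
  intro E D j k X₁ X₂ V₁ V₂ l hE hD hjk hX₁ hX₂ hV₁ hV₂ hl0 hl1 hT₁ hT₂ hF₁ hF₂
  have hl₁ := level_set_low hC hM hδ0 hb3' hb4' hE hD hjk hl0 hX₁ hV₁ hT₁ hF₁
  have hl₂ := level_set_low hC hM hδ0 hb3' hb4' hE hD hjk hl0 hX₂ hV₂ hT₂ hF₂
  -- Rolle
  set g : ι → ℝ → ℝ := fun m θ => 2 * ((j m + k m - 1) * (X₁ + θ * (X₂ - X₁)) +
    k m * (V₁ + θ * (V₂ - V₁))) with hg
  have hder : ∀ θ : ℝ, HasDerivAt (fun θ : ℝ => Real.exp (2 * (V₁ + θ * (V₂ - V₁))) - l +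
      ∑ m ∈ E, (k m - l * j m) * (D m * Real.exp (g m θ)))
      (Real.exp (2 * (V₁ + θ * (V₂ - V₁))) * (2 * (V₂ - V₁)) + ∑ m ∈ E, (k m - l * j m) *
        (D m * (Real.exp (g m θ) * (2 * ((j m + k m - 1) * (X₂ - X₁) + k m * (V₂ - V₁)))))) θ := by
    intro θ
    have hlin : ∀ a b : ℝ, HasDerivAt (fun θ : ℝ => a + θ * b) b θ := by
      intro a b
      simpa using ((hasDerivAt_id θ).mul_const b).const_add a
    refine (((hlin V₁ (V₂ - V₁)).const_mul 2).exp.sub_const l).add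
      (HasDerivAt.fun_sum fun m _ => HasDerivAt.const_mul _ (HasDerivAt.const_mul _ ?_))
    exact ((((hlin X₁ (X₂ - X₁)).const_mul _).add ((hlin V₁ (V₂ - V₁)).const_mul _)).const_mul 2).exp
  obtain ⟨θ, ⟨hθ0, hθ1⟩, hθ⟩ := exists_hasDerivAt_eq_zero (a := (0 : ℝ)) (b := 1) one_pos
    (fun θ _ => (hder θ).continuousAt.continuousWithinAt)
    (by
      have e1 : ∀ m, g m 0 = 2 * ((j m + k m - 1) * X₁ + k m * V₁) := fun m => by
        simp only [hg]; ring
      have e2 : ∀ m, g m 1 = 2 * ((j m + k m - 1) * X₂ + k m * V₂) := fun m => by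
        simp only [hg]; ring
      simp only [e1, e2, zero_mul, add_zero, one_mul, add_sub_cancel]
      rw [hF₁, hF₂]) (fun θ _ => hder θ)
  set Vθ := V₁ + θ * (V₂ - V₁) with hVθ
  set T : ι → ℝ := fun m => D m * Real.exp (g m θ) with hT
  have hT0 : ∀ m ∈ E, 0 ≤ T m := fun m hm => mul_nonneg (hD m hm).1 (Real.exp_pos _).le
  have hTδ : ∀ m ∈ E, T m ≤ δ := by
    intro m hm
    -- The exponent is affine along the segment, so the bound by `δ` at its end points persists,
    -- although the segment leaves the level set.
    have h1 : g m θ ≤ max (2 * ((j m + k m - 1) * X₁ + k m * V₁))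
        (2 * ((j m + k m - 1) * X₂ + k m * V₂)) := by
      refine le_trans (le_of_eq ?_) (lerp_le_max hθ0.le hθ1.le)
      simp only [hg]; ring
    rcases le_max_iff.1 h1 with h2 | h2
    · exact (mul_le_mul_of_nonneg_left (Real.exp_le_exp.2 h2) (hD m hm).1).trans (hT₁ m hm)
    · exact (mul_le_mul_of_nonneg_left (Real.exp_le_exp.2 h2) (hD m hm).1).trans (hT₂ m hm)
  set K := Real.exp (2 * Vθ) with hK
  have hK0 : 0 < K := Real.exp_pos _
  have hlK : l ≤ 3 * K := by
    have h1 := min_le_lerp (a := V₁) (b := V₂) hθ0.le hθ1.le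
    rcases min_le_iff.1 h1 with h2 | h2
    · exact hl₁.trans (by
        have : Real.exp (2 * V₁) ≤ K := Real.exp_le_exp.2 (by linarith)
        linarith)
    · exact hl₂.trans (by
        have : Real.exp (2 * V₂) ≤ K := Real.exp_le_exp.2 (by linarith)
        linarith)
  set S := ∑ m ∈ E, if k m = 0 then 0 else T m with hS
  set S₀ := ∑ m ∈ E, T m with hS₀
  have hS0 : 0 ≤ S := Finset.sum_nonneg fun m hm => by
    split_ifs
    · exact le_rfl
    · exact hT0 m hm
  have hS₀δ : S₀ ≤ N * δ := by
    have := Finset.sum_le_sum hTδ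
    rw [Finset.sum_const, nsmul_eq_mul] at this
    exact this.trans (mul_le_mul_of_nonneg_right hE hδ0.le)
  have hSS₀ : S ≤ S₀ := Finset.sum_le_sum fun m hm => by
    split_ifs
    · exact hT0 m hm
    · exact le_rfl
  have hS₀0 : 0 ≤ S₀ := hS0.trans hSS₀
  set N₂ := K + ∑ m ∈ E, (k m - l * j m) * k m * T m with hN₂
  set N₁ := ∑ m ∈ E, (k m - l * j m) * (j m + k m - 1) * T m with hN₁
  -- The vanishing derivative at `θ` says that the chord has slope `-N₁ / N₂`.
  have hrel : (V₂ - V₁) * N₂ = - ((X₂ - X₁) * N₁) := by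
    have h1 : K * (2 * (V₂ - V₁)) + ∑ m ∈ E, (k m - l * j m) *
        (D m * (Real.exp (g m θ) * (2 * ((j m + k m - 1) * (X₂ - X₁) + k m * (V₂ - V₁))))) =
        2 * ((V₂ - V₁) * N₂ + (X₂ - X₁) * N₁) := by
      have e : 2 * ((V₂ - V₁) * N₂ + (X₂ - X₁) * N₁) = K * (2 * (V₂ - V₁)) +
          (∑ m ∈ E, 2 * (V₂ - V₁) * ((k m - l * j m) * k m * T m) +
            ∑ m ∈ E, 2 * (X₂ - X₁) * ((k m - l * j m) * (j m + k m - 1) * T m)) := by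
        rw [hN₂, hN₁, ← Finset.mul_sum, ← Finset.mul_sum]; ring
      rw [e, ← Finset.sum_add_distrib]
      congr 1
      refine Finset.sum_congr rfl fun m _ => ?_
      simp only [hT]; ring
    rw [h1] at hθ
    linarith
  have hN₂low : (K + S) / 2 ≤ N₂ :=
    level_set_denominator hC hjk hl0 hT0 hK0 hlK hb2' hS₀δ
  have hN₁up : |N₁| ≤ C₃ * (S + 3 * N * δ * K) := by
    rw [hC₃]
    exact level_set_numerator hC hjk hl0 hT0 hK0 hlK hS₀δ
  have h3Nδ : 3 * N * δ ≤ 1 := hb5.trans hσ1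
  clear_value N₁ N₂ S S₀ K
  have hKS : 0 < K + S := by linarith
  have hmain : |V₂ - V₁| * (K + S) ≤ 2 * C₃ * (S + 3 * N * δ * K) * |X₂ - X₁| := by
    have h1 : |V₂ - V₁| * N₂ = |X₂ - X₁| * |N₁| := by
      rw [← abs_mul, ← abs_neg (_ * N₁), ← hrel, abs_mul, abs_of_nonneg (by linarith : 0 ≤ N₂)]
    have h2 : |V₂ - V₁| * ((K + S) / 2) ≤ |V₂ - V₁| * N₂ :=
      mul_le_mul_of_nonneg_left hN₂low (abs_nonneg _)
    have h3 : |X₂ - X₁| * |N₁| ≤ |X₂ - X₁| * (C₃ * (S + 3 * N * δ * K)) :=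
      mul_le_mul_of_nonneg_left hN₁up (abs_nonneg _)
    calc |V₂ - V₁| * (K + S) = 2 * (|V₂ - V₁| * ((K + S) / 2)) := by ring
      _ ≤ 2 * (|X₂ - X₁| * (C₃ * (S + 3 * N * δ * K))) := by linarith
      _ = _ := by ring
  exact level_set_finish hσ0 hε hC₃1 hL hσε hN0 h3Nδ hb5 hb6 hδ0 hX₁ hX₂ hV₁ hV₂
    hθ0 hθ1 hK hS0 (hSS₀.trans hS₀δ) hmain

/-! ### Roots of a perturbed trinomial with prescribed relative phase -/

/-- The data of the equation `1 + y (1 + κ(|y|) e^{iω}) + ρ(y, ω) = 0` in the annulus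
`2/5 ≤ |y| ≤ 3/2`, where `ρ` is a small perturbation and `κ` varies slowly. -/
structure RootFamily (κ : ℝ → ℝ) (ρ : ℂ → ℝ → ℂ) (ε : ℝ) : Prop where
  eps_pos : 0 < ε
  eps_le : ε ≤ 1 / 100
  nonneg : ∀ A ∈ Set.Icc (2 / 5 : ℝ) (3 / 2), 0 ≤ κ A
  le : ∀ A ∈ Set.Icc (2 / 5 : ℝ) (3 / 2), κ A ≤ 11 / 10
  lip : ∀ A ∈ Set.Icc (2 / 5 : ℝ) (3 / 2), ∀ B ∈ Set.Icc (2 / 5 : ℝ) (3 / 2),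
    |κ A - κ B| ≤ ε * |A - B|
  small : ∀ y : ℂ, ‖y‖ ∈ Set.Icc (2 / 5 : ℝ) (3 / 2) → ∀ ω, ‖ρ y ω‖ ≤ ε
  lip_rho : ∀ y : ℂ, ‖y‖ ∈ Set.Icc (2 / 5 : ℝ) (3 / 2) → ∀ z : ℂ,
    ‖z‖ ∈ Set.Icc (2 / 5 : ℝ) (3 / 2) → ∀ ω, ‖ρ y ω - ρ z ω‖ ≤ ε * ‖y - z‖
  cont : ∀ y, Continuous (ρ y)
  periodic : ∀ (y : ℂ) (ω ω' : ℝ),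
    Complex.exp (ω * Complex.I) = Complex.exp (ω' * Complex.I) → ρ y ω = ρ y ω'

namespace RootFamily

variable {κ : ℝ → ℝ} {ρ : ℂ → ℝ → ℂ} {ε : ℝ}

/-- The function whose roots are studied. -/
def eqn (κ : ℝ → ℝ) (ρ : ℂ → ℝ → ℂ) (ω : ℝ) (y : ℂ) : ℂ :=
  1 + y * (1 + κ ‖y‖ * Complex.exp (ω * Complex.I)) + ρ y ω

/-- The annulus where roots are considered. -/
def annulus : Set ℂ := {y | ‖y‖ ∈ Set.Icc (2 / 5 : ℝ) (3 / 2)}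

/-- The relative phases for which there is a root in the annulus. -/
def phases (κ : ℝ → ℝ) : Set ℝ :=
  {ω | 3 / 4 ≤ ‖1 + κ 1 * Complex.exp (ω * Complex.I)‖}

theorem one_mem : (1 : ℝ) ∈ Set.Icc (2 / 5 : ℝ) (3 / 2) := by constructor <;> norm_num

theorem norm_factor_sub (x y : ℝ) (ω : ℝ) :
    ‖(1 + x * Complex.exp (ω * Complex.I)) - (1 + y * Complex.exp (ω * Complex.I))‖ = |x - y| := by
  rw [add_sub_add_left_eq_sub, ← sub_mul, norm_mul, Complex.norm_exp_ofReal_mul_I, mul_one,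
    ← Complex.ofReal_sub, Complex.norm_real, Real.norm_eq_abs]

theorem norm_factor_le (h : RootFamily κ ρ ε) {A : ℝ} (hA : A ∈ Set.Icc (2 / 5 : ℝ) (3 / 2))
    (ω : ℝ) : ‖1 + κ A * Complex.exp (ω * Complex.I)‖ ≤ 1 + κ A := by
  refine (norm_add_le _ _).trans (le_of_eq ?_)
  rw [norm_mul, Complex.norm_exp_ofReal_mul_I, mul_one, Complex.norm_real, Real.norm_eq_abs,
    abs_of_nonneg (h.nonneg A hA), norm_one]

theorem abs_sub_one_le (h : RootFamily κ ρ ε) {A : ℝ} (hA : A ∈ Set.Icc (2 / 5 : ℝ) (3 / 2)) :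
    |κ A - κ 1| ≤ 3 / 5 * ε := by
  refine (h.lip A hA 1 one_mem).trans ?_
  have : |A - 1| ≤ 3 / 5 := by rw [abs_le]; constructor <;> linarith [hA.1, hA.2]
  nlinarith [h.eps_pos]

theorem abs_norm_factor_sub_le (h : RootFamily κ ρ ε) {A : ℝ}
    (hA : A ∈ Set.Icc (2 / 5 : ℝ) (3 / 2)) (ω : ℝ) :
    |‖1 + κ A * Complex.exp (ω * Complex.I)‖ - ‖1 + κ 1 * Complex.exp (ω * Complex.I)‖| ≤
      3 / 5 * ε := by
  refine (abs_norm_sub_norm_le _ _).trans ?_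
  rw [norm_factor_sub]
  exact h.abs_sub_one_le hA

theorem factor_ge (h : RootFamily κ ρ ε) {A : ℝ} (hA : A ∈ Set.Icc (2 / 5 : ℝ) (3 / 2)) {ω : ℝ}
    (hω : ω ∈ phases κ) : 37 / 50 ≤ ‖1 + κ A * Complex.exp (ω * Complex.I)‖ := by
  have h1 := abs_le.1 (h.abs_norm_factor_sub_le hA ω)
  have h2 : 3 / 4 ≤ ‖1 + κ 1 * Complex.exp (ω * Complex.I)‖ := hω
  linarith [h.eps_le]

/-- The modulus of a root, up to the perturbation. -/
theorem norm_root (h : RootFamily κ ρ ε) {y : ℂ} (hy : y ∈ annulus) {ω : ℝ}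
    (h0 : eqn κ ρ ω y = 0) :
    |‖y‖ * ‖1 + κ ‖y‖ * Complex.exp (ω * Complex.I)‖ - 1| ≤ ε := by
  rw [eqn] at h0
  have h1 : y * (1 + κ ‖y‖ * Complex.exp (ω * Complex.I)) = -1 - ρ y ω := by
    linear_combination h0
  rw [← norm_mul, h1]
  have h2 := abs_norm_sub_norm_le (-1 - ρ y ω) (-1)
  rw [norm_neg, norm_one] at h2
  refine h2.trans ?_
  have : -1 - ρ y ω - -1 = - ρ y ω := by ring
  rw [this, norm_neg]
  exact h.small y hy ω

/-- Up to small Lipschitz errors the equation is multiplication of `y` by a factor of norm at least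
`37/50`. Uniqueness of the root and its continuity in the phase both come from here. -/
theorem norm_eqn_sub_ge (h : RootFamily κ ρ ε) {y z : ℂ} (hy : y ∈ annulus) (hz : z ∈ annulus)
    {ω : ℝ} (hω : ω ∈ phases κ) :
    7 / 10 * ‖y - z‖ ≤ ‖eqn κ ρ ω y - eqn κ ρ ω z‖ := by
  have e : (y - z) * (1 + κ ‖y‖ * Complex.exp (ω * Complex.I)) = (eqn κ ρ ω y - eqn κ ρ ω z) -
      (z * ((1 + κ ‖y‖ * Complex.exp (ω * Complex.I)) - (1 + κ ‖z‖ * Complex.exp (ω * Complex.I))) +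
        (ρ y ω - ρ z ω)) := by
    rw [eqn, eqn]; ring
  have h1 := congrArg norm e
  rw [norm_mul] at h1
  have h2 := h.factor_ge hy hω
  have h3 : ‖z * ((1 + κ ‖y‖ * Complex.exp (ω * Complex.I)) -
      (1 + κ ‖z‖ * Complex.exp (ω * Complex.I)))‖ ≤ 3 / 2 * ε * ‖y - z‖ := by
    rw [norm_mul, norm_factor_sub]
    calc ‖z‖ * |κ ‖y‖ - κ ‖z‖| ≤ 3 / 2 * (ε * ‖y - z‖) := by
          refine mul_le_mul hz.2 ((h.lip _ hy _ hz).trans ?_) (abs_nonneg _) (by norm_num)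
          exact mul_le_mul_of_nonneg_left (abs_norm_sub_norm_le _ _) h.eps_pos.le
      _ = _ := by ring
  have h4 := h.lip_rho y hy z hz ω
  have h5 := norm_sub_le (eqn κ ρ ω y - eqn κ ρ ω z)
    (z * ((1 + κ ‖y‖ * Complex.exp (ω * Complex.I)) - (1 + κ ‖z‖ * Complex.exp (ω * Complex.I))) +
        (ρ y ω - ρ z ω))
  have h6 := norm_add_le (z * ((1 + κ ‖y‖ * Complex.exp (ω * Complex.I)) -
    (1 + κ ‖z‖ * Complex.exp (ω * Complex.I)))) (ρ y ω - ρ z ω)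
  have h7 := norm_nonneg (y - z)
  have h8 : 37 / 50 * ‖y - z‖ ≤ ‖y - z‖ * ‖1 + κ ‖y‖ * Complex.exp (ω * Complex.I)‖ := by
    rw [mul_comm (37 / 50 : ℝ)]
    exact mul_le_mul_of_nonneg_left h2 h7
  have h9 : ε * ‖y - z‖ ≤ 1 / 100 * ‖y - z‖ := mul_le_mul_of_nonneg_right h.eps_le h7
  rw [h1] at h8
  linarith

theorem root_unique (h : RootFamily κ ρ ε) {y z : ℂ} (hy : y ∈ annulus) (hz : z ∈ annulus)
    {ω : ℝ} (hω : ω ∈ phases κ) (hy0 : eqn κ ρ ω y = 0) (hz0 : eqn κ ρ ω z = 0) : y = z := by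
  have h1 := h.norm_eqn_sub_ge hy hz hω
  rw [hy0, hz0, sub_zero, norm_zero] at h1
  have h2 : ‖y - z‖ = 0 := le_antisymm (by linarith) (norm_nonneg _)
  exact sub_eq_zero.1 (norm_eq_zero.1 h2)

/-- Solving the main term for `y` gives the map `y ↦ -(1 + ρ) / (1 + κ e^{iω})`, a contraction of
the annulus. -/
theorem exists_root (h : RootFamily κ ρ ε) {ω : ℝ} (hω : ω ∈ phases κ) :
    ∃ y ∈ annulus, eqn κ ρ ω y = 0 := by
  set D : ℂ → ℂ := fun y => 1 + κ ‖y‖ * Complex.exp (ω * Complex.I) with hD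
  set f : ℂ → ℂ := fun y => - (1 + ρ y ω) / D y with hf
  have hD0 : ∀ y ∈ annulus, 37 / 50 ≤ ‖D y‖ := fun y hy => h.factor_ge hy hω
  have hD1 : ∀ y ∈ annulus, ‖D y‖ ≤ 21 / 10 := fun y hy => by
    have := h.norm_factor_le hy ω
    have := h.le _ hy
    simp only [hD]
    linarith
  have hDne : ∀ y ∈ annulus, D y ≠ 0 := fun y hy h0 => by
    have := hD0 y hy
    rw [h0, norm_zero] at this
    norm_num at this
  have hnum : ∀ y ∈ annulus, |‖1 + ρ y ω‖ - 1| ≤ 1 / 100 := by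
    intro y hy
    have h1 := abs_norm_sub_norm_le (1 + ρ y ω) 1
    rw [norm_one, add_sub_cancel_left] at h1
    exact h1.trans ((h.small y hy ω).trans h.eps_le)
  -- The denominator lies between `37/50` and `21/10` and the numerator within `1/100` of one; the
  -- annulus has room for all such quotients.
  have hmaps : Set.MapsTo f annulus annulus := by
    intro y hy
    have h1 := abs_le.1 (hnum y hy)
    have h2 := hD0 y hy
    have h3 := hD1 y hy
    have hDp : 0 < ‖D y‖ := by linarith
    change ‖f y‖ ∈ Set.Icc (2 / 5 : ℝ) (3 / 2)
    rw [hf]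
    simp only [norm_div, norm_neg]
    constructor
    · rw [le_div_iff₀ hDp]; linarith
    · rw [div_le_iff₀ hDp]; linarith
  have hlip : ∀ y ∈ annulus, ∀ z ∈ annulus, ‖f y - f z‖ ≤ 1 / 2 * ‖y - z‖ := by
    intro y hy z hz
    have e : f y - f z = ((1 + ρ z ω) * (D y - D z) - (ρ y ω - ρ z ω) * D z) / (D y * D z) := by
      simp only [hf]
      have h1 := hDne y hy
      have h2 := hDne z hz
      field_simp
      ring
    have h1 := hD0 y hy
    have h2 := hD0 z hz
    have h3 := hD1 z hz
    have h4 := (abs_le.1 (hnum z hz)).2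
    have h5 : ‖D y - D z‖ ≤ ε * ‖y - z‖ := by
      simp only [hD]
      rw [norm_factor_sub]
      refine (h.lip _ hy _ hz).trans ?_
      exact mul_le_mul_of_nonneg_left (abs_norm_sub_norm_le _ _) h.eps_pos.le
    have h6 := h.lip_rho y hy z hz ω
    have h7 : ε * ‖y - z‖ ≤ 1 / 100 * ‖y - z‖ :=
      mul_le_mul_of_nonneg_right h.eps_le (norm_nonneg _)
    rw [e, norm_div, norm_mul, div_le_iff₀ (by positivity)]
    have h8 : ‖(1 + ρ z ω) * (D y - D z) - (ρ y ω - ρ z ω) * D z‖ ≤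
        101 / 100 * (1 / 100 * ‖y - z‖) + 1 / 100 * ‖y - z‖ * (21 / 10) := by
      refine (norm_sub_le _ _).trans ?_
      rw [norm_mul, norm_mul]
      refine add_le_add ?_ ?_
      · exact mul_le_mul (by linarith) (h5.trans h7) (norm_nonneg _) (by norm_num)
      · exact mul_le_mul (h6.trans h7) h3 (norm_nonneg _) (by positivity)
    have h9 : 1 / 2 * (1 / 2) ≤ 1 / 2 * (‖D y‖ * ‖D z‖) := by nlinarith
    have h10 := norm_nonneg (y - z)
    nlinarith
  have hcl : IsClosed annulus := isClosed_Icc.preimage continuous_norm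
  have hcontr : ContractingWith (1 / 2) (hmaps.restrict f annulus annulus) := by
    refine ⟨by rw [← NNReal.coe_lt_coe]; norm_num, ?_⟩
    refine LipschitzWith.of_dist_le_mul fun y z => ?_
    have := hlip y y.2 z z.2
    rw [Subtype.dist_eq, Subtype.dist_eq, dist_eq_norm, dist_eq_norm]
    simpa using this
  have h1mem : (1 : ℂ) ∈ annulus := by
    change ‖(1 : ℂ)‖ ∈ Set.Icc (2 / 5 : ℝ) (3 / 2)
    rw [norm_one]; exact one_mem
  obtain ⟨y, hy, hfix, -⟩ := hcontr.exists_fixedPoint' hcl.isComplete hmaps h1mem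
    (edist_ne_top _ _)
  refine ⟨y, hy, ?_⟩
  have h1 : f y = y := hfix
  simp only [hf] at h1
  rw [div_eq_iff (hDne y hy)] at h1
  rw [eqn]
  simp only [hD] at h1
  linear_combination -h1

open Classical in
/-- The root in the annulus with given relative phase. -/
def root (κ : ℝ → ℝ) (ρ : ℂ → ℝ → ℂ) (ω : ℝ) : ℂ :=
  if h : ∃ y ∈ annulus, eqn κ ρ ω y = 0 then h.choose else 1

theorem root_spec (h : RootFamily κ ρ ε) {ω : ℝ} (hω : ω ∈ phases κ) :
    root κ ρ ω ∈ annulus ∧ eqn κ ρ ω (root κ ρ ω) = 0 := by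
  rw [root, dif_pos (h.exists_root hω)]
  exact (h.exists_root hω).choose_spec

/-- By `norm_eqn_sub_ge` the distance to the root at a nearby phase is bounded by the residual of
the old root, which tends to zero. -/
theorem continuousOn_root (h : RootFamily κ ρ ε) : ContinuousOn (root κ ρ) (phases κ) := by
  intro ω₀ hω₀
  obtain ⟨hy₀, he₀⟩ := h.root_spec hω₀
  set y₀ := root κ ρ ω₀
  rw [ContinuousWithinAt, tendsto_iff_norm_sub_tendsto_zero]
  have hc : Continuous fun ω => eqn κ ρ ω y₀ := by
    have := h.cont y₀
    unfold eqn
    fun_prop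
  have hlim : Filter.Tendsto (fun ω => 10 / 7 * ‖eqn κ ρ ω y₀‖) (nhdsWithin ω₀ (phases κ))
      (nhds 0) := by
    have h1 := (hc.norm.const_mul (10 / 7 : ℝ)).tendsto ω₀
    rw [he₀, norm_zero, mul_zero] at h1
    exact h1.mono_left nhdsWithin_le_nhds
  refine squeeze_zero' (Filter.Eventually.of_forall fun _ => norm_nonneg _) ?_ hlim
  filter_upwards [self_mem_nhdsWithin] with ω hω
  obtain ⟨hy, he⟩ := h.root_spec hω
  have h1 := h.norm_eqn_sub_ge hy hy₀ hω
  rw [he, zero_sub, norm_neg] at h1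
  linarith

/-- Modulus at most `5/4` forces the factor to be at least `4/5 (1 - ε)`, which leaves room above
`3/4` for the variation of `κ`. -/
theorem mem_phases_of_root (h : RootFamily κ ρ ε) {y : ℂ} (hy : y ∈ annulus) {ω : ℝ}
    (h0 : eqn κ ρ ω y = 0) (hle : ‖y‖ ≤ 5 / 4) : ω ∈ phases κ := by
  have h1 := (abs_le.1 (h.norm_root hy h0)).1
  have h2 := abs_le.1 (h.abs_norm_factor_sub_le hy ω)
  change 3 / 4 ≤ ‖1 + κ 1 * Complex.exp (ω * Complex.I)‖
  have h3 := norm_nonneg (1 + κ ‖y‖ * Complex.exp (ω * Complex.I))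
  have h4 := h.eps_le
  have h5 : ‖y‖ * ‖1 + κ ‖y‖ * Complex.exp (ω * Complex.I)‖ ≤
      5 / 4 * ‖1 + κ ‖y‖ * Complex.exp (ω * Complex.I)‖ := mul_le_mul_of_nonneg_right hle h3
  linarith

theorem normSq_factor (x ω : ℝ) : ‖1 + x * Complex.exp (ω * Complex.I)‖ ^ 2 =
    1 + 2 * x * Real.cos ω + x ^ 2 := by
  rw [← Complex.normSq_eq_norm_sq, Complex.exp_mul_I, Complex.normSq_apply]
  simp only [← Complex.ofReal_cos, ← Complex.ofReal_sin, Complex.add_re, Complex.one_re,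
    Complex.mul_re, Complex.ofReal_re, Complex.ofReal_im, Complex.I_re, Complex.I_im,
    Complex.add_im, Complex.mul_im, Complex.one_im]
  linear_combination x ^ 2 * (Real.sin_sq_add_cos_sq ω)

/-- `|1 + κ e^{iω}|² = 1 + 2 κ cos ω + κ²` decreases with `|ω|` on `[-π, π]`. -/
theorem ordConnected_phases (h : RootFamily κ ρ ε) :
    (phases κ ∩ Set.Icc (-Real.pi) Real.pi).OrdConnected := by
  have hk := h.nonneg 1 one_mem
  have key : ∀ ω ∈ phases κ ∩ Set.Icc (-Real.pi) Real.pi, ∀ φ : ℝ, |φ| ≤ |ω| → φ ∈ phases κ := by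
    rintro ω ⟨hω, hω1, hω2⟩ φ hφ
    have h1 : Real.cos |ω| ≤ Real.cos |φ| :=
      Real.cos_le_cos_of_nonneg_of_le_pi (abs_nonneg _) (abs_le.2 ⟨hω1, hω2⟩) hφ
    rw [Real.cos_abs, Real.cos_abs] at h1
    have h2 : 3 / 4 ≤ ‖1 + κ 1 * Complex.exp (ω * Complex.I)‖ := hω
    change 3 / 4 ≤ ‖1 + κ 1 * Complex.exp (φ * Complex.I)‖
    refine h2.trans (le_of_sq_le_sq ?_ (norm_nonneg _))
    rw [normSq_factor, normSq_factor]
    nlinarith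
  refine ⟨fun a ha b hb φ hφ => ⟨?_, ha.2.1.trans hφ.1, hφ.2.trans hb.2.2⟩⟩
  rcases le_total 0 φ with h0 | h0
  · refine key b hb φ ?_
    rw [abs_of_nonneg h0]
    exact hφ.2.trans (le_abs_self b)
  · refine key a ha φ ?_
    rw [abs_of_nonpos h0]
    exact (neg_le_neg hφ.1).trans (neg_le_abs a)

/-- The moduli of roots of small modulus. -/
def moduli (κ : ℝ → ℝ) (ρ : ℂ → ℝ → ℂ) : Set ℝ :=
  {A | A ∈ Set.Icc (2 / 5 : ℝ) (5 / 4) ∧ ∃ ω : ℝ, ∃ y, ‖y‖ = A ∧ eqn κ ρ ω y = 0}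

theorem mem_annulus_of {A : ℝ} (hA : A ∈ Set.Icc (2 / 5 : ℝ) (5 / 4)) {y : ℂ} (hy : ‖y‖ = A) :
    y ∈ annulus := by
  change ‖y‖ ∈ Set.Icc (2 / 5 : ℝ) (3 / 2)
  rw [hy]
  exact ⟨hA.1, hA.2.trans (by norm_num)⟩

theorem eqn_periodic (h : RootFamily κ ρ ε) {ω ω' : ℝ}
    (he : Complex.exp (ω * Complex.I) = Complex.exp (ω' * Complex.I)) (y : ℂ) :
    eqn κ ρ ω y = eqn κ ρ ω' y := by
  rw [eqn, eqn, he, h.periodic y ω ω' he]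

theorem exists_phase (h : RootFamily κ ρ ε) {A : ℝ} (hA : A ∈ moduli κ ρ) :
    ∃ ω ∈ phases κ ∩ Set.Icc (-Real.pi) Real.pi, ‖root κ ρ ω‖ = A := by
  obtain ⟨hA1, ω, y, hy, h0⟩ := hA
  -- Periodicity brings the phase into `[-π, π]`, where the admissible phases form an interval.
  set ω' := Complex.arg (Complex.exp (ω * Complex.I)) with hω'
  have he : Complex.exp (ω' * Complex.I) = Complex.exp (ω * Complex.I) := by
    have := Complex.norm_mul_exp_arg_mul_I (Complex.exp (ω * Complex.I))
    rwa [Complex.norm_exp_ofReal_mul_I, Complex.ofReal_one, one_mul] at this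
  rw [← h.eqn_periodic he] at h0
  have hyA := mem_annulus_of hA1 hy
  have hph := h.mem_phases_of_root hyA h0 (hy.le.trans hA1.2)
  refine ⟨ω', ⟨hph, (Complex.neg_pi_lt_arg _).le, Complex.arg_le_pi _⟩, ?_⟩
  obtain ⟨h1, h2⟩ := h.root_spec hph
  rw [h.root_unique h1 hyA hph h2 h0, hy]

theorem norm_root_mem_moduli (h : RootFamily κ ρ ε) {ω : ℝ} (hω : ω ∈ phases κ)
    (hle : ‖root κ ρ ω‖ ≤ 5 / 4) : ‖root κ ρ ω‖ ∈ moduli κ ρ := by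
  obtain ⟨h1, h2⟩ := h.root_spec hω
  exact ⟨⟨h1.1, hle⟩, ω, _, rfl, h2⟩

theorem mem_moduli_of_between (h : RootFamily κ ρ ε) {ω₁ ω₂ A : ℝ}
    (h₁ : ω₁ ∈ phases κ ∩ Set.Icc (-Real.pi) Real.pi)
    (h₂ : ω₂ ∈ phases κ ∩ Set.Icc (-Real.pi) Real.pi)
    (hA₁ : ‖root κ ρ ω₁‖ ≤ A) (hA₂ : A ≤ ‖root κ ρ ω₂‖) (hA : A ≤ 5 / 4) : A ∈ moduli κ ρ := by
  have hpre : IsPreconnected (phases κ ∩ Set.Icc (-Real.pi) Real.pi) :=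
    h.ordConnected_phases.isPreconnected
  obtain ⟨ω, hω, rfl⟩ := hpre.intermediate_value h₁ h₂
    ((h.continuousOn_root.mono Set.inter_subset_left).norm) ⟨hA₁, hA₂⟩
  exact h.norm_root_mem_moduli hω.1 hA

/-- The moduli are the values, cut off at `5/4`, of a continuous function on an interval of phases.
This is the source of connectedness of the image along half fibres. -/
theorem ordConnected_moduli (h : RootFamily κ ρ ε) : (moduli κ ρ).OrdConnected := by
  refine ⟨fun A hA B hB x hx => ?_⟩
  obtain ⟨ω₁, h₁, rfl⟩ := h.exists_phase hA
  obtain ⟨ω₂, h₂, rfl⟩ := h.exists_phase hB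
  exact h.mem_moduli_of_between h₁ h₂ hx.1 hx.2 (hx.2.trans hB.1.2)

/-- At phase `0` the root has modulus about `1 / (1 + κ)`, which is below `1 - ε`. At the other end
of the phases it is above `1 + ε`: the factor is `1 - κ` at phase `π`, or `3/4` if `π` is not
admissible. The condition `κ 1 ≥ 10 ε` outweighs the errors, and the intermediate value theorem
applies. -/
theorem mem_moduli_of_near_one (h : RootFamily κ ρ ε) (hk : 10 * ε ≤ κ 1) {A : ℝ}
    (hA : |A - 1| ≤ ε) : A ∈ moduli κ ρ := by
  have hpi := Real.pi_pos
  have he0 := h.eps_pos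
  have he1 := h.eps_le
  have hk1 := h.le 1 one_mem
  obtain ⟨hA1, hA2⟩ := abs_le.1 hA
  have hn0 : ‖1 + κ 1 * Complex.exp ((0 : ℝ) * Complex.I)‖ = 1 + κ 1 := by
    have h1 := normSq_factor (κ 1) 0
    rw [Real.cos_zero] at h1
    nlinarith [norm_nonneg (1 + κ 1 * Complex.exp ((0 : ℝ) * Complex.I))]
  have h0 : (0 : ℝ) ∈ phases κ := by
    change 3 / 4 ≤ ‖1 + κ 1 * Complex.exp ((0 : ℝ) * Complex.I)‖
    rw [hn0]; linarith
  have hlow : ‖root κ ρ 0‖ ≤ A := by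
    obtain ⟨h1, h2⟩ := h.root_spec h0
    have h3 := (abs_le.1 (h.norm_root h1 h2)).2
    have h4 := (abs_le.1 (h.abs_norm_factor_sub_le h1 0)).1
    rw [hn0] at h4
    by_contra! hlt
    have h5 : A * (1 + κ 1 - 3 / 5 * ε) ≤ ‖root κ ρ 0‖ *
        ‖1 + κ ‖root κ ρ 0‖ * Complex.exp ((0 : ℝ) * Complex.I)‖ :=
      mul_le_mul hlt.le (by linarith) (by linarith) (norm_nonneg _)
    nlinarith
  by_cases hπ : Real.pi ∈ phases κ
  · refine h.mem_moduli_of_between ⟨h0, by linarith, hpi.le⟩ ⟨hπ, by linarith, le_rfl⟩ hlow ?_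
      (by linarith)
    obtain ⟨h1, h2⟩ := h.root_spec hπ
    have h3 := (abs_le.1 (h.norm_root h1 h2)).1
    have h4 := (abs_le.1 (h.abs_norm_factor_sub_le h1 Real.pi)).2
    have h5 : ‖1 + κ 1 * Complex.exp (Real.pi * Complex.I)‖ = |1 - κ 1| := by
      rw [Complex.exp_pi_mul_I, mul_neg_one, ← sub_eq_add_neg, ← Complex.ofReal_one,
        ← Complex.ofReal_sub, Complex.norm_real, Real.norm_eq_abs]
    have h6 : 3 / 4 ≤ |1 - κ 1| := by rw [← h5]; exact hπ
    -- The bound `κ 1 ≤ 11/10` rules out `κ 1 - 1 ≥ 3/4`.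
    have h7 : 0 ≤ 1 - κ 1 := by
      by_contra! h8
      rw [abs_of_neg h8] at h6
      linarith
    rw [h5, abs_of_nonneg h7] at h4
    by_contra! hlt
    have h9 : ‖root κ ρ Real.pi‖ * ‖1 + κ ‖root κ ρ Real.pi‖ * Complex.exp (Real.pi * Complex.I)‖ ≤
        A * (1 - κ 1 + 3 / 5 * ε) :=
      mul_le_mul hlt.le (by linarith) (norm_nonneg _) (by linarith)
    nlinarith
  · have hc : Continuous fun ω : ℝ => ‖1 + κ 1 * Complex.exp (ω * Complex.I)‖ := by fun_prop
    have h1 : ‖1 + κ 1 * Complex.exp (Real.pi * Complex.I)‖ ≤ 3 / 4 := by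
      by_contra! h2; exact hπ h2.le
    have h2 : 3 / 4 ≤ ‖1 + κ 1 * Complex.exp ((0 : ℝ) * Complex.I)‖ := by rw [hn0]; linarith
    obtain ⟨ω, hω, hωe⟩ := intermediate_value_Icc' hpi.le hc.continuousOn ⟨h1, h2⟩
    have hωp : ω ∈ phases κ := hωe.ge
    refine h.mem_moduli_of_between ⟨h0, by linarith, hpi.le⟩
      ⟨hωp, by linarith [hω.1], hω.2⟩ hlow ?_ (by linarith)
    obtain ⟨h3, h4⟩ := h.root_spec hωp
    have h5 := (abs_le.1 (h.norm_root h3 h4)).1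
    have h6 := (abs_le.1 (h.abs_norm_factor_sub_le h3 ω)).2
    simp only at hωe
    rw [hωe] at h6
    have h7 : ‖root κ ρ ω‖ * ‖1 + κ ‖root κ ρ ω‖ * Complex.exp (ω * Complex.I)‖ ≤
        ‖root κ ρ ω‖ * (3 / 4 + 3 / 5 * ε) :=
      mul_le_mul_of_nonneg_left (by linarith) (norm_nonneg _)
    nlinarith

end RootFamily

/-! ### Amplitudes are close to barycentric coordinates -/

open Classical in
/-- The lattice points that are not vertices of the triangle `v`. -/
def others (d : ℕ) (v : Fin 3 → Fin 3 → ℕ) : Finset (Fin 3 → ℕ) :=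
  (exponents d).filter fun m => m ∉ Set.range v

/-- The deviation of `log c` from the affine function that agrees with it at the vertices `v`. -/
def defect (c : (Fin 3 → ℕ) → ℝ) (v : Fin 3 → Fin 3 → ℕ) (m : Fin 3 → ℕ) : ℝ :=
  Real.log (c m) - ∑ i, bary v (toReal m) i * Real.log (c (v i))

theorem mem_others {d : ℕ} {v : Fin 3 → Fin 3 → ℕ} {m : Fin 3 → ℕ} :
    m ∈ others d v ↔ m ∈ exponents d ∧ m ∉ Set.range v := by
  simp [others]

variable {d : ℕ} {Z : Geometry.SimplicialComplex ℝ (Fin 3 → ℝ)} {v : Fin 3 → Fin 3 → ℕ}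
  {c : (Fin 3 → ℕ) → ℝ}

theorem amp_nonneg (hd : 1 ≤ d) (hc : ∀ m ∈ exponents d, 0 < c m) {x : Fin 3 → ℝ}
    (hx : x ∈ newtonPolygon d) (m : Fin 3 → ℕ) : 0 ≤ amp d c x m := by
  obtain ⟨r, hr⟩ := exists_isAmplitude_amp hd hc hx
  exact hr.amp_nonneg hc m

theorem sum_amp_sq (hd : 1 ≤ d) (hc : ∀ m ∈ exponents d, 0 < c m) {x : Fin 3 → ℝ}
    (hx : x ∈ newtonPolygon d) : ∑ m ∈ exponents d, amp d c x m ^ 2 = 1 := by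
  obtain ⟨r, hr⟩ := exists_isAmplitude_amp hd hc hx
  exact hr.sum_sq

theorem sum_amp_sq_smul (hd : 1 ≤ d) (hc : ∀ m ∈ exponents d, 0 < c m) {x : Fin 3 → ℝ}
    (hx : x ∈ newtonPolygon d) : ∑ m ∈ exponents d, amp d c x m ^ 2 • toReal m = x := by
  obtain ⟨r, hr⟩ := exists_isAmplitude_amp hd hc hx
  funext i
  rw [← hr.mean i, Finset.sum_apply]
  rfl

theorem amp_pos (hd : 1 ≤ d) (hc : ∀ m ∈ exponents d, 0 < c m) {x : Fin 3 → ℝ}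
    (hx : x ∈ newtonPolygon d) (hx0 : ∀ i, 0 < x i) {m : Fin 3 → ℕ} (hm : m ∈ exponents d) :
    0 < amp d c x m := by
  obtain ⟨r, hr⟩ := exists_isAmplitude_amp hd hc hx
  exact hr.amp_pos hd hc hm fun i _ => (hx0 i).ne'

theorem amp_sq_le_one (hd : 1 ≤ d) (hc : ∀ m ∈ exponents d, 0 < c m) {x : Fin 3 → ℝ}
    (hx : x ∈ newtonPolygon d) {m : Fin 3 → ℕ} (hm : m ∈ exponents d) : amp d c x m ^ 2 ≤ 1 := by
  rw [← sum_amp_sq hd hc hx]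
  exact Finset.single_le_sum (f := fun m => amp d c x m ^ 2) (fun _ _ => sq_nonneg _) hm

theorem amp_le_one (hd : 1 ≤ d) (hc : ∀ m ∈ exponents d, 0 < c m) {x : Fin 3 → ℝ}
    (hx : x ∈ newtonPolygon d) {m : Fin 3 → ℕ} (hm : m ∈ exponents d) : amp d c x m ≤ 1 := by
  have := amp_sq_le_one hd hc hx hm
  exact (sq_le_one_iff₀ (amp_nonneg hd hc hx m)).1 this

namespace IsFlag

theorem sum_split {E : Type*} [AddCommMonoid E] (hv : IsFlag d Z v) (f : (Fin 3 → ℕ) → E) :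
    ∑ m ∈ exponents d, f m = ∑ i, f (v i) + ∑ m ∈ others d v, f m := by
  classical
  rw [← Finset.sum_image (s := Finset.univ) (g := v) (f := f) hv.inj.injOn, add_comm, others,
    ← Finset.sum_filter_add_sum_filter_not (exponents d) fun m => m ∉ Set.range v]
  congr 1
  refine Finset.sum_congr ?_ fun _ _ => rfl
  ext m
  simp only [Finset.mem_filter, not_not, Finset.mem_image, Finset.mem_univ, true_and, Set.mem_range]
  refine ⟨fun h => h.2, fun h => ⟨?_, h⟩⟩
  obtain ⟨i, rfl⟩ := h
  exact hv.mem i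

theorem defect_vertex (hv : IsFlag d Z v) (hd : 1 ≤ d) (hZ : IsFullTriangulation d Z)
    (i : Fin 3) : defect c v (v i) = 0 := by
  rw [defect, hv.bary_vertex hd hZ]
  simp [Pi.single_apply]

theorem bary_eq_sum (hv : IsFlag d Z v) (hd : 1 ≤ d) (hc : ∀ m ∈ exponents d, 0 < c m)
    {x : Fin 3 → ℝ} (hx : x ∈ newtonPolygon d) (i : Fin 3) :
    bary v x i = ∑ m ∈ exponents d, amp d c x m ^ 2 * bary v (toReal m) i := by
  have h := congrArg (fun y => bary v y i) (sum_amp_sq_smul hd hc hx)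
  simp only [map_sum, map_smul, Finset.sum_apply, Pi.smul_apply, smul_eq_mul] at h
  exact h.symm

/-- The logarithm of `r^m` is linear in `m`, hence interpolated from the vertices; the coefficients
contribute the defect. -/
theorem log_amp_eq (hv : IsFlag d Z v) (hd : 1 ≤ d) (hZ : IsFullTriangulation d Z)
    (hc : ∀ m ∈ exponents d, 0 < c m) {x : Fin 3 → ℝ} (hx : x ∈ newtonPolygon d)
    (hx0 : ∀ i, 0 < x i) {m : Fin 3 → ℕ} (hm : m ∈ exponents d) :
    Real.log (amp d c x m) =
      ∑ i, bary v (toReal m) i * Real.log (amp d c x (v i)) + defect c v m := by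
  obtain ⟨r, hr⟩ := exists_isAmplitude_amp hd hc hx
  have hpos : ∀ m ∈ exponents d, amp d c x m ≠ 0 := fun m hm => (amp_pos hd hc hx hx0 hm).ne'
  have h1 : ∑ i, (m i : ℝ) * Real.log (r i) =
      ∑ l, bary v (toReal m) l * ∑ i, (v l i : ℝ) * Real.log (r i) := by
    simp only [Finset.mul_sum]
    rw [Finset.sum_comm]
    refine Finset.sum_congr rfl fun i _ => ?_
    have h2 := congrFun (hv.sum_bary hd hZ (toReal m)) i
    simp only [Finset.sum_apply, Pi.smul_apply, smul_eq_mul] at h2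
    have h3 : (m i : ℝ) = ∑ l, bary v (toReal m) l * (v l i : ℝ) := h2.symm
    rw [h3, Finset.sum_mul]
    exact Finset.sum_congr rfl fun l _ => by ring
  rw [hr.log_amp hc hm (hpos m hm), h1, defect]
  have h4 : ∀ l, Real.log (amp d c x (v l)) =
      Real.log (c (v l)) + ∑ i, (v l i : ℝ) * Real.log (r i) :=
    fun l => hr.log_amp hc (hv.mem l) (hpos _ (hv.mem l))
  simp only [h4, mul_add, Finset.sum_add_distrib]
  ring

theorem pos_of_bary_pos (hv : IsFlag d Z v) (hd : 1 ≤ d) (hZ : IsFullTriangulation d Z)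
    {x : Fin 3 → ℝ} (hx : ∀ i, 0 < bary v x i) (j : Fin 3) : 0 < x j := by
  have h1 := congrFun (hv.sum_bary hd hZ x) j
  simp only [Finset.sum_apply, Pi.smul_apply, smul_eq_mul] at h1
  have h2 : ∃ i, v i j ≠ 0 := by
    by_contra! h
    have h3 := congrFun (hv.sum_bary hd hZ (Pi.single j 1)) j
    simp [toReal, h] at h3
  obtain ⟨i, hi⟩ := h2
  rw [← h1]
  refine Finset.sum_pos' (fun l _ => mul_nonneg (hx l).le (Nat.cast_nonneg _))
    ⟨i, Finset.mem_univ i, mul_pos (hx i) ?_⟩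
  exact Nat.cast_pos.2 (Nat.pos_of_ne_zero hi)

theorem mem_of_bary (hv : IsFlag d Z v) (hd : 1 ≤ d) (hZ : IsFullTriangulation d Z)
    {x : Fin 3 → ℝ} (h0 : ∀ i, 0 ≤ bary v x i) (h1 : ∑ i, bary v x i = 1) :
    x ∈ newtonPolygon d := by
  have := hv.sum_mem h0 h1
  rwa [hv.sum_bary hd hZ] at this

/-- A closed condition that holds in the interior of a triangle holds in the triangle. -/
theorem closed_induction (hv : IsFlag d Z v) (hd : 1 ≤ d) (hZ : IsFullTriangulation d Z)
    {f : (Fin 3 → ℝ) → ℝ} (hf : ContinuousOn f (newtonPolygon d)) {b : ℝ}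
    (h : ∀ x ∈ newtonPolygon d, (∀ i, 0 < bary v x i) → f x ≤ b) {x : Fin 3 → ℝ}
    (hx : x ∈ newtonPolygon d) (hx0 : ∀ i, 0 ≤ bary v x i) : f x ≤ b := by
  -- Approach the point along the segment from the barycenter, whose points other than `x` have
  -- positive coordinates.
  set y : Fin 3 → ℝ := ∑ i, (3 : ℝ)⁻¹ • toReal (v i) with hy
  have hby : bary v y = fun _ => (3 : ℝ)⁻¹ := by
    rw [hy]; exact hv.bary_sum hd hZ fun _ => (3 : ℝ)⁻¹
  have hyΔ : y ∈ newtonPolygon d := by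
    refine hv.sum_mem (fun _ => by norm_num) ?_
    simp
  set p : ℝ → Fin 3 → ℝ := fun s => (1 - s) • x + s • y with hp
  have hpΔ : ∀ s ∈ Set.Icc (0 : ℝ) 1, p s ∈ newtonPolygon d := fun s hs =>
    convex_newtonPolygon d hx hyΔ (by linarith [hs.2]) hs.1 (by ring)
  have hpc : ContinuousOn (fun s => f (p s)) (Set.Icc 0 1) :=
    hf.comp (by rw [hp]; fun_prop) hpΔ
  have hlim : Filter.Tendsto (fun s => f (p s)) (nhdsWithin 0 (Set.Ioc (0 : ℝ) 1))
      (nhds (f (p 0))) :=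
    (hpc 0 ⟨le_rfl, zero_le_one⟩).mono_left (nhdsWithin_mono _ Set.Ioc_subset_Icc_self)
  have hp0 : p 0 = x := by simp [hp]
  rw [hp0] at hlim
  have hne : (nhdsWithin 0 (Set.Ioc (0 : ℝ) 1)).NeBot := by
    rw [nhdsWithin_Ioc_eq_nhdsGT zero_lt_one]; infer_instance
  refine le_of_tendsto hlim ?_
  filter_upwards [self_mem_nhdsWithin] with s hs
  refine h _ (hpΔ s ⟨hs.1.le, hs.2⟩) fun i => ?_
  rw [hp]
  simp only [map_add, map_smul, hby, Pi.add_apply, Pi.smul_apply, smul_eq_mul]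
  have := mul_nonneg (sub_nonneg.2 hs.2) (hx0 i)
  have := hs.1
  positivity

/-- An entropy estimate. Since `a² log a ≥ -1`, the sum `∑ a² log a` is at least minus the number of
terms. Interpolating `log a` from the vertices turns it into `∑ λ_i log a_{v i}`, which is at most
zero, plus `∑ a² defect`, which is at most `-M` times the weight off the triangle. Logarithms need
an interior point; continuity gives the rest. -/
theorem sum_others_le (hv : IsFlag d Z v) (hd : 1 ≤ d) (hZ : IsFullTriangulation d Z)
    (hc : ∀ m ∈ exponents d, 0 < c m) {M : ℝ} (hM0 : 0 < M)
    (hM : ∀ m ∈ others d v, defect c v m ≤ -M) {x : Fin 3 → ℝ} (hx : x ∈ newtonPolygon d)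
    (hx0 : ∀ i, 0 ≤ bary v x i) :
    ∑ m ∈ others d v, amp d c x m ^ 2 ≤ (exponents d).card / M := by
  refine hv.closed_induction hd hZ (f := fun x => ∑ m ∈ others d v, amp d c x m ^ 2)
    (continuousOn_finsetSum _ fun m _ => (continuousOn_amp hd hc m).pow 2) ?_ hx hx0
  clear hx hx0 x
  intro x hx hx0
  have hxp := hv.pos_of_bary_pos hd hZ hx0
  have ha0 : ∀ m ∈ exponents d, 0 < amp d c x m := fun m hm => amp_pos hd hc hx hxp hm
  have ha1 : ∀ m ∈ exponents d, amp d c x m ≤ 1 := fun m hm => amp_le_one hd hc hx hm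
  have h1 : -((exponents d).card : ℝ) ≤
      ∑ m ∈ exponents d, amp d c x m ^ 2 * Real.log (amp d c x m) := by
    have : -((exponents d).card : ℝ) = ∑ m ∈ exponents d, (-1 : ℝ) := by simp
    rw [this]
    refine Finset.sum_le_sum fun m hm => ?_
    have h2 := Real.one_sub_inv_le_log_of_pos (ha0 m hm)
    have h3 := mul_le_mul_of_nonneg_left h2 (sq_nonneg (amp d c x m))
    refine le_trans ?_ h3
    have h4 : amp d c x m ^ 2 * (1 - (amp d c x m)⁻¹) = amp d c x m ^ 2 - amp d c x m := by
      have := (ha0 m hm).ne'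
      field_simp
    rw [h4]
    nlinarith [ha1 m hm, sq_nonneg (amp d c x m)]
  have h2 : ∑ m ∈ exponents d, amp d c x m ^ 2 * Real.log (amp d c x m) =
      ∑ i, bary v x i * Real.log (amp d c x (v i)) +
        ∑ m ∈ others d v, amp d c x m ^ 2 * defect c v m := by
    have h3 : ∑ m ∈ exponents d, amp d c x m ^ 2 * defect c v m =
        ∑ m ∈ others d v, amp d c x m ^ 2 * defect c v m := by
      rw [hv.sum_split]
      simp [hv.defect_vertex hd hZ]
    rw [← h3]
    simp only [hv.bary_eq_sum hd hc hx, Finset.sum_mul]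
    rw [Finset.sum_comm, ← Finset.sum_add_distrib]
    refine Finset.sum_congr rfl fun m hm => ?_
    rw [hv.log_amp_eq hd hZ hc hx hxp hm, mul_add, Finset.mul_sum]
    congr 1
    exact Finset.sum_congr rfl fun i _ => by ring
  have h3 : ∑ i, bary v x i * Real.log (amp d c x (v i)) ≤ 0 :=
    Finset.sum_nonpos fun i _ => mul_nonpos_of_nonneg_of_nonpos (hx0 i).le
      (Real.log_nonpos (ha0 _ (hv.mem i)).le (ha1 _ (hv.mem i)))
  have h4 : ∑ m ∈ others d v, amp d c x m ^ 2 * defect c v m ≤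
      -((∑ m ∈ others d v, amp d c x m ^ 2) * M) := by
    rw [Finset.sum_mul, ← Finset.sum_neg_distrib]
    refine Finset.sum_le_sum fun m hm => ?_
    have := mul_le_mul_of_nonneg_left (hM m hm) (sq_nonneg (amp d c x m))
    linarith
  rw [le_div_iff₀ hM0]
  linarith

/-- The difference is precisely the contribution of the other lattice points to the mean. -/
theorem abs_amp_sq_sub_le (hv : IsFlag d Z v) (hd : 1 ≤ d) (hZ : IsFullTriangulation d Z)
    (hc : ∀ m ∈ exponents d, 0 < c m) {C : ℝ}
    (hC : ∀ m ∈ exponents d, ∀ i, |bary v (toReal m) i| ≤ C) {x : Fin 3 → ℝ}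
    (hx : x ∈ newtonPolygon d) (i : Fin 3) :
    |amp d c x (v i) ^ 2 - bary v x i| ≤ C * ∑ m ∈ others d v, amp d c x m ^ 2 := by
  rw [hv.bary_eq_sum hd hc hx, hv.sum_split]
  simp only [hv.bary_vertex hd hZ, Pi.single_apply, mul_ite, mul_one, mul_zero,
    Finset.sum_ite_eq, Finset.mem_univ, if_true]
  rw [sub_add_cancel_left, abs_neg, Finset.mul_sum]
  refine (Finset.abs_sum_le_sum_abs _ _).trans (Finset.sum_le_sum fun m hm => ?_)
  rw [abs_mul, abs_of_nonneg (sq_nonneg _), mul_comm]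
  exact mul_le_mul_of_nonneg_right (hC m (mem_others.1 hm).1 i) (sq_nonneg _)

end IsFlag

theorem exists_bary_bound (d : ℕ) (Z : Geometry.SimplicialComplex ℝ (Fin 3 → ℝ)) :
    ∃ C : ℝ, 1 ≤ C ∧ ∀ v, IsFlag d Z v → ∀ m ∈ exponents d, ∀ i, |bary v (toReal m) i| ≤ C := by
  obtain ⟨C, hC⟩ := (Set.finite_range fun q : {v // IsFlag d Z v} × exponents d × Fin 3 =>
    |bary q.1.1 (toReal q.2.1) q.2.2|).bddAbove
  refine ⟨max 1 C, le_max_left _ _, fun v hv m hm i => ?_⟩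
  exact (hC ⟨(⟨v, hv⟩, ⟨m, hm⟩, i), rfl⟩).trans (le_max_right _ _)

theorem exists_gap (hd : 1 ≤ d) (hZ : IsFullTriangulation d Z) {w : (Fin 3 → ℕ) → ℝ}
    (hw : ConvexityCondition d Z w) :
    ∃ g : ℝ, 0 < g ∧ ∀ v, IsFlag d Z v → ∀ m ∈ others d v, g ≤ heightGap w v m := by
  classical
  -- The dummy value `1` at the vertices keeps the minimum over the finite set positive.
  set f : {v // IsFlag d Z v} × exponents d → ℝ := fun q =>
    if (q.2 : Fin 3 → ℕ) ∈ others d q.1.1 then heightGap w q.1.1 q.2 else 1 with hf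
  have hpos : ∀ q, 0 < f q := by
    intro q
    simp only [hf]
    split_ifs with h
    · have := mem_others.1 h
      exact heightGap_pos hd hZ hw q.1.2 this.1 this.2
    · norm_num
  obtain h | h := isEmpty_or_nonempty ({v // IsFlag d Z v} × exponents d)
  · refine ⟨1, one_pos, fun v hv m hm => ?_⟩
    exact (h.false (⟨v, hv⟩, ⟨m, (mem_others.1 hm).1⟩)).elim
  · obtain ⟨q, hq⟩ := Finite.exists_min f
    refine ⟨f q, hpos q, fun v hv m hm => ?_⟩
    have h1 := hq (⟨v, hv⟩, ⟨m, (mem_others.1 hm).1⟩)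
    have h2 : f (⟨v, hv⟩, ⟨m, (mem_others.1 hm).1⟩) = heightGap w v m := by
      rw [hf]; exact if_pos hm
    rwa [h2] at h1

/-- Since the gap is positive off the triangle, the defect there tends to `-∞` as `t → 0`. -/
theorem defect_rpow {t : ℝ} (ht : 0 < t) (w : (Fin 3 → ℕ) → ℝ) (m : Fin 3 → ℕ) :
    defect (fun m => t ^ w m) v m = heightGap w v m * Real.log t := by
  simp only [defect, heightGap, Real.log_rpow ht, sub_mul, Finset.sum_mul]
  congr 1
  exact Finset.sum_congr rfl fun i _ => by ring

/-! ### Slopes along rays through a vertex -/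

/-- The ratio of the amplitudes of the second and the first vertex. -/
def modulus (d : ℕ) (c : (Fin 3 → ℕ) → ℝ) (v : Fin 3 → Fin 3 → ℕ) (x : Fin 3 → ℝ) : ℝ :=
  amp d c x (v 1) / amp d c x (v 0)

/-- The ratio of the amplitudes of the third and the second vertex. -/
def third (d : ℕ) (c : (Fin 3 → ℕ) → ℝ) (v : Fin 3 → Fin 3 → ℕ) (x : Fin 3 → ℝ) : ℝ :=
  amp d c x (v 2) / amp d c x (v 1)

/-- The ratio of the amplitudes of `m` and the first vertex. -/
def relAmp (d : ℕ) (c : (Fin 3 → ℕ) → ℝ) (v : Fin 3 → Fin 3 → ℕ) (m : Fin 3 → ℕ)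
    (x : Fin 3 → ℝ) : ℝ :=
  amp d c x m / amp d c x (v 0)

/-- The points of the triangle `v` with `λ₂ = l λ₁`, away from the side opposite to `v 0`
and from `v 0`. -/
structure OnRay (d : ℕ) (v : Fin 3 → Fin 3 → ℕ) (b₀ b₁ l : ℝ) (x : Fin 3 → ℝ) : Prop where
  mem : x ∈ newtonPolygon d
  nonneg : ∀ i, 0 ≤ bary v x i
  low₀ : b₀ ≤ bary v x 0
  low₁ : b₁ ≤ bary v x 1
  eq : bary v x 2 = l * bary v x 1

/-- The amplitudes at points of the triangle `v` are close to the barycentric coordinates, and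
vary with small slopes along rays through `v 0`. -/
structure IsTame (d : ℕ) (c : (Fin 3 → ℕ) → ℝ) (v : Fin 3 → Fin 3 → ℕ) (ε : ℝ) : Prop where
  vertex : ∀ x ∈ newtonPolygon d, (∀ i, 0 ≤ bary v x i) → ∀ i,
    |amp d c x (v i) ^ 2 - bary v x i| ≤ ε
  other : ∀ x ∈ newtonPolygon d, (∀ i, 0 ≤ bary v x i) → ∀ m ∈ others d v, amp d c x m ^ 2 ≤ ε
  defect_le : ∀ m ∈ others d v, Real.exp (defect c v m) ≤ ε
  slope_third : ∀ l, 0 ≤ l → l ≤ 1 → ∀ x y, OnRay d v (1 / 7) (1 / 12) l x →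
    OnRay d v (1 / 7) (1 / 12) l y →
    |third d c v x - third d c v y| ≤ ε * |modulus d c v x - modulus d c v y|
  slope_rel : ∀ l, 0 ≤ l → l ≤ 1 → ∀ x y, OnRay d v (1 / 7) (1 / 12) l x →
    OnRay d v (1 / 7) (1 / 12) l y → ∀ m ∈ others d v,
    |relAmp d c v m x - relAmp d c v m y| ≤ ε * |modulus d c v x - modulus d c v y|

variable {d : ℕ} {Z : Geometry.SimplicialComplex ℝ (Fin 3 → ℝ)} {v : Fin 3 → Fin 3 → ℕ}
  {c : (Fin 3 → ℕ) → ℝ}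

/-- Bounds on ratios of amplitudes away from the end points of a ray. -/
theorem OnRay.bounds (hd : 1 ≤ d) (hc : ∀ m ∈ exponents d, 0 < c m) {ε l : ℝ} {x : Fin 3 → ℝ}
    (hε : ε ≤ 1 / 1000) (hx : OnRay d v (1 / 8) (1 / 13) l x) (hl : l ≤ 1)
    (h : ∀ i, |amp d c x (v i) ^ 2 - bary v x i| ≤ ε) :
    1 / 3 ≤ amp d c x (v 0) ∧ 1 / 4 ≤ amp d c x (v 1) ∧ amp d c x (v 2) ≤ 2 * amp d c x (v 1) := by
  have h0 := abs_le.1 (h 0)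
  have h1 := abs_le.1 (h 1)
  have h2 := abs_le.1 (h 2)
  have hl0 := hx.low₀
  have hl1 := hx.low₁
  have hq : bary v x 2 ≤ bary v x 1 := by rw [hx.eq]; nlinarith [hx.nonneg 1]
  refine ⟨?_, ?_, ?_⟩
  · exact (sq_le_sq₀ (by norm_num) (amp_nonneg hd hc hx.mem _)).1 (by linarith)
  · exact (sq_le_sq₀ (by norm_num) (amp_nonneg hd hc hx.mem _)).1 (by linarith)
  · refine (sq_le_sq₀ (amp_nonneg hd hc hx.mem _)
      (mul_nonneg zero_le_two (amp_nonneg hd hc hx.mem _))).1 ?_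
    rw [mul_pow]
    linarith

theorem abs_log_sub_log_le {a b : ℝ} (ha : 1 / 4 ≤ a) (hb : 1 / 4 ≤ b) :
    |Real.log a - Real.log b| ≤ 4 * |a - b| := by
  wlog h : b ≤ a generalizing a b
  · rw [abs_sub_comm, abs_sub_comm a]
    exact this hb ha (le_of_not_ge h)
  have hb0 : 0 < b := by linarith
  have ha0 : 0 < a := by linarith
  rw [abs_of_nonneg (sub_nonneg.2 h), abs_of_nonneg (sub_nonneg.2 (Real.log_le_log hb0 h)),
    ← Real.log_div ha0.ne' hb0.ne']
  refine (Real.log_le_sub_one_of_pos (by positivity)).trans ?_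
  rw [div_sub_one hb0.ne', div_le_iff₀ hb0]
  nlinarith

namespace IsFlag

/-- Eliminating `λ₀ = 1 - λ₁ - λ₂` writes the relative amplitude as `e^{defect} A^{j+k} κ^k`. The
exponents are integers by unimodularity, which `level_set_slope` requires. -/
theorem exp_log_ratio (hv : IsFlag d Z v) (hd : 1 ≤ d) (hZ : IsFullTriangulation d Z)
    (hc : ∀ m ∈ exponents d, 0 < c m) {x : Fin 3 → ℝ} (hx : x ∈ newtonPolygon d)
    (hx0 : ∀ i, 0 < x i) {m : Fin 3 → ℕ} (hm : m ∈ exponents d) :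
    Real.log (relAmp d c v m x) = defect c v m +
      (icoord v m 1 + icoord v m 2) * Real.log (modulus d c v x) +
        icoord v m 2 * Real.log (third d c v x) := by
  have hp : ∀ m ∈ exponents d, amp d c x m ≠ 0 := fun m hm => (amp_pos hd hc hx hx0 hm).ne'
  rw [relAmp, modulus, third, Real.log_div (hp _ hm) (hp _ (hv.mem 0)),
    Real.log_div (hp _ (hv.mem 1)) (hp _ (hv.mem 0)),
    Real.log_div (hp _ (hv.mem 2)) (hp _ (hv.mem 1)), hv.log_amp_eq hd hZ hc hx hx0 hm,
    hv.icoord_cast hd hZ hm, hv.icoord_cast hd hZ hm]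
  have h1 := hv.sum_bary_eq_one hd hZ (sum_toReal hm)
  rw [Fin.sum_univ_three] at h1 ⊢
  have h2 : bary v (toReal m) 0 = 1 - bary v (toReal m) 1 - bary v (toReal m) 2 := by linarith
  rw [h2]
  ring

/-- On the ray `λ₂ = l λ₁` the moment identity, divided by `a_{v 1}²`, is the equation of
`level_set_slope` with `X = log A` and `V = log κ`. The slope of `κ` results directly, that of the
relative amplitudes through `exp_log_ratio`. The hypothesis `l > 0` makes the points interior, so
that the logarithms are meaningful. -/
theorem slope_of_pos (hv : IsFlag d Z v) (hd : 1 ≤ d) (hZ : IsFullTriangulation d Z)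
    (hc : ∀ m ∈ exponents d, 0 < c m) {ε₀ η ε C B δ : ℝ}
    (hslope : ∀ (E : Finset (Fin 3 → ℕ)) (D : (Fin 3 → ℕ) → ℝ) (j k : (Fin 3 → ℕ) → ℤ)
      (X₁ X₂ V₁ V₂ l : ℝ),
      (E.card : ℝ) ≤ (exponents d).card → (∀ m ∈ E, 0 ≤ D m ∧ D m ≤ δ) →
      (∀ m ∈ E, |(j m : ℝ)| ≤ C ∧ |(k m : ℝ)| ≤ C) →
      |X₁| ≤ 3 → |X₂| ≤ 3 → V₁ ≤ 1 → V₂ ≤ 1 → 0 ≤ l → l ≤ 1 →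
      (∀ m ∈ E, D m * Real.exp (2 * ((j m + k m - 1) * X₁ + k m * V₁)) ≤ δ) →
      (∀ m ∈ E, D m * Real.exp (2 * ((j m + k m - 1) * X₂ + k m * V₂)) ≤ δ) →
      (Real.exp (2 * V₁) - l + ∑ m ∈ E, (k m - l * j m) *
        (D m * Real.exp (2 * ((j m + k m - 1) * X₁ + k m * V₁))) = 0) →
      (Real.exp (2 * V₂) - l + ∑ m ∈ E, (k m - l * j m) *
        (D m * Real.exp (2 * ((j m + k m - 1) * X₂ + k m * V₂))) = 0) →
      |V₂ - V₁| ≤ B * |X₂ - X₁| ∧ |Real.exp V₂ - Real.exp V₁| ≤ ε / 4 * |X₂ - X₁|)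
    (hB : 0 < B) (hε : 0 < ε) (hC1 : 1 ≤ C)
    (hC : ∀ m ∈ exponents d, ∀ i, |bary v (toReal m) i| ≤ C)
    (hε₀ : ε₀ ≤ 1 / 1000) (hδ : 16 * ε₀ ≤ δ) (hη0 : 0 ≤ η) (hη : ε₀ ≤ η ^ 2)
    (hηε : 3 * η * ((2 * C + C * B) * 4) ≤ ε)
    (hvert : ∀ x ∈ newtonPolygon d, (∀ i, 0 ≤ bary v x i) → ∀ i,
      |amp d c x (v i) ^ 2 - bary v x i| ≤ ε₀)
    (hother : ∀ x ∈ newtonPolygon d, (∀ i, 0 ≤ bary v x i) → ∀ m ∈ others d v,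
      amp d c x m ^ 2 ≤ ε₀)
    (hdef : ∀ m ∈ others d v, Real.exp (2 * defect c v m) ≤ δ)
    {l : ℝ} (hl0 : 0 < l) (hl1 : l ≤ 1) {x y : Fin 3 → ℝ}
    (hx : OnRay d v (1 / 8) (1 / 13) l x) (hy : OnRay d v (1 / 8) (1 / 13) l y) :
    |third d c v x - third d c v y| ≤ ε * |modulus d c v x - modulus d c v y| ∧
      ∀ m ∈ others d v,
      |relAmp d c v m x - relAmp d c v m y| ≤ ε * |modulus d c v x - modulus d c v y| := by
  have hcoord : ∀ m ∈ others d v, |(icoord v m 1 : ℝ)| ≤ C ∧ |(icoord v m 2 : ℝ)| ≤ C := by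
    intro m hm
    have hm' := (mem_others.1 hm).1
    rw [hv.icoord_cast hd hZ hm', hv.icoord_cast hd hZ hm']
    exact ⟨hC m hm' 1, hC m hm' 2⟩
  have data : ∀ x, OnRay d v (1 / 8) (1 / 13) l x → (∀ i, 0 < x i) ∧ 1 / 4 ≤ modulus d c v x ∧
      0 < third d c v x ∧ |Real.log (modulus d c v x)| ≤ 3 ∧ Real.log (third d c v x) ≤ 1 ∧
      (∀ m ∈ others d v, 0 < relAmp d c v m x ∧ relAmp d c v m x ≤ 3 * η) ∧
      (∀ m ∈ others d v, Real.exp (2 * defect c v m) * Real.exp (2 * ((icoord v m 1 +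
        icoord v m 2 - 1) * Real.log (modulus d c v x) + icoord v m 2 *
          Real.log (third d c v x))) = amp d c x m ^ 2 / amp d c x (v 1) ^ 2) ∧
      (∀ m ∈ others d v, amp d c x m ^ 2 / amp d c x (v 1) ^ 2 ≤ δ) ∧
      (Real.exp (2 * Real.log (third d c v x)) - l + ∑ m ∈ others d v, (icoord v m 2 -
        l * icoord v m 1) * (amp d c x m ^ 2 / amp d c x (v 1) ^ 2) = 0) := by
    intro x hx
    have hxp : ∀ i, 0 < x i := by
      refine hv.pos_of_bary_pos hd hZ fun i => ?_
      have h1 := hx.low₀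
      have h2 := hx.low₁
      have h3 : 0 < bary v x 1 := by linarith
      fin_cases i
      · change 0 < bary v x 0; linarith
      · exact h3
      · change 0 < bary v x 2; rw [hx.eq]; positivity
    obtain ⟨h0, h1, h2⟩ := hx.bounds hd hc hε₀ hl1 (hvert x hx.mem hx.nonneg)
    have hap : ∀ m ∈ exponents d, 0 < amp d c x m := fun m hm => amp_pos hd hc hx.mem hxp hm
    have ha1 : ∀ m ∈ exponents d, amp d c x m ≤ 1 := fun m hm => amp_le_one hd hc hx.mem hm
    have hA0 := hap _ (hv.mem 0)
    have hA1 := hap _ (hv.mem 1)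
    have hA2 := hap _ (hv.mem 2)
    have hmod : 1 / 4 ≤ modulus d c v x := by
      rw [modulus, le_div_iff₀ hA0]
      have := ha1 _ (hv.mem 0)
      linarith
    have hmod3 : modulus d c v x ≤ 3 := by
      rw [modulus, div_le_iff₀ hA0]
      have := ha1 _ (hv.mem 1)
      linarith
    have hth0 : 0 < third d c v x := div_pos hA2 hA1
    have hmod0 : 0 < modulus d c v x := div_pos hA1 hA0
    refine ⟨hxp, hmod, hth0, ?_, ?_, ?_, ?_, ?_, ?_⟩
    · rw [abs_le]
      constructor
      · have := Real.one_sub_inv_le_log_of_pos hmod0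
        have h5 : (modulus d c v x)⁻¹ ≤ 4 := by
          rw [inv_le_comm₀ hmod0 (by norm_num)]; linarith
        linarith
      · have := Real.log_le_sub_one_of_pos hmod0
        linarith
    · have := Real.log_le_sub_one_of_pos hth0
      have h5 : third d c v x ≤ 2 := by rw [third, div_le_iff₀ hA1]; exact h2
      linarith
    · intro m hm
      have hm' := (mem_others.1 hm).1
      refine ⟨div_pos (hap _ hm') hA0, ?_⟩
      have h5 : amp d c x m ≤ η := (sq_le_sq₀ (hap m hm').le hη0).1
        ((hother x hx.mem hx.nonneg m hm).trans hη)
      rw [relAmp, div_le_iff₀ hA0]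
      nlinarith
    · intro m hm
      have hm' := (mem_others.1 hm).1
      have h5 : amp d c x m ^ 2 / amp d c x (v 1) ^ 2 =
          (relAmp d c v m x / modulus d c v x) ^ 2 := by
        rw [relAmp, modulus, div_div_div_cancel_right₀ hA0.ne', div_pow]
      have h6 : 0 < relAmp d c v m x := div_pos (hap _ hm') hA0
      rw [h5, ← Real.exp_add, ← Real.exp_log (pow_pos (div_pos h6 hmod0) 2), Real.log_pow,
        Real.log_div h6.ne' hmod0.ne', hv.exp_log_ratio hd hZ hc hx.mem hxp hm']
      congr 1
      push_cast
      ring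
    · intro m hm
      have h5 := hother x hx.mem hx.nonneg m hm
      rw [div_le_iff₀ (by positivity)]
      have h6 : 1 / 16 ≤ amp d c x (v 1) ^ 2 := by nlinarith
      have h7 : 0 ≤ δ := by nlinarith [sq_nonneg (amp d c x m)]
      nlinarith
    -- The level set equation is the mean in the last coordinate minus `l` times the mean in the
    -- middle one.
    · have hb1 := hv.bary_eq_sum hd hc hx.mem 1
      have hb2 := hv.bary_eq_sum hd hc hx.mem 2
      rw [hv.sum_split] at hb1 hb2
      simp only [hv.bary_vertex hd hZ, Pi.single_apply, mul_ite, mul_one, mul_zero,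
        Finset.sum_ite_eq, Finset.mem_univ, if_true] at hb1 hb2
      have h5 : Real.exp (2 * Real.log (third d c v x)) =
          amp d c x (v 2) ^ 2 / amp d c x (v 1) ^ 2 := by
        rw [two_mul, Real.exp_add, Real.exp_log hth0, third, ← div_pow, sq]
      have h6 : ∑ m ∈ others d v, ((icoord v m 2 : ℝ) - l * icoord v m 1) *
          (amp d c x m ^ 2 / amp d c x (v 1) ^ 2) =
          (∑ m ∈ others d v, amp d c x m ^ 2 * bary v (toReal m) 2 -
            l * ∑ m ∈ others d v, amp d c x m ^ 2 * bary v (toReal m) 1) /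
              amp d c x (v 1) ^ 2 := by
        rw [Finset.mul_sum, ← Finset.sum_sub_distrib, Finset.sum_div]
        refine Finset.sum_congr rfl fun m hm => ?_
        have hm' := (mem_others.1 hm).1
        rw [hv.icoord_cast hd hZ hm', hv.icoord_cast hd hZ hm']
        ring
      have h7 := hx.eq
      rw [hb1, hb2] at h7
      rw [h5, h6]
      have h8 : amp d c x (v 1) ^ 2 ≠ 0 := (pow_pos hA1 2).ne'
      field_simp
      linarith
  obtain ⟨hxp, hx1, hx2, hx3, hx4, hx5, hx6, hx7, hx8⟩ := data x hx
  obtain ⟨hyp, hy1, hy2, hy3, hy4, hy5, hy6, hy7, hy8⟩ := data y hy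
  obtain ⟨hV, hK⟩ := hslope (others d v) (fun m => Real.exp (2 * defect c v m))
    (fun m => icoord v m 1) (fun m => icoord v m 2) (Real.log (modulus d c v y))
    (Real.log (modulus d c v x)) (Real.log (third d c v y)) (Real.log (third d c v x)) l
    (Nat.cast_le.2 (Finset.card_le_card (Finset.filter_subset _ _)))
    (fun m hm => ⟨(Real.exp_pos _).le, hdef m hm⟩) hcoord hy3 hx3 hy4 hx4 hl0.le hl1
    (fun m hm => by rw [hy6 m hm]; exact hy7 m hm) (fun m hm => by rw [hx6 m hm]; exact hx7 m hm)
    (by rw [← hy8]; congr 1; exact Finset.sum_congr rfl fun m hm => by rw [hy6 m hm])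
    (by rw [← hx8]; congr 1; exact Finset.sum_congr rfl fun m hm => by rw [hx6 m hm])
  have hX := abs_log_sub_log_le hx1 hy1
  rw [Real.exp_log hx2, Real.exp_log hy2] at hK
  refine ⟨?_, fun m hm => ?_⟩
  · have := mul_le_mul_of_nonneg_left hX (by positivity : 0 ≤ ε / 4)
    linarith
  · have hm' := (mem_others.1 hm).1
    obtain ⟨hxr, hxr'⟩ := hx5 m hm
    obtain ⟨hyr, hyr'⟩ := hy5 m hm
    have h1 := exp_sub_exp_le (Real.log (relAmp d c v m x)) (Real.log (relAmp d c v m y))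
    rw [Real.exp_log hxr, Real.exp_log hyr] at h1
    have h2 : Real.exp (max (Real.log (relAmp d c v m x)) (Real.log (relAmp d c v m y))) ≤
        3 * η := by
      rcases max_choice (Real.log (relAmp d c v m x)) (Real.log (relAmp d c v m y)) with h | h
      · rw [h, Real.exp_log hxr]; exact hxr'
      · rw [h, Real.exp_log hyr]; exact hyr'
    have h3 : |Real.log (relAmp d c v m x) - Real.log (relAmp d c v m y)| ≤
        (2 * C + C * B) * (4 * |modulus d c v x - modulus d c v y|) := by
      rw [hv.exp_log_ratio hd hZ hc hx.mem hxp hm', hv.exp_log_ratio hd hZ hc hy.mem hyp hm']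
      obtain ⟨hj, hk⟩ := hcoord m hm
      have e : defect c v m + (icoord v m 1 + icoord v m 2) * Real.log (modulus d c v x) +
          icoord v m 2 * Real.log (third d c v x) - (defect c v m +
          (icoord v m 1 + icoord v m 2) * Real.log (modulus d c v y) +
          icoord v m 2 * Real.log (third d c v y)) = (icoord v m 1 + icoord v m 2) *
          (Real.log (modulus d c v x) - Real.log (modulus d c v y)) + icoord v m 2 *
          (Real.log (third d c v x) - Real.log (third d c v y)) := by ring
      rw [e]
      refine (abs_add_le _ _).trans ?_
      rw [abs_mul, abs_mul]
      have h4 : |(icoord v m 1 + icoord v m 2 : ℝ)| ≤ 2 * C :=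
        (abs_add_le _ _).trans (by linarith)
      have h5 := abs_nonneg (Real.log (modulus d c v x) - Real.log (modulus d c v y))
      calc _ ≤ 2 * C * |Real.log (modulus d c v x) - Real.log (modulus d c v y)| +
            C * (B * |Real.log (modulus d c v x) - Real.log (modulus d c v y)|) :=
          add_le_add (mul_le_mul_of_nonneg_right h4 h5)
            (mul_le_mul hk hV (abs_nonneg _) (by linarith))
        _ = (2 * C + C * B) * |Real.log (modulus d c v x) - Real.log (modulus d c v y)| := by ring
        _ ≤ _ := mul_le_mul_of_nonneg_left hX (by positivity)
    calc _ ≤ 3 * η * ((2 * C + C * B) * (4 * |modulus d c v x - modulus d c v y|)) :=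
          h1.trans (mul_le_mul h2 h3 (abs_nonneg _) (by positivity))
      _ = 3 * η * ((2 * C + C * B) * 4) * |modulus d c v x - modulus d c v y| := by ring
      _ ≤ _ := mul_le_mul_of_nonneg_right hηε (abs_nonneg _)

end IsFlag

variable {d : ℕ} {Z : Geometry.SimplicialComplex ℝ (Fin 3 → ℝ)} {v : Fin 3 → Fin 3 → ℕ}
  {c : (Fin 3 → ℕ) → ℝ}

theorem OnRay.mono {b₀ b₁ b₀' b₁' l : ℝ} {x : Fin 3 → ℝ} (h : OnRay d v b₀ b₁ l x)
    (h₀ : b₀' ≤ b₀) (h₁ : b₁' ≤ b₁) : OnRay d v b₀' b₁' l x :=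
  ⟨h.mem, h.nonneg, h₀.trans h.low₀, h₁.trans h.low₁, h.eq⟩

namespace IsFlag

/-- A point on a side of a triangle is a limit of points on rays inside the triangle. -/
theorem exists_tendsto_ray (hv : IsFlag d Z v) (hd : 1 ≤ d) (hZ : IsFullTriangulation d Z)
    (hc : ∀ m ∈ exponents d, 0 < c m) {x : Fin 3 → ℝ} (hx : OnRay d v (1 / 7) (1 / 12) 0 x) :
    ∃ p : ℝ → Fin 3 → ℝ, (∀ᶠ s in nhdsWithin (0 : ℝ) (Set.Ioi 0),
      OnRay d v (1 / 8) (1 / 13) s (p s)) ∧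
      ∀ m, Filter.Tendsto (fun s => amp d c (p s) m) (nhdsWithin (0 : ℝ) (Set.Ioi 0))
        (nhds (amp d c x m)) := by
  have hb0 := hx.low₀
  have hb1 := hx.low₁
  have hb2 : bary v x 2 = 0 := by rw [hx.eq, zero_mul]
  have hsum := hv.sum_bary_eq_one hd hZ hx.mem.2
  rw [Fin.sum_univ_three, hb2] at hsum
  -- Adding `s λ₁` times the last vertex moves the point to the ray of slope `s`. Normalisation
  -- lowers `λ₀` and `λ₁` by a factor at least `13/14`, which the weaker bounds `1/8` and `1/13`
  -- permit.
  set p : ℝ → Fin 3 → ℝ := fun s =>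
    (1 + s * bary v x 1)⁻¹ • (x + (s * bary v x 1) • toReal (v 2)) with hp
  have hbp : ∀ s i, bary v (p s) i =
      (1 + s * bary v x 1)⁻¹ * (bary v x i + s * bary v x 1 * (Pi.single 2 1 : Fin 3 → ℝ) i) := by
    intro s i
    rw [hp]
    simp only [map_smul, map_add, hv.bary_vertex hd hZ, Pi.smul_apply, Pi.add_apply, smul_eq_mul]
  have hev : ∀ᶠ s in nhdsWithin (0 : ℝ) (Set.Ioi 0), OnRay d v (1 / 8) (1 / 13) s (p s) := by
    filter_upwards [Ioo_mem_nhdsGT (show (0 : ℝ) < 1 / 13 by norm_num)] with s hs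
    have hs0 := hs.1
    have hs1 := hs.2
    have hD : 0 < 1 + s * bary v x 1 := by nlinarith
    have hD1 : 1 + s * bary v x 1 ≤ 14 / 13 := by nlinarith
    have h0 : bary v (p s) 0 = (1 + s * bary v x 1)⁻¹ * bary v x 0 := by
      rw [hbp]; simp
    have h1 : bary v (p s) 1 = (1 + s * bary v x 1)⁻¹ * bary v x 1 := by
      rw [hbp]; simp
    have h2 : bary v (p s) 2 = s * ((1 + s * bary v x 1)⁻¹ * bary v x 1) := by
      rw [hbp, hb2]; simp; ring
    have hnn : ∀ i, 0 ≤ bary v (p s) i := by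
      intro i
      fin_cases i
      · change 0 ≤ bary v (p s) 0; rw [h0]; positivity
      · change 0 ≤ bary v (p s) 1; rw [h1]; positivity
      · change 0 ≤ bary v (p s) 2; rw [h2]; positivity
    refine ⟨hv.mem_of_bary hd hZ hnn ?_, hnn, ?_, ?_, by rw [h2, h1]⟩
    · rw [Fin.sum_univ_three, h0, h1, h2]
      field_simp
      linarith
    · rw [h0, inv_mul_eq_div, le_div_iff₀ hD]; linarith
    · rw [h1, inv_mul_eq_div, le_div_iff₀ hD]; linarith
  refine ⟨p, hev, fun m => ?_⟩
  have hcp : ContinuousAt p 0 := by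
    rw [hp]
    have : ContinuousAt (fun s : ℝ => (1 + s * bary v x 1)⁻¹) 0 :=
      ContinuousAt.inv₀ (by fun_prop) (by simp)
    exact this.smul (by fun_prop)
  have hp0 : p 0 = x := by rw [hp]; simp
  have h1 : Filter.Tendsto p (nhdsWithin 0 (Set.Ioi 0)) (nhdsWithin x (newtonPolygon d)) := by
    refine tendsto_nhdsWithin_iff.2 ⟨?_, hev.mono fun s hs => hs.mem⟩
    have := hcp.tendsto
    rw [hp0] at this
    exact this.mono_left nhdsWithin_le_nhds
  exact (continuousOn_amp hd hc m x hx.mem).tendsto.comp h1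

/-- On a side of the triangle amplitudes may vanish and logarithms are of no use; `l = 0` is treated
as a limit of rays with `l > 0`. -/
theorem slope_of_nonneg (hv : IsFlag d Z v) (hd : 1 ≤ d) (hZ : IsFullTriangulation d Z)
    (hc : ∀ m ∈ exponents d, 0 < c m) {ε ε₀ : ℝ} (hε₀ : ε₀ ≤ 1 / 1000)
    (hvert : ∀ x ∈ newtonPolygon d, (∀ i, 0 ≤ bary v x i) → ∀ i,
      |amp d c x (v i) ^ 2 - bary v x i| ≤ ε₀)
    (h : ∀ l, 0 < l → l ≤ 1 → ∀ x y, OnRay d v (1 / 8) (1 / 13) l x →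
      OnRay d v (1 / 8) (1 / 13) l y →
      |third d c v x - third d c v y| ≤ ε * |modulus d c v x - modulus d c v y| ∧
      ∀ m ∈ others d v,
      |relAmp d c v m x - relAmp d c v m y| ≤ ε * |modulus d c v x - modulus d c v y|)
    {l : ℝ} (hl0 : 0 ≤ l) (hl1 : l ≤ 1) {x y : Fin 3 → ℝ}
    (hx : OnRay d v (1 / 7) (1 / 12) l x) (hy : OnRay d v (1 / 7) (1 / 12) l y) :
    |third d c v x - third d c v y| ≤ ε * |modulus d c v x - modulus d c v y| ∧
      ∀ m ∈ others d v,
      |relAmp d c v m x - relAmp d c v m y| ≤ ε * |modulus d c v x - modulus d c v y| := by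
  rcases hl0.lt_or_eq with hl | rfl
  · exact h l hl hl1 x y (hx.mono (by norm_num) (by norm_num))
      (hy.mono (by norm_num) (by norm_num))
  obtain ⟨p, hp, hpt⟩ := hv.exists_tendsto_ray hd hZ hc hx
  obtain ⟨q, hq, hqt⟩ := hv.exists_tendsto_ray hd hZ hc hy
  have ne : ∀ x, OnRay d v (1 / 7) (1 / 12) 0 x → amp d c x (v 0) ≠ 0 ∧ amp d c x (v 1) ≠ 0 := by
    intro x hx
    obtain ⟨h0, h1, -⟩ := (hx.mono (by norm_num) (by norm_num)).bounds hd hc hε₀ hl1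
      (hvert x hx.mem hx.nonneg)
    exact ⟨by linarith, by linarith⟩
  have hev : ∀ᶠ s in nhdsWithin (0 : ℝ) (Set.Ioi 0), 0 < s ∧ s ≤ 1 := by
    filter_upwards [Ioo_mem_nhdsGT (zero_lt_one (α := ℝ))] with s hs
    exact ⟨hs.1, hs.2.le⟩
  obtain ⟨hx0, hx1⟩ := ne x hx
  obtain ⟨hy0, hy1⟩ := ne y hy
  have hmod := ((((hpt (v 1)).div (hpt (v 0)) hx0).sub
    ((hqt (v 1)).div (hqt (v 0)) hy0)).abs).const_mul ε
  refine ⟨?_, fun m hm => ?_⟩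
  · refine le_of_tendsto_of_tendsto (((hpt (v 2)).div (hpt (v 1)) hx1).sub
      ((hqt (v 2)).div (hqt (v 1)) hy1)).abs hmod ?_
    filter_upwards [hp, hq, hev] with s h1 h2 h3
    exact (h s h3.1 h3.2 _ _ h1 h2).1
  · refine le_of_tendsto_of_tendsto (((hpt m).div (hpt (v 0)) hx0).sub
      ((hqt m).div (hqt (v 0)) hy0)).abs hmod ?_
    filter_upwards [hp, hq, hev] with s h1 h2 h3
    exact (h s h3.1 h3.2 _ _ h1 h2).2 m hm

end IsFlag

/-! ### Tameness for small parameters -/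

theorem rpow_pos_exponents {t : ℝ} (ht : 0 < t) (w : (Fin 3 → ℕ) → ℝ) :
    ∀ m ∈ exponents d, 0 < (fun m => t ^ w m) m := fun _ _ => Real.rpow_pos_of_pos ht _

/-- The constants are fixed before `t`: the coordinate bound `C`, the gap `g`, the slope constants
`B` and `δ`, then `η`, `ε₀`, and the depth `M` wanted for the defects. The defects reach `-M` as
soon as `log t ≤ -M / g`. -/
theorem exists_isTame (hd : 1 ≤ d) (hZ : IsFullTriangulation d Z) {w : (Fin 3 → ℕ) → ℝ}
    (hw : ConvexityCondition d Z w) {ε : ℝ} (hε : 0 < ε) :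
    ∃ t₀ : ℝ, 0 < t₀ ∧ ∀ t, 0 < t → t < t₀ → ∀ v, IsFlag d Z v →
      IsTame d (fun m => t ^ w m) v ε := by
  obtain ⟨C, hC1, hC⟩ := exists_bary_bound d Z
  obtain ⟨g, hg, hgap⟩ := exists_gap hd hZ hw
  have hN : (1 : ℝ) ≤ (exponents d).card := by
    rw [Nat.one_le_cast, Nat.one_le_iff_ne_zero, Finset.card_ne_zero]
    exact ⟨_, single_mem_exponents d 0⟩
  obtain ⟨B, hB, hsl⟩ := level_set_slope (ι := Fin 3 → ℕ) C 3 (exponents d).card hC1 (by norm_num) hN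
  obtain ⟨δ, hδ, hslope⟩ := hsl (ε / 4) (by positivity)
  have hC0 : 0 < C := by linarith
  obtain ⟨η, hη, hηε⟩ : ∃ η : ℝ, 0 < η ∧ 3 * η * ((2 * C + C * B) * 4) ≤ ε := by
    refine ⟨ε / (3 * ((2 * C + C * B) * 4)), by positivity, le_of_eq ?_⟩
    field_simp
  obtain ⟨ε₀, hε₀, h1, h2, h3, h4⟩ : ∃ ε₀ : ℝ, 0 < ε₀ ∧ ε₀ ≤ 1 / 1000 ∧ 16 * ε₀ ≤ δ ∧
      ε₀ ≤ η ^ 2 ∧ ε₀ ≤ ε := by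
    refine ⟨min (min (1 / 1000) (δ / 16)) (min (η ^ 2) ε), by positivity, ?_, ?_, ?_, ?_⟩
    · exact (min_le_left _ _).trans (min_le_left _ _)
    · have := (min_le_left (min (1 / 1000) (δ / 16)) (min (η ^ 2) ε)).trans (min_le_right _ _)
      linarith
    · exact (min_le_right _ _).trans (min_le_left _ _)
    · exact (min_le_right _ _).trans (min_le_right _ _)
  obtain ⟨M, hM0, hM1, hM2, hM3⟩ : ∃ M : ℝ, 0 < M ∧ C * ((exponents d).card / M) ≤ ε₀ ∧
      1 / M ≤ ε ∧ 1 / M ≤ δ := by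
    have hN0 : (0 : ℝ) < (exponents d).card := by linarith
    refine ⟨C * (exponents d).card / ε₀ + 1 / ε + 1 / δ, by positivity, ?_, ?_, ?_⟩
    · rw [← mul_div_assoc, div_le_iff₀ (by positivity)]
      have : ε₀ * (C * (exponents d).card / ε₀) = C * (exponents d).card := by field_simp
      have : 0 ≤ ε₀ * (1 / ε) := by positivity
      have : 0 ≤ ε₀ * (1 / δ) := by positivity
      linarith
    · rw [div_le_iff₀ (by positivity)]
      have : ε * (1 / ε) = 1 := by field_simp
      have : 0 ≤ ε * (C * (exponents d).card / ε₀) := by positivity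
      have : 0 ≤ ε * (1 / δ) := by positivity
      linarith
    · rw [div_le_iff₀ (by positivity)]
      have : δ * (1 / δ) = 1 := by field_simp
      have : 0 ≤ δ * (C * (exponents d).card / ε₀) := by positivity
      have : 0 ≤ δ * (1 / ε) := by positivity
      linarith
  refine ⟨min 1 (Real.exp (-(M / g))), by positivity, fun t ht htt v hv => ?_⟩
  have hc := rpow_pos_exponents (d := d) ht w
  have hlog : Real.log t ≤ -(M / g) := by
    rw [Real.log_le_iff_le_exp ht]
    exact (htt.trans_le (min_le_right _ _)).le
  have hdefM : ∀ m ∈ others d v, defect (fun m => t ^ w m) v m ≤ -M := by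
    intro m hm
    rw [defect_rpow ht]
    have h5 := hgap v hv m hm
    have h6 : heightGap w v m * Real.log t ≤ heightGap w v m * -(M / g) :=
      mul_le_mul_of_nonneg_left hlog (by linarith)
    have h7 : g * (M / g) ≤ heightGap w v m * (M / g) :=
      mul_le_mul_of_nonneg_right h5 (by positivity)
    have h8 : g * (M / g) = M := by field_simp
    linarith
  have hexpM : Real.exp (-M) ≤ 1 / M := by
    rw [Real.exp_neg, one_div]
    exact inv_anti₀ hM0 (by linarith [Real.add_one_le_exp M])
  have hsum : ∀ x ∈ newtonPolygon d, (∀ i, 0 ≤ bary v x i) →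
      C * ∑ m ∈ others d v, amp d (fun m => t ^ w m) x m ^ 2 ≤ ε₀ := fun x hx hx0 =>
    (mul_le_mul_of_nonneg_left (hv.sum_others_le hd hZ hc hM0 hdefM hx hx0) hC0.le).trans hM1
  have hvert : ∀ x ∈ newtonPolygon d, (∀ i, 0 ≤ bary v x i) → ∀ i,
      |amp d (fun m => t ^ w m) x (v i) ^ 2 - bary v x i| ≤ ε₀ := fun x hx hx0 i =>
    (hv.abs_amp_sq_sub_le hd hZ hc (hC v hv) hx i).trans (hsum x hx hx0)
  have hother : ∀ x ∈ newtonPolygon d, (∀ i, 0 ≤ bary v x i) → ∀ m ∈ others d v,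
      amp d (fun m => t ^ w m) x m ^ 2 ≤ ε₀ := by
    intro x hx hx0 m hm
    refine le_trans ?_ (hsum x hx hx0)
    have h5 := Finset.single_le_sum (f := fun m => amp d (fun m => t ^ w m) x m ^ 2)
      (fun _ _ => sq_nonneg _) hm
    have h6 := sq_nonneg (amp d (fun m => t ^ w m) x m)
    nlinarith
  have hdef2 : ∀ m ∈ others d v, Real.exp (2 * defect (fun m => t ^ w m) v m) ≤ δ := by
    intro m hm
    refine le_trans (Real.exp_le_exp.2 ?_) (hexpM.trans hM3)
    have := hdefM m hm
    linarith
  have hboth := fun l (hl0 : 0 < l) (hl1 : l ≤ 1) x y (hx : OnRay d v (1 / 8) (1 / 13) l x)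
      (hy : OnRay d v (1 / 8) (1 / 13) l y) =>
    hv.slope_of_pos hd hZ hc hslope hB hε hC1 (hC v hv) h1 h2 hη.le h3 hηε hvert hother hdef2
      hl0 hl1 hx hy
  have hfin := fun l (hl0 : 0 ≤ l) (hl1 : l ≤ 1) x y (hx : OnRay d v (1 / 7) (1 / 12) l x)
      (hy : OnRay d v (1 / 7) (1 / 12) l y) =>
    hv.slope_of_nonneg hd hZ hc h1 hvert hboth hl0 hl1 hx hy
  exact ⟨fun x hx hx0 i => (hvert x hx hx0 i).trans h4,
    fun x hx hx0 m hm => (hother x hx hx0 m hm).trans h4,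
    fun m hm => (Real.exp_le_exp.2 (hdefM m hm)).trans (hexpM.trans hM2),
    fun l hl0 hl1 x y hx hy => (hfin l hl0 hl1 x y hx hy).1,
    fun l hl0 hl1 x y hx hy => (hfin l hl0 hl1 x y hx hy).2⟩

variable {d : ℕ} {Z : Geometry.SimplicialComplex ℝ (Fin 3 → ℝ)} {v : Fin 3 → Fin 3 → ℕ}
  {c : (Fin 3 → ℕ) → ℝ}

/-! ### The image of the curve in terms of relative phases -/

/-- The unit complex number with angle `(j + k) α + k ω`, where `j`, `k` are the last two
barycentric coordinates of `m`. -/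
def phase (v : Fin 3 → Fin 3 → ℕ) (m : Fin 3 → ℕ) (α ω : ℝ) : ℂ :=
  Complex.exp ((α : ℂ) * Complex.I) ^ (icoord v m 1 + icoord v m 2) *
    Complex.exp ((icoord v m 2 : ℂ) * ((ω : ℂ) * Complex.I))

theorem phase_eq_exp (v : Fin 3 → Fin 3 → ℕ) (m : Fin 3 → ℕ) (α ω : ℝ) :
    phase v m α ω = Complex.exp ((((icoord v m 1 + icoord v m 2) * α + icoord v m 2 * ω : ℝ) : ℂ) *
      Complex.I) := by
  rw [phase, ← Complex.exp_int_mul, ← Complex.exp_add]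
  congr 1
  push_cast
  ring

namespace IsFlag

theorem pairing_eq (hv : IsFlag d Z v) (hd : 1 ≤ d) (hZ : IsFullTriangulation d Z)
    (m : Fin 3 → ℕ) (θ : Fin 3 → ℝ) :
    ∑ j, m j * θ j = ∑ i, bary v (toReal m) i * ∑ j, v i j * θ j := by
  simp only [Finset.mul_sum]
  rw [Finset.sum_comm]
  refine Finset.sum_congr rfl fun j _ => ?_
  have h2 := congrFun (hv.sum_bary hd hZ (toReal m)) j
  simp only [Finset.sum_apply, Pi.smul_apply, smul_eq_mul] at h2
  have h3 : (m j : ℝ) = ∑ l, bary v (toReal m) l * (v l j : ℝ) := h2.symm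
  rw [h3, Finset.sum_mul]
  exact Finset.sum_congr rfl fun l _ => by ring

/-- The vertices form a basis of `ℝ³`, so the phases of their three monomials can be prescribed. -/
theorem exists_phase_vector (hv : IsFlag d Z v) (hd : 1 ≤ d) (hZ : IsFullTriangulation d Z)
    (g : Fin 3 → ℝ) : ∃ θ : Fin 3 → ℝ, ∀ i, ∑ j, v i j * θ j = g i := by
  refine ⟨fun j => ∑ l, bary v (Pi.single j 1) l * g l, fun i => ?_⟩
  have h : toReal (v i) = ∑ j, (v i j : ℝ) • (Pi.single j 1 : Fin 3 → ℝ) := by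
    funext l
    simp [toReal, Pi.single_apply]
  have h1 := hv.bary_vertex hd hZ i
  rw [h, map_sum] at h1
  simp only [Finset.mul_sum]
  rw [Finset.sum_comm]
  have h2 : ∀ l, ∑ j, (v i j : ℝ) * bary v (Pi.single j 1) l = (Pi.single i 1 : Fin 3 → ℝ) l := by
    intro l
    rw [← h1]
    simp [Finset.sum_apply]
  calc _ = ∑ l, (∑ j, (v i j : ℝ) * bary v (Pi.single j 1) l) * g l := by
        refine Finset.sum_congr rfl fun l _ => ?_
        rw [Finset.sum_mul]
        exact Finset.sum_congr rfl fun j _ => by ring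
    _ = g i := by simp [h2, Pi.single_apply]

/-- Membership in the image of the curve, after division by the first monomial. -/
theorem mem_momentImage_iff_phases (hv : IsFlag d Z v) (hd : 1 ≤ d)
    (hZ : IsFullTriangulation d Z) (hc : ∀ m ∈ exponents d, 0 < c m) (x : newtonPolygon d)
    (h0 : 0 < amp d c x (v 0)) (h1 : 0 < amp d c x (v 1)) :
    x ∈ momentImage d c ↔ ∃ α ω : ℝ,
      1 + modulus d c v x * Complex.exp (α * Complex.I) *
        (1 + third d c v x * Complex.exp (ω * Complex.I)) +
        ∑ m ∈ others d v, relAmp d c v m x * phase v m α ω = 0 := by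
  have key : ∀ θ : Fin 3 → ℝ, ∀ α ω : ℝ,
      ∑ j, v 1 j * θ j = ∑ j, v 0 j * θ j + α → ∑ j, v 2 j * θ j = ∑ j, v 1 j * θ j + ω →
      ∑ m ∈ exponents d, (amp d c x m : ℂ) * Complex.exp ((∑ i, m i * θ i : ℝ) * Complex.I) =
      amp d c x (v 0) * Complex.exp ((∑ j, v 0 j * θ j : ℝ) * Complex.I) *
      (1 + modulus d c v x * Complex.exp (α * Complex.I) *
        (1 + third d c v x * Complex.exp (ω * Complex.I)) +
        ∑ m ∈ others d v, relAmp d c v m x * phase v m α ω) := by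
    intro θ α ω hα hω
    have h0' : (amp d c x (v 0) : ℂ) ≠ 0 := Complex.ofReal_ne_zero.2 h0.ne'
    have h1' : (amp d c x (v 1) : ℂ) ≠ 0 := Complex.ofReal_ne_zero.2 h1.ne'
    rw [hv.sum_split, Fin.sum_univ_three, mul_add, Finset.mul_sum]
    congr 1
    · rw [hω, hα, modulus, third]
      push_cast
      simp only [add_mul, Complex.exp_add]
      field_simp
      ring
    · refine Finset.sum_congr rfl fun m hm => ?_
      have hm' := (mem_others.1 hm).1
      rw [relAmp, phase_eq_exp, hv.pairing_eq hd hZ m θ, Fin.sum_univ_three, hω, hα,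
        ← hv.icoord_cast hd hZ hm', ← hv.icoord_cast hd hZ hm', ← hv.icoord_cast hd hZ hm']
      have h2 := hv.sum_bary_eq_one hd hZ (sum_toReal hm')
      rw [Fin.sum_univ_three, ← hv.icoord_cast hd hZ hm', ← hv.icoord_cast hd hZ hm',
        ← hv.icoord_cast hd hZ hm'] at h2
      set s : ℝ := ∑ j, v 0 j * θ j
      have h3 : (icoord v m 0 : ℝ) * s + icoord v m 1 * (s + α) + icoord v m 2 * (s + α + ω) =
          s + ((icoord v m 1 + icoord v m 2) * α + icoord v m 2 * ω) := by
        linear_combination s * h2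
      rw [h3, Complex.ofReal_add s, add_mul, Complex.exp_add]
      push_cast
      field_simp
  have hne : ∀ s : ℝ, (amp d c x (v 0) : ℂ) * Complex.exp ((s : ℂ) * Complex.I) ≠ 0 := fun s =>
    mul_ne_zero (Complex.ofReal_ne_zero.2 h0.ne') (Complex.exp_ne_zero _)
  rw [mem_momentImage_iff hd hc]
  constructor
  · rintro ⟨θ, hθ⟩
    refine ⟨∑ j, v 1 j * θ j - ∑ j, v 0 j * θ j, ∑ j, v 2 j * θ j - ∑ j, v 1 j * θ j, ?_⟩
    rw [key θ _ _ (add_sub_cancel _ _).symm (add_sub_cancel _ _).symm] at hθ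
    exact (mul_eq_zero.1 hθ).resolve_left (hne _)
  · rintro ⟨α, ω, h⟩
    obtain ⟨θ, hθ⟩ := hv.exists_phase_vector hd hZ ![0, α, α + ω]
    refine ⟨θ, ?_⟩
    rw [key θ α ω (by simp [hθ]) (by simp [hθ]), h, mul_zero]

end IsFlag

/-! ### Parametrisation of rays -/

/-- Ratios determine the amplitudes, whose squares sum to one, and the amplitudes determine the
point as their mean. -/
theorem eq_of_relAmp_eq (hd : 1 ≤ d) (hc : ∀ m ∈ exponents d, 0 < c m) {x y : Fin 3 → ℝ}
    (hx : x ∈ newtonPolygon d) (hy : y ∈ newtonPolygon d) (hx0 : 0 < amp d c x (v 0))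
    (hy0 : 0 < amp d c y (v 0)) (h : ∀ m ∈ exponents d, relAmp d c v m x = relAmp d c v m y) :
    x = y := by
  have h1 : ∀ m ∈ exponents d, amp d c x m = amp d c x (v 0) / amp d c y (v 0) * amp d c y m := by
    intro m hm
    have := h m hm
    rw [relAmp, relAmp, div_eq_div_iff hx0.ne' hy0.ne'] at this
    field_simp
    linarith
  have h2 : (amp d c x (v 0) / amp d c y (v 0)) ^ 2 = 1 := by
    have h3 := sum_amp_sq hd hc hx
    rw [Finset.sum_congr rfl fun m hm => by rw [h1 m hm, mul_pow], ← Finset.mul_sum,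
      sum_amp_sq hd hc hy, mul_one] at h3
    exact h3
  rw [← sum_amp_sq_smul hd hc hx, ← sum_amp_sq_smul hd hc hy]
  refine Finset.sum_congr rfl fun m hm => ?_
  rw [h1 m hm, mul_pow, h2, one_mul]

/-- The point with barycentric coordinates proportional to `(1, μ, l μ)`. -/
def rayPoint (v : Fin 3 → Fin 3 → ℕ) (l μ : ℝ) : Fin 3 → ℝ :=
  ∑ i, ((1 + μ + l * μ)⁻¹ * (![1, μ, l * μ] : Fin 3 → ℝ) i) • toReal (v i)

namespace IsFlag

theorem bary_rayPoint (hv : IsFlag d Z v) (hd : 1 ≤ d) (hZ : IsFullTriangulation d Z)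
    (l μ : ℝ) : bary v (rayPoint v l μ) 0 = (1 + μ + l * μ)⁻¹ ∧
      bary v (rayPoint v l μ) 1 = (1 + μ + l * μ)⁻¹ * μ ∧
      bary v (rayPoint v l μ) 2 = (1 + μ + l * μ)⁻¹ * (l * μ) := by
  rw [rayPoint, hv.bary_sum hd hZ]
  simp

theorem bary_rayPoint_nonneg (hv : IsFlag d Z v) (hd : 1 ≤ d) (hZ : IsFullTriangulation d Z)
    {l μ : ℝ} (hl : 0 ≤ l) (hμ : 0 ≤ μ) (i : Fin 3) : 0 ≤ bary v (rayPoint v l μ) i := by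
  obtain ⟨h0, h1, h2⟩ := hv.bary_rayPoint hd hZ l μ
  fin_cases i
  · change 0 ≤ bary v (rayPoint v l μ) 0; rw [h0]; positivity
  · change 0 ≤ bary v (rayPoint v l μ) 1; rw [h1]; positivity
  · change 0 ≤ bary v (rayPoint v l μ) 2; rw [h2]; positivity

theorem rayPoint_mem (hv : IsFlag d Z v) (hd : 1 ≤ d) (hZ : IsFullTriangulation d Z)
    {l μ : ℝ} (hl : 0 ≤ l) (hμ : 0 ≤ μ) : rayPoint v l μ ∈ newtonPolygon d := by
  refine hv.mem_of_bary hd hZ (hv.bary_rayPoint_nonneg hd hZ hl hμ) ?_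
  obtain ⟨h0, h1, h2⟩ := hv.bary_rayPoint hd hZ l μ
  rw [Fin.sum_univ_three, h0, h1, h2]
  have : 1 + μ + l * μ ≠ 0 := by positivity
  field_simp

theorem eq_of_bary (hv : IsFlag d Z v) (hd : 1 ≤ d) (hZ : IsFullTriangulation d Z)
    {x y : Fin 3 → ℝ} (h : ∀ i, bary v x i = bary v y i) : x = y := by
  rw [← hv.sum_bary hd hZ x, ← hv.sum_bary hd hZ y]
  exact Finset.sum_congr rfl fun i _ => by rw [h]

theorem eq_rayPoint (hv : IsFlag d Z v) (hd : 1 ≤ d) (hZ : IsFullTriangulation d Z)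
    {x : Fin 3 → ℝ} (hx : x ∈ newtonPolygon d) {l μ : ℝ} (hl : 0 ≤ l) (hμ : 0 ≤ μ)
    (h1 : bary v x 1 = μ * bary v x 0) (h2 : bary v x 2 = l * bary v x 1) :
    x = rayPoint v l μ := by
  have h3 := hv.sum_bary_eq_one hd hZ hx.2
  rw [Fin.sum_univ_three, h2, h1] at h3
  have h4 : 1 + μ + l * μ ≠ 0 := by positivity
  have h5 : bary v x 0 = (1 + μ + l * μ)⁻¹ := by
    refine eq_inv_of_mul_eq_one_left ?_; linarith
  obtain ⟨r0, r1, r2⟩ := hv.bary_rayPoint hd hZ l μ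
  refine hv.eq_of_bary hd hZ fun i => ?_
  fin_cases i
  · change bary v x 0 = bary v (rayPoint v l μ) 0; rw [r0, h5]
  · change bary v x 1 = bary v (rayPoint v l μ) 1; rw [r1, h1, h5]; ring
  · change bary v x 2 = bary v (rayPoint v l μ) 2; rw [r2, h2, h1, h5]; ring

theorem onRay_rayPoint (hv : IsFlag d Z v) (hd : 1 ≤ d) (hZ : IsFullTriangulation d Z)
    {l μ : ℝ} (hl0 : 0 ≤ l) (hl1 : l ≤ 1) (hμ : μ ∈ Set.Icc (1 / 10 : ℝ) 3) :
    OnRay d v (1 / 7) (1 / 12) l (rayPoint v l μ) := by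
  have hμ0 : 0 ≤ μ := by linarith [hμ.1]
  obtain ⟨h0, h1, h2⟩ := hv.bary_rayPoint hd hZ l μ
  have hD : 0 < 1 + μ + l * μ := by positivity
  have hlμ : l * μ ≤ μ := by nlinarith
  refine ⟨hv.rayPoint_mem hd hZ hl0 hμ0, hv.bary_rayPoint_nonneg hd hZ hl0 hμ0, ?_, ?_, ?_⟩
  · rw [h0, one_div]; exact inv_anti₀ hD (by linarith [hμ.2])
  · rw [h1, inv_mul_eq_div, le_div_iff₀ hD]; linarith [hμ.1]
  · rw [h1, h2]; ring

theorem continuousOn_rayPoint (v : Fin 3 → Fin 3 → ℕ) {l : ℝ} (hl : 0 ≤ l) :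
    ContinuousOn (rayPoint v l) (Set.Ici 0) := by
  unfold rayPoint
  refine continuousOn_finsetSum _ fun i _ => ?_
  refine ContinuousOn.smul (f := fun μ => (1 + μ + l * μ)⁻¹ * (![1, μ, l * μ] : Fin 3 → ℝ) i)
    (g := fun _ => toReal (v i)) (ContinuousOn.mul ?_ ?_) continuousOn_const
  · refine ContinuousOn.inv₀ (by fun_prop) fun μ hμ => ?_
    have : (0 : ℝ) ≤ μ := hμ
    positivity
  · fin_cases i
    · exact continuousOn_const
    · exact continuousOn_id
    · exact continuousOn_const.mul continuousOn_id

end IsFlag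

/-- The basic estimates at a point of a ray. -/
theorem IsTame.bounds (hd : 1 ≤ d) (hc : ∀ m ∈ exponents d, 0 < c m) {ε l : ℝ}
    (ht : IsTame d c v ε) (hε : ε ≤ 1 / 1000) {x : Fin 3 → ℝ}
    (hx : OnRay d v (1 / 7) (1 / 12) l x) (hl : l ≤ 1) :
    1 / 3 ≤ amp d c x (v 0) ∧ 1 / 4 ≤ amp d c x (v 1) ∧ amp d c x (v 2) ≤ 2 * amp d c x (v 1) :=
  (hx.mono (by norm_num) (by norm_num)).bounds hd hc hε hl (ht.vertex x hx.mem hx.nonneg)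

namespace IsFlag

/-- For equal moduli the slope bounds have right side zero, so all amplitude ratios agree. -/
theorem injOn_modulus (hv : IsFlag d Z v) (hd : 1 ≤ d)
    (hc : ∀ m ∈ exponents d, 0 < c m) {ε l : ℝ}
    (ht : IsTame d c v ε) (hε : ε ≤ 1 / 1000) (hl0 : 0 ≤ l) (hl1 : l ≤ 1) {x y : Fin 3 → ℝ}
    (hx : OnRay d v (1 / 7) (1 / 12) l x) (hy : OnRay d v (1 / 7) (1 / 12) l y)
    (h : modulus d c v x = modulus d c v y) : x = y := by
  obtain ⟨hx0, hx1, -⟩ := ht.bounds hd hc hε hx hl1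
  obtain ⟨hy0, hy1, -⟩ := ht.bounds hd hc hε hy hl1
  have hx0' : 0 < amp d c x (v 0) := by linarith
  have hy0' : 0 < amp d c y (v 0) := by linarith
  have h3 := ht.slope_third l hl0 hl1 x y hx hy
  rw [h, sub_self, abs_zero, mul_zero] at h3
  have h3' : third d c v x = third d c v y :=
    sub_eq_zero.1 (abs_eq_zero.1 (le_antisymm h3 (abs_nonneg _)))
  refine eq_of_relAmp_eq (v := v) hd hc hx.mem hy.mem hx0' hy0' fun m hm => ?_
  by_cases hmv : m ∈ Set.range v
  · obtain ⟨i, rfl⟩ := hmv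
    fin_cases i
    · change amp d c x (v 0) / amp d c x (v 0) = amp d c y (v 0) / amp d c y (v 0)
      rw [div_self hx0'.ne', div_self hy0'.ne']
    · exact h
    · change amp d c x (v 2) / amp d c x (v 0) = amp d c y (v 2) / amp d c y (v 0)
      have h5 : ∀ x, 1 / 4 ≤ amp d c x (v 1) →
          amp d c x (v 2) / amp d c x (v 0) = third d c v x * modulus d c v x := by
        intro x hx
        have : amp d c x (v 1) ≠ 0 := by linarith
        rw [third, modulus, div_mul_div_cancel₀ this]
      rw [h5 x hx1, h5 y hy1, h3', h]
  · have h4 := ht.slope_rel l hl0 hl1 x y hx hy m (mem_others.2 ⟨hm, hmv⟩)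
    rw [h, sub_self, abs_zero, mul_zero] at h4
    exact sub_eq_zero.1 (abs_eq_zero.1 (le_antisymm h4 (abs_nonneg _)))

theorem modulus_sq_bounds (hv : IsFlag d Z v) (hd : 1 ≤ d) (hc : ∀ m ∈ exponents d, 0 < c m)
    {ε : ℝ} (ht : IsTame d c v ε) (hε : ε ≤ 1 / 1000) {x : Fin 3 → ℝ}
    (hx : x ∈ newtonPolygon d) (hx0 : ∀ i, 0 ≤ bary v x i) (h7 : 1 / 7 ≤ bary v x 0) :
    (bary v x 1 - ε) ≤ modulus d c v x ^ 2 * (bary v x 0 + ε) ∧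
      modulus d c v x ^ 2 * (bary v x 0 - ε) ≤ bary v x 1 + ε := by
  have h0 := abs_le.1 (ht.vertex x hx hx0 0)
  have h1 := abs_le.1 (ht.vertex x hx hx0 1)
  have hp : 0 < amp d c x (v 0) ^ 2 := by linarith
  have h2 : modulus d c v x ^ 2 * amp d c x (v 0) ^ 2 = amp d c x (v 1) ^ 2 := by
    rw [modulus, div_pow, div_mul_cancel₀ _ hp.ne']
  have h3 := sq_nonneg (modulus d c v x)
  constructor
  · have := mul_le_mul_of_nonneg_left (show amp d c x (v 0) ^ 2 ≤ bary v x 0 + ε by linarith) h3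
    linarith
  · have := mul_le_mul_of_nonneg_left (show bary v x 0 - ε ≤ amp d c x (v 0) ^ 2 by linarith) h3
    linarith

theorem modulus_nonneg (hd : 1 ≤ d) (hc : ∀ m ∈ exponents d, 0 < c m) {x : Fin 3 → ℝ}
    (hx : x ∈ newtonPolygon d) : 0 ≤ modulus d c v x :=
  div_nonneg (amp_nonneg hd hc hx _) (amp_nonneg hd hc hx _)

theorem continuousOn_modulus_ray (hv : IsFlag d Z v) (hd : 1 ≤ d) (hZ : IsFullTriangulation d Z)
    (hc : ∀ m ∈ exponents d, 0 < c m) {ε l : ℝ} (ht : IsTame d c v ε) (hε : ε ≤ 1 / 1000)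
    (hl0 : 0 ≤ l) (hl1 : l ≤ 1) :
    ContinuousOn (fun μ => modulus d c v (rayPoint v l μ)) (Set.Icc (1 / 10 : ℝ) 3) := by
  have h1 : ∀ m, ContinuousOn (fun μ => amp d c (rayPoint v l μ) m) (Set.Icc (1 / 10 : ℝ) 3) :=
    fun m => (continuousOn_amp hd hc m).comp
      ((continuousOn_rayPoint v hl0).mono fun μ hμ => by
        have := hμ.1
        exact (show (0 : ℝ) ≤ μ by linarith))
      fun μ hμ => (hv.onRay_rayPoint hd hZ hl0 hl1 hμ).mem
  refine (h1 _).div (h1 _) fun μ hμ => ?_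
  have := (ht.bounds hd hc hε (hv.onRay_rayPoint hd hZ hl0 hl1 hμ) hl1).1
  linarith

/-- The squared modulus is about `μ`, and `1/10 < (2/5)²`, `3 > (3/2)²`. This is why the parameter
interval `[1/10, 3]` covers the annulus. -/
theorem modulus_ray_ends (hv : IsFlag d Z v) (hd : 1 ≤ d) (hZ : IsFullTriangulation d Z)
    (hc : ∀ m ∈ exponents d, 0 < c m) {ε l : ℝ} (ht : IsTame d c v ε) (hε : ε ≤ 1 / 1000)
    (hl0 : 0 ≤ l) (hl1 : l ≤ 1) : modulus d c v (rayPoint v l (1 / 10)) < 2 / 5 ∧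
      3 / 2 < modulus d c v (rayPoint v l 3) := by
  have ha : (1 / 10 : ℝ) ∈ Set.Icc (1 / 10 : ℝ) 3 := by constructor <;> norm_num
  have hb : (3 : ℝ) ∈ Set.Icc (1 / 10 : ℝ) 3 := by constructor <;> norm_num
  have hA := hv.onRay_rayPoint hd hZ hl0 hl1 ha
  have hB := hv.onRay_rayPoint hd hZ hl0 hl1 hb
  constructor
  · have h1 := (hv.modulus_sq_bounds hd hc ht hε hA.mem hA.nonneg hA.low₀).2
    obtain ⟨r0, r1, -⟩ := hv.bary_rayPoint hd hZ l (1 / 10)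
    have h2 := hA.low₀
    rw [← r0] at r1
    rw [r1] at h1
    by_contra! h
    have h3 : (2 / 5 : ℝ) ^ 2 ≤ modulus d c v (rayPoint v l (1 / 10)) ^ 2 :=
      pow_le_pow_left₀ (by norm_num) h 2
    have h4 := mul_le_mul_of_nonneg_right h3
      (show 0 ≤ bary v (rayPoint v l (1 / 10)) 0 - ε by linarith)
    linarith
  · have h1 := (hv.modulus_sq_bounds hd hc ht hε hB.mem hB.nonneg hB.low₀).1
    obtain ⟨r0, r1, -⟩ := hv.bary_rayPoint hd hZ l 3
    have h2 := hB.low₀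
    rw [← r0] at r1
    rw [r1] at h1
    by_contra! h
    have h3 : modulus d c v (rayPoint v l 3) ^ 2 ≤ (3 / 2 : ℝ) ^ 2 :=
      pow_le_pow_left₀ (modulus_nonneg hd hc hB.mem) h 2
    have hε0 : 0 ≤ ε := (abs_nonneg _).trans (ht.vertex _ hB.mem hB.nonneg 0)
    have h4 := mul_le_mul_of_nonneg_right h3
      (show 0 ≤ bary v (rayPoint v l 3) 0 + ε by linarith)
    linarith

/-- A continuous injective function on an interval, with end values in increasing order. -/
theorem strictMonoOn_modulus_ray (hv : IsFlag d Z v) (hd : 1 ≤ d) (hZ : IsFullTriangulation d Z)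
    (hc : ∀ m ∈ exponents d, 0 < c m) {ε l : ℝ} (ht : IsTame d c v ε) (hε : ε ≤ 1 / 1000)
    (hl0 : 0 ≤ l) (hl1 : l ≤ 1) :
    StrictMonoOn (fun μ => modulus d c v (rayPoint v l μ)) (Set.Icc (1 / 10 : ℝ) 3) := by
  have hinj : Set.InjOn (fun μ => modulus d c v (rayPoint v l μ)) (Set.Icc (1 / 10 : ℝ) 3) := by
    intro μ hμ μ' hμ' h
    have h1 := hv.injOn_modulus hd hc ht hε hl0 hl1 (hv.onRay_rayPoint hd hZ hl0 hl1 hμ)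
      (hv.onRay_rayPoint hd hZ hl0 hl1 hμ') h
    obtain ⟨r0, r1, -⟩ := hv.bary_rayPoint hd hZ l μ
    obtain ⟨r0', r1', -⟩ := hv.bary_rayPoint hd hZ l μ'
    rw [h1] at r0 r1
    have h2 := (hv.onRay_rayPoint hd hZ hl0 hl1 hμ').low₀
    rw [← r0] at r1
    rw [← r0'] at r1'
    rw [r1] at r1'
    exact mul_left_cancel₀ (by linarith) r1'
  obtain ⟨h1, h2⟩ := hv.modulus_ray_ends hd hZ hc ht hε hl0 hl1
  refine (hv.continuousOn_modulus_ray hd hZ hc ht hε hl0 hl1).strictMonoOn_of_injOn_Icc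
    (by norm_num) (by linarith) hinj

theorem exists_ray_modulus (hv : IsFlag d Z v) (hd : 1 ≤ d) (hZ : IsFullTriangulation d Z)
    (hc : ∀ m ∈ exponents d, 0 < c m) {ε l : ℝ} (ht : IsTame d c v ε) (hε : ε ≤ 1 / 1000)
    (hl0 : 0 ≤ l) (hl1 : l ≤ 1) {A : ℝ} (hA : A ∈ Set.Icc (2 / 5 : ℝ) (3 / 2)) :
    ∃ μ ∈ Set.Icc (1 / 10 : ℝ) 3, modulus d c v (rayPoint v l μ) = A := by
  obtain ⟨h1, h2⟩ := hv.modulus_ray_ends hd hZ hc ht hε hl0 hl1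
  exact intermediate_value_Icc (by norm_num)
    (hv.continuousOn_modulus_ray hd hZ hc ht hε hl0 hl1) ⟨by linarith [hA.1], by linarith [hA.2]⟩

end IsFlag

variable {d : ℕ} {Z : Geometry.SimplicialComplex ℝ (Fin 3 → ℝ)} {v : Fin 3 → Fin 3 → ℕ}
  {c : (Fin 3 → ℕ) → ℝ}

/-! ### Rays as root families -/

theorem norm_zpow_sub_zpow_le {u w : ℂ} (hu : ‖u‖ = 1) (hw : ‖w‖ = 1) (n : ℤ) :
    ‖u ^ n - w ^ n‖ ≤ |(n : ℝ)| * ‖u - w‖ := by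
  have key : ∀ n : ℕ, ‖u ^ n - w ^ n‖ ≤ n * ‖u - w‖ := by
    intro n
    induction n with
    | zero => simp
    | succ n ih =>
      have e : u ^ (n + 1) - w ^ (n + 1) = u ^ n * (u - w) + (u ^ n - w ^ n) * w := by ring
      rw [e]
      refine (norm_add_le _ _).trans ?_
      rw [norm_mul, norm_mul, norm_pow, hu, hw, one_pow, one_mul, mul_one]
      push_cast
      linarith
  have hu0 : u ≠ 0 := fun h => by rw [h, norm_zero] at hu; exact zero_ne_one hu
  have hw0 : w ≠ 0 := fun h => by rw [h, norm_zero] at hw; exact zero_ne_one hw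
  rcases Int.le_total 0 n with h | h
  · obtain ⟨k, rfl⟩ := Int.eq_ofNat_of_zero_le h
    simpa using key k
  · obtain ⟨k, rfl⟩ : ∃ k : ℕ, n = -(k : ℤ) := ⟨n.natAbs, by omega⟩
    have e : u ^ (-(k : ℤ)) - w ^ (-(k : ℤ)) = (w ^ k - u ^ k) / (u ^ k * w ^ k) := by
      rw [zpow_neg, zpow_neg, zpow_natCast, zpow_natCast]
      have h1 := pow_ne_zero k hu0
      have h2 := pow_ne_zero k hw0
      field_simp
    rw [e, norm_div, norm_mul, norm_pow, norm_pow, hu, hw, one_pow, mul_one, div_one,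
      norm_sub_rev]
    simpa using key k

theorem norm_unit_sub_unit_le {y z : ℂ} (hy : 2 / 5 ≤ ‖y‖) (hz : 2 / 5 ≤ ‖z‖) :
    ‖y / ‖y‖ - z / ‖z‖‖ ≤ 5 * ‖y - z‖ := by
  have hy0 : 0 < ‖y‖ := by linarith
  have hz0 : 0 < ‖z‖ := by linarith
  have hy' : (‖y‖ : ℂ) ≠ 0 := Complex.ofReal_ne_zero.2 hy0.ne'
  have hz' : (‖z‖ : ℂ) ≠ 0 := Complex.ofReal_ne_zero.2 hz0.ne'
  have e : y / ‖y‖ - z / ‖z‖ = ((y - z) + z / ‖z‖ * ((‖z‖ - ‖y‖ : ℝ) : ℂ)) / ‖y‖ := by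
    push_cast
    field_simp
    ring
  have h1 := abs_norm_sub_norm_le z y
  rw [norm_sub_rev] at h1
  rw [e, norm_div, Complex.norm_real, Real.norm_eq_abs, abs_of_pos hy0, div_le_iff₀ hy0]
  refine (norm_add_le _ _).trans ?_
  rw [norm_mul, norm_div, Complex.norm_real, Complex.norm_real, Real.norm_eq_abs,
    Real.norm_eq_abs, abs_of_pos hz0, div_self hz0.ne', one_mul]
  nlinarith [norm_nonneg (y - z)]

open Classical in
/-- The parameter of the point of the ray with a given modulus. -/
def par (d : ℕ) (c : (Fin 3 → ℕ) → ℝ) (v : Fin 3 → Fin 3 → ℕ) (l A : ℝ) : ℝ :=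
  if h : ∃ μ ∈ Set.Icc (1 / 10 : ℝ) 3, modulus d c v (rayPoint v l μ) = A then h.choose else 1

/-- The ratio of the third and second amplitudes, as a function of the modulus. -/
def rayKappa (d : ℕ) (c : (Fin 3 → ℕ) → ℝ) (v : Fin 3 → Fin 3 → ℕ) (l A : ℝ) : ℝ :=
  third d c v (rayPoint v l (par d c v l A))

/-- The contribution of the lattice points outside the triangle. -/
def rayRho (d : ℕ) (c : (Fin 3 → ℕ) → ℝ) (v : Fin 3 → Fin 3 → ℕ) (l : ℝ) (y : ℂ) (ω : ℝ) : ℂ :=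
  ∑ m ∈ others d v, relAmp d c v m (rayPoint v l (par d c v l ‖y‖)) *
    ((y / ‖y‖) ^ (icoord v m 1 + icoord v m 2) *
      Complex.exp ((icoord v m 2 : ℂ) * ((ω : ℂ) * Complex.I)))

theorem par_mem (d : ℕ) (c : (Fin 3 → ℕ) → ℝ) (v : Fin 3 → Fin 3 → ℕ) (l A : ℝ) :
    par d c v l A ∈ Set.Icc (1 / 10 : ℝ) 3 := by
  unfold par
  split_ifs with h
  · exact h.choose_spec.1
  · constructor <;> norm_num

/-- The numerical conditions on the amplitudes under which all rays are root families. -/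
structure IsFine (d : ℕ) (c : (Fin 3 → ℕ) → ℝ) (v : Fin 3 → Fin 3 → ℕ) (ε : ℝ) : Prop where
  pos : 0 < ε
  le : ε ≤ 1 / 1000
  exists_tame : ∃ ε₁ η C : ℝ, IsTame d c v ε₁ ∧ 0 ≤ ε₁ ∧ 0 ≤ η ∧ ε₁ ≤ η ^ 2 ∧ ε₁ ≤ 1 / 10000 ∧
    7 * ε₁ ≤ ε ∧ (∀ m ∈ exponents d, ∀ i, |bary v (toReal m) i| ≤ C) ∧
    (exponents d).card * (ε₁ + 3 * η * (10 * C)) ≤ ε ∧ (exponents d).card * (3 * η) ≤ ε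

theorem card_others_le (d : ℕ) (v : Fin 3 → Fin 3 → ℕ) :
    ((others d v).card : ℝ) ≤ (exponents d).card :=
  Nat.cast_le.2 (Finset.card_le_card (Finset.filter_subset _ _))

namespace IsFlag

theorem modulus_par (hv : IsFlag d Z v) (hd : 1 ≤ d) (hZ : IsFullTriangulation d Z)
    (hc : ∀ m ∈ exponents d, 0 < c m) {ε l : ℝ} (ht : IsTame d c v ε) (hε : ε ≤ 1 / 1000)
    (hl0 : 0 ≤ l) (hl1 : l ≤ 1) {A : ℝ} (hA : A ∈ Set.Icc (2 / 5 : ℝ) (3 / 2)) :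
    modulus d c v (rayPoint v l (par d c v l A)) = A := by
  have h := hv.exists_ray_modulus hd hZ hc ht hε hl0 hl1 hA
  rw [par, dif_pos h]
  exact h.choose_spec.2

theorem par_modulus (hv : IsFlag d Z v) (hd : 1 ≤ d) (hZ : IsFullTriangulation d Z)
    (hc : ∀ m ∈ exponents d, 0 < c m) {ε l : ℝ} (ht : IsTame d c v ε) (hε : ε ≤ 1 / 1000)
    (hl0 : 0 ≤ l) (hl1 : l ≤ 1) {μ : ℝ} (hμ : μ ∈ Set.Icc (1 / 10 : ℝ) 3) :
    par d c v l (modulus d c v (rayPoint v l μ)) = μ := by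
  have h : ∃ μ' ∈ Set.Icc (1 / 10 : ℝ) 3,
      modulus d c v (rayPoint v l μ') = modulus d c v (rayPoint v l μ) := ⟨μ, hμ, rfl⟩
  rw [par, dif_pos h]
  exact (hv.strictMonoOn_modulus_ray hd hZ hc ht hε hl0 hl1).injOn h.choose_spec.1 hμ
    h.choose_spec.2

/-- These are the tame estimates with the modulus as parameter, `par` being inverse to the modulus
on the ray. The bound `11/10` on `κ` reflects `λ₂ ≤ λ₁`. The perturbation is Lipschitz because the
relative amplitudes are small with small slopes and the unit factors have exponents at most `2 C`.
-/
theorem rootFamily (hv : IsFlag d Z v) (hd : 1 ≤ d) (hZ : IsFullTriangulation d Z)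
    (hc : ∀ m ∈ exponents d, 0 < c m) {ε l : ℝ} (hf : IsFine d c v ε) (hl0 : 0 ≤ l)
    (hl1 : l ≤ 1) : RootFamily (rayKappa d c v l) (rayRho d c v l) ε := by
  obtain ⟨ε₁, η, C, ht, hε₁0, hη0, hη, hε₁, hε₁ε, hC, hN, hN'⟩ := hf.exists_tame
  have hε₁' : ε₁ ≤ 1 / 1000 := by linarith
  have hray : ∀ A, OnRay d v (1 / 7) (1 / 12) l (rayPoint v l (par d c v l A)) := fun A =>
    hv.onRay_rayPoint hd hZ hl0 hl1 (par_mem d c v l A)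
  have hmod : ∀ A ∈ Set.Icc (2 / 5 : ℝ) (3 / 2),
      modulus d c v (rayPoint v l (par d c v l A)) = A := fun A hA =>
    hv.modulus_par hd hZ hc ht hε₁' hl0 hl1 hA
  have hrel : ∀ A, ∀ m ∈ others d v,
      0 ≤ relAmp d c v m (rayPoint v l (par d c v l A)) ∧
      relAmp d c v m (rayPoint v l (par d c v l A)) ≤ 3 * η := by
    intro A m hm
    obtain ⟨h0, -, -⟩ := ht.bounds hd hc hε₁' (hray A) hl1
    have h1 := amp_nonneg hd hc (hray A).mem m
    have h2 : amp d c (rayPoint v l (par d c v l A)) m ≤ η := (sq_le_sq₀ h1 hη0).1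
      ((ht.other _ (hray A).mem (hray A).nonneg m hm).trans hη)
    refine ⟨div_nonneg h1 (amp_nonneg hd hc (hray A).mem _), ?_⟩
    rw [relAmp, div_le_iff₀ (by linarith)]
    nlinarith
  have hunit : ∀ y : ℂ, ‖y‖ ∈ Set.Icc (2 / 5 : ℝ) (3 / 2) → ‖y / ‖y‖‖ = 1 := by
    intro y hy
    have : 0 < ‖y‖ := by linarith [hy.1]
    rw [norm_div, Complex.norm_real, norm_norm, div_self this.ne']
  have hexp : ∀ (k : ℤ) (ω : ℝ), ‖Complex.exp ((k : ℂ) * ((ω : ℂ) * Complex.I))‖ = 1 := by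
    intro k ω
    have : (k : ℂ) * ((ω : ℂ) * Complex.I) = ((k * ω : ℝ) : ℂ) * Complex.I := by push_cast; ring
    rw [this, Complex.norm_exp_ofReal_mul_I]
  refine ⟨hf.pos, hf.le.trans (by norm_num), ?_, ?_, ?_, ?_, ?_, ?_, ?_⟩
  · exact fun A _ => div_nonneg (amp_nonneg hd hc (hray A).mem _)
      (amp_nonneg hd hc (hray A).mem _)
  · intro A _
    obtain ⟨h0, h1, -⟩ := ht.bounds hd hc hε₁' (hray A) hl1
    rw [rayKappa, third, div_le_iff₀ (by linarith)]
    have h2 := abs_le.1 (ht.vertex _ (hray A).mem (hray A).nonneg 1)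
    have h3 := abs_le.1 (ht.vertex _ (hray A).mem (hray A).nonneg 2)
    have h4 := (hray A).low₁
    have h5 : bary v (rayPoint v l (par d c v l A)) 2 ≤
        bary v (rayPoint v l (par d c v l A)) 1 := by
      rw [(hray A).eq]; nlinarith
    refine (sq_le_sq₀ (amp_nonneg hd hc (hray A).mem _) (by linarith)).1 ?_
    rw [mul_pow]
    linarith
  · intro A hA B hB
    have h1 := ht.slope_third l hl0 hl1 _ _ (hray A) (hray B)
    rw [hmod A hA, hmod B hB] at h1
    exact h1.trans (mul_le_mul_of_nonneg_right (by linarith) (abs_nonneg _))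
  · intro y hy ω
    refine (norm_sum_le _ _).trans ?_
    calc _ ≤ ∑ m ∈ others d v, 3 * η := by
          refine Finset.sum_le_sum fun m hm => ?_
          rw [norm_mul, norm_mul, norm_zpow, hunit y hy, hexp, one_zpow, mul_one, mul_one,
            Complex.norm_real, Real.norm_eq_abs, abs_of_nonneg (hrel _ m hm).1]
          exact (hrel _ m hm).2
      _ = (others d v).card * (3 * η) := by rw [Finset.sum_const, nsmul_eq_mul]
      _ ≤ (exponents d).card * (3 * η) :=
          mul_le_mul_of_nonneg_right (card_others_le d v) (by positivity)
      _ ≤ ε := hN'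
  · intro y hy z hz ω
    rw [rayRho, rayRho, ← Finset.sum_sub_distrib]
    refine (norm_sum_le _ _).trans ?_
    calc _ ≤ ∑ m ∈ others d v, (ε₁ + 3 * η * (10 * C)) * ‖y - z‖ := by
          refine Finset.sum_le_sum fun m hm => ?_
          set b := relAmp d c v m (rayPoint v l (par d c v l ‖y‖))
          set b' := relAmp d c v m (rayPoint v l (par d c v l ‖z‖))
          set n := icoord v m 1 + icoord v m 2 with hn
          have e : (b : ℂ) * ((y / ‖y‖) ^ n *
              Complex.exp ((icoord v m 2 : ℂ) * ((ω : ℂ) * Complex.I))) -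
              b' * ((z / ‖z‖) ^ n *
              Complex.exp ((icoord v m 2 : ℂ) * ((ω : ℂ) * Complex.I))) =
              (((b - b' : ℝ) : ℂ) * (y / ‖y‖) ^ n + b' * ((y / ‖y‖) ^ n - (z / ‖z‖) ^ n)) *
              Complex.exp ((icoord v m 2 : ℂ) * ((ω : ℂ) * Complex.I)) := by
            push_cast; ring
          rw [e, norm_mul, hexp, mul_one]
          refine (norm_add_le _ _).trans ?_
          rw [norm_mul, norm_mul, norm_zpow, hunit y hy, one_zpow, mul_one, Complex.norm_real,
            Complex.norm_real, Real.norm_eq_abs, Real.norm_eq_abs,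
            abs_of_nonneg (hrel _ m hm).1, add_mul]
          have h1 := ht.slope_rel l hl0 hl1 _ _ (hray ‖y‖) (hray ‖z‖) m hm
          rw [hmod _ hy, hmod _ hz] at h1
          have h2 : |‖y‖ - ‖z‖| ≤ ‖y - z‖ := abs_norm_sub_norm_le _ _
          have h3 := norm_zpow_sub_zpow_le (hunit y hy) (hunit z hz) n
          have h4 := norm_unit_sub_unit_le hy.1 hz.1
          have hm' := (mem_others.1 hm).1
          have h5 : |(n : ℝ)| ≤ 2 * C := by
            rw [hn]
            push_cast
            rw [hv.icoord_cast hd hZ hm', hv.icoord_cast hd hZ hm']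
            refine (abs_add_le _ _).trans ?_
            have := hC m hm' 1
            have := hC m hm' 2
            linarith
          have hyz := norm_nonneg (y - z)
          refine add_le_add (h1.trans (mul_le_mul_of_nonneg_left h2 hε₁0)) ?_
          calc b' * ‖(y / ‖y‖) ^ n - (z / ‖z‖) ^ n‖ ≤ 3 * η * (2 * C * (5 * ‖y - z‖)) := by
                refine mul_le_mul (hrel _ m hm).2 (h3.trans ?_) (norm_nonneg _) (by positivity)
                exact mul_le_mul h5 h4 (norm_nonneg _) ((abs_nonneg _).trans h5)
            _ = _ := by ring
      _ = (others d v).card * (ε₁ + 3 * η * (10 * C)) * ‖y - z‖ := by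
          rw [Finset.sum_const, nsmul_eq_mul]; ring
      _ ≤ ε * ‖y - z‖ := by
          refine mul_le_mul_of_nonneg_right (le_trans ?_ hN) (norm_nonneg _)
          refine mul_le_mul_of_nonneg_right (card_others_le d v) ?_
          have : 0 ≤ C := (abs_nonneg _).trans (hC _ (hv.mem 0) 0)
          positivity
  · intro y
    unfold rayRho
    fun_prop
  · intro y ω ω' h
    unfold rayRho
    refine Finset.sum_congr rfl fun m _ => ?_
    rw [Complex.exp_int_mul, Complex.exp_int_mul, h]

theorem eqn_ray (hv : IsFlag d Z v) (hd : 1 ≤ d) (hZ : IsFullTriangulation d Z)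
    (hc : ∀ m ∈ exponents d, 0 < c m) {ε l : ℝ} (ht : IsTame d c v ε) (hε : ε ≤ 1 / 1000)
    (hl0 : 0 ≤ l) (hl1 : l ≤ 1) {μ : ℝ} (hμ : μ ∈ Set.Icc (1 / 10 : ℝ) 3) (α ω : ℝ) :
    RootFamily.eqn (rayKappa d c v l) (rayRho d c v l) ω
      (modulus d c v (rayPoint v l μ) * Complex.exp (α * Complex.I)) =
      1 + modulus d c v (rayPoint v l μ) * Complex.exp (α * Complex.I) *
        (1 + third d c v (rayPoint v l μ) * Complex.exp (ω * Complex.I)) +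
        ∑ m ∈ others d v, relAmp d c v m (rayPoint v l μ) * phase v m α ω := by
  have hx := hv.onRay_rayPoint hd hZ hl0 hl1 hμ
  obtain ⟨h0, h1, -⟩ := ht.bounds hd hc hε hx hl1
  have hA : 0 < modulus d c v (rayPoint v l μ) := div_pos (by linarith) (by linarith)
  have hn : ‖(modulus d c v (rayPoint v l μ) : ℂ) * Complex.exp (α * Complex.I)‖ =
      modulus d c v (rayPoint v l μ) := by
    rw [norm_mul, Complex.norm_exp_ofReal_mul_I, mul_one, Complex.norm_real, Real.norm_eq_abs,
      abs_of_pos hA]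
  rw [RootFamily.eqn, rayRho, hn, rayKappa, hv.par_modulus hd hZ hc ht hε hl0 hl1 hμ,
    mul_div_cancel_left₀ _ (Complex.ofReal_ne_zero.2 hA.ne')]
  rfl

theorem rayPoint_mem_momentImage_iff (hv : IsFlag d Z v) (hd : 1 ≤ d)
    (hZ : IsFullTriangulation d Z)
    (hc : ∀ m ∈ exponents d, 0 < c m) {ε l : ℝ} (ht : IsTame d c v ε) (hε : ε ≤ 1 / 1000)
    (hl0 : 0 ≤ l) (hl1 : l ≤ 1) {μ : ℝ} (hμ : μ ∈ Set.Icc (1 / 10 : ℝ) 3)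
    (hA : modulus d c v (rayPoint v l μ) ∈ Set.Icc (2 / 5 : ℝ) (5 / 4)) (x : newtonPolygon d)
    (hxμ : (x : Fin 3 → ℝ) = rayPoint v l μ) :
    x ∈ momentImage d c ↔ modulus d c v (rayPoint v l μ) ∈
      RootFamily.moduli (rayKappa d c v l) (rayRho d c v l) := by
  have hx := hv.onRay_rayPoint hd hZ hl0 hl1 hμ
  obtain ⟨h0, h1, -⟩ := ht.bounds hd hc hε hx hl1
  rw [hv.mem_momentImage_iff_phases hd hZ hc x (by rw [hxμ]; linarith)
    (by rw [hxμ]; linarith), hxμ]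
  constructor
  · rintro ⟨α, ω, h⟩
    refine ⟨hA, ω, _, ?_, (hv.eqn_ray hd hZ hc ht hε hl0 hl1 hμ α ω).trans h⟩
    rw [norm_mul, Complex.norm_exp_ofReal_mul_I, mul_one, Complex.norm_real, Real.norm_eq_abs,
      abs_of_nonneg (by linarith [hA.1])]
  · rintro ⟨-, ω, y, hy, h⟩
    refine ⟨Complex.arg y, ω, ?_⟩
    rw [← hv.eqn_ray hd hZ hc ht hε hl0 hl1 hμ, ← hy, Complex.norm_mul_exp_arg_mul_I]
    exact h

end IsFlag

variable {d : ℕ} {Z : Geometry.SimplicialComplex ℝ (Fin 3 → ℝ)} {v : Fin 3 → Fin 3 → ℕ}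
  {c : (Fin 3 → ℕ) → ℝ}

/-! ### Real points of the curve -/

namespace RootFamily

variable {κ : ℝ → ℝ} {ρ : ℂ → ℝ → ℂ} {ε : ℝ}

theorem re_eqn (κ : ℝ → ℝ) (ρ : ℂ → ℝ → ℂ) (ω : ℝ) {A : ℝ} (hA : 0 ≤ A) :
    (eqn κ ρ ω (-A : ℂ)).re = 1 - A * (1 + κ A * Real.cos ω) + (ρ (-A : ℂ) ω).re := by
  have hn : ‖(-A : ℂ)‖ = A := by
    rw [norm_neg, Complex.norm_real, Real.norm_eq_abs, abs_of_nonneg hA]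
  rw [eqn, hn, Complex.exp_mul_I]
  simp [← Complex.ofReal_cos, ← Complex.ofReal_sin]
  ring

/-- For `κ ≤ 1/8` the main term `1 - A (1 + κ cos ω)` falls at rate at least about `7/8`, more than
the slopes of `κ` and `ρ` can offset. -/
theorem re_eqn_lt (h : RootFamily κ ρ ε) (hκ : ∀ A ∈ Set.Icc (2 / 5 : ℝ) (3 / 2), κ A ≤ 1 / 8)
    {A B : ℝ} (hA : A ∈ Set.Icc (2 / 5 : ℝ) (3 / 2)) (hB : B ∈ Set.Icc (2 / 5 : ℝ) (3 / 2))
    (hAB : A < B) (ω : ℝ) : (eqn κ ρ ω (-B : ℂ)).re < (eqn κ ρ ω (-A : ℂ)).re := by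
  have hn : ∀ A ∈ Set.Icc (2 / 5 : ℝ) (3 / 2), ‖(-A : ℂ)‖ = A := fun A hA => by
    rw [norm_neg, Complex.norm_real, Real.norm_eq_abs, abs_of_nonneg (by linarith [hA.1])]
  rw [re_eqn _ _ _ (show 0 ≤ A by linarith [hA.1]), re_eqn _ _ _ (show 0 ≤ B by linarith [hB.1])]
  have h1 := h.lip_rho (-B) (by rw [hn B hB]; exact hB) (-A) (by rw [hn A hA]; exact hA) ω
  have h2 : ‖(-B : ℂ) - -A‖ = B - A := by
    have : (-B : ℂ) - -A = -((B - A : ℝ) : ℂ) := by push_cast; ring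
    rw [this, norm_neg, Complex.norm_real, Real.norm_eq_abs, abs_of_pos (sub_pos.2 hAB)]
  rw [h2] at h1
  have h3 := (Complex.re_le_norm _).trans h1
  rw [Complex.sub_re] at h3
  have h4 := abs_le.1 (h.lip A hA B hB)
  rw [abs_sub_comm, abs_of_pos (sub_pos.2 hAB)] at h4
  have h5 := hκ B hB
  have h6 := h.nonneg B hB
  have hc := abs_le.1 (Real.abs_cos_le_one ω)
  have he := h.eps_le
  have he0 := h.eps_pos
  have e : A * (1 + κ A * Real.cos ω) - B * (1 + κ B * Real.cos ω) =
      -(B - A) * (1 + κ B * Real.cos ω) + A * ((κ A - κ B) * Real.cos ω) := by ring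
  have h7 : 7 / 8 ≤ 1 + κ B * Real.cos ω := by nlinarith
  have h8 : (κ A - κ B) * Real.cos ω ≤ ε * (B - A) := by
    refine (le_abs_self _).trans ?_
    rw [abs_mul]
    calc _ ≤ ε * (B - A) * 1 :=
          mul_le_mul (abs_le.2 h4) (Real.abs_cos_le_one ω) (abs_nonneg _) (by nlinarith)
      _ = _ := mul_one _
  have h9 : A * ((κ A - κ B) * Real.cos ω) ≤ 3 / 2 * (ε * (B - A)) :=
    (mul_le_mul_of_nonneg_left h8 (by linarith [hA.1])).trans
      (mul_le_mul_of_nonneg_right hA.2 (by nlinarith))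
  have h10 : (B - A) * (7 / 8) ≤ (B - A) * (1 + κ B * Real.cos ω) :=
    mul_le_mul_of_nonneg_left h7 (by linarith)
  have h11 : ε * (B - A) ≤ 1 / 100 * (B - A) := mul_le_mul_of_nonneg_right he (by linarith)
  linarith

/-- `17/20 · 9/8 < 1 - ε`. -/
theorem re_eqn_pos (h : RootFamily κ ρ ε) (hκ : ∀ A ∈ Set.Icc (2 / 5 : ℝ) (3 / 2), κ A ≤ 1 / 8)
    {A : ℝ} (hA : A ∈ Set.Icc (2 / 5 : ℝ) (17 / 20)) (ω : ℝ) :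
    0 < (eqn κ ρ ω (-A : ℂ)).re := by
  have hA' : A ∈ Set.Icc (2 / 5 : ℝ) (3 / 2) := ⟨hA.1, hA.2.trans (by norm_num)⟩
  have hA0 : 0 ≤ A := by linarith [hA.1]
  rw [re_eqn _ _ _ hA0]
  have h1 := h.small (-A) (by
    rw [norm_neg, Complex.norm_real, Real.norm_eq_abs, abs_of_nonneg hA0]; exact hA') ω
  have h2 := abs_le.1 ((Complex.abs_re_le_norm _).trans h1)
  have hc := abs_le.1 (Real.abs_cos_le_one ω)
  have h3 : κ A * Real.cos ω ≤ 1 / 8 := by nlinarith [h.nonneg A hA', hκ A hA']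
  have h4 : A * (1 + κ A * Real.cos ω) ≤ 17 / 20 * (9 / 8) := by
    nlinarith [hA.2]
  linarith [h.eps_le]

/-- `6/5 · 7/8 > 1 + ε`. -/
theorem re_eqn_neg (h : RootFamily κ ρ ε) (hκ : ∀ A ∈ Set.Icc (2 / 5 : ℝ) (3 / 2), κ A ≤ 1 / 8)
    {A : ℝ} (hA : A ∈ Set.Icc (6 / 5 : ℝ) (3 / 2)) (ω : ℝ) :
    (eqn κ ρ ω (-A : ℂ)).re < 0 := by
  have hA' : A ∈ Set.Icc (2 / 5 : ℝ) (3 / 2) := ⟨le_trans (by norm_num) hA.1, hA.2⟩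
  have hA0 : 0 ≤ A := by linarith [hA.1]
  rw [re_eqn _ _ _ hA0]
  have h1 := h.small (-A) (by
    rw [norm_neg, Complex.norm_real, Real.norm_eq_abs, abs_of_nonneg hA0]; exact hA') ω
  have h2 := abs_le.1 ((Complex.abs_re_le_norm _).trans h1)
  have hc := abs_le.1 (Real.abs_cos_le_one ω)
  have h3 : -(1 / 8) ≤ κ A * Real.cos ω := by nlinarith [h.nonneg A hA', hκ A hA']
  have h4 : 6 / 5 * (7 / 8) ≤ A * (1 + κ A * Real.cos ω) := by
    nlinarith [hA.1]
  linarith [h.eps_le]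

theorem mem_phases_of_le (h : RootFamily κ ρ ε) (hκ : κ 1 ≤ 1 / 8) (ω : ℝ) : ω ∈ phases κ := by
  change 3 / 4 ≤ ‖1 + κ 1 * Complex.exp (ω * Complex.I)‖
  have h1 := norm_sub_le (1 + κ 1 * Complex.exp (ω * Complex.I))
    (κ 1 * Complex.exp (ω * Complex.I))
  rw [add_sub_cancel_right, norm_one, norm_mul, Complex.norm_exp_ofReal_mul_I, mul_one,
    Complex.norm_real, Real.norm_eq_abs, abs_of_nonneg (h.nonneg 1 one_mem)] at h1
  linarith

end RootFamily

/-- The sum of all amplitudes with the signs of the monomials at the real point with one negative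
coordinate, normalised to be positive at `m₀`. -/
def signedSum (d : ℕ) (c : (Fin 3 → ℕ) → ℝ) (i : Fin 3) (m₀ : Fin 3 → ℕ) (x : Fin 3 → ℝ) : ℝ :=
  ∑ m ∈ exponents d, (-1) ^ (m i + m₀ i) * amp d c x m

theorem neg_one_pow_eq_exp (a b : ℕ) :
    ((-1 : ℂ)) ^ (a + b) = Complex.exp (((Real.pi * (a - b) : ℝ) : ℂ) * Complex.I) := by
  have h1 : (((Real.pi * (a - b) : ℝ) : ℂ) * Complex.I) =
      a * (Real.pi * Complex.I) - b * (Real.pi * Complex.I) := by push_cast; ring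
  rw [h1, Complex.exp_sub, Complex.exp_nat_mul, Complex.exp_nat_mul, Complex.exp_pi_mul_I,
    eq_div_iff (pow_ne_zero _ (by norm_num)), pow_add, mul_assoc, ← mul_pow]
  norm_num

theorem continuousOn_signedSum (hd : 1 ≤ d) (hc : ∀ m ∈ exponents d, 0 < c m) (i : Fin 3)
    (m₀ : Fin 3 → ℕ) : ContinuousOn (signedSum d c i m₀) (newtonPolygon d) :=
  continuousOn_finsetSum _ fun m _ => continuousOn_const.mul (continuousOn_amp hd hc m)

/-- A monomial cannot dominate all others at a point of the curve. -/
theorem amp_le_of_mem (hd : 1 ≤ d) (hc : ∀ m ∈ exponents d, 0 < c m) (hv : IsFlag d Z v)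
    (x : newtonPolygon d) (hx : x ∈ momentImage d c) :
    amp d c x (v 0) ≤ amp d c x (v 1) + amp d c x (v 2) + ∑ m ∈ others d v, amp d c x m := by
  obtain ⟨θ, hθ⟩ := (mem_momentImage_iff hd hc x).1 hx
  have hn : ∀ m, ‖(amp d c x m : ℂ) * Complex.exp ((∑ i, m i * θ i : ℝ) * Complex.I)‖ =
      amp d c x m := fun m => by
    rw [norm_mul, Complex.norm_exp_ofReal_mul_I, mul_one, Complex.norm_real, Real.norm_eq_abs,
      abs_of_nonneg (amp_nonneg hd hc x.2 m)]
  rw [hv.sum_split, Fin.sum_univ_three] at hθ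
  have h1 : (amp d c x (v 0) : ℂ) * Complex.exp ((∑ i, v 0 i * θ i : ℝ) * Complex.I) =
      -((amp d c x (v 1) * Complex.exp ((∑ i, v 1 i * θ i : ℝ) * Complex.I) +
        amp d c x (v 2) * Complex.exp ((∑ i, v 2 i * θ i : ℝ) * Complex.I)) +
        ∑ m ∈ others d v, amp d c x m * Complex.exp ((∑ i, m i * θ i : ℝ) * Complex.I)) := by
    linear_combination hθ
  rw [← hn (v 0), h1, norm_neg]
  refine (norm_add_le _ _).trans (add_le_add ((norm_add_le _ _).trans ?_) ?_)
  · rw [hn, hn]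
  · refine (norm_sum_le _ _).trans (Finset.sum_le_sum fun m _ => (hn m).le)

namespace IsFlag

/-- At the real point whose `i`-th coordinate is negative the monomial `m` has angle `π m_i`, which
is linear in `m` and hence interpolated from the vertices. -/
theorem phase_real (hv : IsFlag d Z v) (hd : 1 ≤ d) (hZ : IsFullTriangulation d Z) (i : Fin 3)
    {m : Fin 3 → ℕ} (hm : m ∈ exponents d) :
    phase v m (Real.pi * (v 1 i - v 0 i)) (Real.pi * (v 2 i - v 1 i)) =
      (-1) ^ (m i + v 0 i) := by
  rw [phase_eq_exp, neg_one_pow_eq_exp, hv.icoord_cast hd hZ hm, hv.icoord_cast hd hZ hm]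
  have h1 := congrFun (hv.sum_bary hd hZ (toReal m)) i
  have h2 := hv.sum_bary_eq_one hd hZ (sum_toReal hm)
  rw [Fin.sum_univ_three] at h1 h2
  simp only [Pi.add_apply, Pi.smul_apply, smul_eq_mul] at h1
  have e : ∀ m : Fin 3 → ℕ, toReal m i = m i := fun _ => rfl
  rw [e, e, e, e] at h1
  congr 3
  rw [← h1]
  linear_combination -(Real.pi * (v 0 i : ℝ)) * h2

/-- The real equation is a special case of the complex one. -/
theorem signedSum_div (hv : IsFlag d Z v) (hd : 1 ≤ d) (hZ : IsFullTriangulation d Z)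
    (i : Fin 3) {x : Fin 3 → ℝ} (h0 : amp d c x (v 0) ≠ 0) (h1 : amp d c x (v 1) ≠ 0) :
    ((signedSum d c i (v 0) x / amp d c x (v 0) : ℝ) : ℂ) =
      1 + modulus d c v x * Complex.exp ((Real.pi * (v 1 i - v 0 i) : ℝ) * Complex.I) *
        (1 + third d c v x * Complex.exp ((Real.pi * (v 2 i - v 1 i) : ℝ) * Complex.I)) +
        ∑ m ∈ others d v, relAmp d c v m x *
          phase v m (Real.pi * (v 1 i - v 0 i)) (Real.pi * (v 2 i - v 1 i)) := by
  have h0' : (amp d c x (v 0) : ℂ) ≠ 0 := Complex.ofReal_ne_zero.2 h0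
  have h1' : (amp d c x (v 1) : ℂ) ≠ 0 := Complex.ofReal_ne_zero.2 h1
  have e0 : ((-1 : ℂ)) ^ (v 0 i + v 0 i) = 1 := by rw [← two_mul, pow_mul]; norm_num
  have e1 : ((-1 : ℂ)) ^ (v 2 i + v 0 i) = (-1) ^ (v 1 i + v 0 i) * (-1) ^ (v 2 i + v 1 i) := by
    rw [← pow_add, show v 1 i + v 0 i + (v 2 i + v 1 i) = v 2 i + v 0 i + 2 * v 1 i by ring,
      pow_add _ _ (2 * v 1 i), pow_mul]
    norm_num
  rw [signedSum, hv.sum_split, Fin.sum_univ_three, ← neg_one_pow_eq_exp, ← neg_one_pow_eq_exp,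
    modulus, third]
  push_cast
  rw [add_div, Finset.sum_div]
  congr 1
  · rw [e0, e1]
    field_simp
    ring
  · refine Finset.sum_congr rfl fun m hm => ?_
    rw [hv.phase_real hd hZ i (mem_others.1 hm).1, relAmp]
    push_cast
    ring

/-- Near a side `λ₂ ≤ λ₁ / 100`, so the ratio is at most about `1/10`. -/
theorem third_le (hv : IsFlag d Z v) (hd : 1 ≤ d) (hc : ∀ m ∈ exponents d, 0 < c m) {ε l : ℝ}
    (ht : IsTame d c v ε) (hε : ε ≤ 1 / 10000) (hl1 : l ≤ 1 / 100) {x : Fin 3 → ℝ}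
    (hx : OnRay d v (1 / 7) (1 / 12) l x) : third d c v x ≤ 1 / 8 := by
  obtain ⟨h0, h1, -⟩ := ht.bounds hd hc (by linarith) hx (by linarith)
  rw [third, div_le_iff₀ (by linarith)]
  have h2 := abs_le.1 (ht.vertex _ hx.mem hx.nonneg 1)
  have h3 := abs_le.1 (ht.vertex _ hx.mem hx.nonneg 2)
  have h4 := hx.low₁
  have h5 : bary v x 2 ≤ 1 / 100 * bary v x 1 := by
    rw [hx.eq]; nlinarith
  refine (sq_le_sq₀ (amp_nonneg hd hc hx.mem _) (by linarith)).1 ?_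
  rw [mul_pow]
  linarith

/-- On each ray close to a side there is exactly one real point of the curve. -/
theorem exists_real_root (hv : IsFlag d Z v) (hd : 1 ≤ d) (hZ : IsFullTriangulation d Z)
    (hc : ∀ m ∈ exponents d, 0 < c m) {ε l : ℝ} (hf : IsFine d c v ε) (hl0 : 0 ≤ l)
    (hl1 : l ≤ 1 / 100) {i : Fin 3} (hi : Odd (v 0 i + v 1 i)) :
    ∃ μ₀ ∈ Set.Icc (1 / 10 : ℝ) 3,
      modulus d c v (rayPoint v l μ₀) ∈ Set.Icc (17 / 20 : ℝ) (6 / 5) ∧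
      signedSum d c i (v 0) (rayPoint v l μ₀) = 0 ∧
      RootFamily.eqn (rayKappa d c v l) (rayRho d c v l) (Real.pi * (v 2 i - v 1 i))
        (-(modulus d c v (rayPoint v l μ₀) : ℂ)) = 0 ∧
      ∀ μ ∈ Set.Icc (1 / 10 : ℝ) 3,
        modulus d c v (rayPoint v l μ) ∈ Set.Icc (2 / 5 : ℝ) (3 / 2) →
        (μ < μ₀ → 0 < signedSum d c i (v 0) (rayPoint v l μ)) ∧
        (μ₀ < μ → signedSum d c i (v 0) (rayPoint v l μ) < 0) := by
  have hl1' : l ≤ 1 := by linarith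
  have hR := hv.rootFamily hd hZ hc hf hl0 hl1'
  obtain ⟨ε₁, η, C, ht, hε₁0, hη0, hη, hε₁, hε₁ε, hC, hN, hN'⟩ := hf.exists_tame
  have hε₁' : ε₁ ≤ 1 / 1000 := by linarith
  have hκ : ∀ A ∈ Set.Icc (2 / 5 : ℝ) (3 / 2), rayKappa d c v l A ≤ 1 / 8 := fun A _ =>
    hv.third_le hd hc ht hε₁ hl1 (hv.onRay_rayPoint hd hZ hl0 hl1' (par_mem d c v l A))
  -- Oddness gives the second vertex the sign opposite to the first, so real points correspond to
  -- the negative roots `y = -A`.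
  have hexp : Complex.exp ((Real.pi * (v 1 i - v 0 i) : ℝ) * Complex.I) = -1 := by
    rw [← neg_one_pow_eq_exp, add_comm, hi.neg_one_pow]
  have hpos : ∀ μ ∈ Set.Icc (1 / 10 : ℝ) 3, 0 < amp d c (rayPoint v l μ) (v 0) ∧
      0 < amp d c (rayPoint v l μ) (v 1) := fun μ hμ => by
    obtain ⟨h0, h1, -⟩ := ht.bounds hd hc hε₁' (hv.onRay_rayPoint hd hZ hl0 hl1' hμ) hl1'
    exact ⟨by linarith, by linarith⟩
  have heq : ∀ μ ∈ Set.Icc (1 / 10 : ℝ) 3,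
      RootFamily.eqn (rayKappa d c v l) (rayRho d c v l) (Real.pi * (v 2 i - v 1 i))
        (-(modulus d c v (rayPoint v l μ) : ℂ)) =
      ((signedSum d c i (v 0) (rayPoint v l μ) / amp d c (rayPoint v l μ) (v 0) : ℝ) : ℂ) := by
    intro μ hμ
    rw [hv.signedSum_div hd hZ i (hpos μ hμ).1.ne' (hpos μ hμ).2.ne',
      ← hv.eqn_ray hd hZ hc ht hε₁' hl0 hl1' hμ, hexp, mul_neg_one]
  have hre : ∀ μ ∈ Set.Icc (1 / 10 : ℝ) 3,
      (RootFamily.eqn (rayKappa d c v l) (rayRho d c v l) (Real.pi * (v 2 i - v 1 i))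
        (-(modulus d c v (rayPoint v l μ) : ℂ))).re =
      signedSum d c i (v 0) (rayPoint v l μ) / amp d c (rayPoint v l μ) (v 0) := fun μ hμ => by
    rw [heq μ hμ, Complex.ofReal_re]
  have hmono := hv.strictMonoOn_modulus_ray hd hZ hc ht hε₁' hl0 hl1'
  obtain ⟨a, ha, haA⟩ := hv.exists_ray_modulus hd hZ hc ht hε₁' hl0 hl1'
    (A := 17 / 20) (by constructor <;> norm_num)
  obtain ⟨b, hb, hbA⟩ := hv.exists_ray_modulus hd hZ hc ht hε₁' hl0 hl1'
    (A := 6 / 5) (by constructor <;> norm_num)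
  have hab : a < b := by
    rw [← hmono.lt_iff_lt ha hb]
    simp only [haA, hbA]
    norm_num
  have hsub : Set.Icc a b ⊆ Set.Icc (1 / 10 : ℝ) 3 := Set.Icc_subset_Icc ha.1 hb.2
  have hcont : ContinuousOn (fun μ => signedSum d c i (v 0) (rayPoint v l μ)) (Set.Icc a b) :=
    (continuousOn_signedSum hd hc i (v 0)).comp
      ((continuousOn_rayPoint v hl0).mono fun μ hμ => by
        have := (hsub hμ).1
        exact (show (0 : ℝ) ≤ μ by linarith))
      fun μ hμ => (hv.onRay_rayPoint hd hZ hl0 hl1' (hsub hμ)).mem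
  have hsa : 0 < signedSum d c i (v 0) (rayPoint v l a) := by
    have h1 := hR.re_eqn_pos hκ (A := modulus d c v (rayPoint v l a))
      (by rw [haA]; constructor <;> norm_num) (Real.pi * (v 2 i - v 1 i))
    rw [hre a ha] at h1
    exact (div_pos_iff_of_pos_right (hpos a ha).1).1 h1
  have hsb : signedSum d c i (v 0) (rayPoint v l b) < 0 := by
    have h1 := hR.re_eqn_neg hκ (A := modulus d c v (rayPoint v l b))
      (by rw [hbA]; constructor <;> norm_num) (Real.pi * (v 2 i - v 1 i))
    rw [hre b hb] at h1
    exact (div_neg_iff.1 h1).elim (fun h => absurd h.2 (not_lt.2 (hpos b hb).1.le)) fun h => h.1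
  obtain ⟨μ₀, hμ₀, hs₀⟩ := intermediate_value_Icc' hab.le hcont ⟨hsb.le, hsa.le⟩
  simp only at hs₀
  have hμ₀' := hsub hμ₀
  have hA₀ : modulus d c v (rayPoint v l μ₀) ∈ Set.Icc (17 / 20 : ℝ) (6 / 5) := by
    rw [← haA, ← hbA]
    exact ⟨hmono.monotoneOn ha hμ₀' hμ₀.1, hmono.monotoneOn hμ₀' hb hμ₀.2⟩
  have hA₀' : modulus d c v (rayPoint v l μ₀) ∈ Set.Icc (2 / 5 : ℝ) (3 / 2) :=
    ⟨le_trans (by norm_num) hA₀.1, hA₀.2.trans (by norm_num)⟩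
  refine ⟨μ₀, hμ₀', hA₀, hs₀, ?_, fun μ hμ hA => ⟨fun hlt => ?_, fun hlt => ?_⟩⟩
  · rw [heq μ₀ hμ₀', hs₀, zero_div, Complex.ofReal_zero]
  · have h1 := hR.re_eqn_lt hκ hA hA₀' (hmono hμ hμ₀' hlt) (Real.pi * (v 2 i - v 1 i))
    rw [hre μ₀ hμ₀', hre μ hμ, hs₀, zero_div] at h1
    exact (div_pos_iff_of_pos_right (hpos μ hμ).1).1 h1
  · have h1 := hR.re_eqn_lt hκ hA₀' hA (hmono hμ₀' hμ hlt) (Real.pi * (v 2 i - v 1 i))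
    rw [hre μ₀ hμ₀', hre μ hμ, hs₀, zero_div] at h1
    exact (div_neg_iff.1 h1).elim (fun h => absurd h.2 (not_lt.2 (hpos μ hμ).1.le)) fun h => h.1

end IsFlag

variable {d : ℕ} {Z : Geometry.SimplicialComplex ℝ (Fin 3 → ℝ)} {v : Fin 3 → Fin 3 → ℕ}
  {c : (Fin 3 → ℕ) → ℝ}

/-! ### Fibres over the dual graph -/

/-- The point with `λ₁ - λ₀ = s` and `λ₂ = r (1 - |s|)`. -/
def fibPoint (v : Fin 3 → Fin 3 → ℕ) (r s : ℝ) : Fin 3 → ℝ :=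
  ∑ i, (![(1 - s - r * (1 - |s|)) / 2, (1 + s - r * (1 - |s|)) / 2, r * (1 - |s|)] :
    Fin 3 → ℝ) i • toReal (v i)

/-- The triangle `v` with its first two vertices exchanged. -/
def flip (v : Fin 3 → Fin 3 → ℕ) : Fin 3 → Fin 3 → ℕ := v ∘ Equiv.swap 0 1

@[simp] theorem flip_zero (v : Fin 3 → Fin 3 → ℕ) : flip v 0 = v 1 := by simp [flip]

@[simp] theorem flip_one (v : Fin 3 → Fin 3 → ℕ) : flip v 1 = v 0 := by simp [flip]

@[simp] theorem flip_two (v : Fin 3 → Fin 3 → ℕ) : flip v 2 = v 2 := by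
  rw [flip, Function.comp_apply, Equiv.swap_apply_of_ne_of_ne (by decide) (by decide)]

@[simp] theorem flip_flip (v : Fin 3 → Fin 3 → ℕ) : flip (flip v) = v := by
  funext i; simp [flip]

/-- Exchanging the first two vertices reverses the fibre; what is proved for `s ≤ 0` carries over to
`s ≥ 0`. -/
theorem fibPoint_flip (v : Fin 3 → Fin 3 → ℕ) (r s : ℝ) :
    fibPoint (flip v) r (-s) = fibPoint v r s := by
  rw [fibPoint, fibPoint, Fin.sum_univ_three, Fin.sum_univ_three]
  simp only [flip_zero, flip_one, flip_two, abs_neg, Matrix.cons_val_zero, Matrix.cons_val_one,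
    Matrix.cons_val_two, Matrix.head_cons, Matrix.tail_cons, sub_neg_eq_add, ← sub_eq_add_neg]
  rw [add_comm (((1 + s - r * (1 - |s|)) / 2) • toReal (v 1))]

/-- The parameter on the ray through `v 0` of a point of a fibre. -/
def fibParam (r s : ℝ) : ℝ := (1 + s) * (1 - r) / (1 - s - r * (1 + s))

theorem fibParam_den {r s : ℝ} (hr0 : 0 ≤ r) (hr1 : r ≤ 1 / 3) (hs : s ≤ 0) :
    0 < 1 - s - r * (1 + s) := by nlinarith

theorem fibParam_zero {r : ℝ} (hr1 : r ≤ 1 / 3) : fibParam r 0 = 1 := by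
  have : 1 - r ≠ 0 := by linarith
  simp [fibParam, this]

theorem fibParam_lt {r s s' : ℝ} (hr0 : 0 ≤ r) (hr1 : r ≤ 1 / 3) (hs : -1 ≤ s) (h : s < s')
    (hs' : s' ≤ 0) : fibParam r s < fibParam r s' := by
  rw [fibParam, fibParam, div_lt_div_iff₀ (fibParam_den hr0 hr1 (h.le.trans hs'))
    (fibParam_den hr0 hr1 hs')]
  have : 0 < (1 - r) * (s' - s) := mul_pos (by linarith) (by linarith)
  nlinarith

theorem fibParam_le {r s s' : ℝ} (hr0 : 0 ≤ r) (hr1 : r ≤ 1 / 3) (hs : -1 ≤ s) (h : s ≤ s')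
    (hs' : s' ≤ 0) : fibParam r s ≤ fibParam r s' := by
  rcases h.lt_or_eq with h | rfl
  · exact (fibParam_lt hr0 hr1 hs h hs').le
  · exact le_rfl

theorem fibParam_nonneg {r s : ℝ} (hr0 : 0 ≤ r) (hr1 : r ≤ 1 / 3) (hs : -1 ≤ s) (hs' : s ≤ 0) :
    0 ≤ fibParam r s :=
  div_nonneg (mul_nonneg (by linarith) (by linarith)) (fibParam_den hr0 hr1 hs').le

theorem fibParam_le_one {r s : ℝ} (hr0 : 0 ≤ r) (hr1 : r ≤ 1 / 3) (hs : -1 ≤ s) (hs' : s ≤ 0) :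
    fibParam r s ≤ 1 := by
  rw [← fibParam_zero hr1]
  exact fibParam_le hr0 hr1 hs hs' le_rfl

/-- The slope of the rays that make up a fibre. -/
def fibSlope (r : ℝ) : ℝ := 2 * r / (1 - r)

theorem fibSlope_nonneg {r : ℝ} (hr0 : 0 ≤ r) (hr1 : r ≤ 1 / 3) : 0 ≤ fibSlope r :=
  div_nonneg (by linarith) (by linarith)

theorem fibSlope_le_one {r : ℝ} (hr1 : r ≤ 1 / 3) : fibSlope r ≤ 1 := by
  rw [fibSlope, div_le_one (by linarith)]; linarith

namespace IsFlag

theorem flip (hv : IsFlag d Z v) : IsFlag d Z (flip v) := hv.perm _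

theorem bary_flip (hv : IsFlag d Z v) (hd : 1 ≤ d) (hZ : IsFullTriangulation d Z)
    (x : Fin 3 → ℝ) : bary (Fattening.flip v) x 0 = bary v x 1 ∧
      bary (Fattening.flip v) x 1 = bary v x 0 ∧ bary (Fattening.flip v) x 2 = bary v x 2 := by
  have h := hv.bary_perm hd hZ (Equiv.swap 0 1) x
  refine ⟨?_, ?_, ?_⟩
  · rw [Fattening.flip, h]; simp
  · rw [Fattening.flip, h]; simp
  · rw [Fattening.flip, h, Equiv.swap_apply_of_ne_of_ne (by decide) (by decide)]

theorem bary_fibPoint (hv : IsFlag d Z v) (hd : 1 ≤ d) (hZ : IsFullTriangulation d Z)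
    (r s : ℝ) : bary v (fibPoint v r s) 0 = (1 - s - r * (1 - |s|)) / 2 ∧
      bary v (fibPoint v r s) 1 = (1 + s - r * (1 - |s|)) / 2 ∧
      bary v (fibPoint v r s) 2 = r * (1 - |s|) := by
  rw [fibPoint, hv.bary_sum hd hZ]
  simp

theorem fibPoint_bary_nonneg (hv : IsFlag d Z v) (hd : 1 ≤ d) (hZ : IsFullTriangulation d Z)
    {r s : ℝ} (hr0 : 0 ≤ r) (hr1 : r ≤ 1 / 3) (hs : |s| ≤ 1) (i : Fin 3) :
    0 ≤ bary v (fibPoint v r s) i := by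
  obtain ⟨h0, h1, h2⟩ := hv.bary_fibPoint hd hZ r s
  have h3 := le_abs_self s
  have h4 := neg_le_abs s
  have h5 : r * (1 - |s|) ≤ 1 - |s| := by nlinarith
  have h6 : 0 ≤ r * (1 - |s|) := mul_nonneg hr0 (by linarith)
  fin_cases i
  · change 0 ≤ bary v (fibPoint v r s) 0; rw [h0]; linarith
  · change 0 ≤ bary v (fibPoint v r s) 1; rw [h1]; linarith
  · change 0 ≤ bary v (fibPoint v r s) 2; rw [h2]; exact h6

theorem fibPoint_mem (hv : IsFlag d Z v) (hd : 1 ≤ d) (hZ : IsFullTriangulation d Z)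
    {r s : ℝ} (hr0 : 0 ≤ r) (hr1 : r ≤ 1 / 3) (hs : |s| ≤ 1) :
    fibPoint v r s ∈ newtonPolygon d := by
  refine hv.mem_of_bary hd hZ (hv.fibPoint_bary_nonneg hd hZ hr0 hr1 hs) ?_
  obtain ⟨h0, h1, h2⟩ := hv.bary_fibPoint hd hZ r s
  rw [Fin.sum_univ_three, h0, h1, h2]
  ring

/-- A point of a triangle that is not a vertex lies on a fibre. -/
theorem eq_fibPoint (hv : IsFlag d Z v) (hd : 1 ≤ d) (hZ : IsFullTriangulation d Z)
    {x : Fin 3 → ℝ} (hx : x ∈ newtonPolygon d) {r s : ℝ}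
    (hs : s = bary v x 1 - bary v x 0) (hr : bary v x 2 = r * (1 - |s|)) :
    x = fibPoint v r s := by
  obtain ⟨h0, h1, h2⟩ := hv.bary_fibPoint hd hZ r s
  have h3 := hv.sum_bary_eq_one hd hZ hx.2
  rw [Fin.sum_univ_three] at h3
  refine hv.eq_of_bary hd hZ fun i => ?_
  fin_cases i
  · change bary v x 0 = bary v (fibPoint v r s) 0; rw [h0, ← hr]; linarith
  · change bary v x 1 = bary v (fibPoint v r s) 1; rw [h1, ← hr]; linarith
  · change bary v x 2 = bary v (fibPoint v r s) 2; rw [h2, hr]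

/-- For `s ≤ 0` one has `λ₂ = r (1 + s)` and `λ₁ = (1 - r) (1 + s) / 2`, with the constant quotient
`2 r / (1 - r)`: half a fibre lies on a ray through `v 0`. -/
theorem fibPoint_eq_rayPoint (hv : IsFlag d Z v) (hd : 1 ≤ d) (hZ : IsFullTriangulation d Z)
    {r s : ℝ} (hr0 : 0 ≤ r) (hr1 : r ≤ 1 / 3) (hs : -1 ≤ s) (hs' : s ≤ 0) :
    fibPoint v r s = rayPoint v (fibSlope r) (fibParam r s) := by
  have habs : |s| = -s := abs_of_nonpos hs'
  obtain ⟨h0, h1, h2⟩ := hv.bary_fibPoint hd hZ r s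
  refine hv.eq_rayPoint hd hZ (hv.fibPoint_mem hd hZ hr0 hr1 (by rw [habs]; linarith))
    (fibSlope_nonneg hr0 hr1) (fibParam_nonneg hr0 hr1 hs hs') ?_ ?_
  · rw [h0, h1, habs, fibParam]
    rw [sub_neg_eq_add, div_mul_div_cancel₀ (fibParam_den hr0 hr1 hs').ne']
    ring
  · rw [h1, h2, habs, fibSlope]
    have : 1 - r ≠ 0 := by linarith
    field_simp
    ring

theorem exists_fibPoint_of_ray (hv : IsFlag d Z v) (hd : 1 ≤ d) (hZ : IsFullTriangulation d Z)
    {r μ : ℝ} (hr0 : 0 ≤ r) (hr1 : r ≤ 1 / 3) (hμ0 : 0 < μ) (hμ1 : μ ≤ 1) :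
    ∃ s, -1 < s ∧ s ≤ 0 ∧ fibParam r s = μ := by
  have hden : 0 < 1 - r + μ * (1 + r) := by nlinarith
  -- The solution of `fibParam r s = μ` for `s`.
  refine ⟨(μ * (1 - r) - (1 - r)) / (1 - r + μ * (1 + r)), ?_, ?_, ?_⟩
  · rw [lt_div_iff₀ hden]; nlinarith
  · exact div_nonpos_of_nonpos_of_nonneg (by nlinarith) hden.le
  · have h1 : 1 - r ≠ 0 := by linarith
    set D := 1 - r + μ * (1 + r) with hD
    have h2 : 1 + (μ * (1 - r) - (1 - r)) / D = 2 * μ / D := by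
      rw [eq_div_iff hden.ne', add_mul, div_mul_cancel₀ _ hden.ne', hD]; ring
    have h3 : 1 - (μ * (1 - r) - (1 - r)) / D - r * (2 * μ / D) = 2 * (1 - r) / D := by
      rw [eq_div_iff hden.ne', sub_mul, sub_mul, div_mul_cancel₀ _ hden.ne', mul_assoc r,
        div_mul_cancel₀ _ hden.ne', hD]
      ring
    rw [fibParam, h2, h3, div_eq_iff (div_ne_zero (mul_ne_zero two_ne_zero h1) hden.ne')]
    ring

end IsFlag

theorem signedSum_swap {i : Fin 3} {m₀ m₁ : Fin 3 → ℕ} (h : Odd (m₀ i + m₁ i)) (x : Fin 3 → ℝ) :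
    signedSum d c i m₁ x = - signedSum d c i m₀ x := by
  rw [signedSum, signedSum, ← Finset.sum_neg_distrib]
  refine Finset.sum_congr rfl fun m _ => ?_
  have h1 : (-1 : ℝ) ^ (m i + m₁ i) * (-1) ^ (m i + m₀ i) = -1 := by
    rw [← pow_add, show m i + m₁ i + (m i + m₀ i) = 2 * m i + (m₀ i + m₁ i) by ring, pow_add,
      pow_mul, h.neg_one_pow]
    norm_num
  have h2 : (-1 : ℝ) ^ (m i + m₀ i) * (-1) ^ (m i + m₀ i) = 1 := by
    rw [← pow_add, ← two_mul, pow_mul]; norm_num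
  have h3 : (-1 : ℝ) ^ (m i + m₁ i) = -(-1) ^ (m i + m₀ i) := by
    have h4 : (-1 : ℝ) ^ (m i + m₁ i) * ((-1) ^ (m i + m₀ i) * (-1) ^ (m i + m₀ i)) =
      -1 * (-1) ^ (m i + m₀ i) := by rw [← mul_assoc, h1]
    rw [h2] at h4
    linarith
  rw [h3, neg_mul]

/-- The image of the curve as a set of vectors. -/
def imageSet (d : ℕ) (c : (Fin 3 → ℕ) → ℝ) : Set (Fin 3 → ℝ) := Subtype.val '' momentImage d c

theorem mem_imageSet_iff {x : newtonPolygon d} :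
    (x : Fin 3 → ℝ) ∈ imageSet d c ↔ x ∈ momentImage d c :=
  ⟨fun ⟨_, hy, h⟩ => Subtype.ext h ▸ hy, fun h => ⟨x, h, rfl⟩⟩

theorem exists_of_mem_imageSet {x : Fin 3 → ℝ} (h : x ∈ imageSet d c) :
    ∃ hx : x ∈ newtonPolygon d, (⟨x, hx⟩ : newtonPolygon d) ∈ momentImage d c := by
  obtain ⟨y, hy, rfl⟩ := h
  exact ⟨y.2, hy⟩

variable {d : ℕ} {Z : Geometry.SimplicialComplex ℝ (Fin 3 → ℝ)} {v : Fin 3 → Fin 3 → ℕ}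
  {c : (Fin 3 → ℕ) → ℝ}

/-! ### The image of the curve on a fibre -/

namespace IsFlag

theorem sum_others_amp_le (hd : 1 ≤ d) (hc : ∀ m ∈ exponents d, 0 < c m)
    {ε₁ η : ℝ} (ht : IsTame d c v ε₁) (hη0 : 0 ≤ η) (hη : ε₁ ≤ η ^ 2) {x : Fin 3 → ℝ}
    (hx : x ∈ newtonPolygon d) (hx0 : ∀ i, 0 ≤ bary v x i) :
    ∑ m ∈ others d v, amp d c x m ≤ (exponents d).card * η := by
  calc _ ≤ ∑ m ∈ others d v, η := Finset.sum_le_sum fun m hm =>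
        (sq_le_sq₀ (amp_nonneg hd hc hx m) hη0).1 ((ht.other x hx hx0 m hm).trans hη)
    _ = (others d v).card * η := by rw [Finset.sum_const, nsmul_eq_mul]
    _ ≤ _ := mul_le_mul_of_nonneg_right (card_others_le d v) hη0

theorem one_le_card (d : ℕ) : (1 : ℝ) ≤ (exponents d).card := by
  rw [Nat.one_le_cast, Nat.one_le_iff_ne_zero, Finset.card_ne_zero]
  exact ⟨_, single_mem_exponents d 0⟩

/-- A point of the image in the part of the triangle close to `v 0` is not too close to `v 0`. -/
theorem modulus_ge_of_mem (hv : IsFlag d Z v) (hd : 1 ≤ d) (hZ : IsFullTriangulation d Z)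
    (hc : ∀ m ∈ exponents d, 0 < c m) {ε : ℝ} (hf : IsFine d c v ε) {x : Fin 3 → ℝ}
    (hxK : x ∈ imageSet d c) (hx0 : ∀ i, 0 ≤ bary v x i) (h10 : bary v x 1 ≤ bary v x 0)
    (h21 : bary v x 2 ≤ bary v x 1) : 9 / 20 ≤ modulus d c v x := by
  obtain ⟨hx, hxK'⟩ := exists_of_mem_imageSet hxK
  obtain ⟨ε₁, η, C, ht, hε₁0, hη0, hη, hε₁, hε₁ε, hC, hN, hN'⟩ := hf.exists_tame
  have h1 := amp_le_of_mem hd hc hv ⟨x, hx⟩ hxK'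
  have h2 := sum_others_amp_le hd hc ht hη0 hη hx hx0
  have hsum := hv.sum_bary_eq_one hd hZ hx.2
  rw [Fin.sum_univ_three] at hsum
  have e0 := abs_le.1 (ht.vertex x hx hx0 0)
  have e1 := abs_le.1 (ht.vertex x hx hx0 1)
  have e2 := abs_le.1 (ht.vertex x hx hx0 2)
  have hle := hf.le
  have hcard := one_le_card d
  have p1 := amp_nonneg hd hc hx (v 1)
  have p0 := amp_nonneg hd hc hx (v 0)
  -- Here `λ₀ ≥ 1/3`. The first term is at most the sum of the others, and `a_{v 2} ≤ a_{v 1} + 2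
  -- η`, so the modulus is at least `1/2` up to small errors.
  have h0 : 57 / 100 ≤ amp d c x (v 0) := by
    refine (sq_le_sq₀ (by norm_num) p0).1 ?_
    norm_num
    linarith
  have hη1 : η ≤ 1 / 3000 := by nlinarith
  have h3 : amp d c x (v 2) ≤ amp d c x (v 1) + 2 * η := by
    refine (sq_le_sq₀ (amp_nonneg hd hc hx _) (by positivity)).1 ?_
    nlinarith
  simp only at h1
  rw [modulus, le_div_iff₀ (by linarith)]
  linarith

theorem modulus_le_of_le (hv : IsFlag d Z v) (hd : 1 ≤ d) (hZ : IsFullTriangulation d Z)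
    (hc : ∀ m ∈ exponents d, 0 < c m) {ε : ℝ} (ht : IsTame d c v ε) (hε : ε ≤ 1 / 1000)
    {x : Fin 3 → ℝ} (hx : x ∈ newtonPolygon d) (hx0 : ∀ i, 0 ≤ bary v x i)
    (h10 : bary v x 1 ≤ bary v x 0) (h21 : bary v x 2 ≤ bary v x 1) :
    modulus d c v x ≤ 11 / 10 := by
  have hsum := hv.sum_bary_eq_one hd hZ hx.2
  rw [Fin.sum_univ_three] at hsum
  have h1 := (hv.modulus_sq_bounds hd hc ht hε hx hx0 (by linarith)).2
  by_contra! h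
  have h3 : (11 / 10 : ℝ) ^ 2 ≤ modulus d c v x ^ 2 := pow_le_pow_left₀ (by norm_num) h.le 2
  have h4 := mul_le_mul_of_nonneg_right h3 (show 0 ≤ bary v x 0 - ε by linarith)
  linarith

theorem fibPoint_sorted (hv : IsFlag d Z v) (hd : 1 ≤ d) (hZ : IsFullTriangulation d Z)
    {r s : ℝ} (hr1 : r ≤ 1 / 3) (hs : -1 ≤ s) (hs' : s ≤ 0) :
    bary v (fibPoint v r s) 1 ≤ bary v (fibPoint v r s) 0 ∧
      bary v (fibPoint v r s) 2 ≤ bary v (fibPoint v r s) 1 := by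
  obtain ⟨h0, h1, h2⟩ := hv.bary_fibPoint hd hZ r s
  rw [h0, h1, h2, abs_of_nonpos hs']
  constructor
  · linarith
  · nlinarith

/-- The parameter of a point of the image lies in the good range. -/
theorem fibParam_of_modulus (hv : IsFlag d Z v) (hd : 1 ≤ d) (hZ : IsFullTriangulation d Z)
    (hc : ∀ m ∈ exponents d, 0 < c m) {ε : ℝ} (ht : IsTame d c v ε) (hε : ε ≤ 1 / 1000)
    {r s : ℝ} (hr0 : 0 ≤ r) (hr1 : r ≤ 1 / 3) (hs : -1 < s) (hs' : s ≤ 0)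
    (hA : 9 / 20 ≤ modulus d c v (fibPoint v r s)) :
    fibParam r s ∈ Set.Icc (1 / 10 : ℝ) 3 := by
  have habs : |s| ≤ 1 := by rw [abs_of_nonpos hs']; linarith
  have hx := hv.fibPoint_mem hd hZ hr0 hr1 habs
  have hx0 := hv.fibPoint_bary_nonneg hd hZ hr0 hr1 habs
  have hsum := hv.sum_bary_eq_one hd hZ hx.2
  rw [Fin.sum_univ_three] at hsum
  obtain ⟨h10, h21⟩ := hv.fibPoint_sorted hd hZ hr1 hs.le hs'
  have h1 := (hv.modulus_sq_bounds hd hc ht hε hx hx0 (by linarith)).2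
  refine ⟨?_, (fibParam_le_one hr0 hr1 hs.le hs').trans (by norm_num)⟩
  have h3 : (9 / 20 : ℝ) ^ 2 ≤ modulus d c v (fibPoint v r s) ^ 2 :=
    pow_le_pow_left₀ (by norm_num) hA 2
  have h4 := mul_le_mul_of_nonneg_right h3
    (show 0 ≤ bary v (fibPoint v r s) 0 - ε by linarith)
  have h5 : bary v (fibPoint v r s) 1 = fibParam r s * bary v (fibPoint v r s) 0 := by
    obtain ⟨h0, h1, h2⟩ := hv.bary_fibPoint hd hZ r s
    rw [h0, h1, abs_of_nonpos hs', fibParam, sub_neg_eq_add,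
      div_mul_div_cancel₀ (fibParam_den hr0 hr1 hs').ne']
    ring
  by_contra! h6
  nlinarith

theorem mem_iff_moduli (hv : IsFlag d Z v) (hd : 1 ≤ d) (hZ : IsFullTriangulation d Z)
    (hc : ∀ m ∈ exponents d, 0 < c m) {ε : ℝ} (ht : IsTame d c v ε) (hε : ε ≤ 1 / 1000)
    {r s : ℝ} (hr0 : 0 ≤ r) (hr1 : r ≤ 1 / 3) (hs : -1 < s) (hs' : s ≤ 0)
    (hA : 9 / 20 ≤ modulus d c v (fibPoint v r s)) :
    fibPoint v r s ∈ imageSet d c ↔ modulus d c v (rayPoint v (fibSlope r) (fibParam r s)) ∈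
      RootFamily.moduli (rayKappa d c v (fibSlope r)) (rayRho d c v (fibSlope r)) := by
  have habs : |s| ≤ 1 := by rw [abs_of_nonpos hs']; linarith
  have hx := hv.fibPoint_mem hd hZ hr0 hr1 habs
  have hx0 := hv.fibPoint_bary_nonneg hd hZ hr0 hr1 habs
  obtain ⟨h10, h21⟩ := hv.fibPoint_sorted hd hZ hr1 hs.le hs'
  have hA' := hv.modulus_le_of_le hd hZ hc ht hε hx hx0 h10 h21
  have e := hv.fibPoint_eq_rayPoint hd hZ hr0 hr1 hs.le hs'
  rw [← hv.rayPoint_mem_momentImage_iff hd hZ hc ht hε (fibSlope_nonneg hr0 hr1)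
    (fibSlope_le_one hr1) (hv.fibParam_of_modulus hd hZ hc ht hε hr0 hr1 hs hs' hA)
    (by rw [← e]; exact ⟨by linarith, by linarith⟩) ⟨fibPoint v r s, hx⟩ e]
  exact mem_imageSet_iff (x := ⟨fibPoint v r s, hx⟩)

theorem modulus_fib_le (hv : IsFlag d Z v) (hd : 1 ≤ d) (hZ : IsFullTriangulation d Z)
    (hc : ∀ m ∈ exponents d, 0 < c m) {ε : ℝ} (ht : IsTame d c v ε) (hε : ε ≤ 1 / 1000)
    {r s s' : ℝ} (hr0 : 0 ≤ r) (hr1 : r ≤ 1 / 3) (hs : -1 < s) (hss' : s ≤ s') (hs' : s' ≤ 0)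
    (hA : 9 / 20 ≤ modulus d c v (fibPoint v r s)) :
    modulus d c v (fibPoint v r s) ≤ modulus d c v (fibPoint v r s') := by
  have h1 := hv.fibParam_of_modulus hd hZ hc ht hε hr0 hr1 hs (hss'.trans hs') hA
  have h2 := fibParam_le hr0 hr1 hs.le hss' hs'
  have h3 := fibParam_le_one hr0 hr1 (hs.le.trans hss') hs'
  rw [hv.fibPoint_eq_rayPoint hd hZ hr0 hr1 hs.le (hss'.trans hs'),
    hv.fibPoint_eq_rayPoint hd hZ hr0 hr1 (hs.le.trans hss') hs']
  exact (hv.strictMonoOn_modulus_ray hd hZ hc ht hε (fibSlope_nonneg hr0 hr1)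
    (fibSlope_le_one hr1)).monotoneOn h1 ⟨h1.1.trans h2, h3.trans (by norm_num)⟩ h2

/-- On half a fibre the image is order connected. -/
theorem half_fibre (hv : IsFlag d Z v) (hd : 1 ≤ d) (hZ : IsFullTriangulation d Z)
    (hc : ∀ m ∈ exponents d, 0 < c m) {ε : ℝ} (hf : IsFine d c v ε) {r a b s : ℝ}
    (hr0 : 0 ≤ r) (hr1 : r ≤ 1 / 3) (ha : -1 < a) (has : a ≤ s) (hsb : s ≤ b) (hb : b ≤ 0)
    (haK : fibPoint v r a ∈ imageSet d c) (hbK : fibPoint v r b ∈ imageSet d c) :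
    fibPoint v r s ∈ imageSet d c := by
  obtain ⟨ε₁, η, C, ht, hε₁0, hη0, hη, hε₁, hε₁ε, hC, hN, hN'⟩ := hf.exists_tame
  have hε₁' : ε₁ ≤ 1 / 1000 := by linarith
  have ha0 : a ≤ 0 := has.trans (hsb.trans hb)
  have hA : 9 / 20 ≤ modulus d c v (fibPoint v r a) := by
    obtain ⟨h10, h21⟩ := hv.fibPoint_sorted hd hZ hr1 ha.le ha0
    exact hv.modulus_ge_of_mem hd hZ hc hf haK
      (hv.fibPoint_bary_nonneg hd hZ hr0 hr1 (by rw [abs_of_nonpos ha0]; linarith)) h10 h21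
  have hAs := hv.modulus_fib_le hd hZ hc ht hε₁' hr0 hr1 ha has (hsb.trans hb) hA
  have hAb := hv.modulus_fib_le hd hZ hc ht hε₁' hr0 hr1 (ha.trans_le has) hsb hb (hA.trans hAs)
  rw [hv.mem_iff_moduli hd hZ hc ht hε₁' hr0 hr1 (by linarith) (by linarith) hA] at haK
  rw [hv.mem_iff_moduli hd hZ hc ht hε₁' hr0 hr1 (by linarith) hb (by linarith)] at hbK
  rw [hv.mem_iff_moduli hd hZ hc ht hε₁' hr0 hr1 (by linarith) (by linarith) (by linarith)]
  have hR := hv.rootFamily hd hZ hc hf (fibSlope_nonneg hr0 hr1) (fibSlope_le_one hr1)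
  refine hR.ordConnected_moduli.out haK hbK ?_
  rw [hv.fibPoint_eq_rayPoint hd hZ hr0 hr1 ha.le ha0,
    hv.fibPoint_eq_rayPoint hd hZ hr0 hr1 (by linarith) (by linarith)] at hAs
  rw [hv.fibPoint_eq_rayPoint hd hZ hr0 hr1 (by linarith) (hsb.trans hb),
    hv.fibPoint_eq_rayPoint hd hZ hr0 hr1 (by linarith) hb] at hAb
  exact ⟨hAs, hAb⟩

/-- Away from the sides of the triangles, the dual graph lies in the image. -/
theorem fibPoint_zero_mem (hv : IsFlag d Z v) (hd : 1 ≤ d) (hZ : IsFullTriangulation d Z)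
    (hc : ∀ m ∈ exponents d, 0 < c m) {ε : ℝ} (hf : IsFine d c v ε) {r : ℝ}
    (hr : 7 * ε ≤ r) (hr1 : r ≤ 1 / 3) : fibPoint v r 0 ∈ imageSet d c := by
  obtain ⟨ε₁, η, C, ht, hε₁0, hη0, hη, hε₁, hε₁ε, hC, hN, hN'⟩ := hf.exists_tame
  have hε₁' : ε₁ ≤ 1 / 1000 := by linarith
  have hε0 := hf.pos
  have hεle := hf.le
  have hr0 : 0 ≤ r := by linarith
  have hl0 := fibSlope_nonneg hr0 hr1
  have hl1 := fibSlope_le_one hr1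
  have hR := hv.rootFamily hd hZ hc hf hl0 hl1
  have hx := hv.fibPoint_mem hd hZ hr0 hr1 (s := 0) (by simp)
  have hx0 := hv.fibPoint_bary_nonneg hd hZ hr0 hr1 (s := 0) (by simp)
  obtain ⟨b0, b1, b2⟩ := hv.bary_fibPoint hd hZ r 0
  simp only [abs_zero, sub_zero, mul_one, add_zero] at b0 b1 b2
  have hmod0 := modulus_nonneg (v := v) hd hc hx
  -- As `λ₀ = λ₁ ≥ 1/3` on the graph, `A²` differs from one by about `6 ε₁` at most, and `7 ε₁ ≤ ε`.
  have hnear : |modulus d c v (fibPoint v r 0) - 1| ≤ ε := by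
    obtain ⟨h1, h2⟩ := hv.modulus_sq_bounds hd hc ht hε₁' hx hx0 (by rw [b0]; linarith)
    rw [b0, b1] at h1 h2
    set A := modulus d c v (fibPoint v r 0)
    have h3 : 1 / 3 ≤ (1 - r) / 2 := by linarith
    rw [abs_le]
    constructor
    · by_contra! h
      have h4 : A ^ 2 < 1 - ε := by nlinarith
      nlinarith
    · by_contra! h
      have h4 : 1 + ε < A ^ 2 := by nlinarith
      nlinarith
  rw [hv.mem_iff_moduli hd hZ hc ht hε₁' hr0 hr1 (by norm_num) le_rfl
    (by linarith [(abs_le.1 hnear).1]),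
    ← hv.fibPoint_eq_rayPoint hd hZ hr0 hr1 (by norm_num) le_rfl]
  -- It remains to see `κ ≥ 10 ε`. Since `a_{v 1} ≤ 1`, it suffices that `a_{v 2}² ≥ 100 ε²`; and
  -- `a_{v 2}² ≥ r / 6 - ε₁` with `r ≥ 7 ε`, while `100 ε² ≤ ε / 10`.
  refine hR.mem_moduli_of_near_one ?_ hnear
  have hray := hv.onRay_rayPoint hd hZ hl0 hl1 (par_mem d c v (fibSlope r) 1)
  obtain ⟨a0, a1, -⟩ := ht.bounds hd hc hε₁' hray hl1
  rw [rayKappa, third, le_div_iff₀ (by linarith)]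
  have h2 := abs_le.1 (ht.vertex _ hray.mem hray.nonneg 2)
  have h3 := hray.low₁
  have h4 : 2 * r ≤ fibSlope r := by
    rw [fibSlope, le_div_iff₀ (by linarith)]; nlinarith
  have h5 : r / 6 ≤ bary v (rayPoint v (fibSlope r) (par d c v (fibSlope r) 1)) 2 := by
    rw [hray.eq]; nlinarith
  have h6 := amp_le_one hd hc hray.mem (hv.mem 1)
  refine le_trans (mul_le_mul_of_nonneg_left h6 (by positivity)) ?_
  refine (sq_le_sq₀ (by positivity) (amp_nonneg hd hc hray.mem _)).1 ?_
  nlinarith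

end IsFlag

variable {d : ℕ} {Z : Geometry.SimplicialComplex ℝ (Fin 3 → ℝ)} {v : Fin 3 → Fin 3 → ℕ}
  {c : (Fin 3 → ℕ) → ℝ}

/-! ### The real point on a fibre -/

namespace IsFlag

/-- At `s = -1/2` on a fibre near the side `λ₁ / λ₀` is about `1/3`, which lies between `(9/20)²`
and `(3/5)²`. The upper estimate is used in `modulus_le_of_le_neg_half`. -/
theorem modulus_ge_mid (hv : IsFlag d Z v) (hd : 1 ≤ d) (hZ : IsFullTriangulation d Z)
    (hc : ∀ m ∈ exponents d, 0 < c m) {ε : ℝ} (ht : IsTame d c v ε) (hε : ε ≤ 1 / 1000)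
    {r s : ℝ} (hr0 : 0 ≤ r) (hr1 : r ≤ 1 / 300) (hs : -(1 / 2) ≤ s) (hs' : s ≤ 0) :
    9 / 20 ≤ modulus d c v (fibPoint v r s) := by
  have habs : |s| = -s := abs_of_nonpos hs'
  have habs1 : |s| ≤ 1 := by rw [habs]; linarith
  have hr1' : r ≤ 1 / 3 := by linarith
  obtain ⟨h0, h1, h2⟩ := hv.bary_fibPoint hd hZ r s
  rw [habs] at h0 h1
  have hrs : r * (1 - -s) ≤ 1 / 300 := by nlinarith
  have hrs0 : 0 ≤ r * (1 - -s) := mul_nonneg hr0 (by linarith)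
  have h3 := (hv.modulus_sq_bounds hd hc ht hε (hv.fibPoint_mem hd hZ hr0 hr1' habs1)
    (hv.fibPoint_bary_nonneg hd hZ hr0 hr1' habs1) (by rw [h0]; linarith)).1
  by_contra! h
  have h4 : modulus d c v (fibPoint v r s) ^ 2 ≤ (9 / 20 : ℝ) ^ 2 :=
    pow_le_pow_left₀ (modulus_nonneg hd hc (hv.fibPoint_mem hd hZ hr0 hr1' habs1)) h.le 2
  have hε0 : 0 ≤ ε := (abs_nonneg _).trans (ht.vertex _ (hv.fibPoint_mem hd hZ hr0 hr1' habs1)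
    (hv.fibPoint_bary_nonneg hd hZ hr0 hr1' habs1) 0)
  have h5 := mul_le_mul_of_nonneg_right h4
    (show 0 ≤ bary v (fibPoint v r s) 0 + ε by rw [h0]; linarith)
  rw [h0] at h3 h5
  rw [h1] at h3
  linarith

theorem modulus_le_of_le_neg_half (hv : IsFlag d Z v) (hd : 1 ≤ d) (hZ : IsFullTriangulation d Z)
    (hc : ∀ m ∈ exponents d, 0 < c m) {ε : ℝ} (ht : IsTame d c v ε) (hε : ε ≤ 1 / 1000)
    {r s : ℝ} (hr0 : 0 ≤ r) (hr1 : r ≤ 1 / 300) (hs : -1 ≤ s) (hs' : s ≤ -(1 / 2)) :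
    modulus d c v (fibPoint v r s) ≤ 3 / 5 := by
  have habs : |s| = -s := abs_of_nonpos (by linarith)
  have habs1 : |s| ≤ 1 := by rw [habs]; linarith
  have hr1' : r ≤ 1 / 3 := by linarith
  obtain ⟨h0, h1, h2⟩ := hv.bary_fibPoint hd hZ r s
  rw [habs] at h0 h1
  have hrs : r * (1 - -s) ≤ 1 / 300 := by nlinarith
  have hrs0 : 0 ≤ r * (1 - -s) := mul_nonneg hr0 (by linarith)
  have h3 := (hv.modulus_sq_bounds hd hc ht hε (hv.fibPoint_mem hd hZ hr0 hr1' habs1)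
    (hv.fibPoint_bary_nonneg hd hZ hr0 hr1' habs1) (by rw [h0]; linarith)).2
  by_contra! h
  have h4 : (3 / 5 : ℝ) ^ 2 ≤ modulus d c v (fibPoint v r s) ^ 2 :=
    pow_le_pow_left₀ (by norm_num) h.le 2
  have h5 := mul_le_mul_of_nonneg_right h4
    (show 0 ≤ bary v (fibPoint v r s) 0 - ε by rw [h0]; linarith)
  rw [h0] at h3 h5
  rw [h1] at h3
  linarith

theorem fibSlope_le {r : ℝ} (hr1 : r ≤ 1 / 300) : fibSlope r ≤ 1 / 100 := by
  rw [fibSlope, div_le_iff₀ (by linarith)]; linarith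

/-- For `s ≤ -1/2` the modulus is at most `3/5`, and `3/5 · 9/8 < 1 - ε`: the first term could not
be cancelled. -/
theorem fibPoint_gt_of_mem (hv : IsFlag d Z v) (hd : 1 ≤ d) (hZ : IsFullTriangulation d Z)
    (hc : ∀ m ∈ exponents d, 0 < c m) {ε : ℝ} (hf : IsFine d c v ε) {r s : ℝ}
    (hr0 : 0 ≤ r) (hr1 : r ≤ 1 / 300) (hs : -1 < s) (hs' : s ≤ 0)
    (hK : fibPoint v r s ∈ imageSet d c) : -(1 / 2) < s := by
  have hr1' : r ≤ 1 / 3 := by linarith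
  have habs1 : |s| ≤ 1 := by rw [abs_of_nonpos hs']; linarith
  have hR := hv.rootFamily hd hZ hc hf (fibSlope_nonneg hr0 hr1') (fibSlope_le_one hr1')
  obtain ⟨h10, h21⟩ := hv.fibPoint_sorted hd hZ hr1' hs.le hs'
  have hA := hv.modulus_ge_of_mem hd hZ hc hf hK
    (hv.fibPoint_bary_nonneg hd hZ hr0 hr1' habs1) h10 h21
  obtain ⟨ε₁, η, C, ht, hε₁0, hη0, hη, hε₁, hε₁ε, hC, hN, hN'⟩ := hf.exists_tame
  have hε₁' : ε₁ ≤ 1 / 1000 := by linarith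
  by_contra! hlt
  have hA' := hv.modulus_le_of_le_neg_half hd hZ hc ht hε₁' hr0 hr1 hs.le hlt
  rw [hv.mem_iff_moduli hd hZ hc ht hε₁' hr0 hr1' hs hs' hA] at hK
  rw [hv.fibPoint_eq_rayPoint hd hZ hr0 hr1' hs.le hs'] at hA'
  obtain ⟨hA₁, ω, y, hy, h0⟩ := hK
  have hyA := RootFamily.mem_annulus_of hA₁ hy
  have h1 := (abs_le.1 (hR.norm_root hyA h0)).1
  have h2 := hR.norm_factor_le hyA ω
  have h3 : rayKappa d c v (fibSlope r) ‖y‖ ≤ 1 / 8 := hv.third_le hd hc ht hε₁ (fibSlope_le hr1)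
    (hv.onRay_rayPoint hd hZ (fibSlope_nonneg hr0 hr1') (fibSlope_le_one hr1')
      (par_mem d c v (fibSlope r) ‖y‖))
  have h4 : ‖y‖ * ‖1 + rayKappa d c v (fibSlope r) ‖y‖ * Complex.exp (ω * Complex.I)‖ ≤
      3 / 5 * (9 / 8) :=
    mul_le_mul (hy.le.trans hA') (h2.trans (by linarith)) (norm_nonneg _) (by norm_num)
  linarith [hf.le]

/-- The real point on a fibre, if it lies on the side of `v 0`. -/
theorem exists_real_of_nonpos (hv : IsFlag d Z v) (hd : 1 ≤ d) (hZ : IsFullTriangulation d Z)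
    (hc : ∀ m ∈ exponents d, 0 < c m) {ε : ℝ} (hf : IsFine d c v ε)
    (hf' : IsFine d c (Fattening.flip v) ε) {r : ℝ} (hr0 : 0 ≤ r) (hr1 : r ≤ 1 / 300) {i : Fin 3}
    (hi : Odd (v 0 i + v 1 i)) (h0 : signedSum d c i (v 0) (fibPoint v r 0) ≤ 0) :
    ∃ z, |z| < 1 / 2 ∧ signedSum d c i (v 0) (fibPoint v r z) = 0 ∧
      fibPoint v r z ∈ imageSet d c ∧
      (∀ s, |s| ≤ 1 / 2 → (s < z → 0 < signedSum d c i (v 0) (fibPoint v r s)) ∧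
        (z < s → signedSum d c i (v 0) (fibPoint v r s) < 0)) ∧
      ∀ s, |s| < 1 → fibPoint v r s ∈ imageSet d c → ∀ s' ∈ Set.uIcc s z,
        fibPoint v r s' ∈ imageSet d c := by
  have hr1' : r ≤ 1 / 3 := by linarith
  have hl0 := fibSlope_nonneg hr0 hr1'
  have hl1 := fibSlope_le_one hr1'
  have hl := fibSlope_le hr1
  obtain ⟨μ₀, hμ₀, hA₀, hs₀, he₀, hsgn⟩ := hv.exists_real_root hd hZ hc hf hl0 hl hi
  have hi' : Odd (Fattening.flip v 0 i + Fattening.flip v 1 i) := by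
    rw [flip_zero, flip_one, add_comm]; exact hi
  obtain ⟨μ₁, hμ₁, hA₁, hs₁, he₁, hsgn'⟩ := hv.flip.exists_real_root hd hZ hc hf' hl0 hl hi'
  obtain ⟨ε₁, η, C, ht, hε₁0, hη0, hη, hε₁, hε₁ε, hC, hN, hN'⟩ := hf.exists_tame
  obtain ⟨ε₁', η', C', ht', hε₁0', hη0', hη', hε₁', hε₁ε', hC', hN₁, hN₁'⟩ := hf'.exists_tame
  have hε : ε₁ ≤ 1 / 1000 := by linarith
  have hε' : ε₁' ≤ 1 / 1000 := by linarith
  have hgood : ∀ {v : Fin 3 → Fin 3 → ℕ} {e : ℝ}, IsFlag d Z v → IsTame d c v e →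
      e ≤ 1 / 1000 → ∀ s, -(1 / 2) ≤ s → s ≤ 0 → fibParam r s ∈ Set.Icc (1 / 10 : ℝ) 3 ∧
        modulus d c v (rayPoint v (fibSlope r) (fibParam r s)) ∈ Set.Icc (2 / 5 : ℝ) (3 / 2) := by
    intro v e hv ht he s hs hs'
    have h1 := hv.modulus_ge_mid hd hZ hc ht he hr0 hr1 hs hs'
    have habs1 : |s| ≤ 1 := by rw [abs_of_nonpos hs']; linarith
    obtain ⟨h10, h21⟩ := hv.fibPoint_sorted hd hZ (s := s) hr1' (by linarith) hs'
    have h2 := hv.modulus_le_of_le hd hZ hc ht he (hv.fibPoint_mem hd hZ hr0 hr1' habs1)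
      (hv.fibPoint_bary_nonneg hd hZ hr0 hr1' habs1) h10 h21
    have h3 := hv.fibParam_of_modulus hd hZ hc ht he hr0 hr1' (by linarith) hs' h1
    rw [hv.fibPoint_eq_rayPoint hd hZ hr0 hr1' (by linarith) hs'] at h1 h2
    exact ⟨h3, by linarith, by linarith⟩
  have hray0 : fibPoint v r 0 = rayPoint v (fibSlope r) 1 := by
    rw [hv.fibPoint_eq_rayPoint hd hZ hr0 hr1' (by norm_num) le_rfl, fibParam_zero hr1']
  have hflip0 : fibPoint (Fattening.flip v) r 0 = fibPoint v r 0 := by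
    have := fibPoint_flip v r 0
    rwa [neg_zero] at this
  have hray0' : fibPoint v r 0 = rayPoint (Fattening.flip v) (fibSlope r) 1 := by
    rw [← hflip0, hv.flip.fibPoint_eq_rayPoint hd hZ hr0 hr1' (by norm_num) le_rfl,
      fibParam_zero hr1']
  -- The sign of the signed sum in the middle of the fibre puts the real root of the ray through `v
  -- 0` not beyond the middle, and that of the ray through `v 1` not before it.
  have hμ₀1 : μ₀ ≤ 1 := by
    by_contra! h
    obtain ⟨h1, h2⟩ := hgood hv ht hε 0 (by norm_num) le_rfl
    rw [fibParam_zero hr1'] at h1 h2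
    have h3 := (hsgn 1 h1 h2).1 h
    rw [← hray0] at h3
    linarith
  have hμ₁1 : 1 ≤ μ₁ := by
    by_contra! h
    obtain ⟨h1, h2⟩ := hgood hv.flip ht' hε' 0 (by norm_num) le_rfl
    rw [fibParam_zero hr1'] at h1 h2
    have h3 := (hsgn' 1 h1 h2).2 h
    rw [← hray0', flip_zero, signedSum_swap hi] at h3
    linarith
  obtain ⟨z, hz1, hz0, hzμ⟩ := hv.exists_fibPoint_of_ray hd hZ hr0 hr1'
    (show 0 < μ₀ by linarith [hμ₀.1]) hμ₀1
  have hzray : fibPoint v r z = rayPoint v (fibSlope r) μ₀ := by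
    rw [hv.fibPoint_eq_rayPoint hd hZ hr0 hr1' hz1.le hz0, hzμ]
  have hz2 : -(1 / 2) < z := by
    by_contra! h
    have := hv.modulus_le_of_le_neg_half hd hZ hc ht hε hr0 hr1 hz1.le h
    rw [hzray] at this
    linarith [hA₀.1]
  have hzK : fibPoint v r z ∈ imageSet d c := by
    rw [hv.mem_iff_moduli hd hZ hc ht hε hr0 hr1' hz1 hz0 (by rw [hzray]; linarith [hA₀.1]), hzμ]
    refine ⟨⟨by linarith [hA₀.1], by linarith [hA₀.2]⟩, _, _, ?_, he₀⟩
    rw [norm_neg, Complex.norm_real, Real.norm_eq_abs, abs_of_nonneg (by linarith [hA₀.1])]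
  refine ⟨z, by rw [abs_of_nonpos hz0]; linarith, by rw [hzray]; exact hs₀, hzK, ?_, ?_⟩
  · intro s hs
    obtain ⟨hs1, hs2⟩ := abs_le.1 hs
    rcases le_or_gt s 0 with hs0 | hs0
    · obtain ⟨h1, h2⟩ := hgood hv ht hε s hs1 hs0
      have h3 := hsgn _ h1 h2
      rw [← hv.fibPoint_eq_rayPoint hd hZ hr0 hr1' (by linarith) hs0, ← hzμ] at h3
      exact ⟨fun h => h3.1 (fibParam_lt hr0 hr1' (by linarith) h hz0),
        fun h => h3.2 (fibParam_lt hr0 hr1' hz1.le h hs0)⟩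
    · refine ⟨fun h => absurd h (by linarith), fun _ => ?_⟩
      obtain ⟨h1, h2⟩ := hgood hv.flip ht' hε' (-s) (by linarith) (by linarith)
      have h3 := (hsgn' _ h1 h2).1 (lt_of_lt_of_le (by
        rw [← fibParam_zero hr1']
        exact fibParam_lt hr0 hr1' (by linarith) (by linarith) le_rfl) hμ₁1)
      rw [← hv.flip.fibPoint_eq_rayPoint hd hZ hr0 hr1' (by linarith) (by linarith),
        fibPoint_flip, flip_zero, signedSum_swap hi] at h3
      linarith
  · intro s hs hsK s' hs'
    obtain ⟨hs1, hs2⟩ := abs_lt.1 hs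
    have hleft : ∀ s, -1 < s → s ≤ 0 → fibPoint v r s ∈ imageSet d c → ∀ s' ∈ Set.uIcc s z,
        fibPoint v r s' ∈ imageSet d c := by
      intro s hs1 hs0 hsK s' hs'
      rcases le_total s z with h | h
      · rw [Set.uIcc_of_le h] at hs'
        exact hv.half_fibre hd hZ hc hf hr0 hr1' hs1 hs'.1 hs'.2 hz0 hsK hzK
      · rw [Set.uIcc_of_ge h] at hs'
        exact hv.half_fibre hd hZ hc hf hr0 hr1' hz1 hs'.1 hs'.2 hs0 hzK hsK
    rcases le_or_gt s 0 with hs0 | hs0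
    · exact hleft s hs1 hs0 hsK s' hs'
    · have hsK' : fibPoint (Fattening.flip v) r (-s) ∈ imageSet d c := by rwa [fibPoint_flip]
      have hn1 : -1 < -s := by linarith
      have hn0 : -s ≤ 0 := by linarith
      -- On the ray through `v 1` the middle of the fibre lies between the given point of the image
      -- and the real root `μ₁`. Order connectedness of the moduli puts it in the image, so the two
      -- halves can be joined there.
      have h0K : fibPoint v r 0 ∈ imageSet d c := by
        obtain ⟨h10, h21⟩ := hv.flip.fibPoint_sorted hd hZ hr1' hn1.le hn0
        have hA := hv.flip.modulus_ge_of_mem hd hZ hc hf' hsK'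
          (hv.flip.fibPoint_bary_nonneg hd hZ hr0 hr1' (by rw [abs_neg]; exact hs.le)) h10 h21
        have hA' := hv.flip.modulus_fib_le hd hZ hc ht' hε' hr0 hr1' hn1 hn0 le_rfl hA
        have hmem := (hv.flip.mem_iff_moduli hd hZ hc ht' hε' hr0 hr1' hn1 hn0 hA).1 hsK'
        rw [← hflip0, hv.flip.mem_iff_moduli hd hZ hc ht' hε' hr0 hr1' (by norm_num) le_rfl
          (hA.trans hA')]
        have hR := hv.flip.rootFamily hd hZ hc hf' hl0 hl1
        have hmem1 : modulus d c (Fattening.flip v) (rayPoint (Fattening.flip v) (fibSlope r) μ₁) ∈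
            RootFamily.moduli (rayKappa d c (Fattening.flip v) (fibSlope r))
              (rayRho d c (Fattening.flip v) (fibSlope r)) := by
          refine ⟨⟨by linarith [hA₁.1], by linarith [hA₁.2]⟩, _, _, ?_, he₁⟩
          rw [norm_neg, Complex.norm_real, Real.norm_eq_abs, abs_of_nonneg (by linarith [hA₁.1])]
        refine hR.ordConnected_moduli.out hmem hmem1 ⟨?_, ?_⟩
        · rw [← hv.flip.fibPoint_eq_rayPoint hd hZ hr0 hr1' hn1.le hn0,
            ← hv.flip.fibPoint_eq_rayPoint hd hZ hr0 hr1' (by norm_num) le_rfl]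
          exact hA'
        · rw [fibParam_zero hr1']
          exact (hv.flip.strictMonoOn_modulus_ray hd hZ hc ht' hε' hl0 hl1).monotoneOn
            (by constructor <;> norm_num) hμ₁ hμ₁1
      rw [Set.uIcc_of_ge (hz0.trans hs0.le)] at hs'
      rcases le_or_gt s' 0 with h | h
      · exact hleft 0 (by norm_num) le_rfl h0K s' (by
          rw [Set.uIcc_of_ge hz0]; exact ⟨hs'.1, h⟩)
      · rw [← fibPoint_flip]
        refine hv.flip.half_fibre hd hZ hc hf' hr0 hr1' hn1 (neg_le_neg hs'.2)
          (show -s' ≤ 0 by linarith) le_rfl hsK' ?_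
        rw [hflip0]; exact h0K

/-- The real point on a fibre close to a side. -/
theorem exists_real (hv : IsFlag d Z v) (hd : 1 ≤ d) (hZ : IsFullTriangulation d Z)
    (hc : ∀ m ∈ exponents d, 0 < c m) {ε : ℝ} (hf : IsFine d c v ε)
    (hf' : IsFine d c (Fattening.flip v) ε) {r : ℝ} (hr0 : 0 ≤ r) (hr1 : r ≤ 1 / 300) {i : Fin 3}
    (hi : Odd (v 0 i + v 1 i)) :
    ∃ z, |z| < 1 / 2 ∧ signedSum d c i (v 0) (fibPoint v r z) = 0 ∧
      fibPoint v r z ∈ imageSet d c ∧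
      (∀ s, |s| ≤ 1 / 2 → (s < z → 0 < signedSum d c i (v 0) (fibPoint v r s)) ∧
        (z < s → signedSum d c i (v 0) (fibPoint v r s) < 0)) ∧
      ∀ s, |s| < 1 → fibPoint v r s ∈ imageSet d c → ∀ s' ∈ Set.uIcc s z,
        fibPoint v r s' ∈ imageSet d c := by
  rcases le_or_gt (signedSum d c i (v 0) (fibPoint v r 0)) 0 with h0 | h0
  · exact hv.exists_real_of_nonpos hd hZ hc hf hf' hr0 hr1 hi h0
  · have hflip0 : fibPoint (Fattening.flip v) r 0 = fibPoint v r 0 := by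
      have := fibPoint_flip v r 0
      rwa [neg_zero] at this
    have hf'' : IsFine d c (Fattening.flip (Fattening.flip v)) ε := by rwa [flip_flip]
    obtain ⟨z, hz, hz0, hzK, hsgn, hstar⟩ := hv.flip.exists_real_of_nonpos hd hZ hc hf' hf'' hr0 hr1
      (i := i) (by rw [flip_zero, flip_one, add_comm]; exact hi)
      (by rw [flip_zero, hflip0, signedSum_swap hi]; linarith)
    have e : ∀ s, fibPoint v r s = fibPoint (Fattening.flip v) r (-s) :=
      fun s => (fibPoint_flip v r s).symm
    have e' : ∀ x, signedSum d c i (v 0) x = - signedSum d c i (v 1) x := fun x => by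
      rw [signedSum_swap hi, neg_neg]
    rw [flip_zero] at hz0 hsgn
    refine ⟨-z, by rwa [abs_neg], by rw [e, e', neg_neg, hz0, neg_zero],
      by rwa [e, neg_neg], fun s hs => ?_, fun s hs hsK s' hs' => ?_⟩
    · have h1 := hsgn (-s) (by rwa [abs_neg])
      rw [e, e']
      exact ⟨fun h => neg_pos.2 (h1.2 (by linarith)), fun h => neg_lt_zero.2 (h1.1 (by linarith))⟩
    · rw [e] at hsK ⊢
      refine hstar (-s) (by rwa [abs_neg]) hsK (-s') ?_
      rw [Set.mem_uIcc] at hs' ⊢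
      rcases hs' with h | h
      · right; constructor <;> linarith
      · left; constructor <;> linarith

/-- The real point is close to the dual graph. -/
theorem abs_real_le (hv : IsFlag d Z v) (hd : 1 ≤ d) (hZ : IsFullTriangulation d Z)
    (hc : ∀ m ∈ exponents d, 0 < c m) {ε : ℝ} (hf : IsFine d c v ε) {r z z₀ : ℝ}
    (hr0 : 0 ≤ r) (hr1 : r ≤ 1 / 300) {i : Fin 3}
    (hi : Odd (v 0 i + v 1 i)) (hz : |z| ≤ 1 / 2)
    (h0 : signedSum d c i (v 0) (fibPoint v r z) = 0) (hz₀ : 0 ≤ z₀)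
    (h1 : r + ε ≤ (z₀ / 8) ^ 2) (h2 : ε ≤ z₀ / 8) : |z| ≤ z₀ := by
  have hr1' : r ≤ 1 / 3 := by linarith
  obtain ⟨ε₁, η, C, ht, hε₁0, hη0, hη, hε₁, hε₁ε, hC, hN, hN'⟩ := hf.exists_tame
  have hx := hv.fibPoint_mem hd hZ hr0 hr1' (s := z) (by linarith)
  have hx0 := hv.fibPoint_bary_nonneg hd hZ hr0 hr1' (s := z) (by linarith)
  obtain ⟨b0, b1, b2⟩ := hv.bary_fibPoint hd hZ r z
  set x := fibPoint v r z
  have hz0 := abs_nonneg z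
  have e0 := ht.vertex x hx hx0 0
  have e1 := ht.vertex x hx hx0 1
  have e2 := abs_le.1 (ht.vertex x hx hx0 2)
  have hε0 := hf.pos
  have ha2 : amp d c x (v 2) ≤ z₀ / 8 := by
    refine (sq_le_sq₀ (amp_nonneg hd hc hx _) (by linarith)).1 ?_
    rw [b2] at e2
    have : r * (1 - |z|) ≤ r := by nlinarith
    linarith
  have hothers : ∑ m ∈ others d v, amp d c x m ≤ ε := by
    refine (sum_others_amp_le hd hc ht hη0 hη hx hx0).trans ?_
    have : 0 ≤ ((exponents d).card : ℝ) * η := by positivity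
    linarith
  -- In the signed sum the first two vertices have opposite signs, so its vanishing bounds the
  -- difference of their amplitudes.
  have hdiff : |amp d c x (v 1) - amp d c x (v 0)| ≤ amp d c x (v 2) +
      ∑ m ∈ others d v, amp d c x m := by
    rw [signedSum, hv.sum_split, Fin.sum_univ_three] at h0
    have q0 : (-1 : ℝ) ^ (v 0 i + v 0 i) = 1 := by rw [← two_mul, pow_mul]; norm_num
    have q1 : (-1 : ℝ) ^ (v 1 i + v 0 i) = -1 := by rw [add_comm, hi.neg_one_pow]
    rw [q0, q1] at h0
    have h3 : amp d c x (v 1) - amp d c x (v 0) = (-1) ^ (v 2 i + v 0 i) * amp d c x (v 2) +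
        ∑ m ∈ others d v, (-1) ^ (m i + v 0 i) * amp d c x m := by linarith
    have h4 : ∀ (n : ℕ) m, |(-1) ^ n * amp d c x m| = amp d c x m := fun n m => by
      rw [abs_mul, abs_pow, abs_neg, abs_one, one_pow, one_mul,
        abs_of_nonneg (amp_nonneg hd hc hx m)]
    rw [h3]
    refine (abs_add_le _ _).trans (add_le_add (h4 _ _).le ?_)
    exact (Finset.abs_sum_le_sum_abs _ _).trans (Finset.sum_le_sum fun m _ => (h4 _ _).le)
  have p0 := amp_nonneg hd hc hx (v 0)
  have p1 := amp_nonneg hd hc hx (v 1)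
  have l0 := amp_le_one hd hc hx (hv.mem 0)
  have l1 := amp_le_one hd hc hx (hv.mem 1)
  have h5 : |amp d c x (v 1) ^ 2 - amp d c x (v 0) ^ 2| ≤ 2 * (z₀ / 8 + ε) := by
    have : amp d c x (v 1) ^ 2 - amp d c x (v 0) ^ 2 = (amp d c x (v 1) + amp d c x (v 0)) *
        (amp d c x (v 1) - amp d c x (v 0)) := by ring
    rw [this, abs_mul, abs_of_nonneg (by linarith)]
    exact mul_le_mul (by linarith) (by linarith) (abs_nonneg _) (by norm_num)
  have h6 : z = bary v x 1 - bary v x 0 := by rw [b0, b1]; ring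
  have e0' := abs_le.1 e0
  have e1' := abs_le.1 e1
  have h5' := abs_le.1 h5
  rw [h6, abs_le]
  constructor <;> linarith

end IsFlag

variable {d : ℕ} {Z : Geometry.SimplicialComplex ℝ (Fin 3 → ℝ)} {v v' : Fin 3 → Fin 3 → ℕ}
  {c : (Fin 3 → ℕ) → ℝ}

/-! ### The position of the real point -/

/-- A coordinate in which the first two vertices differ by an odd number. -/
def oddIndex (v : Fin 3 → Fin 3 → ℕ) : Fin 3 :=
  if Odd (v 0 0 + v 1 0) then 0 else if Odd (v 0 1 + v 1 1) then 1 else 2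

theorem oddIndex_congr (h0 : v 0 = v' 0) (h1 : v 1 = v' 1) : oddIndex v = oddIndex v' := by
  rw [oddIndex, oddIndex, h0, h1]

theorem oddIndex_flip (v : Fin 3 → Fin 3 → ℕ) : oddIndex (flip v) = oddIndex v := by
  simp only [oddIndex, flip_zero, flip_one, add_comm]

/-- If the two vertices agreed modulo two, their midpoint would be a lattice point of the triangle
that is not a vertex. -/
theorem IsFlag.odd_oddIndex (hv : IsFlag d Z v) (hd : 1 ≤ d) (hZ : IsFullTriangulation d Z) :
    Odd (v 0 (oddIndex v) + v 1 (oddIndex v)) := by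
  unfold oddIndex
  split_ifs with h0 h1
  · exact h0
  · exact h1
  by_contra h2
  have heven : ∀ i, Even (v 0 i + v 1 i) := by
    intro i
    rw [← Nat.not_odd_iff_even]
    fin_cases i
    · exact h0
    · exact h1
    · exact h2
  choose m hm using heven
  have hreal : toReal m = ∑ i, (![1 / 2, 1 / 2, 0] : Fin 3 → ℝ) i • toReal (v i) := by
    funext j
    have h3 : (v 0 j : ℝ) + v 1 j = m j + m j := by exact_mod_cast hm j
    rw [Fin.sum_univ_three]
    simp only [toReal, Pi.add_apply, Pi.smul_apply, smul_eq_mul, Matrix.cons_val_zero,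
      Matrix.cons_val_one, Matrix.cons_val_two, Matrix.head_cons, Matrix.tail_cons]
    change (m j : ℝ) = 1 / 2 * v 0 j + 1 / 2 * v 1 j + 0 * v 2 j
    linarith
  have hb : bary v (toReal m) = ![1 / 2, 1 / 2, 0] := by rw [hreal, hv.bary_sum hd hZ]
  have hmem : m ∈ exponents d := by
    rw [mem_exponents]
    have h3 := mem_exponents.1 (hv.mem 0)
    have h4 := mem_exponents.1 (hv.mem 1)
    rw [Fin.sum_univ_three] at h3 h4 ⊢
    have := hm 0
    have := hm 1
    have := hm 2
    omega
  obtain ⟨i, hi⟩ := hv.eq_vertex hd hZ hmem fun i => by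
    rw [hb]; fin_cases i <;> simp
  rw [hi, hv.bary_vertex hd hZ] at hb
  have h5 := congrFun hb 0
  have h6 := congrFun hb 1
  fin_cases i
  · norm_num [Pi.single_apply] at h5
  · norm_num [Pi.single_apply] at h5
  · norm_num [Pi.single_apply] at h5

theorem fibPoint_zero_congr (h0 : v 0 = v' 0) (h1 : v 1 = v' 1) (s : ℝ) :
    fibPoint v 0 s = fibPoint v' 0 s := by
  rw [fibPoint, fibPoint, Fin.sum_univ_three, Fin.sum_univ_three, h0, h1]
  simp

open Classical in
/-- A choice of a number with a given property. -/
def someReal (p : ℝ → Prop) : ℝ := if h : ∃ z, p z then h.choose else 0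

/-- The position on a fibre of the real point of the curve. -/
def realPt (d : ℕ) (c : (Fin 3 → ℕ) → ℝ) (v : Fin 3 → Fin 3 → ℕ) (r : ℝ) : ℝ :=
  someReal fun z => |z| < 1 / 2 ∧ signedSum d c (oddIndex v) (v 0) (fibPoint v r z) = 0

/-- On the side itself the real point depends only on the edge and not on the third vertex. This
lets the constructions in adjacent triangles fit together. -/
theorem realPt_congr (h0 : v 0 = v' 0) (h1 : v 1 = v' 1) : realPt d c v 0 = realPt d c v' 0 := by
  have : (fun z => |z| < 1 / 2 ∧ signedSum d c (oddIndex v) (v 0) (fibPoint v 0 z) = 0) =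
      fun z => |z| < 1 / 2 ∧ signedSum d c (oddIndex v') (v' 0) (fibPoint v' 0 z) = 0 := by
    funext z
    rw [oddIndex_congr h0 h1, h0, fibPoint_zero_congr h0 h1]
  unfold realPt
  rw [this]

namespace IsFlag

theorem realPt_spec (hv : IsFlag d Z v) (hd : 1 ≤ d) (hZ : IsFullTriangulation d Z)
    (hc : ∀ m ∈ exponents d, 0 < c m) {ε : ℝ} (hf : IsFine d c v ε)
    (hf' : IsFine d c (Fattening.flip v) ε) {r : ℝ} (hr0 : 0 ≤ r) (hr1 : r ≤ 1 / 300) :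
    |realPt d c v r| < 1 / 2 ∧
      signedSum d c (oddIndex v) (v 0) (fibPoint v r (realPt d c v r)) = 0 ∧
      fibPoint v r (realPt d c v r) ∈ imageSet d c ∧
      (∀ s, |s| ≤ 1 / 2 →
        (s < realPt d c v r → 0 < signedSum d c (oddIndex v) (v 0) (fibPoint v r s)) ∧
        (realPt d c v r < s → signedSum d c (oddIndex v) (v 0) (fibPoint v r s) < 0)) ∧
      ∀ s, |s| < 1 → fibPoint v r s ∈ imageSet d c → ∀ s' ∈ Set.uIcc s (realPt d c v r),
        fibPoint v r s' ∈ imageSet d c := by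
  obtain ⟨z, hz, hz0, hzK, hsgn, hstar⟩ := hv.exists_real hd hZ hc hf hf' hr0 hr1
    (hv.odd_oddIndex hd hZ)
  have hex : ∃ z, |z| < 1 / 2 ∧ signedSum d c (oddIndex v) (v 0) (fibPoint v r z) = 0 :=
    ⟨z, hz, hz0⟩
  have heq : realPt d c v r = z := by
    rw [realPt, someReal, dif_pos hex]
    obtain ⟨h1, h2⟩ := hex.choose_spec
    have h3 := hsgn _ h1.le
    rcases lt_trichotomy hex.choose z with h | h | h
    · exact absurd h2 (h3.1 h).ne'
    · exact h
    · exact absurd h2 (h3.2 h).ne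
  rw [heq]
  exact ⟨hz, hz0, hzK, hsgn, hstar⟩

theorem realPt_unique (hv : IsFlag d Z v) (hd : 1 ≤ d) (hZ : IsFullTriangulation d Z)
    (hc : ∀ m ∈ exponents d, 0 < c m) {ε : ℝ} (hf : IsFine d c v ε)
    (hf' : IsFine d c (Fattening.flip v) ε) {r : ℝ} (hr0 : 0 ≤ r) (hr1 : r ≤ 1 / 300) {z : ℝ}
    (hz : |z| ≤ 1 / 2) (h0 : signedSum d c (oddIndex v) (v 0) (fibPoint v r z) = 0) :
    z = realPt d c v r := by
  obtain ⟨-, -, -, hsgn, -⟩ := hv.realPt_spec hd hZ hc hf hf' hr0 hr1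
  rcases lt_trichotomy z (realPt d c v r) with h | h | h
  · exact absurd h0 ((hsgn z hz).1 h).ne'
  · exact h
  · exact absurd h0 ((hsgn z hz).2 h).ne

theorem realPt_flip (hv : IsFlag d Z v) (hd : 1 ≤ d) (hZ : IsFullTriangulation d Z)
    (hc : ∀ m ∈ exponents d, 0 < c m) {ε : ℝ} (hf : IsFine d c v ε)
    (hf' : IsFine d c (Fattening.flip v) ε) {r : ℝ} (hr0 : 0 ≤ r) (hr1 : r ≤ 1 / 300) :
    realPt d c (Fattening.flip v) r = - realPt d c v r := by
  obtain ⟨h1, h2, -⟩ := hv.realPt_spec hd hZ hc hf hf' hr0 hr1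
  refine (hv.flip.realPt_unique hd hZ hc hf' (by rwa [flip_flip]) hr0 hr1
    (by rw [abs_neg]; exact h1.le) ?_).symm
  rw [fibPoint_flip, flip_zero, oddIndex_flip, signedSum_swap (hv.odd_oddIndex hd hZ), h2, neg_zero]

/-- The signed sum changes sign exactly at this point. Its strict signs at fixed positions on either
side persist for nearby `r` and trap the zero. -/
theorem continuousOn_realPt (hv : IsFlag d Z v) (hd : 1 ≤ d) (hZ : IsFullTriangulation d Z)
    (hc : ∀ m ∈ exponents d, 0 < c m) {ε : ℝ} (hf : IsFine d c v ε)
    (hf' : IsFine d c (Fattening.flip v) ε) :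
    ContinuousOn (realPt d c v) (Set.Icc 0 (1 / 300)) := by
  have hcont : ∀ s, |s| ≤ 1 / 2 →
      ContinuousOn (fun r => signedSum d c (oddIndex v) (v 0) (fibPoint v r s))
        (Set.Icc 0 (1 / 300)) := by
    intro s hs
    refine (continuousOn_signedSum hd hc _ _).comp ?_ fun r hr =>
      hv.fibPoint_mem hd hZ hr.1 (hr.2.trans (by norm_num)) (by linarith)
    unfold fibPoint
    refine continuousOn_finsetSum _ fun i _ => ?_
    refine ContinuousOn.smul (f := fun r : ℝ => (![(1 - s - r * (1 - |s|)) / 2,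
      (1 + s - r * (1 - |s|)) / 2, r * (1 - |s|)] : Fin 3 → ℝ) i) (g := fun _ => toReal (v i))
      ?_ continuousOn_const
    fin_cases i
    · change ContinuousOn (fun r : ℝ => (1 - s - r * (1 - |s|)) / 2) _
      fun_prop
    · change ContinuousOn (fun r : ℝ => (1 + s - r * (1 - |s|)) / 2) _
      fun_prop
    · change ContinuousOn (fun r : ℝ => r * (1 - |s|)) _
      fun_prop
  intro r hr
  obtain ⟨h1, h2, -, h3, -⟩ := hv.realPt_spec hd hZ hc hf hf' hr.1 hr.2
  obtain ⟨h1a, h1b⟩ := abs_lt.1 h1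
  refine tendsto_order.2 ⟨fun a ha => ?_, fun b hb => ?_⟩
  · obtain ⟨s, hs1, hs2⟩ := exists_between (max_lt ha h1a)
    have hs3 : |s| ≤ 1 / 2 := abs_le.2 ⟨((le_max_right _ _).trans_lt hs1).le, by linarith⟩
    have h4 := (hcont s hs3 r hr).eventually (lt_mem_nhds ((h3 s hs3).1 hs2))
    filter_upwards [h4, self_mem_nhdsWithin] with r' hr' hmem
    obtain ⟨-, h5, -, h6, -⟩ := hv.realPt_spec hd hZ hc hf hf' hmem.1 hmem.2
    refine (le_max_left _ _).trans_lt (hs1.trans ?_)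
    by_contra! h7
    rcases h7.lt_or_eq with h | h
    · exact absurd ((h6 s hs3).2 h) (not_lt.2 hr'.le)
    · rw [h] at h5; exact hr'.ne' h5
  · obtain ⟨s, hs1, hs2⟩ := exists_between (lt_min hb h1b)
    have hs3 : |s| ≤ 1 / 2 := abs_le.2 ⟨by linarith, (hs2.trans_le (min_le_right _ _)).le⟩
    have h4 := (hcont s hs3 r hr).eventually (gt_mem_nhds ((h3 s hs3).2 hs1))
    filter_upwards [h4, self_mem_nhdsWithin] with r' hr' hmem
    obtain ⟨-, h5, -, h6, -⟩ := hv.realPt_spec hd hZ hc hf hf' hmem.1 hmem.2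
    refine lt_of_lt_of_le ?_ (min_le_left b (1 / 2))
    refine lt_trans ?_ hs2
    by_contra! h7
    rcases h7.lt_or_eq with h | h
    · exact absurd ((h6 s hs3).1 h) (not_lt.2 hr'.le)
    · rw [← h] at h5; exact hr'.ne h5

/-- On a boundary edge, only the real point lies in the image. -/
theorem signedSum_eq_zero_of_boundary (hv : IsFlag d Z v) (hd : 1 ≤ d)
    (hZ : IsFullTriangulation d Z)
    (hc : ∀ m ∈ exponents d, 0 < c m) {ε : ℝ} (hf : IsFine d c v ε) {s : ℝ} (hs : -1 < s)
    (hs' : s ≤ 0) (hK : fibPoint v 0 s ∈ imageSet d c)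
    (h2 : amp d c (fibPoint v 0 s) (v 2) = 0)
    (hoth : ∀ m ∈ others d v, icoord v m 2 ≠ 0 → amp d c (fibPoint v 0 s) m = 0) {i : Fin 3}
    (hi : Odd (v 0 i + v 1 i)) : signedSum d c i (v 0) (fibPoint v 0 s) = 0 := by
  have hr1' : (0 : ℝ) ≤ 1 / 3 := by norm_num
  have habs1 : |s| ≤ 1 := by rw [abs_of_nonpos hs']; linarith
  obtain ⟨h10, h21⟩ := hv.fibPoint_sorted hd hZ hr1' hs.le hs'
  have hx := hv.fibPoint_mem hd hZ le_rfl hr1' habs1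
  have hx0 := hv.fibPoint_bary_nonneg hd hZ le_rfl hr1' habs1
  have hA := hv.modulus_ge_of_mem hd hZ hc hf hK hx0 h10 h21
  have hl : fibSlope 0 = 0 := by simp [fibSlope]
  have hl1 : (0 : ℝ) ≤ 1 / 100 := by norm_num
  have hR := hv.rootFamily hd hZ hc hf le_rfl zero_le_one
  obtain ⟨μ₀, hμ₀, hA₀, hs₀, he₀, -⟩ := hv.exists_real_root hd hZ hc hf le_rfl hl1 hi
  obtain ⟨ε₁, η, C, ht, hε₁0, hη0, hη, hε₁, hε₁ε, hC, hN, hN'⟩ := hf.exists_tame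
  have hε : ε₁ ≤ 1 / 1000 := by linarith
  have hA' := hv.modulus_le_of_le hd hZ hc ht hε hx hx0 h10 h21
  have hμ := hv.fibParam_of_modulus hd hZ hc ht hε le_rfl hr1' hs hs' hA
  have e := hv.fibPoint_eq_rayPoint hd hZ le_rfl hr1' hs.le hs'
  rw [hl] at e
  set μ := fibParam 0 s
  obtain ⟨hx', hK'⟩ := exists_of_mem_imageSet hK
  obtain ⟨p0, p1, -⟩ := ht.bounds hd hc hε (hv.onRay_rayPoint hd hZ le_rfl zero_le_one hμ)
    zero_le_one
  rw [hv.mem_momentImage_iff_phases hd hZ hc ⟨_, hx'⟩ (by change 0 < amp d c (fibPoint v 0 s) (v 0); rw [e]; linarith)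
    (by change 0 < amp d c (fibPoint v 0 s) (v 1); rw [e]; linarith)] at hK'
  obtain ⟨α, ω, hαω⟩ := hK'
  -- All terms that depend on `ω` vanish on the edge, so `ω` may be replaced by the angle of the
  -- real point. Uniqueness of the root at that angle then gives the real modulus.
  set ω₁ : ℝ := Real.pi * (v 2 i - v 1 i) with hω₁
  have hroot : RootFamily.eqn (rayKappa d c v 0) (rayRho d c v 0) ω₁
      (modulus d c v (rayPoint v 0 μ) * Complex.exp (α * Complex.I)) = 0 := by
    rw [hv.eqn_ray hd hZ hc ht hε le_rfl zero_le_one hμ, ← e, ← hαω]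
    have h3 : third d c v (fibPoint v 0 s) = 0 := by rw [third, h2, zero_div]
    rw [h3]
    simp only [Complex.ofReal_zero, zero_mul]
    congr 1
    refine Finset.sum_congr rfl fun m hm => ?_
    by_cases hk : icoord v m 2 = 0
    · rw [phase, phase, hk]; simp
    · rw [relAmp, hoth m hm hk]; simp
  have hκ : rayKappa d c v 0 1 ≤ 1 / 8 :=
    hv.third_le hd hc ht hε₁ hl1 (hv.onRay_rayPoint hd hZ le_rfl zero_le_one (par_mem d c v 0 1))
  have hn : ‖(modulus d c v (rayPoint v 0 μ) : ℂ) * Complex.exp (α * Complex.I)‖ =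
      modulus d c v (rayPoint v 0 μ) := by
    rw [norm_mul, Complex.norm_exp_ofReal_mul_I, mul_one, Complex.norm_real, Real.norm_eq_abs,
      abs_of_nonneg (by rw [← e]; linarith)]
  have hn₀ : ‖(-(modulus d c v (rayPoint v 0 μ₀) : ℂ))‖ = modulus d c v (rayPoint v 0 μ₀) := by
    rw [norm_neg, Complex.norm_real, Real.norm_eq_abs, abs_of_nonneg (by linarith [hA₀.1])]
  have heq := hR.root_unique
    (RootFamily.mem_annulus_of (by rw [← e]; exact ⟨by linarith, by linarith⟩) hn)
    (RootFamily.mem_annulus_of ⟨by linarith [hA₀.1], by linarith [hA₀.2]⟩ hn₀)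
    (hR.mem_phases_of_le hκ ω₁) hroot he₀
  have h5 := congrArg norm heq
  rw [hn, hn₀] at h5
  have h6 := (hv.strictMonoOn_modulus_ray hd hZ hc ht hε le_rfl zero_le_one).injOn hμ hμ₀ h5
  rw [e, h6]
  exact hs₀

end IsFlag

variable {d : ℕ} {Z : Geometry.SimplicialComplex ℝ (Fin 3 → ℝ)} {v v' : Fin 3 → Fin 3 → ℕ}
  {φ ψ : (Fin 3 → Fin 3 → ℕ) → ℝ → ℝ → ℝ}

/-! ### Maps of the polygon that move points along the fibres -/

/-- The third of a triangle in which the last barycentric coordinate is the smallest. -/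
def InSector (v : Fin 3 → Fin 3 → ℕ) (x : Fin 3 → ℝ) : Prop :=
  (∀ i, 0 ≤ bary v x i) ∧ bary v x 2 ≤ bary v x 0 ∧ bary v x 2 ≤ bary v x 1

/-- The position of a point on its fibre. -/
def fibS (v : Fin 3 → Fin 3 → ℕ) (x : Fin 3 → ℝ) : ℝ := bary v x 1 - bary v x 0

/-- The parameter of the fibre through a point. -/
def fibR (v : Fin 3 → Fin 3 → ℕ) (x : Fin 3 → ℝ) : ℝ := bary v x 2 / (1 - |fibS v x|)

/-- The point of the same fibre at the position given by `φ`. -/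
def pushOf (φ : (Fin 3 → Fin 3 → ℕ) → ℝ → ℝ → ℝ) (v : Fin 3 → Fin 3 → ℕ) (x : Fin 3 → ℝ) :
    Fin 3 → ℝ :=
  fibPoint v (fibR v x) (φ v (fibR v x) (fibS v x))

/-- A family of maps of the fibres that fit together to a map of the polygon. -/
structure IsFibreMap (d : ℕ) (Z : Geometry.SimplicialComplex ℝ (Fin 3 → ℝ))
    (φ : (Fin 3 → Fin 3 → ℕ) → ℝ → ℝ → ℝ) : Prop where
  flip : ∀ v r s, IsFlag d Z v → 0 ≤ r → φ (flip v) r (-s) = -φ v r s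
  congr : ∀ v v' s, v 0 = v' 0 → v 1 = v' 1 → φ v 0 s = φ v' 0 s
  far : ∀ v r s, 1 / 2 ≤ |s| → φ v r s = s
  deep : ∀ v r s, 1 / 10 ≤ r → φ v r s = s
  maps : ∀ v r s, IsFlag d Z v → 0 ≤ r → |s| ≤ 1 / 2 → |φ v r s| ≤ 1 / 2

theorem continuous_fibPoint (v : Fin 3 → Fin 3 → ℕ) :
    Continuous fun p : ℝ × ℝ => fibPoint v p.1 p.2 := by
  unfold fibPoint
  simp only [Fin.sum_univ_three, Matrix.cons_val_zero, Matrix.cons_val_one,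
    Matrix.cons_val_two, Matrix.head_cons, Matrix.tail_cons]
  fun_prop

theorem continuous_fibS (v : Fin 3 → Fin 3 → ℕ) : Continuous (fibS v) := by
  have h : ∀ i, Continuous fun x => bary v x i := fun i =>
    (continuous_apply i).comp (LinearMap.continuous_of_finiteDimensional (bary v))
  exact (h 1).sub (h 0)

theorem isClosed_inSector (v : Fin 3 → Fin 3 → ℕ) : IsClosed {x | InSector v x} := by
  have h : ∀ i, Continuous fun x => bary v x i := fun i =>
    (continuous_apply i).comp (LinearMap.continuous_of_finiteDimensional (bary v))
  refine IsClosed.and ?_ ((isClosed_le (h 2) (h 0)).and (isClosed_le (h 2) (h 1)))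
  simp only [Set.ofPred_forall]
  exact isClosed_iInter fun i => isClosed_le continuous_const (h i)

theorem exists_sector (hd : 1 ≤ d) (hZ : IsFullTriangulation d Z) {x : Fin 3 → ℝ}
    (hx : x ∈ newtonPolygon d) : ∃ v, IsFlag d Z v ∧ InSector v x := by
  obtain ⟨v, hv, h0, h1, h2⟩ := exists_sorted_flag hd hZ hx
  exact ⟨v, hv, h0, h2.trans h1, h2⟩

namespace IsFlag

theorem inSector_flip (hv : IsFlag d Z v) (hd : 1 ≤ d) (hZ : IsFullTriangulation d Z)
    {x : Fin 3 → ℝ} (h : InSector v x) : InSector (Fattening.flip v) x := by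
  obtain ⟨h0, h1, h2⟩ := hv.bary_flip hd hZ x
  refine ⟨fun i => ?_, by rw [h0, h2]; exact h.2.2, by rw [h1, h2]; exact h.2.1⟩
  fin_cases i
  · exact h0 ▸ h.1 1
  · exact h1 ▸ h.1 0
  · exact h2 ▸ h.1 2

theorem fibS_flip (hv : IsFlag d Z v) (hd : 1 ≤ d) (hZ : IsFullTriangulation d Z)
    (x : Fin 3 → ℝ) : fibS (Fattening.flip v) x = -fibS v x := by
  obtain ⟨h0, h1, -⟩ := hv.bary_flip hd hZ x
  rw [fibS, fibS, h0, h1, neg_sub]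

theorem fibR_flip (hv : IsFlag d Z v) (hd : 1 ≤ d) (hZ : IsFullTriangulation d Z)
    (x : Fin 3 → ℝ) : fibR (Fattening.flip v) x = fibR v x := by
  rw [fibR, fibR, hv.fibS_flip hd hZ, (hv.bary_flip hd hZ x).2.2, abs_neg]

theorem three_mul_le (hv : IsFlag d Z v) (hd : 1 ≤ d) (hZ : IsFullTriangulation d Z)
    {x : Fin 3 → ℝ} (hx : x ∈ newtonPolygon d) (h : InSector v x) :
    3 * bary v x 2 ≤ 1 - |fibS v x| := by
  have h3 := hv.sum_bary_eq_one hd hZ hx.2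
  rw [Fin.sum_univ_three] at h3
  have : |fibS v x| ≤ 1 - 3 * bary v x 2 := by
    rw [fibS, abs_le]
    constructor <;> linarith [h.2.1, h.2.2]
  linarith

theorem abs_fibS_le (hv : IsFlag d Z v) (hd : 1 ≤ d) (hZ : IsFullTriangulation d Z)
    {x : Fin 3 → ℝ} (hx : x ∈ newtonPolygon d) (h : InSector v x) : |fibS v x| ≤ 1 := by
  linarith [hv.three_mul_le hd hZ hx h, h.1 2]

theorem fibR_mem (hv : IsFlag d Z v) (hd : 1 ≤ d) (hZ : IsFullTriangulation d Z)
    {x : Fin 3 → ℝ} (hx : x ∈ newtonPolygon d) (h : InSector v x) :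
    fibR v x ∈ Set.Icc (0 : ℝ) (1 / 3) := by
  have h1 := hv.three_mul_le hd hZ hx h
  have h2 := h.1 2
  refine ⟨div_nonneg h2 (by linarith), ?_⟩
  rcases (show 0 ≤ 1 - |fibS v x| by linarith).eq_or_lt with h0 | h0
  · rw [fibR, ← h0, div_zero]; norm_num
  · rw [fibR, div_le_iff₀ h0]; linarith

theorem bary_two_eq (hv : IsFlag d Z v) (hd : 1 ≤ d) (hZ : IsFullTriangulation d Z)
    {x : Fin 3 → ℝ} (hx : x ∈ newtonPolygon d) (h : InSector v x) :
    bary v x 2 = fibR v x * (1 - |fibS v x|) := by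
  have h1 := hv.three_mul_le hd hZ hx h
  have h2 := h.1 2
  rcases (show 0 ≤ 1 - |fibS v x| by linarith).eq_or_lt with h0 | h0
  · rw [← h0, mul_zero]; linarith
  · rw [fibR, div_mul_cancel₀ _ h0.ne']

theorem fibPoint_fib (hv : IsFlag d Z v) (hd : 1 ≤ d) (hZ : IsFullTriangulation d Z)
    {x : Fin 3 → ℝ} (hx : x ∈ newtonPolygon d) (h : InSector v x) :
    fibPoint v (fibR v x) (fibS v x) = x :=
  (hv.eq_fibPoint hd hZ hx rfl (hv.bary_two_eq hd hZ hx h)).symm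

theorem fib_fibPoint (hv : IsFlag d Z v) (hd : 1 ≤ d) (hZ : IsFullTriangulation d Z)
    {r s : ℝ} (hr0 : 0 ≤ r) (hr1 : r ≤ 1 / 3) (hs : |s| < 1) :
    InSector v (fibPoint v r s) ∧ fibS v (fibPoint v r s) = s ∧ fibR v (fibPoint v r s) = r := by
  obtain ⟨h0, h1, h2⟩ := hv.bary_fibPoint hd hZ r s
  have hS : fibS v (fibPoint v r s) = s := by rw [fibS, h0, h1]; ring
  have h3 : 3 * (r * (1 - |s|)) ≤ 1 - |s| := by nlinarith
  refine ⟨⟨hv.fibPoint_bary_nonneg hd hZ hr0 hr1 hs.le, ?_, ?_⟩, hS, ?_⟩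
  · rw [h0, h2]; linarith [le_abs_self s]
  · rw [h1, h2]; linarith [neg_le_abs s]
  · rw [fibR, hS, h2, mul_div_cancel_right₀]
    linarith

/-- Away from the vertices and the barycenters, sectors overlap only in the evident way. -/
theorem sector_unique (hv : IsFlag d Z v) (hv' : IsFlag d Z v') (hd : 1 ≤ d)
    (hZ : IsFullTriangulation d Z) {x : Fin 3 → ℝ} (hx : x ∈ newtonPolygon d)
    (h : InSector v x) (h' : InSector v' x) (hs : |fibS v x| < 1 / 2) (hr : fibR v x < 1 / 10) :
    ∃ u, (u = v' ∨ u = Fattening.flip v') ∧ u 0 = v 0 ∧ u 1 = v 1 ∧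
      (u = v ∨ bary v x 2 = 0) := by
  have h2 := hv.bary_two_eq hd hZ hx h
  have h3 := hv.sum_bary_eq_one hd hZ hx.2
  rw [Fin.sum_univ_three] at h3
  have hr0 := (hv.fibR_mem hd hZ hx h).1
  have hlt : bary v x 2 < 1 / 10 := by rw [h2]; nlinarith [abs_nonneg (fibS v x)]
  rw [fibS, abs_lt] at hs
  have hH := hat_vertex hd hZ hv hx h.1
  have hH' := hat_vertex hd hZ hv' hx h'.1
  have hrange : ∀ i, bary v x i ≠ 0 → ∃ j, v' j = v i := by
    intro i hi
    by_contra hcon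
    have := hat_eq_zero hd hZ hv' hx h'.1 (m := v i) (by simpa using hcon)
    rw [hH] at this
    exact hi this
  have hsmall : ∀ k, v' k ≠ v 0 → v' k ≠ v 1 → bary v' x k < 1 / 10 := by
    intro k hk0 hk1
    rw [← hH']
    by_cases hk2 : v' k = v 2
    · rw [hk2, hH]; exact hlt
    · rw [hat_eq_zero hd hZ hv hx h.1]
      · norm_num
      · rintro ⟨j, hj⟩
        fin_cases j
        · exact hk0 hj.symm
        · exact hk1 hj.symm
        · exact hk2 hj.symm
  -- `λ₀` and `λ₁` exceed `1/5` and every other coordinate is below `1/10`. So both vertices occur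
  -- in `v'`, and not in the last place, where the smallest coordinate of a sector sits.
  obtain ⟨i, hi⟩ := hrange 0 (by linarith)
  obtain ⟨j, hj⟩ := hrange 1 (by linarith)
  have hbi : bary v' x i = bary v x 0 := by rw [← hH', hi, hH]
  have hbj : bary v' x j = bary v x 1 := by rw [← hH', hj, hH]
  have hij : i ≠ j := by
    rintro rfl
    exact absurd (hv.inj (hi.symm.trans hj)) (by decide)
  have hk : ∀ k, k ≠ i → k ≠ j → bary v' x k < 1 / 10 := fun k hki hkj =>
    hsmall k (fun e => hki (hv'.inj (e.trans hi.symm))) (fun e => hkj (hv'.inj (e.trans hj.symm)))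
  have hlast : ∀ u : Fin 3 → Fin 3 → ℕ, Set.range v' ⊆ Set.range u → u 0 = v 0 → u 1 = v 1 →
      (u = v ∨ bary v x 2 = 0) := by
    intro u hu h0 h1
    by_cases hz : bary v x 2 = 0
    · exact Or.inr hz
    · left
      obtain ⟨l, hl⟩ := hrange 2 hz
      obtain ⟨k, hk⟩ := hu ⟨l, hl⟩
      have hk2 : k = 2 := by
        fin_cases k
        · exact absurd (hv.inj (h0.symm.trans hk)) (by decide)
        · exact absurd (hv.inj (h1.symm.trans hk)) (by decide)
        · rfl
      subst hk2
      funext l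
      fin_cases l
      · exact h0
      · exact h1
      · exact hk
  have hflip : Set.range v' ⊆ Set.range (Fattening.flip v') := by
    rw [Fattening.flip, (Equiv.swap (0 : Fin 3) 1).surjective.range_comp]
  fin_cases i <;> fin_cases j
  · exact absurd rfl hij
  · exact ⟨v', Or.inl rfl, hi, hj, hlast v' subset_rfl hi hj⟩
  · have := hk 1 (by decide) (by decide)
    have := h'.2.2
    change bary v' x 2 = _ at hbj
    linarith
  · refine ⟨Fattening.flip v', Or.inr rfl, ?_, ?_, hlast _ hflip ?_ ?_⟩ <;> simpa
  · exact absurd rfl hij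
  · have := hk 0 (by decide) (by decide)
    have := h'.2.1
    change bary v' x 2 = _ at hbj
    linarith
  · have := hk 1 (by decide) (by decide)
    have := h'.2.2
    change bary v' x 2 = _ at hbi
    linarith
  · have := hk 0 (by decide) (by decide)
    have := h'.2.1
    change bary v' x 2 = _ at hbi
    linarith
  · exact absurd rfl hij

theorem pushOf_flip (hv : IsFlag d Z v) (hd : 1 ≤ d) (hZ : IsFullTriangulation d Z)
    (hφ : IsFibreMap d Z φ) {x : Fin 3 → ℝ} (hx : x ∈ newtonPolygon d) (h : InSector v x) :
    pushOf φ (Fattening.flip v) x = pushOf φ v x := by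
  rw [pushOf, hv.fibR_flip hd hZ, hv.fibS_flip hd hZ, hφ.flip _ _ _ hv (hv.fibR_mem hd hZ hx h).1,
    fibPoint_flip, pushOf]

theorem pushOf_eq_self (hv : IsFlag d Z v) (hd : 1 ≤ d) (hZ : IsFullTriangulation d Z)
    (hφ : IsFibreMap d Z φ) {x : Fin 3 → ℝ} (hx : x ∈ newtonPolygon d) (h : InSector v x)
    (h' : 1 / 2 ≤ |fibS v x| ∨ 1 / 10 ≤ fibR v x) : pushOf φ v x = x := by
  rw [pushOf]
  rcases h' with h' | h'
  · rw [hφ.far _ _ _ h', hv.fibPoint_fib hd hZ hx h]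
  · rw [hφ.deep _ _ _ h', hv.fibPoint_fib hd hZ hx h]

/-- Where the fibre maps are not the identity, two overlapping sectors belong to the same edge.
Either they agree up to the exchange of two vertices, or the point lies on the edge, where `r = 0`
and the map depends on the edge alone. -/
theorem pushOf_unique (hv : IsFlag d Z v) (hv' : IsFlag d Z v') (hd : 1 ≤ d)
    (hZ : IsFullTriangulation d Z) (hφ : IsFibreMap d Z φ) {x : Fin 3 → ℝ}
    (hx : x ∈ newtonPolygon d) (h : InSector v x) (h' : InSector v' x) :
    pushOf φ v x = pushOf φ v' x := by
  have key : ∀ {v v'}, IsFlag d Z v → IsFlag d Z v' → InSector v x → InSector v' x →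
      |fibS v x| < 1 / 2 → fibR v x < 1 / 10 → pushOf φ v x = pushOf φ v' x := by
    intro v v' hv hv' h h' hs hr
    obtain ⟨u, hu, h0, h1, h2⟩ := hv.sector_unique hv' hd hZ hx h h' hs hr
    have hpu : pushOf φ v' x = pushOf φ u x := by
      rcases hu with rfl | rfl
      · rfl
      · exact (hv'.pushOf_flip hd hZ hφ hx h').symm
    rw [hpu]
    rcases h2 with rfl | h2
    · rfl
    have huf : IsFlag d Z u ∧ InSector u x := by
      rcases hu with rfl | rfl
      · exact ⟨hv', h'⟩
      · exact ⟨hv'.flip, hv'.inSector_flip hd hZ h'⟩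
    have hb : ∀ i, u i = v i → bary u x i = bary v x i := fun i hi => by
      rw [← hat_vertex hd hZ huf.1 hx huf.2.1, hi, hat_vertex hd hZ hv hx h.1]
    have h3 := hv.sum_bary_eq_one hd hZ hx.2
    have h4 := huf.1.sum_bary_eq_one hd hZ hx.2
    rw [Fin.sum_univ_three] at h3 h4
    have hb2 : bary u x 2 = 0 := by linarith [hb 0 h0, hb 1 h1]
    rw [pushOf, pushOf, fibR, fibR, h2, hb2, zero_div, zero_div, fibS, fibS, hb 0 h0, hb 1 h1,
      fibPoint_zero_congr h0 h1, hφ.congr _ _ _ h0 h1]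
  by_cases hs : |fibS v x| < 1 / 2 ∧ fibR v x < 1 / 10
  · exact key hv hv' h h' hs.1 hs.2
  by_cases hs' : |fibS v' x| < 1 / 2 ∧ fibR v' x < 1 / 10
  · exact (key hv' hv h' h hs'.1 hs'.2).symm
  rw [not_and_or, not_lt, not_lt] at hs hs'
  rw [hv.pushOf_eq_self hd hZ hφ hx h hs, hv'.pushOf_eq_self hd hZ hφ hx h' hs']

theorem abs_map_le (hv : IsFlag d Z v) (hφ : IsFibreMap d Z φ) {r s : ℝ} (hr : 0 ≤ r) {a : ℝ}
    (ha : 1 / 2 ≤ a) (hs : |s| ≤ a) : |φ v r s| ≤ a := by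
  rcases le_total |s| (1 / 2) with h | h
  · exact (hφ.maps _ _ _ hv hr h).trans ha
  · rwa [hφ.far _ _ _ h]

theorem pushOf_mem (hv : IsFlag d Z v) (hd : 1 ≤ d) (hZ : IsFullTriangulation d Z)
    (hφ : IsFibreMap d Z φ) {x : Fin 3 → ℝ} (hx : x ∈ newtonPolygon d) (h : InSector v x) :
    pushOf φ v x ∈ newtonPolygon d := by
  obtain ⟨h0, h1⟩ := hv.fibR_mem hd hZ hx h
  exact hv.fibPoint_mem hd hZ h0 h1
    (hv.abs_map_le hφ h0 (by norm_num) (hv.abs_fibS_le hd hZ hx h))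

theorem bary_pushOf (hv : IsFlag d Z v) (hd : 1 ≤ d) (hZ : IsFullTriangulation d Z)
    (hφ : IsFibreMap d Z φ) {x : Fin 3 → ℝ} (hx : x ∈ newtonPolygon d) (h : InSector v x)
    (i : Fin 3) : 0 ≤ bary v (pushOf φ v x) i ∧ (bary v (pushOf φ v x) i = 0 ↔ bary v x i = 0) := by
  obtain ⟨h0, h1⟩ := hv.fibR_mem hd hZ hx h
  refine ⟨hv.fibPoint_bary_nonneg hd hZ h0 h1
    (hv.abs_map_le hφ h0 (by norm_num) (hv.abs_fibS_le hd hZ hx h)) i, ?_⟩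
  rcases le_or_gt (1 / 2) |fibS v x| with h2 | h2
  · rw [hv.pushOf_eq_self hd hZ hφ hx h (Or.inl h2)]
  have h3 := hφ.maps v (fibR v x) (fibS v x) hv h0 h2.le
  have hpos : ∀ s, |s| ≤ 1 / 2 → 0 < bary v (fibPoint v (fibR v x) s) 0 ∧
      0 < bary v (fibPoint v (fibR v x) s) 1 ∧
      (bary v (fibPoint v (fibR v x) s) 2 = 0 ↔ fibR v x = 0) := by
    intro s hs
    obtain ⟨h4, h5, h6⟩ := hv.bary_fibPoint hd hZ (fibR v x) s
    obtain ⟨h7, h8⟩ := abs_le.1 hs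
    have h9 : fibR v x * (1 - |s|) ≤ 1 / 3 := by nlinarith [abs_nonneg s]
    refine ⟨by rw [h4]; linarith, by rw [h5]; linarith, ?_⟩
    rw [h6, mul_eq_zero, or_iff_left (by linarith)]
  have ha := hpos _ h3
  have hb := hpos _ h2.le
  rw [hv.fibPoint_fib hd hZ hx h] at hb
  fin_cases i
  · exact iff_of_false ha.1.ne' hb.1.ne'
  · exact iff_of_false ha.2.1.ne' hb.2.1.ne'
  · exact ha.2.2.trans hb.2.2.symm

/-- Each of the three coefficients changes by at most `2/3 |s - s'|`, and the coordinates of the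
vertices are at most `d`. -/
theorem dist_fibPoint_le (hv : IsFlag d Z v) {r : ℝ} (hr0 : 0 ≤ r) (hr1 : r ≤ 1 / 3) (s s' : ℝ) :
    dist (fibPoint v r s) (fibPoint v r s') ≤ 2 * d * |s - s'| := by
  refine (dist_pi_le_iff (by positivity)).2 fun j => ?_
  have hle : ∀ i, 0 ≤ (v i j : ℝ) ∧ (v i j : ℝ) ≤ d := by
    intro i
    refine ⟨Nat.cast_nonneg _, ?_⟩
    have := mem_exponents.1 (hv.mem i)
    exact_mod_cast this ▸ Finset.single_le_sum (f := v i) (fun _ _ => Nat.zero_le _)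
      (Finset.mem_univ j)
  have habs := abs_abs_sub_abs_le s s'
  rw [Real.dist_eq, fibPoint, fibPoint, Fin.sum_univ_three, Fin.sum_univ_three]
  simp only [Pi.add_apply, Pi.smul_apply, smul_eq_mul, toReal, Matrix.cons_val_zero,
    Matrix.cons_val_one, Matrix.cons_val_two, Matrix.head_cons, Matrix.tail_cons]
  set D := |s - s'|
  set u := |s| - |s'|
  have hD := abs_nonneg (s - s')
  have h1 : ∀ a q : ℝ, |a| ≤ 2 / 3 * D → 0 ≤ q → q ≤ d → |a * q| ≤ 2 / 3 * D * d := by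
    intro a q ha hq hq'
    rw [abs_mul, abs_of_nonneg hq]
    exact mul_le_mul ha hq' hq (by positivity)
  have hru : |r * u| ≤ 1 / 3 * D := by
    rw [abs_mul, abs_of_nonneg hr0]
    exact mul_le_mul hr1 habs (abs_nonneg _) (by norm_num)
  obtain ⟨a1, a2⟩ := abs_le.1 hru
  obtain ⟨b1, b2⟩ := abs_le.1 (le_refl |s - s'|)
  have e0 := h1 ((-(s - s') + r * u) / 2) _ (abs_le.2 ⟨by linarith, by linarith⟩) (hle 0).1 (hle 0).2
  have e1 := h1 (((s - s') + r * u) / 2) _ (abs_le.2 ⟨by linarith, by linarith⟩) (hle 1).1 (hle 1).2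
  have e2 := h1 (-(r * u)) _ (abs_le.2 ⟨by linarith, by linarith⟩) (hle 2).1 (hle 2).2
  have e : (1 - s - r * (1 - |s|)) / 2 * (v 0 j : ℝ) + (1 + s - r * (1 - |s|)) / 2 * v 1 j +
      r * (1 - |s|) * v 2 j - ((1 - s' - r * (1 - |s'|)) / 2 * v 0 j +
      (1 + s' - r * (1 - |s'|)) / 2 * v 1 j + r * (1 - |s'|) * v 2 j) =
      (-(s - s') + r * u) / 2 * v 0 j + ((s - s') + r * u) / 2 * v 1 j + -(r * u) * v 2 j := by
    simp only [u]; ring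
  rw [e]
  refine (abs_add_three _ _ _).trans ?_
  linarith

end IsFlag

open Classical in
/-- The map of the polygon obtained from maps of the fibres. -/
def liftVec (d : ℕ) (Z : Geometry.SimplicialComplex ℝ (Fin 3 → ℝ))
    (φ : (Fin 3 → Fin 3 → ℕ) → ℝ → ℝ → ℝ) (x : Fin 3 → ℝ) : Fin 3 → ℝ :=
  if h : ∃ v, IsFlag d Z v ∧ InSector v x then pushOf φ h.choose x else x

theorem liftVec_eq (hd : 1 ≤ d) (hZ : IsFullTriangulation d Z) (hφ : IsFibreMap d Z φ)
    (hv : IsFlag d Z v) {x : Fin 3 → ℝ} (hx : x ∈ newtonPolygon d) (h : InSector v x) :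
    liftVec d Z φ x = pushOf φ v x := by
  have hex : ∃ v, IsFlag d Z v ∧ InSector v x := ⟨v, hv, h⟩
  rw [liftVec, dif_pos hex]
  exact hex.choose_spec.1.pushOf_unique hv hd hZ hφ hx hex.choose_spec.2 h

theorem liftVec_fibPoint (hd : 1 ≤ d) (hZ : IsFullTriangulation d Z) (hφ : IsFibreMap d Z φ)
    (hv : IsFlag d Z v) {r s : ℝ} (hr0 : 0 ≤ r) (hr1 : r ≤ 1 / 3) (hs : |s| < 1) :
    liftVec d Z φ (fibPoint v r s) = fibPoint v r (φ v r s) := by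
  obtain ⟨h0, h1, h2⟩ := hv.fib_fibPoint hd hZ hr0 hr1 hs
  rw [liftVec_eq hd hZ hφ hv (hv.fibPoint_mem hd hZ hr0 hr1 hs.le) h0, pushOf, h1, h2]

theorem liftVec_mem (hd : 1 ≤ d) (hZ : IsFullTriangulation d Z) (hφ : IsFibreMap d Z φ)
    {x : Fin 3 → ℝ} (hx : x ∈ newtonPolygon d) : liftVec d Z φ x ∈ newtonPolygon d := by
  obtain ⟨v, hv, h⟩ := exists_sector hd hZ hx
  rw [liftVec_eq hd hZ hφ hv hx h]
  exact hv.pushOf_mem hd hZ hφ hx h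

/-- Moving along a fibre changes the vanishing of no barycentric coordinate. Together with
`mem_convexHull_face_iff` this shows that simplices are preserved. -/
theorem hat_liftVec (hd : 1 ≤ d) (hZ : IsFullTriangulation d Z) (hφ : IsFibreMap d Z φ)
    {x : Fin 3 → ℝ} (hx : x ∈ newtonPolygon d) (m : Fin 3 → ℕ) :
    hat d Z (liftVec d Z φ x) m = 0 ↔ hat d Z x m = 0 := by
  obtain ⟨v, hv, h⟩ := exists_sector hd hZ hx
  have hb := hv.bary_pushOf hd hZ hφ hx h
  have hm := hv.pushOf_mem hd hZ hφ hx h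
  rw [liftVec_eq hd hZ hφ hv hx h]
  by_cases hmv : m ∈ Set.range v
  · obtain ⟨i, rfl⟩ := hmv
    rw [hat_vertex hd hZ hv hm fun i => (hb i).1, hat_vertex hd hZ hv hx h.1]
    exact (hb i).2
  · rw [hat_eq_zero hd hZ hv hm (fun i => (hb i).1) hmv, hat_eq_zero hd hZ hv hx h.1 hmv]

theorem liftVec_liftVec (hd : 1 ≤ d) (hZ : IsFullTriangulation d Z) (hφ : IsFibreMap d Z φ)
    (hψ : IsFibreMap d Z ψ)
    (hinv : ∀ v r s, IsFlag d Z v → 0 ≤ r → |s| ≤ 1 / 2 → ψ v r (φ v r s) = s)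
    {x : Fin 3 → ℝ} (hx : x ∈ newtonPolygon d) :
    liftVec d Z ψ (liftVec d Z φ x) = x := by
  obtain ⟨v, hv, h⟩ := exists_sector hd hZ hx
  obtain ⟨h0, h1⟩ := hv.fibR_mem hd hZ hx h
  rw [liftVec_eq hd hZ hφ hv hx h]
  rcases le_or_gt (1 / 2) |fibS v x| with h2 | h2
  · rw [hv.pushOf_eq_self hd hZ hφ hx h (Or.inl h2), liftVec_eq hd hZ hψ hv hx h,
      hv.pushOf_eq_self hd hZ hψ hx h (Or.inl h2)]
  · rw [pushOf, liftVec_fibPoint hd hZ hψ hv h0 h1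
      ((hφ.maps _ _ _ hv h0 h2.le).trans_lt (by norm_num)), hinv _ _ _ hv h0 h2.le,
      hv.fibPoint_fib hd hZ hx h]

/-- The pieces `|s| ≥ 1/2` of the sectors are fixed pointwise, and treating them separately avoids
the division by `1 - |s|` at the vertices. -/
theorem continuous_liftVec (hd : 1 ≤ d) (hZ : IsFullTriangulation d Z) (hφ : IsFibreMap d Z φ)
    (hcont : ∀ v, IsFlag d Z v → ContinuousOn (fun p : ℝ × ℝ => φ v p.1 p.2)
      (Set.Icc 0 (1 / 3) ×ˢ Set.univ)) :
    Continuous fun x : newtonPolygon d => liftVec d Z φ x := by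
  have hS : ∀ v, Continuous fun x : newtonPolygon d => fibS v x := fun v =>
    (continuous_fibS v).comp continuous_subtype_val
  let f : {v // IsFlag d Z v} × Bool → Set (newtonPolygon d) := fun p =>
    {x | InSector p.1.1 x ∧ bif p.2 then |fibS p.1.1 x| ≤ 1 / 2 else 1 / 2 ≤ |fibS p.1.1 x|}
  refine (locallyFinite_of_finite f).continuous ?_ ?_ ?_
  · refine Set.eq_univ_of_forall fun x => ?_
    obtain ⟨v, hv, h⟩ := exists_sector hd hZ x.2
    rcases le_total |fibS v x| (1 / 2) with h1 | h1
    · exact Set.mem_iUnion.2 ⟨(⟨v, hv⟩, true), h, h1⟩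
    · exact Set.mem_iUnion.2 ⟨(⟨v, hv⟩, false), h, h1⟩
  · rintro ⟨⟨v, hv⟩, b⟩
    have h1 : IsClosed {x : newtonPolygon d | InSector v x} :=
      (isClosed_inSector v).preimage continuous_subtype_val
    cases b
    · exact h1.inter (isClosed_le continuous_const (hS v).abs)
    · exact h1.inter (isClosed_le (hS v).abs continuous_const)
  · rintro ⟨⟨v, hv⟩, b⟩
    cases b
    · refine continuous_subtype_val.continuousOn.congr fun x hx => ?_
      rw [liftVec_eq hd hZ hφ hv x.2 hx.1, hv.pushOf_eq_self hd hZ hφ x.2 hx.1 (Or.inl hx.2)]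
    · have hR : ContinuousOn (fun x : newtonPolygon d => fibR v x) (f (⟨v, hv⟩, true)) := by
        refine ContinuousOn.div ?_ ?_ fun x hx => ?_
        · exact ((continuous_apply 2).comp ((LinearMap.continuous_of_finiteDimensional
            (bary v)).comp continuous_subtype_val)).continuousOn
        · exact (continuous_const.sub (hS v).abs).continuousOn
        · have : |fibS v x| ≤ 1 / 2 := hx.2
          linarith
      have h2 := (hcont v hv).comp (hR.prodMk (hS v).continuousOn)
        fun x hx => ⟨hv.fibR_mem hd hZ x.2 hx.1, Set.mem_univ _⟩
      refine ((continuous_fibPoint v).comp_continuousOn (hR.prodMk h2)).congr fun x hx => ?_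
      exact liftVec_eq hd hZ hφ hv x.2 hx.1

/-- The homeomorphism of the polygon obtained from mutually inverse maps of the fibres. -/
theorem exists_liftHomeo (hd : 1 ≤ d) (hZ : IsFullTriangulation d Z) (hφ : IsFibreMap d Z φ)
    (hψ : IsFibreMap d Z ψ)
    (hinv : ∀ v r s, IsFlag d Z v → 0 ≤ r → |s| ≤ 1 / 2 → ψ v r (φ v r s) = s)
    (hinv' : ∀ v r s, IsFlag d Z v → 0 ≤ r → |s| ≤ 1 / 2 → φ v r (ψ v r s) = s)
    (hcont : ∀ v, IsFlag d Z v → ContinuousOn (fun p : ℝ × ℝ => φ v p.1 p.2)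
      (Set.Icc 0 (1 / 3) ×ˢ Set.univ)) {ε : ℝ}
    (hε : ∀ v r s, IsFlag d Z v → 0 ≤ r → |φ v r s - s| ≤ ε) :
    ∃ h : newtonPolygon d ≃ₜ newtonPolygon d, (∀ x, (h x : Fin 3 → ℝ) = liftVec d Z φ x) ∧
      (∀ x, dist (h x) x ≤ 2 * d * ε) ∧ PreservesSimplices Z h := by
  let e : newtonPolygon d ≃ newtonPolygon d :=
    { toFun := fun x => ⟨liftVec d Z φ x, liftVec_mem hd hZ hφ x.2⟩
      invFun := fun x => ⟨liftVec d Z ψ x, liftVec_mem hd hZ hψ x.2⟩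
      left_inv := fun x => Subtype.ext (liftVec_liftVec hd hZ hφ hψ hinv x.2)
      right_inv := fun x => Subtype.ext (liftVec_liftVec hd hZ hψ hφ hinv' x.2) }
  have he : Continuous e := (continuous_liftVec hd hZ hφ hcont).subtype_mk _
  refine ⟨he.homeoOfEquivCompactToT2, fun x => rfl, fun x => ?_, fun s hs x => ?_⟩
  · obtain ⟨v, hv, h⟩ := exists_sector hd hZ x.2
    obtain ⟨h0, h1⟩ := hv.fibR_mem hd hZ x.2 h
    change dist (liftVec d Z φ x) x ≤ _
    rw [liftVec_eq hd hZ hφ hv x.2 h]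
    nth_rewrite 2 [← hv.fibPoint_fib hd hZ x.2 h]
    refine (hv.dist_fibPoint_le h0 h1 _ _).trans ?_
    exact mul_le_mul_of_nonneg_left (hε _ _ _ hv h0) (by positivity)
  · change liftVec d Z φ x ∈ _ ↔ _
    rw [mem_convexHull_face_iff hd hZ hs (liftVec_mem hd hZ hφ x.2),
      mem_convexHull_face_iff hd hZ hs x.2]
    simp only [ne_eq, hat_liftVec hd hZ hφ x.2]

variable {d : ℕ} {Z : Geometry.SimplicialComplex ℝ (Fin 3 → ℝ)} {v : Fin 3 → Fin 3 → ℕ}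
  {c : (Fin 3 → ℕ) → ℝ} {ε r₀ z₀ : ℝ}

/-! ### The homeomorphism that moves the dual graph into the image -/

/-- A piecewise linear map of the interval that takes zero to `g`. -/
def shift (g s : ℝ) : ℝ := s + g * max 0 (1 - 2 * |s|)

/-- The inverse of `shift g`. -/
def unshift (g s : ℝ) : ℝ :=
  if 1 / 2 ≤ |s| then s else if g ≤ s then (s - g) / (1 - 2 * g) else (s - g) / (1 + 2 * g)

theorem shift_far {g s : ℝ} (hs : 1 / 2 ≤ |s|) : shift g s = s := by
  rw [shift, max_eq_left (by linarith), mul_zero, add_zero]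

theorem shift_near {g s : ℝ} (hs : |s| ≤ 1 / 2) : shift g s = s + g * (1 - 2 * |s|) := by
  rw [shift, max_eq_right (by linarith)]

theorem shift_zero (g : ℝ) : shift g 0 = g := by simp [shift]

theorem zero_shift (s : ℝ) : shift 0 s = s := by simp [shift]

theorem shift_neg (g s : ℝ) : shift (-g) (-s) = -shift g s := by
  simp only [shift, abs_neg]; ring

theorem abs_shift_sub (g s : ℝ) : |shift g s - s| ≤ |g| := by
  rw [shift, add_sub_cancel_left, abs_mul]
  refine mul_le_of_le_one_right (abs_nonneg _) ?_
  rw [abs_of_nonneg (le_max_left _ _)]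
  exact max_le zero_le_one (by linarith [abs_nonneg s])

theorem abs_shift_lt {g s : ℝ} (hg : |g| ≤ 1 / 4) (hs : |s| < 1 / 2) : |shift g s| < 1 / 2 := by
  rw [shift_near hs.le]
  have h0 : |g * (1 - 2 * |s|)| ≤ 1 / 4 * (1 - 2 * |s|) := by
    rw [abs_mul, abs_of_nonneg (a := 1 - 2 * |s|) (by linarith)]
    exact mul_le_mul_of_nonneg_right hg (by linarith)
  linarith [abs_add_le s (g * (1 - 2 * |s|))]

/-- The added bump has Lipschitz constant `2 |g| ≤ 1/2`. -/
theorem monotone_shift {g : ℝ} (hg : |g| ≤ 1 / 4) : Monotone (shift g) := by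
  intro s s' h
  have h1 : |max 0 (1 - 2 * |s'|) - max 0 (1 - 2 * |s|)| ≤ 2 * (s' - s) := by
    rw [max_comm 0, max_comm 0]
    refine (abs_max_sub_max_le_abs _ _ _).trans ?_
    have := abs_abs_sub_abs_le s s'
    rw [abs_of_nonpos (sub_nonpos.2 h)] at this
    rw [show (1 - 2 * |s'|) - (1 - 2 * |s|) = 2 * (|s| - |s'|) by ring, abs_mul, abs_two]
    linarith
  have h2 : |g * (max 0 (1 - 2 * |s'|) - max 0 (1 - 2 * |s|))| ≤ 1 / 4 * (2 * (s' - s)) := by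
    rw [abs_mul]; exact mul_le_mul hg h1 (abs_nonneg _) (by norm_num)
  have h3 := (abs_le.1 h2).1
  rw [shift, shift]
  linarith

theorem abs_unshift_lt {g s : ℝ} (hg : |g| ≤ 1 / 4) (hs : |s| < 1 / 2) :
    |unshift g s| < 1 / 2 := by
  obtain ⟨g1, g2⟩ := abs_le.1 hg
  obtain ⟨s1, s2⟩ := abs_lt.1 hs
  rw [unshift, if_neg (by linarith)]
  split_ifs with h
  · rw [abs_lt, lt_div_iff₀ (by linarith), div_lt_iff₀ (by linarith)]
    constructor <;> linarith
  · rw [abs_lt, lt_div_iff₀ (by linarith), div_lt_iff₀ (by linarith)]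
    constructor <;> linarith

theorem shift_unshift {g s : ℝ} (hg : |g| ≤ 1 / 4) : shift g (unshift g s) = s := by
  by_cases hs : 1 / 2 ≤ |s|
  · rw [unshift, if_pos hs, shift_far hs]
  · obtain ⟨g1, g2⟩ := abs_le.1 hg
    rw [shift_near (abs_unshift_lt hg (not_le.1 hs)).le, unshift, if_neg hs]
    split_ifs with h
    · rw [abs_of_nonneg (div_nonneg (by linarith) (by linarith))]
      have : 1 - 2 * g ≠ 0 := by linarith
      linear_combination div_mul_cancel₀ (s - g) this
    · rw [abs_of_nonpos (div_nonpos_of_nonpos_of_nonneg (by linarith) (by linarith))]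
      have : 1 + 2 * g ≠ 0 := by linarith
      linear_combination div_mul_cancel₀ (s - g) this

theorem unshift_shift {g s : ℝ} (hg : |g| ≤ 1 / 4) : unshift g (shift g s) = s := by
  by_cases hs : 1 / 2 ≤ |s|
  · rw [shift_far hs, unshift, if_pos hs]
  · obtain ⟨g1, g2⟩ := abs_le.1 hg
    have h1 := abs_shift_lt hg (not_le.1 hs)
    have h2 := monotone_shift hg
    rw [unshift, if_neg (by linarith)]
    rw [not_le] at hs
    rcases le_or_gt 0 s with h | h
    · have h3 := h2 h
      rw [shift_zero] at h3
      rw [if_pos h3, shift_near hs.le, abs_of_nonneg h]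
      have : 1 - 2 * g ≠ 0 := by linarith
      rw [div_eq_iff this]; ring
    · have h3 : shift g s < g := by
        rw [shift_near hs.le, abs_of_neg h]; nlinarith
      rw [if_neg (by linarith), shift_near hs.le, abs_of_neg h]
      have : 1 + 2 * g ≠ 0 := by linarith
      rw [div_eq_iff this]; ring

theorem unshift_neg {g s : ℝ} (hg : |g| ≤ 1 / 4) : unshift (-g) (-s) = -unshift g s := by
  rw [← shift_unshift (s := s) hg, ← shift_neg, unshift_shift (by rwa [abs_neg]),
    unshift_shift hg]

/-- The position to which the middle of a fibre is moved. -/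
def centre (d : ℕ) (c : (Fin 3 → ℕ) → ℝ) (r₀ : ℝ) (v : Fin 3 → Fin 3 → ℕ) (r : ℝ) : ℝ :=
  max 0 (min 1 (2 - 2 * r / r₀)) * realPt d c v (min r r₀)

/-- The standing assumptions on the coefficients and on the sizes involved. -/
structure Setup (d : ℕ) (Z : Geometry.SimplicialComplex ℝ (Fin 3 → ℝ)) (c : (Fin 3 → ℕ) → ℝ)
    (ε r₀ z₀ : ℝ) : Prop where
  one_le : 1 ≤ d
  full : IsFullTriangulation d Z
  pos : ∀ m ∈ exponents d, 0 < c m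
  fine : ∀ v, IsFlag d Z v → IsFine d c v ε
  eps_le : 14 * ε ≤ r₀
  r_pos : 0 < r₀
  r_le : r₀ ≤ 1 / 300
  z_nonneg : 0 ≤ z₀
  z_le : z₀ ≤ 1 / 4
  r_add_le : r₀ + ε ≤ (z₀ / 8) ^ 2
  eps_le' : ε ≤ z₀ / 8
  dominant : ∀ v, IsFlag d Z v → ∀ A : ℝ, 9 / 20 ≤ A → A ≤ 11 / 10 →
    ∑ m ∈ others d v, Real.exp (defect c v m) * A ^ icoord v m 1 < 1

namespace Setup

theorem abs_realPt_le (S : Setup d Z c ε r₀ z₀) (hv : IsFlag d Z v) {r : ℝ} (hr0 : 0 ≤ r) (hr1 : r ≤ r₀) :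
    |realPt d c v r| ≤ z₀ := by
  have hr : r ≤ 1 / 300 := hr1.trans S.r_le
  obtain ⟨h1, h2, -⟩ := hv.realPt_spec S.one_le S.full S.pos (S.fine _ hv) (S.fine _ hv.flip) hr0 hr
  have h3 : r + ε ≤ (z₀ / 8) ^ 2 := by linarith [S.r_add_le]
  exact hv.abs_real_le S.one_le S.full S.pos (S.fine _ hv) hr0 hr
    (hv.odd_oddIndex S.one_le S.full) h1.le h2 S.z_nonneg h3 S.eps_le'

theorem cutoff_mem (S : Setup d Z c ε r₀ z₀) (r : ℝ) : max 0 (min 1 (2 - 2 * r / r₀)) ∈ Set.Icc (0 : ℝ) 1 :=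
  ⟨le_max_left _ _, max_le zero_le_one (min_le_left _ _)⟩

theorem min_mem (S : Setup d Z c ε r₀ z₀) {r : ℝ} (hr : 0 ≤ r) : 0 ≤ min r r₀ ∧ min r r₀ ≤ 1 / 300 :=
  ⟨le_min hr S.r_pos.le, (min_le_right _ _).trans S.r_le⟩

theorem abs_centre_le (S : Setup d Z c ε r₀ z₀) (hv : IsFlag d Z v) {r : ℝ} (hr : 0 ≤ r) : |centre d c r₀ v r| ≤ z₀ := by
  obtain ⟨h0, h1⟩ := S.cutoff_mem r
  rw [centre, abs_mul, abs_of_nonneg h0]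
  exact (mul_le_of_le_one_left (abs_nonneg _) h1).trans
    (S.abs_realPt_le hv (S.min_mem hr).1 (min_le_right _ _))

theorem abs_centre_le' (S : Setup d Z c ε r₀ z₀) (hv : IsFlag d Z v) {r : ℝ} (hr : 0 ≤ r) : |centre d c r₀ v r| ≤ 1 / 4 :=
  (S.abs_centre_le hv hr).trans S.z_le

theorem centre_of_ge (S : Setup d Z c ε r₀ z₀) {r : ℝ} (hr : r₀ ≤ r) : centre d c r₀ v r = 0 := by
  have h1 : 2 * 1 ≤ 2 * (r / r₀) := by
    have := (one_le_div S.r_pos).2 hr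
    linarith
  rw [centre, max_eq_left, zero_mul]
  refine (min_le_right _ _).trans ?_
  rw [mul_div_assoc]
  linarith

theorem centre_of_le (S : Setup d Z c ε r₀ z₀) {r : ℝ} (hr : r ≤ r₀ / 2) : centre d c r₀ v r = realPt d c v r := by
  have h1 : r / r₀ ≤ 1 / 2 := by rw [div_le_iff₀ S.r_pos]; linarith
  rw [centre, min_eq_left, max_eq_right zero_le_one, one_mul, min_eq_left (by linarith [S.r_pos])]
  rw [mul_div_assoc]
  linarith

theorem centre_flip (S : Setup d Z c ε r₀ z₀) (hv : IsFlag d Z v) {r : ℝ} (hr : 0 ≤ r) :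
    centre d c r₀ (flip v) r = -centre d c r₀ v r := by
  rw [centre, centre, hv.realPt_flip S.one_le S.full S.pos (S.fine _ hv) (S.fine _ hv.flip)
    (S.min_mem hr).1 (S.min_mem hr).2, mul_neg]

theorem centre_congr (S : Setup d Z c ε r₀ z₀) {v' : Fin 3 → Fin 3 → ℕ} (h0 : v 0 = v' 0) (h1 : v 1 = v' 1) :
    centre d c r₀ v 0 = centre d c r₀ v' 0 := by
  rw [centre, centre, min_eq_left S.r_pos.le, realPt_congr h0 h1]

theorem isFibreMap_shift (S : Setup d Z c ε r₀ z₀) : IsFibreMap d Z fun v r => shift (centre d c r₀ v r) where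
  flip v r s hv hr := by rw [S.centre_flip hv hr, shift_neg]
  congr v v' s h0 h1 := by rw [S.centre_congr h0 h1]
  far v r s hs := shift_far hs
  deep v r s hr := by rw [S.centre_of_ge (by linarith [S.r_le]), zero_shift]
  maps v r s hv hr hs := by
    rcases hs.lt_or_eq with h | h
    · exact (abs_shift_lt (S.abs_centre_le' hv hr) h).le
    · rw [shift_far h.ge]; exact hs

theorem isFibreMap_unshift (S : Setup d Z c ε r₀ z₀) : IsFibreMap d Z fun v r => unshift (centre d c r₀ v r) where
  flip v r s hv hr := by rw [S.centre_flip hv hr, unshift_neg (S.abs_centre_le' hv hr)]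
  congr v v' s h0 h1 := by rw [S.centre_congr h0 h1]
  far v r s hs := by rw [unshift, if_pos hs]
  deep v r s hr := by
    rw [S.centre_of_ge (by linarith [S.r_le])]
    nth_rewrite 1 [← zero_shift s]
    exact unshift_shift (by norm_num)
  maps v r s hv hr hs := by
    rcases hs.lt_or_eq with h | h
    · exact (abs_unshift_lt (S.abs_centre_le' hv hr) h).le
    · rw [unshift, if_pos h.ge]; exact hs

theorem continuousOn_centre (S : Setup d Z c ε r₀ z₀) (hv : IsFlag d Z v) : ContinuousOn (centre d c r₀ v) (Set.Ici 0) := by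
  refine ContinuousOn.mul (Continuous.continuousOn (by fun_prop)) ?_
  exact (hv.continuousOn_realPt S.one_le S.full S.pos (S.fine _ hv) (S.fine _ hv.flip)).comp
    (Continuous.continuousOn (by fun_prop)) fun r hr => S.min_mem hr

theorem exists_homeo (S : Setup d Z c ε r₀ z₀) : ∃ h : newtonPolygon d ≃ₜ newtonPolygon d,
    (∀ v r s, IsFlag d Z v → 0 ≤ r → r ≤ 1 / 3 → |s| < 1 → ∀ x : newtonPolygon d,
      (x : Fin 3 → ℝ) = fibPoint v r s →
        (h x : Fin 3 → ℝ) = fibPoint v r (shift (centre d c r₀ v r) s)) ∧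
      (∀ x, dist (h x) x ≤ 2 * d * z₀) ∧ PreservesSimplices Z h := by
  have hcont : ∀ v, IsFlag d Z v → ContinuousOn
      (fun p : ℝ × ℝ => shift (centre d c r₀ v p.1) p.2) (Set.Icc 0 (1 / 3) ×ˢ Set.univ) := by
    intro v hv
    refine ContinuousOn.add continuousOn_snd (ContinuousOn.mul ?_
      (Continuous.continuousOn (by fun_prop)))
    exact (S.continuousOn_centre hv).comp continuousOn_fst fun p hp => hp.1.1
  obtain ⟨h, h1, h2, h3⟩ := exists_liftHomeo S.one_le S.full S.isFibreMap_shift S.isFibreMap_unshift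
    (fun v r s hv hr _ => unshift_shift (S.abs_centre_le' hv hr))
    (fun v r s hv hr _ => shift_unshift (S.abs_centre_le' hv hr)) hcont
    (fun v r s hv hr => (abs_shift_sub _ _).trans (S.abs_centre_le hv hr))
  refine ⟨h, fun v r s hv hr0 hr1 hs x hx => ?_, h2, h3⟩
  rw [h1, hx, liftVec_fibPoint S.one_le S.full S.isFibreMap_shift hv hr0 hr1 hs]

/-! ### The fibres of the image are intervals -/

/-- From `r₀ / 2 ≥ 7 ε` on, the middle of the fibre lies in the image, and order connectedness of
the two halves makes the fibre star-shaped about it. -/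
theorem zero_star (S : Setup d Z c ε r₀ z₀) (hv : IsFlag d Z v) {r : ℝ} (hr0 : r₀ / 2 ≤ r) (hr1 : r ≤ 1 / 3) {s s' : ℝ}
    (hs : |s| < 1) (hK : fibPoint v r s ∈ imageSet d c) (hs' : s' ∈ Set.uIcc s 0) :
    fibPoint v r s' ∈ imageSet d c := by
  have hr : 0 ≤ r := by linarith [S.r_pos]
  have h7 : 7 * ε ≤ r := by linarith [S.eps_le]
  have key : ∀ {v s s'}, IsFlag d Z v → -1 < s → s ≤ s' → s' ≤ 0 → fibPoint v r s ∈ imageSet d c →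
      fibPoint v r s' ∈ imageSet d c := fun hv h1 h2 h3 hK =>
    hv.half_fibre S.one_le S.full S.pos (S.fine _ hv) hr hr1 h1 h2 h3 le_rfl hK
      (hv.fibPoint_zero_mem S.one_le S.full S.pos (S.fine _ hv) h7 hr1)
  obtain ⟨h1, h2⟩ := abs_lt.1 hs
  rcases le_total s 0 with h | h
  · rw [Set.uIcc_of_le h] at hs'
    exact key hv h1 hs'.1 hs'.2 hK
  · rw [Set.uIcc_of_ge h] at hs'
    rw [← fibPoint_flip] at hK ⊢
    exact key hv.flip (by linarith) (by linarith [hs'.2]) (by linarith [hs'.1]) hK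

/-- Between `r₀ / 2` and `r₀` both the middle of the fibre and the real point lie in the image, and
so does the segment between them, on which the centre lies. -/
theorem centre_mem (S : Setup d Z c ε r₀ z₀) (hv : IsFlag d Z v) {r : ℝ} (hr0 : 0 ≤ r) (hr1 : r ≤ 1 / 3) :
    fibPoint v r (centre d c r₀ v r) ∈ imageSet d c := by
  have hreal : r ≤ r₀ → |realPt d c v r| < 1 / 2 ∧ fibPoint v r (realPt d c v r) ∈ imageSet d c :=
    fun h => by
      obtain ⟨h1, -, h2, -⟩ := hv.realPt_spec S.one_le S.full S.pos (S.fine _ hv)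
        (S.fine _ hv.flip) hr0 (h.trans S.r_le)
      exact ⟨h1, h2⟩
  rcases le_total r (r₀ / 2) with h | h
  · rw [S.centre_of_le h]
    exact (hreal (by linarith [S.r_pos])).2
  rcases le_total r₀ r with h' | h'
  · rw [S.centre_of_ge h']
    exact hv.fibPoint_zero_mem S.one_le S.full S.pos (S.fine _ hv) (by linarith [S.eps_le]) hr1
  · obtain ⟨h1, h2⟩ := hreal h'
    refine S.zero_star hv h hr1 (h1.trans (by norm_num)) h2 ?_
    obtain ⟨h3, h4⟩ := S.cutoff_mem r
    rw [centre, min_eq_left h']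
    rcases le_total 0 (realPt d c v r) with h5 | h5
    · rw [Set.uIcc_of_ge h5]
      exact ⟨mul_nonneg h3 h5, mul_le_of_le_one_left h5 h4⟩
    · rw [Set.uIcc_of_le h5]
      exact ⟨by nlinarith, mul_nonpos_of_nonneg_of_nonpos h3 h5⟩

/-- Close to the side the centre is the real point. Farther away both the given point and the centre
are joined inside the image to the middle of the fibre. -/
theorem star (S : Setup d Z c ε r₀ z₀) (hv : IsFlag d Z v) {r : ℝ} (hr0 : 0 ≤ r) (hr1 : r ≤ 1 / 3) {s s' : ℝ}
    (hs : |s| < 1) (hK : fibPoint v r s ∈ imageSet d c)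
    (hs' : s' ∈ Set.uIcc s (centre d c r₀ v r)) : fibPoint v r s' ∈ imageSet d c := by
  rcases le_total r (r₀ / 2) with h | h
  · rw [S.centre_of_le h] at hs'
    obtain ⟨-, -, -, -, h1⟩ := hv.realPt_spec S.one_le S.full S.pos (S.fine _ hv)
      (S.fine _ hv.flip) hr0 (by linarith [S.r_le, S.r_pos])
    exact h1 s hs hK s' hs'
  · rcases Set.uIcc_subset_uIcc_union_uIcc (b := 0) hs' with h1 | h1
    · exact S.zero_star hv h hr1 hs hK h1
    · rw [Set.uIcc_comm] at h1
      exact S.zero_star hv h hr1 ((S.abs_centre_le' hv hr0).trans_lt (by norm_num))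
        (S.centre_mem hv hr0 hr1) h1

end Setup

variable {d : ℕ} {Z : Geometry.SimplicialComplex ℝ (Fin 3 → ℝ)} {v : Fin 3 → Fin 3 → ℕ}
  {c : (Fin 3 → ℕ) → ℝ} {ε r₀ z₀ : ℝ}

/-! ### The deformation along the fibres -/

open Classical in
/-- The amount by which the barycentric coordinate at `m` exceeds all others. -/
def lead (d : ℕ) (Z : Geometry.SimplicialComplex ℝ (Fin 3 → ℝ)) (x : Fin 3 → ℝ)
    (m : Fin 3 → ℕ) : ℝ :=
  max 0 (hat d Z x m - ‖fun m' : exponents d => if m'.1 = m then 0 else hat d Z x m'‖)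

/-- The straight line deformation of the complement of the vertices into the dual graph. -/
def deform (d : ℕ) (Z : Geometry.SimplicialComplex ℝ (Fin 3 → ℝ)) (τ : ℝ) (x : Fin 3 → ℝ) :
    Fin 3 → ℝ :=
  (1 - τ) • x + τ • ((1 - ∑ m ∈ exponents d, lead d Z x m)⁻¹ •
    (x - ∑ m ∈ exponents d, lead d Z x m • toReal m))

theorem continuous_lead (hd : 1 ≤ d) (hZ : IsFullTriangulation d Z) (m : Fin 3 → ℕ) :
    Continuous fun x : newtonPolygon d => lead d Z x m := by
  unfold lead
  refine continuous_const.max ((continuous_hat hd hZ m).sub (continuous_norm.comp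
    (continuous_pi fun m' => ?_)))
  split_ifs
  · exact continuous_const
  · exact continuous_hat hd hZ _

namespace IsFlag

/-- In a sorted triangle `λ₀` is the largest hat value and `λ₁` the second largest, so `v 0` alone
can lead. -/
theorem lead_eq (hv : IsFlag d Z v) (hd : 1 ≤ d) (hZ : IsFullTriangulation d Z)
    {x : Fin 3 → ℝ} (hx : x ∈ newtonPolygon d) (h0 : ∀ i, 0 ≤ bary v x i)
    (h10 : bary v x 1 ≤ bary v x 0) (h21 : bary v x 2 ≤ bary v x 1) :
    lead d Z x (v 0) = bary v x 0 - bary v x 1 ∧ ∀ m, m ≠ v 0 → lead d Z x m = 0 := by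
  have hH := hat_vertex hd hZ hv hx h0
  have hle : ∀ m, m ≠ v 0 → hat d Z x m ≤ bary v x 1 := by
    intro m hm
    by_cases hmv : m ∈ Set.range v
    · obtain ⟨i, rfl⟩ := hmv
      rw [hH]
      fin_cases i
      · exact absurd rfl hm
      · exact le_rfl
      · exact h21
    · rw [hat_eq_zero hd hZ hv hx h0 hmv]; exact h0 1
  constructor
  · have : ‖fun m' : exponents d => if m'.1 = v 0 then 0 else hat d Z x m'‖ = bary v x 1 := by
      refine le_antisymm ((pi_norm_le_iff_of_nonneg (h0 1)).2 fun m' => ?_) ?_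
      · split_ifs with h
        · rw [norm_zero]; exact h0 1
        · rw [Real.norm_eq_abs, abs_of_nonneg (hat_nonneg hd hZ hx _)]
          exact hle _ h
      · have h := norm_le_pi_norm (fun m' : exponents d => if m'.1 = v 0 then 0 else hat d Z x m')
          ⟨v 1, hv.mem 1⟩
        dsimp only at h
        rw [if_neg fun e => absurd (hv.inj e) (by decide), hH, Real.norm_eq_abs] at h
        exact (le_abs_self _).trans h
    rw [lead, hH, max_eq_right]
    · congr 1
    · refine sub_nonneg.2 (le_trans (le_of_eq ?_) h10)
      convert this
  · intro m hm
    refine max_eq_left (sub_nonpos.2 ?_)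
    have h := norm_le_pi_norm (fun m' : exponents d => if m'.1 = m then 0 else hat d Z x m')
      ⟨v 0, hv.mem 0⟩
    dsimp only at h
    rw [if_neg (Ne.symm hm), hH, Real.norm_eq_abs] at h
    refine ((hle m hm).trans h10).trans ((le_abs_self _).trans (h.trans (le_of_eq ?_)))
    congr! 2

theorem sum_lead (hv : IsFlag d Z v) (hd : 1 ≤ d) (hZ : IsFullTriangulation d Z)
    {r s : ℝ} (hr0 : 0 ≤ r) (hr1 : r ≤ 1 / 3) (hs : -1 ≤ s) (hs' : s ≤ 0) :
    ∑ m ∈ exponents d, lead d Z (fibPoint v r s) m = -s ∧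
      ∑ m ∈ exponents d, lead d Z (fibPoint v r s) m • toReal m = -s • toReal (v 0) := by
  have habs : |s| ≤ 1 := abs_le.2 ⟨hs, by linarith⟩
  obtain ⟨h10, h21⟩ := hv.fibPoint_sorted hd hZ hr1 hs hs'
  obtain ⟨h1, h2⟩ := hv.lead_eq hd hZ (hv.fibPoint_mem hd hZ hr0 hr1 habs)
    (hv.fibPoint_bary_nonneg hd hZ hr0 hr1 habs) h10 h21
  obtain ⟨b0, b1, -⟩ := hv.bary_fibPoint hd hZ r s
  have h3 : lead d Z (fibPoint v r s) (v 0) = -s := by rw [h1, b0, b1]; ring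
  constructor
  · rw [Finset.sum_eq_single_of_mem _ (hv.mem 0) fun m _ hm => h2 m hm, h3]
  · rw [Finset.sum_eq_single_of_mem _ (hv.mem 0) fun m _ hm => by rw [h2 m hm, zero_smul], h3]

/-- The formula of `deform` takes the excess away from the leading vertex, renormalises and
interpolates. Being global, it inherits continuity from the hat functions without any gluing; on
fibres it is the scaling of `s`. -/
theorem deform_fibPoint (hv : IsFlag d Z v) (hd : 1 ≤ d) (hZ : IsFullTriangulation d Z)
    {r s τ : ℝ} (hr0 : 0 ≤ r) (hr1 : r ≤ 1 / 3) (hs : -1 < s) (hs' : s ≤ 0) (hτ : τ ≤ 1) :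
    deform d Z τ (fibPoint v r s) = fibPoint v r ((1 - τ) * s) := by
  obtain ⟨h1, h2⟩ := hv.sum_lead hd hZ hr0 hr1 hs.le hs'
  have h3 : (1 - τ) * s ≤ 0 := mul_nonpos_of_nonneg_of_nonpos (by linarith) hs'
  have h4 : (1 + s)⁻¹ * (1 + s) = 1 := inv_mul_cancel₀ (by linarith)
  funext j
  rw [deform, h1, h2, fibPoint, fibPoint, abs_of_nonpos hs', abs_of_nonpos h3, sub_neg_eq_add,
    Fin.sum_univ_three, Fin.sum_univ_three]
  simp only [Pi.add_apply, Pi.sub_apply, Pi.smul_apply, smul_eq_mul, Matrix.cons_val_zero,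
    Matrix.cons_val_one, Matrix.cons_val_two, Matrix.head_cons, Matrix.tail_cons]
  linear_combination τ * ((1 - r) / 2 * toReal (v 0) j + (1 - r) / 2 * toReal (v 1) j
    + r * toReal (v 2) j) * h4

end IsFlag

theorem fibPoint_neg_one (v : Fin 3 → Fin 3 → ℕ) (r : ℝ) : fibPoint v r (-1) = toReal (v 0) := by
  rw [fibPoint, Fin.sum_univ_three]
  simp only [Matrix.cons_val_zero, Matrix.cons_val_one, Matrix.cons_val_two, Matrix.head_cons,
    Matrix.tail_cons]
  norm_num

theorem exists_sorted_fibPoint (hd : 1 ≤ d) (hZ : IsFullTriangulation d Z) {x : Fin 3 → ℝ}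
    (hx : x ∈ newtonPolygon d) : ∃ v r s, IsFlag d Z v ∧ 0 ≤ r ∧ r ≤ 1 / 3 ∧ -1 ≤ s ∧ s ≤ 0 ∧
      x = fibPoint v r s := by
  obtain ⟨v, hv, h0, h10, h21⟩ := exists_sorted_flag hd hZ hx
  have hS : InSector v x := ⟨h0, h21.trans h10, h21⟩
  obtain ⟨h1, h2⟩ := hv.fibR_mem hd hZ hx hS
  exact ⟨v, fibR v x, fibS v x, hv, h1, h2, (abs_le.1 (hv.abs_fibS_le hd hZ hx hS)).1,
    sub_nonpos.2 h10, (hv.fibPoint_fib hd hZ hx hS).symm⟩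

theorem mem_dualGraph_iff_fibPoint (hd : 1 ≤ d) (hZ : IsFullTriangulation d Z)
    {x : newtonPolygon d} : x ∈ dualGraph d Z ↔ ∃ v r, IsFlag d Z v ∧ 0 ≤ r ∧ r ≤ 1 / 3 ∧
      (x : Fin 3 → ℝ) = fibPoint v r 0 := by
  rw [mem_dualGraph_iff hd hZ]
  constructor
  · rintro ⟨v, hv, h0, h01, h21⟩
    have hS : InSector v x := ⟨h0, h21.trans h01.ge, h21⟩
    obtain ⟨h1, h2⟩ := hv.fibR_mem hd hZ x.2 hS
    refine ⟨v, fibR v x, hv, h1, h2, ?_⟩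
    have h3 : fibS v x = 0 := sub_eq_zero.2 h01.symm
    rw [← h3, hv.fibPoint_fib hd hZ x.2 hS]
  · rintro ⟨v, r, hv, h0, h1, hx⟩
    obtain ⟨b0, b1, b2⟩ := hv.bary_fibPoint hd hZ r 0
    rw [hx]
    refine ⟨v, hv, hv.fibPoint_bary_nonneg hd hZ h0 h1 (by norm_num), ?_, ?_⟩
    · rw [b0, b1]; ring
    · rw [b1, b2, abs_zero]; linarith

/-! ### The retraction and the boundary points of the image -/

namespace Setup

/-- At a vertex the modulus is nearly zero, whereas it is at least `9/20` on the image. -/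
theorem vertex_notMem (S : Setup d Z c ε r₀ z₀) (hv : IsFlag d Z v) :
    toReal (v 0) ∉ imageSet d c := by
  intro hK
  have hb := hv.bary_vertex S.one_le S.full 0
  obtain ⟨ε₁, η, C, ht, -, -, -, hε₁, -⟩ := (S.fine v hv).exists_tame
  have h0 : ∀ i, 0 ≤ bary v (toReal (v 0)) i := by
    intro i; rw [hb]; fin_cases i <;> simp
  have h1 := hv.modulus_ge_of_mem S.one_le S.full S.pos (S.fine v hv) hK h0 (by rw [hb]; simp)
    (by rw [hb]; simp)
  obtain ⟨hx, -⟩ := exists_of_mem_imageSet hK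
  have h2 := abs_le.1 (ht.vertex _ hx h0 0)
  have h3 := abs_le.1 (ht.vertex _ hx h0 1)
  rw [hb] at h2 h3
  simp only [Pi.single_eq_same, Pi.single_eq_of_ne (show (1 : Fin 3) ≠ 0 by decide)] at h2 h3
  have h4 : 0 < amp d c (toReal (v 0)) (v 0) :=
    lt_of_le_of_ne (amp_nonneg S.one_le S.pos hx _) fun h => by rw [← h] at h2; linarith [h2.1]
  rw [modulus, le_div_iff₀ h4] at h1
  nlinarith [amp_nonneg S.one_le S.pos hx (v 1)]

theorem neg_one_lt (S : Setup d Z c ε r₀ z₀) (hv : IsFlag d Z v) {r s : ℝ} (hs : -1 ≤ s)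
    (hK : fibPoint v r s ∈ imageSet d c) : -1 < s := by
  refine lt_of_le_of_ne hs fun h => S.vertex_notMem hv ?_
  rwa [← h, fibPoint_neg_one] at hK

/-- Vertices are simplices, hence fixed by `h`, and they are not in the image. So preimages of
points of the image avoid the vertices, where the denominator in `deform` vanishes. -/
theorem exists_preimage (S : Setup d Z c ε r₀ z₀) {h : newtonPolygon d ≃ₜ newtonPolygon d}
    (hs : PreservesSimplices Z h) {y : newtonPolygon d} (hy : h y ∈ momentImage d c) :
    ∃ v r s, IsFlag d Z v ∧ 0 ≤ r ∧ r ≤ 1 / 3 ∧ -1 < s ∧ s ≤ 0 ∧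
      (y : Fin 3 → ℝ) = fibPoint v r s := by
  obtain ⟨v, r, s, hv, hr0, hr1, hs0, hs1, hx⟩ := exists_sorted_fibPoint S.one_le S.full y.2
  refine ⟨v, r, s, hv, hr0, hr1, lt_of_le_of_ne hs0 fun he => ?_, hs1, hx⟩
  have h1 : (y : Fin 3 → ℝ) = toReal (v 0) := by
    rw [hx, ← he, fibPoint_neg_one]
  have h2 : toReal (v 0) ∈ Z.vertices := by
    rw [S.full.vertices_eq]; exact ⟨v 0, hv.mem 0, rfl⟩
  have h3 := (hs {toReal (v 0)} h2 y).2 (by rw [h1]; simp)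
  rw [Finset.coe_singleton, convexHull_singleton, Set.mem_singleton_iff] at h3
  exact S.vertex_notMem hv (h3 ▸ mem_imageSet_iff.2 hy)

/-- Conjugate `deform` by `h`. On a fibre the resulting path runs monotonically from a point of the
image towards the centre, and star-shapedness keeps it inside the image. -/
theorem isStrongDeformationRetract (S : Setup d Z c ε r₀ z₀)
    {h : newtonPolygon d ≃ₜ newtonPolygon d} (hs : PreservesSimplices Z h)
    (hh : ∀ v r s, IsFlag d Z v → 0 ≤ r → r ≤ 1 / 3 → |s| < 1 → ∀ x : newtonPolygon d,
      (x : Fin 3 → ℝ) = fibPoint v r s →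
        (h x : Fin 3 → ℝ) = fibPoint v r (shift (centre d c r₀ v r) s)) :
    IsStrongDeformationRetract (h '' dualGraph d Z) (momentImage d c) := by
  have hd := S.one_le
  have hZ := S.full
  have habs : ∀ {s : ℝ}, -1 < s → s ≤ 0 → |s| < 1 := fun h1 h2 => abs_lt.2 ⟨h1, by linarith⟩
  have hsub : ∀ {s τ : ℝ}, -1 < s → s ≤ 0 → 0 ≤ τ → τ ≤ 1 → s ≤ (1 - τ) * s ∧ (1 - τ) * s ≤ 0 :=
    fun h1 h2 h3 h4 => ⟨by nlinarith, mul_nonpos_of_nonneg_of_nonpos (by linarith) h2⟩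
  have hmem : ∀ (τ : unitInterval) (x : momentImage d c),
      deform d Z τ (h.symm x) ∈ newtonPolygon d := by
    intro τ x
    obtain ⟨v, r, s, hv, hr0, hr1, hs0, hs1, hx⟩ := S.exists_preimage hs (y := h.symm x)
      (by rw [h.apply_symm_apply]; exact x.2)
    obtain ⟨h1, h2⟩ := hsub hs0 hs1 τ.2.1 τ.2.2
    rw [hx, hv.deform_fibPoint hd hZ hr0 hr1 hs0 hs1 τ.2.2]
    exact hv.fibPoint_mem hd hZ hr0 hr1 (habs (by linarith) h2).le
  have hmemK : ∀ (τ : unitInterval) (x : momentImage d c),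
      h ⟨deform d Z τ (h.symm x), hmem τ x⟩ ∈ momentImage d c := by
    intro τ x
    obtain ⟨v, r, s, hv, hr0, hr1, hs0, hs1, hx⟩ := S.exists_preimage hs (y := h.symm x)
      (by rw [h.apply_symm_apply]; exact x.2)
    obtain ⟨h1, h2⟩ := hsub hs0 hs1 τ.2.1 τ.2.2
    have h3 := hh v r _ hv hr0 hr1 (habs (by linarith) h2) ⟨deform d Z τ (h.symm x), hmem τ x⟩
      (by change deform d Z τ (h.symm x) = _; rw [hx, hv.deform_fibPoint hd hZ hr0 hr1 hs0 hs1 τ.2.2])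
    have h4 := hh v r s hv hr0 hr1 (habs hs0 hs1) _ hx
    rw [h.apply_symm_apply] at h4
    rw [← mem_imageSet_iff, h3]
    have hg := S.abs_centre_le' hv hr0
    have hxK := mem_imageSet_iff.2 x.2
    rw [h4] at hxK
    refine S.star hv hr0 hr1 ?_ hxK ?_
    · rcases le_or_gt (1 / 2) |s| with h5 | h5
      · rw [shift_far h5]; exact habs hs0 hs1
      · exact (abs_shift_lt hg h5).trans (by norm_num)
    · have h6 := monotone_shift hg h2
      rw [shift_zero] at h6
      exact Set.Icc_subset_uIcc ⟨monotone_shift hg h1, h6⟩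
  have hcont : Continuous fun p : unitInterval × momentImage d c =>
      deform d Z p.1 (h.symm p.2) := by
    have hl : ∀ m, Continuous fun p : unitInterval × momentImage d c =>
        lead d Z (h.symm p.2) m := fun m => (continuous_lead hd hZ m).comp
      (h.symm.continuous.comp (continuous_subtype_val.comp continuous_snd))
    have hx : Continuous fun p : unitInterval × momentImage d c =>
        ((h.symm p.2 : newtonPolygon d) : Fin 3 → ℝ) := continuous_subtype_val.comp
      (h.symm.continuous.comp (continuous_subtype_val.comp continuous_snd))
    have hτ : Continuous fun p : unitInterval × momentImage d c => (p.1 : ℝ) :=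
      continuous_subtype_val.comp continuous_fst
    refine ((continuous_const.sub hτ).smul hx).add (hτ.smul (Continuous.smul (Continuous.inv₀
      (continuous_const.sub (continuous_finsetSum _ fun m _ => hl m)) fun p => ?_)
      (hx.sub (continuous_finsetSum _ fun m _ => (hl m).smul continuous_const))))
    obtain ⟨v, r, s, hv, hr0, hr1, hs0, hs1, hx⟩ := S.exists_preimage hs (y := h.symm p.2)
      (by rw [h.apply_symm_apply]; exact p.2.2)
    change 1 - ∑ m ∈ exponents d, lead d Z (h.symm p.2) m ≠ 0
    rw [hx, (hv.sum_lead hd hZ hr0 hr1 hs0.le hs1).1]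
    linarith
  let F : C(unitInterval × momentImage d c, momentImage d c) :=
    ⟨fun p => ⟨h ⟨deform d Z p.1 (h.symm p.2), hmem p.1 p.2⟩, hmemK p.1 p.2⟩,
      (h.continuous.comp (hcont.subtype_mk _)).subtype_mk _⟩
  have hrel : ∀ (τ : unitInterval) (x : momentImage d c), (x : newtonPolygon d) ∈ h '' dualGraph d Z →
      F (τ, x) = x := by
    rintro τ x ⟨y, hy, hyx⟩
    refine Subtype.ext ?_
    refine Eq.trans (congrArg h (Subtype.ext (a2 := y) ?_)) hyx
    change deform d Z τ (h.symm x) = y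
    obtain ⟨v, r, hv, hr0, hr1, he⟩ := (mem_dualGraph_iff_fibPoint hd hZ).1 hy
    rw [← hyx, h.symm_apply_apply, he, hv.deform_fibPoint hd hZ hr0 hr1 (by norm_num) le_rfl τ.2.2,
      mul_zero]
  refine ⟨?_, ⟨fun x => F (1, x), by fun_prop⟩, fun x => ?_, ⟨⟨⟨F, fun x => ?_, fun x => rfl⟩, ?_⟩⟩⟩
  · rintro _ ⟨y, hy, rfl⟩
    obtain ⟨v, r, hv, hr0, hr1, he⟩ := (mem_dualGraph_iff_fibPoint hd hZ).1 hy
    rw [← mem_imageSet_iff, hh v r 0 hv hr0 hr1 (by norm_num) y he, shift_zero]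
    exact S.centre_mem hv hr0 hr1
  · refine ⟨_, ?_, rfl⟩
    obtain ⟨v, r, s, hv, hr0, hr1, hs0, hs1, hx⟩ := S.exists_preimage hs (y := h.symm x)
      (by rw [h.apply_symm_apply]; exact x.2)
    refine (mem_dualGraph_iff_fibPoint hd hZ).2 ⟨v, r, hv, hr0, hr1, ?_⟩
    change deform d Z 1 (h.symm x) = _
    rw [hx, hv.deform_fibPoint hd hZ hr0 hr1 hs0 hs1 le_rfl, sub_self, zero_mul]
  · refine Subtype.ext ?_
    change h ⟨deform d Z (0 : ℝ) (h.symm x), hmem 0 x⟩ = x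
    have : (⟨deform d Z (0 : ℝ) (h.symm x), hmem 0 x⟩ : newtonPolygon d) = h.symm x := by
      refine Subtype.ext ?_
      change deform d Z (0 : ℝ) (h.symm x) = _
      rw [deform, sub_zero, one_smul, zero_smul, add_zero]
    rw [this, h.apply_symm_apply]
  · intro τ x hx
    exact hrel τ x hx

/-- The image meets the boundary of the polygon only in the end points of the moved graph. -/
theorem inter_boundary_subset (S : Setup d Z c ε r₀ z₀)
    {h : newtonPolygon d ≃ₜ newtonPolygon d}
    (hh : ∀ v r s, IsFlag d Z v → 0 ≤ r → r ≤ 1 / 3 → |s| < 1 → ∀ x : newtonPolygon d,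
      (x : Fin 3 → ℝ) = fibPoint v r s →
        (h x : Fin 3 → ℝ) = fibPoint v r (shift (centre d c r₀ v r) s)) :
    momentImage d c ∩ polygonBoundary d ⊆ h '' dualGraph d Z := by
  have hd := S.one_le
  have hZ := S.full
  rintro x ⟨hxK, i, hi⟩
  obtain ⟨v, r, s, hv, hr0, hr1, hs0, hs1, hx⟩ := exists_sorted_fibPoint hd hZ x.2
  have hf := S.fine v hv
  have hK := mem_imageSet_iff.2 hxK
  rw [hx] at hK
  replace hs0 := S.neg_one_lt hv hs0 hK
  have habs : |s| < 1 := abs_lt.2 ⟨hs0, by linarith⟩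
  obtain ⟨h10, h21⟩ := hv.fibPoint_sorted hd hZ hr1 hs0.le hs1
  have hM := hv.modulus_ge_of_mem hd hZ S.pos hf hK
    (hv.fibPoint_bary_nonneg hd hZ hr0 hr1 habs.le) h10 h21
  rw [hx] at hi
  obtain ⟨ρ, hρ⟩ := exists_isAmplitude_amp hd S.pos (hv.fibPoint_mem hd hZ hr0 hr1 habs.le)
  have hzero : ∀ m : Fin 3 → ℕ, m i ≠ 0 → amp d c (fibPoint v r s) m = 0 := fun m hm =>
    hρ.amp_eq_zero hd S.pos hm hi
  -- Otherwise the amplitude at `v 0` vanishes and the modulus, a division by zero, takes the value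
  -- zero, contrary to the bound `9/20`.
  have hv0 : v 0 i = 0 := by
    by_contra hne
    rw [modulus, hzero _ hne, div_zero] at hM
    norm_num at hM
  have hv1 : v 1 i = 0 := by
    by_contra hne
    rw [modulus, hzero _ hne, zero_div] at hM
    norm_num at hM
  -- Both `v 0` and `v 1` lie on the edge `x i = 0` of `Δ`, so the `i`-th coordinate is a multiple
  -- of `λ₂`; this yields `r = 0`.
  have hcoord : ∀ y : Fin 3 → ℝ, y i = bary v y 2 * v 2 i := by
    intro y
    have := congrFun (hv.sum_bary hd hZ y) i
    rw [Fin.sum_univ_three] at this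
    simp only [Pi.add_apply, Pi.smul_apply, smul_eq_mul, toReal, hv0, hv1, Nat.cast_zero,
      mul_zero, zero_add] at this
    exact this.symm
  have hv2 : v 2 i ≠ 0 := by
    intro h0
    have := hcoord (Pi.single i 1)
    rw [h0] at this
    simp at this
  have hr : r = 0 := by
    have h1 := hcoord (fibPoint v r s)
    rw [hi, (hv.bary_fibPoint hd hZ r s).2.2] at h1
    have h2 : (v 2 i : ℝ) ≠ 0 := by exact_mod_cast hv2
    rcases mul_eq_zero.1 h1.symm with h3 | h3
    · exact (mul_eq_zero.1 h3).resolve_right (by linarith)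
    · exact absurd h3 h2
  subst hr
  have hoth : ∀ m ∈ others d v, icoord v m 2 ≠ 0 → amp d c (fibPoint v 0 s) m = 0 := by
    intro m hm hne
    refine hzero m fun h0 => hne ?_
    have h1 := hcoord (toReal m)
    rw [← hv.icoord_cast hd hZ (mem_others.1 hm).1 2, toReal, h0, Nat.cast_zero] at h1
    have h2 : (v 2 i : ℝ) ≠ 0 := by exact_mod_cast hv2
    exact_mod_cast (mul_eq_zero.1 h1.symm).resolve_right h2
  have h0 := hv.signedSum_eq_zero_of_boundary hd hZ S.pos hf hs0 hs1 hK (hzero _ hv2) hoth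
    (hv.odd_oddIndex hd hZ)
  have h1 := hv.fibPoint_gt_of_mem hd hZ S.pos hf le_rfl (by norm_num) hs0 hs1 hK
  have h2 := hv.realPt_unique hd hZ S.pos hf (S.fine _ hv.flip) le_rfl (by norm_num)
    (abs_le.2 ⟨h1.le, by linarith⟩) h0
  have hr3 : (0 : ℝ) ≤ 1 / 3 := by norm_num
  have hm := hv.fibPoint_mem hd hZ le_rfl hr3 (s := 0) (by norm_num)
  refine ⟨⟨_, hm⟩, (mem_dualGraph_iff_fibPoint hd hZ).2 ⟨v, 0, hv, le_rfl, hr3, rfl⟩, ?_⟩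
  refine Subtype.ext ?_
  rw [hh v 0 0 hv le_rfl hr3 (by norm_num) _ rfl, shift_zero,
    S.centre_of_le (by linarith [S.r_pos]), ← h2, hx]

end Setup

/-! ### Exponential sums -/

section ExpSum

open Filter Topology

variable {ι : Type*} (s : Finset ι) (δ : ι → ℂ) (n k : ι → ℝ)

/-- A nonconstant holomorphic function is open, and no set of real numbers is a neighbourhood in
`ℂ`. -/
theorem eventually_real_eq_constant {f : ℂ → ℂ} {z₀ : ℂ} (hf : AnalyticAt ℂ f z₀)
    (h : ∀ᶠ z in 𝓝 z₀, (f z).im = 0) : ∀ᶠ z in 𝓝 z₀, f z = f z₀ := by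
  rcases hf.eventually_constant_or_nhds_le_map_nhds with h1 | h1
  · exact h1
  · exfalso
    have h2 : {z : ℂ | z.im = 0} ∈ 𝓝 (f z₀) := h1 h
    have h3 : Tendsto (fun t : ℝ => f z₀ + t * Complex.I) (𝓝 0) (𝓝 (f z₀)) := by
      have : Continuous fun t : ℝ => f z₀ + t * Complex.I := by fun_prop
      simpa using this.tendsto 0
    have h4 := h3 h2
    rw [Filter.mem_map, Metric.mem_nhds_iff] at h4
    obtain ⟨r, hr, h5⟩ := h4
    have h6 := h5 (a := r / 2) (by rw [Metric.mem_ball, dist_zero_right, Real.norm_eq_abs,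
      abs_of_pos (by positivity)]; linarith)
    have h7 : (f z₀).im = 0 := h.self_of_nhds
    have h8 : (f z₀ + ((r / 2 : ℝ) : ℂ) * Complex.I).im = 0 := h6
    simp [h7] at h8
    linarith

/-- Exponentials with different real frequencies are linearly independent. -/
theorem expSum_filter_eq_zero (ρ : ι → ℝ) {W₀ : ℂ}
    (h : ∀ᶠ W in 𝓝 W₀, ∑ i ∈ s, Complex.exp (δ i + ρ i * W) = 0) (a : ℝ) (W : ℂ) :
    ∑ i ∈ s with ρ i = a, Complex.exp (δ i + ρ i * W) = 0 := by
  have hall : (fun W => ∑ i ∈ s, Complex.exp (δ i + ρ i * W)) = fun _ => 0 := by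
    have hd : Differentiable ℂ fun W => ∑ i ∈ s, Complex.exp (δ i + ρ i * W) := by fun_prop
    exact AnalyticOnNhd.eq_of_eventuallyEq (fun W _ => hd.analyticAt W) analyticOnNhd_const h
  -- Different real frequencies give different characters of the additive group `ℂ`, which are
  -- independent by Dedekind's theorem.
  let χ : ℝ → (Multiplicative ℂ →* ℂ) := fun r =>
    { toFun := fun W => Complex.exp (r * W.toAdd)
      map_one' := by simp
      map_mul' := fun x y => by rw [toAdd_mul, mul_add, Complex.exp_add] }
  have hχ : Function.Injective χ := by
    intro r r' he
    have h1 := DFunLike.congr_fun he (Multiplicative.ofAdd 1)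
    change Complex.exp (r * 1) = Complex.exp (r' * 1) at h1
    rw [mul_one, mul_one, ← Complex.ofReal_exp, ← Complex.ofReal_exp, Complex.ofReal_inj] at h1
    exact Real.exp_injective h1
  have hli := (linearIndependent_monoidHom (Multiplicative ℂ) ℂ).comp χ hχ
  have hterm : ∀ b W, ∑ i ∈ s with ρ i = b, Complex.exp (δ i + ρ i * W) =
      (∑ i ∈ s with ρ i = b, Complex.exp (δ i)) * Complex.exp (b * W) := by
    intro b W
    rw [Finset.sum_mul]
    refine Finset.sum_congr rfl fun i hi => ?_
    rw [(Finset.mem_filter.1 hi).2, Complex.exp_add]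
  rw [hterm]
  by_cases ha : a ∈ s.image ρ
  · rw [linearIndependent_iff'.1 hli (s.image ρ)
      (fun b => ∑ i ∈ s with ρ i = b, Complex.exp (δ i)) ?_ a ha, zero_mul]
    funext W
    have h1 := congrFun hall W.toAdd
    rw [← Finset.sum_fiberwise_of_maps_to (t := s.image ρ) (g := ρ)
      fun i hi => Finset.mem_image_of_mem _ hi] at h1
    rw [Finset.sum_apply]
    refine Eq.trans (Finset.sum_congr rfl fun b _ => ?_) h1
    exact (hterm b _).symm
  · rw [Finset.filter_eq_empty_iff.2 fun i hi hia => ha (Finset.mem_image.2 ⟨i, hi, hia⟩),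
      Finset.sum_empty, zero_mul]

/-- An exponential sum in two variables. -/
def expSum (Y W : ℂ) : ℂ := ∑ i ∈ s, Complex.exp (δ i + n i * Y + k i * W)

/-- The amoeba of an exponential sum. -/
def amoeba : Set (ℝ × ℝ) :=
  {p | ∃ α ω : ℝ, expSum s δ n k (p.1 + α * Complex.I) (p.2 + ω * Complex.I) = 0}

theorem mem_amoeba {Y W : ℂ} (h : expSum s δ n k Y W = 0) : (Y.re, W.re) ∈ amoeba s δ n k :=
  ⟨Y.im, W.im, by rw [Complex.re_add_im, Complex.re_add_im]; exact h⟩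

/-- A zero whose amoeba point is not a limit of interior points lies on an affine solution. -/
theorem exists_affine_of_notMem {Y₀ W₀ : ℂ} (h0 : expSum s δ n k Y₀ W₀ = 0)
    (h1 : ∑ i ∈ s, (n i : ℂ) * Complex.exp (δ i + n i * Y₀ + k i * W₀) ≠ 0)
    (h2 : (Y₀.re, W₀.re) ∉ closure (interior (amoeba s δ n k))) :
    ∃ β : ℝ, ∃ γ : ℂ, Y₀ = γ + β * W₀ ∧ ∀ᶠ W in 𝓝 W₀, expSum s δ n k (γ + β * W) W = 0 := by
  set f : ℂ × ℂ → ℂ := fun p => expSum s δ n k p.2 p.1 with hf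
  have cdf : ContDiffAt ℂ ⊤ f (W₀, Y₀) := by
    have : ContDiff ℂ ⊤ f := by unfold f expSum; fun_prop
    exact this.contDiffAt
  have hY : HasDerivAt (fun Y => expSum s δ n k Y W₀)
      (∑ i ∈ s, (n i : ℂ) * Complex.exp (δ i + n i * Y₀ + k i * W₀)) Y₀ := by
    unfold expSum
    refine HasDerivAt.fun_sum fun i _ => ?_
    have h3 : HasDerivAt (fun Y : ℂ => δ i + n i * Y + k i * W₀) (n i) Y₀ := by
      simpa using (((hasDerivAt_id Y₀).const_mul (n i : ℂ)).const_add (δ i)).add_const (k i * W₀)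
    simpa [mul_comm] using h3.cexp
  have hinv : (fderiv ℂ f (W₀, Y₀) ∘L .inr ℂ ℂ ℂ).IsInvertible := by
    set D := fderiv ℂ f (W₀, Y₀) ∘L .inr ℂ ℂ ℂ with hD
    have h3 : HasFDerivAt (fun Y => f (W₀, Y)) D Y₀ := by
      have h4 : HasFDerivAt (fun Y : ℂ => (W₀, Y)) (.inr ℂ ℂ ℂ) Y₀ := hasFDerivAt_prodMk_right W₀ Y₀
      exact (cdf.differentiableAt (by simp)).hasFDerivAt.comp Y₀ h4
    have h5 : D 1 = ∑ i ∈ s, (n i : ℂ) * Complex.exp (δ i + n i * Y₀ + k i * W₀) :=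
      h3.hasDerivAt.unique hY
    rw [← h5] at h1
    refine ⟨ContinuousLinearEquiv.unitsEquivAut ℂ (Units.mk0 (D 1) h1), ?_⟩
    ext
    simp
  set g := cdf.implicitFunction (by simp) hinv with hg
  have g0 : g W₀ = Y₀ := cdf.implicitFunction_apply_self (by simp) hinv
  have gF : ∀ᶠ W in 𝓝 W₀, expSum s δ n k (g W) W = 0 := by
    filter_upwards [cdf.eventually_apply_implicitFunction (by simp) hinv] with W hW
    exact hW.trans h0
  have gA : AnalyticAt ℂ g W₀ :=
    (cdf.contDiffAt_implicitFunction (by simp) hinv).analyticAt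
  have hcont : ContinuousAt (fun W => ((g W).re, W.re)) W₀ :=
    (Complex.continuous_re.continuousAt.comp gA.continuousAt).prodMk
      Complex.continuous_re.continuousAt
  have hout : ∀ᶠ W in 𝓝 W₀, ((g W).re, W.re) ∉ interior (amoeba s δ n k) := by
    rw [← g0] at h2
    filter_upwards [hcont.eventually (isClosed_closure.isOpen_compl.mem_nhds h2)] with W hW h
    exact hW (subset_closure h)
  -- Where `g'` is not real the map `W ↦ (Re g(W), Re W)` has surjective real differential, so it
  -- covers a neighbourhood and the amoeba point is interior.
  have hreal : ∀ᶠ W in 𝓝 W₀, (deriv g W).im = 0 := by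
    filter_upwards [gF.eventually_nhds, gA.eventually_analyticAt, hout] with W hW hWA hWo
    by_contra him
    refine hWo ?_
    have h3 := (hWA.hasStrictDerivAt.hasStrictFDerivAt.restrictScalars ℝ)
    have h4 : HasStrictFDerivAt (fun W => ((g W).re, W.re))
        ((Complex.reCLM ∘L ((ContinuousLinearMap.toSpanSingleton ℂ (deriv g W)).restrictScalars
          ℝ)).prod Complex.reCLM) W :=
      (Complex.reCLM.hasStrictFDerivAt.comp W h3).prodMk Complex.reCLM.hasStrictFDerivAt
    have h5 := h4.map_nhds_eq_of_surj ?_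
    · rw [mem_interior_iff_mem_nhds, ← h5, Filter.mem_map]
      filter_upwards [hW] with W' hW'
      exact mem_amoeba s δ n k hW'
    · refine LinearMap.range_eq_top.2 fun p => ?_
      -- The real part settles the second component; the imaginary part solves for the first, with
      -- `Im g'` as divisor.
      refine ⟨p.2 + ((p.2 * (deriv g W).re - p.1) / (deriv g W).im : ℝ) * Complex.I, ?_⟩
      refine Prod.ext ?_ ?_
      · simp
        field_simp
        ring
      · simp
  obtain ⟨hconst⟩ : Nonempty (∀ᶠ W in 𝓝 W₀, deriv g W = deriv g W₀) :=
    ⟨eventually_real_eq_constant gA.deriv hreal⟩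
  have hβ : deriv g W₀ = ((deriv g W₀).re : ℂ) :=
    Complex.ext rfl (by simpa using hreal.self_of_nhds)
  set β := (deriv g W₀).re
  obtain ⟨r, hr, hball⟩ := Metric.eventually_nhds_iff_ball.1
    (hconst.and gA.eventually_analyticAt)
  have haff : ∀ W ∈ Metric.ball W₀ r, g W - β * W = Y₀ - β * W₀ := by
    intro W hW
    rw [← g0]
    refine Metric.isOpen_ball.is_const_of_deriv_eq_zero (f := fun W => g W - β * W)
      (convex_ball W₀ r).isPreconnected (fun z hz => ?_) (fun z hz => ?_) hW
      (Metric.mem_ball_self hr)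
    · exact ((hball z hz).2.differentiableAt.sub (by fun_prop)).differentiableWithinAt
    · have h3 : HasDerivAt (fun W => g W - β * W) (deriv g z - β * 1) z :=
        (hball z hz).2.differentiableAt.hasDerivAt.sub ((hasDerivAt_id z).const_mul (β : ℂ))
      rw [h3.deriv, (hball z hz).1, hβ]
      simp
  refine ⟨β, Y₀ - β * W₀, by ring, ?_⟩
  filter_upwards [gF, Metric.ball_mem_nhds W₀ hr] with W h3 h4
  rw [← haff W h4, sub_add_cancel]
  exact h3

/-- If the terms with frequencies of three vertices dominate, then all zeros with a given amoeba
point are limits of interior points. -/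
theorem mem_closure_interior_amoeba {Y W : ℂ} (h0 : expSum s δ n k Y W = 0)
    (v : Fin 3 → ι) (hv : ∀ j, v j ∈ s) {o : Finset ι}
    (ho : ∀ i, i ∈ o ↔ i ∈ s ∧ i ∉ Set.range v)
    (hn : n (v 0) = 0 ∧ n (v 1) = 1 ∧ n (v 2) = 1)
    (hk : k (v 0) = 0 ∧ k (v 1) = 0 ∧ k (v 2) = 1)
    (hder : ∑ i ∈ o, |n i - 1| * ‖Complex.exp (δ i + n i * Y + k i * W)‖ <
      ‖Complex.exp (δ (v 0) + n (v 0) * Y + k (v 0) * W)‖)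
    (hdom : ∀ j, (j = 0 ∨ j = 1) →
      ∑ i ∈ o, ‖Complex.exp (δ i + n i * Y + k i * W)‖ <
        ‖Complex.exp (δ (v j) + n (v j) * Y + k (v j) * W)‖)
    (hdom2 : ∑ i ∈ o.filter (k · = 1),
        ‖Complex.exp (δ i + n i * Y + k i * W)‖ <
        ‖Complex.exp (δ (v 2) + n (v 2) * Y + k (v 2) * W)‖) :
    (Y.re, W.re) ∈ closure (interior (amoeba s δ n k)) := by
  set E : ι → ℂ := fun i => Complex.exp (δ i + n i * Y + k i * W) with hE
  have hsplit : ∀ (G : ι → ℂ) (j : Fin 3), (∀ l, l ≠ j → G (v l) = 0) →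
      ∑ i ∈ s, G i = G (v j) + ∑ i ∈ o, G i := by
    classical
    intro G j hG
    rw [← Finset.add_sum_erase s G (hv j)]
    congr 1
    symm
    refine Finset.sum_subset (fun i hi => ?_) fun i hi hi' => ?_
    · obtain ⟨h1, h2⟩ := (ho i).1 hi
      exact Finset.mem_erase.2 ⟨fun h => h2 ⟨j, h.symm⟩, h1⟩
    · obtain ⟨h1, h2⟩ := Finset.mem_erase.1 hi
      rw [ho, not_and, not_not] at hi'
      obtain ⟨l, rfl⟩ := hi' h2
      exact hG l fun h => h1 (by rw [h])
  by_contra hcon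
  -- Subtracting the equation from its `Y`-derivative leaves the factors `n - 1`, which vanish at `v
  -- 1` and `v 2`; the term of `v 0` cannot be balanced by the others.
  have h1 : ∑ i ∈ s, (n i : ℂ) * E i ≠ 0 := by
    intro h
    have h2 : ∑ i ∈ s, ((n i : ℂ) - 1) * E i = 0 := by
      simp only [sub_mul, one_mul, Finset.sum_sub_distrib]
      rw [h, show ∑ i ∈ s, E i = 0 from h0, sub_zero]
    rw [hsplit _ 0, hn.1, add_eq_zero_iff_eq_neg] at h2
    · have h3 := congrArg norm h2
      rw [norm_neg, Complex.ofReal_zero, zero_sub, neg_one_mul, norm_neg] at h3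
      refine (h3.le.trans (norm_sum_le _ _)).not_gt (lt_of_eq_of_lt ?_ hder)
      refine Finset.sum_congr rfl fun i _ => ?_
      rw [norm_mul, ← Complex.ofReal_one, ← Complex.ofReal_sub, Complex.norm_real, Real.norm_eq_abs]
    · intro l hl
      fin_cases l
      · exact absurd rfl hl
      · change ((n (v 1) : ℂ) - 1) * _ = 0
        rw [hn.2.1]; simp
      · change ((n (v 2) : ℂ) - 1) * _ = 0
        rw [hn.2.2]; simp
  obtain ⟨β, γ, hY, hev⟩ := exists_affine_of_notMem s δ n k h0 h1 hcon
  set ρ : ι → ℝ := fun i => n i * β + k i with hρ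
  -- Along the affine solution the sum is an exponential sum in `W` with real frequencies `n β + k`
  -- that vanishes identically, so the terms of equal frequency cancel among themselves.
  have hgroup : ∀ a, ∑ i ∈ s with ρ i = a, E i = 0 := by
    intro a
    have h3 := expSum_filter_eq_zero s (fun i => δ i + n i * γ) ρ (W₀ := W) ?_ a W
    · refine Eq.trans (Finset.sum_congr rfl fun i _ => ?_) h3
      simp only [E, ρ, hY]
      congr 1
      push_cast
      ring
    · filter_upwards [hev] with W' h4
      refine Eq.trans (Finset.sum_congr rfl fun i _ => ?_) h4
      simp only [ρ]
      congr 1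
      push_cast
      ring
  have hle : ∀ j, (∀ l, l ≠ j → ρ (v l) ≠ ρ (v j)) →
      ‖E (v j)‖ ≤ ∑ i ∈ o.filter (ρ · = ρ (v j)), ‖E i‖ := by
    intro j hj
    have h3 := hgroup (ρ (v j))
    rw [Finset.sum_filter, hsplit _ j, if_pos rfl, add_eq_zero_iff_eq_neg,
      ← Finset.sum_filter] at h3
    · rw [h3, norm_neg]
      exact norm_sum_le _ _
    · intro l hl
      rw [if_neg (hj l hl)]
  have hle' : ∀ j, (∀ l, l ≠ j → ρ (v l) ≠ ρ (v j)) →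
      ‖E (v j)‖ ≤ ∑ i ∈ o, ‖E i‖ := fun j hj => (hle j hj).trans
    (Finset.sum_le_sum_of_subset_of_nonneg (Finset.filter_subset _ _) fun _ _ _ => norm_nonneg _)
  have r0 : ρ (v 0) = 0 := by simp [ρ, hn.1, hk.1]
  have r1 : ρ (v 1) = β := by simp [ρ, hn.2.1, hk.2.1]
  have r2 : ρ (v 2) = β + 1 := by simp [ρ, hn.2.2, hk.2.2]
  have hsep : ∀ j, (∀ l, l ≠ j → ![0, β, β + 1] l ≠ ![0, β, β + 1] j) →
      ∀ l, l ≠ j → ρ (v l) ≠ ρ (v j) := by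
    have hr : ∀ l, ρ (v l) = ![0, β, β + 1] l := by
      intro l
      fin_cases l
      · exact r0
      · exact r1
      · exact r2
    intro j hj l hl
    rw [hr, hr]
    exact hj l hl
  -- The vertices have frequencies `0`, `β`, `β + 1`. Alone in its group is `v 2` if `β = 0`, `v 1`
  -- if `β = -1`, and `v 0` in all other cases. The term of `v 2` may be small, but for `β = 0` it
  -- competes only with terms that have `k = 1`.
  by_cases hβ0 : β = 0
  · refine (hle 2 (hsep 2 fun l hl => ?_)).not_gt (lt_of_eq_of_lt ?_ hdom2)
    · subst hβ0; fin_cases l <;> simp at hl ⊢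
    · refine Finset.sum_congr (Finset.filter_congr fun i _ => ?_) fun i _ => rfl
      rw [r2, hρ, hβ0]
      simp
  by_cases hβ1 : β = -1
  · refine (hle' 1 (hsep 1 fun l hl => ?_)).not_gt (hdom 1 (Or.inr rfl))
    subst hβ1; fin_cases l <;> simp at hl ⊢
  · refine (hle' 0 (hsep 0 fun l hl => ?_)).not_gt (hdom 0 (Or.inl rfl))
    have : β + 1 ≠ 0 := fun h => hβ1 (by linarith)
    fin_cases l
    · exact absurd rfl hl
    · exact hβ0
    · exact this

end ExpSum

variable {d : ℕ} {Z : Geometry.SimplicialComplex ℝ (Fin 3 → ℝ)} {v : Fin 3 → Fin 3 → ℕ}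
  {c : (Fin 3 → ℕ) → ℝ} {ε r₀ z₀ : ℝ}

/-! ### Logarithmic coordinates on the interior of the polygon -/

/-- The relative amplitude of `m` as a function of the logarithmic coordinates. -/
def logAmp (c : (Fin 3 → ℕ) → ℝ) (v : Fin 3 → Fin 3 → ℕ) (m : Fin 3 → ℕ) (p : ℝ × ℝ) : ℝ :=
  Real.exp (defect c v m + (icoord v m 1 + icoord v m 2) * p.1 + icoord v m 2 * p.2)

/-- The point of the polygon with given logarithmic coordinates. -/
def logPoint (d : ℕ) (c : (Fin 3 → ℕ) → ℝ) (v : Fin 3 → Fin 3 → ℕ) (p : ℝ × ℝ) : Fin 3 → ℝ :=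
  (∑ m ∈ exponents d, logAmp c v m p ^ 2)⁻¹ •
    ∑ m ∈ exponents d, logAmp c v m p ^ 2 • toReal m

/-- The amoeba of the curve in the logarithmic coordinates. -/
def curveAmoeba (d : ℕ) (c : (Fin 3 → ℕ) → ℝ) (v : Fin 3 → Fin 3 → ℕ) : Set (ℝ × ℝ) :=
  amoeba (exponents d) (fun m => (defect c v m : ℂ))
    (fun m => (icoord v m 1 : ℝ) + icoord v m 2) (fun m => (icoord v m 2 : ℝ))

theorem sum_logAmp_sq_pos (d : ℕ) (c : (Fin 3 → ℕ) → ℝ) (v : Fin 3 → Fin 3 → ℕ) (p : ℝ × ℝ) :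
    0 < ∑ m ∈ exponents d, logAmp c v m p ^ 2 :=
  Finset.sum_pos (fun m _ => pow_pos (Real.exp_pos _) 2) ⟨_, single_mem_exponents d 0⟩

theorem continuous_logPoint (d : ℕ) (c : (Fin 3 → ℕ) → ℝ) (v : Fin 3 → Fin 3 → ℕ) :
    Continuous (logPoint d c v) := by
  have h : ∀ m, Continuous (logAmp c v m) := fun m => by unfold logAmp; fun_prop
  exact ((continuous_finsetSum _ fun m _ => (h m).pow 2).inv₀
    fun p => (sum_logAmp_sq_pos d c v p).ne').smul
      (continuous_finsetSum _ fun m _ => ((h m).pow 2).smul continuous_const)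

theorem norm_exp_eq_logAmp (m : Fin 3 → ℕ) (Y W : ℂ) :
    ‖Complex.exp ((defect c v m : ℂ) + (((icoord v m 1 : ℝ) + icoord v m 2 : ℝ) : ℂ) * Y +
      ((icoord v m 2 : ℝ) : ℂ) * W)‖ = logAmp c v m (Y.re, W.re) := by
  rw [Complex.norm_exp, logAmp, Complex.add_re, Complex.add_re, Complex.re_ofReal_mul,
    Complex.re_ofReal_mul, Complex.ofReal_re]

namespace IsFlag

theorem icoord_vertex (hv : IsFlag d Z v) (hd : 1 ≤ d) (hZ : IsFullTriangulation d Z)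
    (i j : Fin 3) : icoord v (v i) j = if j = i then 1 else 0 := by
  rw [icoord, hv.bary_vertex hd hZ, Pi.single_apply]
  split_ifs <;> simp

theorem logAmp_vertex (hv : IsFlag d Z v) (hd : 1 ≤ d) (hZ : IsFullTriangulation d Z)
    (p : ℝ × ℝ) : logAmp c v (v 0) p = 1 ∧ logAmp c v (v 1) p = Real.exp p.1 ∧
      logAmp c v (v 2) p = Real.exp (p.1 + p.2) := by
  simp [logAmp, hv.icoord_vertex hd hZ, hv.defect_vertex hd hZ]

/-- The vertices form a basis, so the logarithms of the three vertex monomials can be prescribed by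
the radii; all other monomials follow by interpolation. -/
theorem exists_radii (hv : IsFlag d Z v) (hd : 1 ≤ d) (hZ : IsFullTriangulation d Z)
    (hc : ∀ m ∈ exponents d, 0 < c m) (p : ℝ × ℝ) :
    ∃ r : Fin 3 → ℝ, (∀ i, 0 < r i) ∧
      ∀ m ∈ exponents d, c m * ∏ i, r i ^ m i = logAmp c v m p := by
  set τ : Fin 3 → ℝ := fun l => ![0, p.1, p.1 + p.2] l - Real.log (c (v l)) with hτ
  refine ⟨fun i => Real.exp (∑ l, bary v (Pi.single i 1) l * τ l), fun i => Real.exp_pos _,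
    fun m hm => ?_⟩
  have h1 : toReal m = ∑ i, (m i : ℝ) • (Pi.single i 1 : Fin 3 → ℝ) := by
    funext j
    simp [toReal, Finset.sum_apply, Pi.single_apply]
  have h2 : ∀ l, bary v (toReal m) l = ∑ i, (m i : ℝ) * bary v (Pi.single i 1) l := by
    intro l
    rw [h1, map_sum, Finset.sum_apply]
    exact Finset.sum_congr rfl fun i _ => by rw [map_smul, Pi.smul_apply, smul_eq_mul]
  have h3 : ∑ i, (m i : ℝ) * ∑ l, bary v (Pi.single i 1) l * τ l =
      ∑ l, bary v (toReal m) l * τ l := by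
    simp only [h2, Finset.mul_sum, Finset.sum_mul, mul_assoc]
    exact Finset.sum_comm
  simp only [← Real.exp_nat_mul]
  rw [← Real.exp_sum, h3, ← Real.exp_log (hc m hm), ← Real.exp_add, logAmp, defect,
    hv.icoord_cast hd hZ hm, hv.icoord_cast hd hZ hm]
  congr 1
  simp only [Fin.sum_univ_three, hτ, Matrix.cons_val_zero, Matrix.cons_val_one,
    Matrix.cons_val_two, Matrix.head_cons, Matrix.tail_cons]
  ring

theorem logPoint_spec (hv : IsFlag d Z v) (hd : 1 ≤ d) (hZ : IsFullTriangulation d Z)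
    (hc : ∀ m ∈ exponents d, 0 < c m) (p : ℝ × ℝ) :
    logPoint d c v p ∈ newtonPolygon d ∧ (∀ i, 0 < logPoint d c v p i) ∧
      ∀ m ∈ exponents d, relAmp d c v m (logPoint d c v p) = logAmp c v m p := by
  obtain ⟨r, hr, hrm⟩ := hv.exists_radii hd hZ hc p
  have hr0 : r ≠ 0 := fun h => (hr 0).ne' (congrFun h 0)
  obtain ⟨s, hs, h1⟩ := exists_scale hd hc (fun i => (hr i).le) hr0
  have hS := sum_logAmp_sq_pos d c v p
  have hx : ∀ i, ∑ m ∈ exponents d, (c m * ∏ i, r i ^ m i) ^ 2 * m i =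
      logPoint d c v p i * ∑ m ∈ exponents d, (c m * ∏ i, r i ^ m i) ^ 2 := by
    intro i
    have e1 : ∑ m ∈ exponents d, (c m * ∏ i, r i ^ m i) ^ 2 * m i =
        ∑ m ∈ exponents d, logAmp c v m p ^ 2 * m i :=
      Finset.sum_congr rfl fun m hm => by rw [hrm m hm]
    have e2 : ∑ m ∈ exponents d, (c m * ∏ i, r i ^ m i) ^ 2 =
        ∑ m ∈ exponents d, logAmp c v m p ^ 2 :=
      Finset.sum_congr rfl fun m hm => by rw [hrm m hm]
    rw [e1, e2, logPoint, Pi.smul_apply, smul_eq_mul,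
      mul_right_comm, inv_mul_cancel₀ hS.ne', one_mul, Finset.sum_apply]
    rfl
  have hA := isAmplitude_of_scale hc (fun i => (hr i).le) hs h1 hx
  have ha : ∀ m ∈ exponents d, amp d c (logPoint d c v p) m = s ^ d * logAmp c v m p := by
    intro m hm
    rw [hA.amp_eq hd hc, ← hrm m hm]
    exact if_pos hm
  have hpos : ∀ i, 0 < logPoint d c v p i := by
    intro i
    rw [← hA.mean i]
    refine Finset.sum_pos' (fun m _ => by positivity) ⟨_, single_mem_exponents d i, ?_⟩
    rw [if_pos (single_mem_exponents d i), hrm _ (single_mem_exponents d i), Pi.single_eq_same]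
    have : 0 < logAmp c v (Pi.single i d) p := Real.exp_pos _
    have : (0 : ℝ) < d := by exact_mod_cast hd
    positivity
  refine ⟨⟨fun i => (hpos i).le, ?_⟩, hpos, fun m hm => ?_⟩
  · simp only [← hA.mean]
    rw [Finset.sum_comm, Finset.sum_congr rfl fun m hm => by
      rw [← Finset.mul_sum, ← Nat.cast_sum, mem_exponents.1 hm], ← Finset.sum_mul, hA.sum_sq, one_mul]
  · rw [relAmp, ha m hm, ha _ (hv.mem 0), (hv.logAmp_vertex hd hZ p).1, mul_one,
      mul_div_cancel_left₀ _ (pow_pos hs d).ne']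

theorem relAmp_vertices (hv : IsFlag d Z v) (hd : 1 ≤ d)
    (hc : ∀ m ∈ exponents d, 0 < c m) {x : Fin 3 → ℝ} (hx : x ∈ newtonPolygon d)
    (hx0 : ∀ i, 0 < x i) : relAmp d c v (v 0) x = 1 ∧
      relAmp d c v (v 1) x = modulus d c v x ∧
      relAmp d c v (v 2) x = modulus d c v x * third d c v x := by
  have h0 := (amp_pos hd hc hx hx0 (hv.mem 0)).ne'
  have h1 := (amp_pos hd hc hx hx0 (hv.mem 1)).ne'
  refine ⟨div_self h0, rfl, ?_⟩
  rw [relAmp, modulus, third]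
  field_simp

theorem modulus_third_pos (hv : IsFlag d Z v) (hd : 1 ≤ d)
    (hc : ∀ m ∈ exponents d, 0 < c m) {x : Fin 3 → ℝ} (hx : x ∈ newtonPolygon d)
    (hx0 : ∀ i, 0 < x i) : 0 < modulus d c v x ∧ 0 < third d c v x :=
  have h := fun i => amp_pos hd hc hx hx0 (hv.mem i)
  ⟨div_pos (h 1) (h 0), div_pos (h 2) (h 1)⟩

theorem relAmp_eq_logAmp (hv : IsFlag d Z v) (hd : 1 ≤ d) (hZ : IsFullTriangulation d Z)
    (hc : ∀ m ∈ exponents d, 0 < c m) {x : Fin 3 → ℝ} (hx : x ∈ newtonPolygon d)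
    (hx0 : ∀ i, 0 < x i) {m : Fin 3 → ℕ} (hm : m ∈ exponents d) :
    relAmp d c v m x = logAmp c v m (Real.log (modulus d c v x), Real.log (third d c v x)) := by
  rw [logAmp, ← hv.exp_log_ratio hd hZ hc hx hx0 hm, Real.exp_log]
  exact div_pos (amp_pos hd hc hx hx0 hm) (amp_pos hd hc hx hx0 (hv.mem 0))

theorem logPoint_log (hv : IsFlag d Z v) (hd : 1 ≤ d) (hZ : IsFullTriangulation d Z)
    (hc : ∀ m ∈ exponents d, 0 < c m) {x : Fin 3 → ℝ} (hx : x ∈ newtonPolygon d)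
    (hx0 : ∀ i, 0 < x i) :
    logPoint d c v (Real.log (modulus d c v x), Real.log (third d c v x)) = x := by
  obtain ⟨h1, h2, h3⟩ := hv.logPoint_spec hd hZ hc
    (Real.log (modulus d c v x), Real.log (third d c v x))
  refine eq_of_relAmp_eq hd hc h1 hx (amp_pos hd hc h1 h2 (hv.mem 0))
    (amp_pos hd hc hx hx0 (hv.mem 0)) fun m hm => ?_
  rw [h3 m hm, hv.relAmp_eq_logAmp hd hZ hc hx hx0 hm]

theorem mem_momentImage_iff_amoeba (hv : IsFlag d Z v) (hd : 1 ≤ d)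
    (hZ : IsFullTriangulation d Z) (hc : ∀ m ∈ exponents d, 0 < c m) {x : newtonPolygon d}
    (hx0 : ∀ i, 0 < (x : Fin 3 → ℝ) i) : x ∈ momentImage d c ↔
      (Real.log (modulus d c v x), Real.log (third d c v x)) ∈ curveAmoeba d c v := by
  rw [hv.mem_momentImage_iff_phases hd hZ hc x (amp_pos hd hc x.2 hx0 (hv.mem 0))
    (amp_pos hd hc x.2 hx0 (hv.mem 1))]
  refine exists_congr fun α => exists_congr fun ω => ?_
  have hterm : ∀ m ∈ exponents d, Complex.exp ((defect c v m : ℂ) +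
      (((icoord v m 1 : ℝ) + icoord v m 2 : ℝ) : ℂ) *
        ((Real.log (modulus d c v x) : ℝ) + α * Complex.I) +
      ((icoord v m 2 : ℝ) : ℂ) * ((Real.log (third d c v x) : ℝ) + ω * Complex.I)) =
      relAmp d c v m x * phase v m α ω := by
    intro m hm
    rw [phase_eq_exp, hv.relAmp_eq_logAmp hd hZ hc x.2 hx0 hm, logAmp, Complex.ofReal_exp,
      ← Complex.exp_add]
    congr 1
    push_cast
    ring
  obtain ⟨a0, a1, a2⟩ := hv.relAmp_vertices hd hc x.2 hx0
  have hI := hv.icoord_vertex hd hZ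
  have p0 : phase v (v 0) α ω = 1 := by simp [phase, hI]
  have p1 : phase v (v 1) α ω = Complex.exp (α * Complex.I) := by simp [phase, hI]
  have p2 : phase v (v 2) α ω = Complex.exp (α * Complex.I) * Complex.exp (ω * Complex.I) := by
    simp [phase, hI]
  rw [expSum, Finset.sum_congr rfl hterm, hv.sum_split, Fin.sum_univ_three, a0, a1, a2, p0, p1, p2]
  refine Eq.congr ?_ rfl
  push_cast
  ring

end IsFlag

/-! ### The image is the closure of its interior -/

/-- The image is the projection of a closed set along the compact torus of phases. -/
theorem isClosed_momentImage (hd : 1 ≤ d) (hc : ∀ m ∈ exponents d, 0 < c m) :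
    IsClosed (momentImage d c) := by
  let G : newtonPolygon d × (Fin 3 → Circle) → ℂ := fun q =>
    ∑ m ∈ exponents d, (amp d c q.1 m : ℂ) * ∏ i, (q.2 i : ℂ) ^ m i
  have hG : Continuous G := by
    refine continuous_finsetSum _ fun m _ => Continuous.mul ?_ (by fun_prop)
    exact Complex.continuous_ofReal.comp
      ((continuousOn_iff_continuous_domRestrict.1 (continuousOn_amp hd hc m)).comp continuous_fst)
  have h := isClosedMap_fst_of_compactSpace _ (isClosed_singleton (x := (0 : ℂ)).preimage hG)
  convert h using 1
  ext x
  rw [mem_momentImage_iff hd hc]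
  have hexp : ∀ (θ : Fin 3 → ℝ) (m : Fin 3 → ℕ), Complex.exp ((∑ i, m i * θ i : ℝ) * Complex.I) =
      ∏ i, (Circle.exp (θ i) : ℂ) ^ m i := by
    intro θ m
    simp only [Circle.coe_exp, ← Complex.exp_nat_mul]
    rw [← Complex.exp_sum]
    push_cast
    rw [Finset.sum_mul]
    simp only [mul_assoc]
  constructor
  · rintro ⟨θ, hθ⟩
    refine ⟨(x, fun i => Circle.exp (θ i)), ?_, rfl⟩
    simp only [hexp] at hθ
    exact hθ
  · rintro ⟨⟨y, u⟩, hu, rfl⟩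
    refine ⟨fun i => Complex.arg (u i), ?_⟩
    simp only [hexp, Circle.exp_arg]
    exact hu

namespace Setup

/-- The estimates for the exponential sum at a point of the image. -/
theorem log_mem_closure_interior (S : Setup d Z c ε r₀ z₀) (hv : IsFlag d Z v)
    {x : newtonPolygon d} (hxK : x ∈ momentImage d c) (hx0 : ∀ i, 0 < (x : Fin 3 → ℝ) i)
    (hb : ∀ i, 0 ≤ bary v (x : Fin 3 → ℝ) i) (h10 : bary v (x : Fin 3 → ℝ) 1 ≤ bary v x 0)
    (h21 : bary v (x : Fin 3 → ℝ) 2 ≤ bary v x 1) :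
    (Real.log (modulus d c v x), Real.log (third d c v x)) ∈
      closure (interior (curveAmoeba d c v)) := by
  have hd := S.one_le
  have hZ := S.full
  have hc := S.pos
  have hf := S.fine v hv
  have hf1 := hf.le
  obtain ⟨ε₁, η, C, ht, hε₁0, hη0, hη, hε₁, hε₁ε, hC, hN, hN'⟩ := hf.exists_tame
  have hA := hv.modulus_ge_of_mem hd hZ hc hf (mem_imageSet_iff.2 hxK) hb h10 h21
  have hA' := hv.modulus_le_of_le hd hZ hc ht (by linarith) x.2 hb h10 h21
  obtain ⟨hM, hT⟩ := hv.modulus_third_pos hd hc x.2 hx0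
  obtain ⟨a0, a1, a2⟩ := hv.relAmp_vertices hd hc x.2 hx0
  have hI := hv.icoord_vertex hd hZ
  have hsum := hv.sum_bary_eq_one hd hZ x.2.2
  rw [Fin.sum_univ_three] at hsum
  have hamp0 : 1 / 3 ≤ amp d c x (v 0) := by
    have h1 := (abs_le.1 (ht.vertex x x.2 hb 0)).1
    have h2 := amp_nonneg hd hc x.2 (v 0)
    nlinarith
  have hrel : ∀ m ∈ others d v, relAmp d c v m x ≤ 3 * η := by
    intro m hm
    have h1 : amp d c x m ≤ η := (sq_le_sq₀ (amp_nonneg hd hc x.2 m) hη0).1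
      ((ht.other x x.2 hb m hm).trans hη)
    rw [relAmp, div_le_iff₀ (by linarith)]
    nlinarith
  have hrel0 : ∀ m ∈ others d v, 0 ≤ relAmp d c v m x := fun m hm =>
    div_nonneg (amp_nonneg hd hc x.2 _) (amp_nonneg hd hc x.2 _)
  have hC1 : 1 ≤ C := by
    have := hC _ (hv.mem 0) 0
    rwa [hv.bary_vertex hd hZ, Pi.single_eq_same, abs_one] at this
  have hcard := card_others_le d v
  have hsum1 : ∑ m ∈ others d v, relAmp d c v m x ≤ ε := by
    refine (Finset.sum_le_card_nsmul _ _ _ hrel).trans ?_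
    rw [nsmul_eq_mul]
    exact (mul_le_mul_of_nonneg_right hcard (by positivity)).trans hN'
  have hsum2 : ∑ m ∈ others d v, |(icoord v m 1 : ℝ) + icoord v m 2 - 1| * relAmp d c v m x ≤ ε := by
    refine (Finset.sum_le_card_nsmul _ _ (3 * η * (10 * C)) fun m hm => ?_).trans ?_
    · have h1 := hC m (mem_others.1 hm).1
      have h2 : |(icoord v m 1 : ℝ) + icoord v m 2 - 1| ≤ 10 * C := by
        rw [hv.icoord_cast hd hZ (mem_others.1 hm).1, hv.icoord_cast hd hZ (mem_others.1 hm).1]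
        have h3 := abs_le.1 (h1 1)
        have h4 := abs_le.1 (h1 2)
        exact abs_le.2 ⟨by linarith, by linarith⟩
      rw [mul_comm]
      exact mul_le_mul (hrel m hm) h2 (abs_nonneg _) (by positivity)
    · rw [nsmul_eq_mul]
      refine (mul_le_mul_of_nonneg_right hcard (by positivity)).trans (le_trans ?_ hN)
      exact mul_le_mul_of_nonneg_left (by linarith) (Nat.cast_nonneg _)
  obtain ⟨α, ω, h0⟩ := (hv.mem_momentImage_iff_amoeba hd hZ hc hx0).1 hxK
  set Y : ℂ := (Real.log (modulus d c v x) : ℝ) + α * Complex.I with hY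
  set W : ℂ := (Real.log (third d c v x) : ℝ) + ω * Complex.I with hW
  have hYre : Y.re = Real.log (modulus d c v x) := by simp [hY]
  have hWre : W.re = Real.log (third d c v x) := by simp [hW]
  have hnorm : ∀ m ∈ exponents d, ‖Complex.exp ((defect c v m : ℂ) +
      (((icoord v m 1 : ℝ) + icoord v m 2 : ℝ) : ℂ) * Y + ((icoord v m 2 : ℝ) : ℂ) * W)‖ =
      relAmp d c v m x := by
    intro m hm
    rw [norm_exp_eq_logAmp, hYre, hWre, hv.relAmp_eq_logAmp hd hZ hc x.2 hx0 hm]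
  have hmem : ∀ m ∈ others d v, m ∈ exponents d := fun m hm => (mem_others.1 hm).1
  rw [← hYre, ← hWre]
  refine mem_closure_interior_amoeba _ _ _ _ h0 v hv.mem (o := others d v) (fun i => mem_others)
    (by simp [hI]) (by simp [hI]) ?_ ?_ ?_
  · rw [hnorm _ (hv.mem 0), a0, Finset.sum_congr rfl fun m hm => by rw [hnorm m (hmem m hm)]]
    linarith
  · intro j hj
    rw [hnorm _ (hv.mem j), Finset.sum_congr rfl fun m hm => hnorm m (hmem m hm)]
    rcases hj with rfl | rfl
    · rw [a0]; linarith
    · rw [a1]; linarith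
  -- Near a side `κ` can be arbitrarily small. But the terms with `k = 1` share the factor `A κ`
  -- with the term of `v 2`, and the quotients `e^{defect} A^j` are controlled by `dominant`.
  · rw [hnorm _ (hv.mem 2), a2, Finset.sum_congr rfl fun m hm =>
      hnorm m (hmem m (Finset.mem_filter.1 hm).1)]
    have hterm : ∀ m ∈ (others d v).filter fun m => (icoord v m 2 : ℝ) = 1, relAmp d c v m x =
        (Real.exp (defect c v m) * modulus d c v x ^ icoord v m 1) *
          (modulus d c v x * third d c v x) := by
      intro m hm
      obtain ⟨h1, h2⟩ := Finset.mem_filter.1 hm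
      rw [hv.relAmp_eq_logAmp hd hZ hc x.2 hx0 (hmem m h1), logAmp, h2, one_mul, Real.exp_add,
        Real.exp_log hT, add_mul, one_mul, ← add_assoc, Real.exp_add, Real.exp_log hM, Real.exp_add,
        mul_comm (icoord v m 1 : ℝ), ← Real.rpow_def_of_pos hM, Real.rpow_intCast]
      ring
    rw [Finset.sum_congr rfl hterm, ← Finset.sum_mul]
    refine mul_lt_of_lt_one_left (mul_pos hM hT) (lt_of_le_of_lt ?_ (S.dominant v hv _ hA hA'))
    exact Finset.sum_le_sum_of_subset_of_nonneg (Finset.filter_subset _ _)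
      fun m _ _ => mul_nonneg (Real.exp_pos _).le (zpow_nonneg hM.le _)

/-- `logPoint` and the logarithmic coordinates are continuous and inverse to each other on the
interior of `Δ`, so the property transfers from the amoeba. -/
theorem mem_closure_interior_of_pos (S : Setup d Z c ε r₀ z₀) {x : newtonPolygon d}
    (hxK : x ∈ momentImage d c) (hx0 : ∀ i, 0 < (x : Fin 3 → ℝ) i) :
    x ∈ closure (interior (momentImage d c)) := by
  have hd := S.one_le
  have hZ := S.full
  have hc := S.pos
  obtain ⟨v, hv, hb, h10, h21⟩ := exists_sorted_flag hd hZ x.2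
  have hmem := S.log_mem_closure_interior hv hxK hx0 hb h10 h21
  let M : ℝ × ℝ → newtonPolygon d := fun p => ⟨logPoint d c v p, (hv.logPoint_spec hd hZ hc p).1⟩
  have hM : Continuous M := (continuous_logPoint d c v).subtype_mk _
  have hMx : M (Real.log (modulus d c v x), Real.log (third d c v x)) = x :=
    Subtype.ext (hv.logPoint_log hd hZ hc x.2 hx0)
  rw [← hMx]
  refine closure_mono ?_ (image_closure_subset_closure_image hM ⟨_, hmem, rfl⟩)
  rintro _ ⟨p, hp, rfl⟩
  obtain ⟨h1, h2, h3⟩ := hv.logPoint_spec hd hZ hc p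
  obtain ⟨e0, e1, e2⟩ := hv.logAmp_vertex (c := c) hd hZ p
  obtain ⟨-, b1, b2⟩ := hv.relAmp_vertices hd hc h1 h2
  have f1 : modulus d c v (logPoint d c v p) = Real.exp p.1 := by rw [← b1, h3 _ (hv.mem 1), e1]
  have f2 : third d c v (logPoint d c v p) = Real.exp p.2 := by
    rw [h3 _ (hv.mem 2), e2, f1, Real.exp_add] at b2
    exact (mul_left_cancel₀ (Real.exp_pos _).ne' b2).symm
  let L : newtonPolygon d → ℝ × ℝ := fun y => (Real.log (modulus d c v y), Real.log (third d c v y))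
  have hLM : L (M p) = p := by
    refine Prod.ext ?_ ?_
    · change Real.log (modulus d c v (logPoint d c v p)) = _; rw [f1, Real.log_exp]
    · change Real.log (third d c v (logPoint d c v p)) = _; rw [f2, Real.log_exp]
  have hamp : ∀ m, ContinuousAt (fun y : newtonPolygon d => amp d c y m) (M p) := fun m =>
    (continuousOn_iff_continuous_domRestrict.1 (continuousOn_amp hd hc m)).continuousAt
  have hne : ∀ i, amp d c (logPoint d c v p) (v i) ≠ 0 := fun i =>
    (amp_pos hd hc h1 h2 (hv.mem i)).ne'
  have hL : ContinuousAt L (M p) := by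
    refine ContinuousAt.prodMk (ContinuousAt.log ((hamp _).div (hamp _) (hne 0)) ?_)
      (ContinuousAt.log ((hamp _).div (hamp _) (hne 1)) ?_)
    · exact (hv.modulus_third_pos hd hc h1 h2).1.ne'
    · exact (hv.modulus_third_pos hd hc h1 h2).2.ne'
  have hpos : ∀ᶠ y : newtonPolygon d in nhds (M p), ∀ i, 0 < (y : Fin 3 → ℝ) i :=
    Filter.eventually_all.2 fun i => ((continuous_apply i).comp
      continuous_subtype_val).continuousAt.eventually (lt_mem_nhds (h2 i))
  rw [mem_interior_iff_mem_nhds]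
  have hA : curveAmoeba d c v ∈ nhds (L (M p)) := by rw [hLM]; exact mem_interior_iff_mem_nhds.1 hp
  filter_upwards [hpos, hL.preimage_mem_nhds hA] with y hy0 hy
  exact (hv.mem_momentImage_iff_amoeba hd hZ hc hy0).2 hy

theorem closure_interior_eq (S : Setup d Z c ε r₀ z₀) :
    closure (interior (momentImage d c)) = momentImage d c := by
  have hd := S.one_le
  have hZ := S.full
  have hc := S.pos
  refine subset_antisymm
    ((closure_mono interior_subset).trans (isClosed_momentImage hd hc).closure_subset) ?_
  intro x hxK
  by_cases hx0 : ∀ i, 0 < (x : Fin 3 → ℝ) i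
  · exact S.mem_closure_interior_of_pos hxK hx0
  push Not at hx0
  obtain ⟨i, hi⟩ := hx0
  obtain ⟨h, hh, -⟩ := S.exists_homeo
  -- A point of the image on `∂Δ` lies on the moved graph. The path `q` follows the moved graph and
  -- runs through interior points of `Δ` for positive parameters.
  obtain ⟨y, hy, rfl⟩ := S.inter_boundary_subset hh ⟨hxK, i, le_antisymm hi (x.2.1 i)⟩
  obtain ⟨v, r, hv, hr0, hr1, he⟩ := (mem_dualGraph_iff_fibPoint hd hZ).1 hy
  have hhy := hh v r 0 hv hr0 hr1 (by norm_num) y he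
  rw [shift_zero] at hhy
  have habs : ∀ t : Set.Icc (0 : ℝ) (1 / 3), |centre d c r₀ v t| < 1 := fun t =>
    (S.abs_centre_le' hv t.2.1).trans_lt (by norm_num)
  let q : Set.Icc (0 : ℝ) (1 / 3) → newtonPolygon d := fun t =>
    ⟨fibPoint v t (centre d c r₀ v t), hv.fibPoint_mem hd hZ t.2.1 t.2.2 (habs t).le⟩
  have hq : Continuous q := by
    refine Continuous.subtype_mk ((continuous_fibPoint v).comp
      (continuous_subtype_val.prodMk ?_)) _
    exact continuousOn_iff_continuous_domRestrict.1 ((S.continuousOn_centre hv).mono fun t ht => ht.1)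
  have hqy : q ⟨r, hr0, hr1⟩ = h y := Subtype.ext hhy.symm
  have hpos : ∀ t : Set.Icc (0 : ℝ) (1 / 3), 0 < (t : ℝ) →
      q t ∈ closure (interior (momentImage d c)) := by
    intro t ht
    refine S.mem_closure_interior_of_pos (mem_imageSet_iff.1 (S.centre_mem hv t.2.1 t.2.2))
      fun i => hv.pos_of_bary_pos hd hZ (fun j => ?_) i
    obtain ⟨b0, b1, b2⟩ := hv.bary_fibPoint hd hZ t (centre d c r₀ v t)
    have h1 := abs_lt.1 (habs t)
    have h2 := neg_abs_le (centre d c r₀ v t)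
    have h3 := le_abs_self (centre d c r₀ v t)
    have h4 : (t : ℝ) * (1 - |centre d c r₀ v t|) < 1 - |centre d c r₀ v t| := by
      nlinarith [habs t, t.2.2]
    fin_cases j
    · change 0 < bary v (fibPoint v t (centre d c r₀ v t)) 0; rw [b0]; linarith
    · change 0 < bary v (fibPoint v t (centre d c r₀ v t)) 1; rw [b1]; linarith
    · change 0 < bary v (fibPoint v t (centre d c r₀ v t)) 2; rw [b2]
      exact mul_pos ht (by linarith [habs t])
  rcases hr0.lt_or_eq with h0 | h0
  · rw [← hqy]; exact hpos _ h0
  rw [← hqy]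
  subst h0
  refine isClosed_closure.mem_of_tendsto (f := fun n : ℕ => q ⟨1 / 3 * (1 / (n + 1)), ?_, ?_⟩)
    (b := Filter.atTop) ?_ (Filter.Eventually.of_forall fun n => hpos _ ?_)
  · positivity
  · rw [mul_le_iff_le_one_right (by norm_num)]
    exact Nat.one_div_le_one_div (Nat.zero_le n) |>.trans (by norm_num)
  · refine (hq.tendsto _).comp (tendsto_subtype_rng.2 ?_)
    simpa using tendsto_one_div_add_atTop_nhds_zero_nat.const_mul (1 / 3 : ℝ)
  · change (0 : ℝ) < 1 / 3 * (1 / (n + 1))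
    positivity

end Setup

variable {d : ℕ} {Z : Geometry.SimplicialComplex ℝ (Fin 3 → ℝ)}

/-! ### Small parameters -/

theorem zpow_le_exp {A C : ℝ} (hA : 9 / 20 ≤ A) (hA' : A ≤ 11 / 10) {j : ℤ} (hj : |(j : ℝ)| ≤ C) :
    A ^ j ≤ Real.exp (2 * C) := by
  have hA0 : 0 < A := by linarith
  have h1 := Real.log_le_sub_one_of_pos hA0
  have h2 := Real.one_sub_inv_le_log_of_pos hA0
  have h3 : A⁻¹ ≤ 20 / 9 := by
    rw [inv_le_comm₀ hA0 (by norm_num)]; linarith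
  have h4 : |Real.log A| ≤ 2 := abs_le.2 ⟨by linarith, by linarith⟩
  rw [← Real.rpow_intCast, Real.rpow_def_of_pos hA0]
  refine Real.exp_le_exp.2 ((le_abs_self _).trans ?_)
  rw [abs_mul]
  exact mul_le_mul h4 hj (abs_nonneg _) (by norm_num)

/-- The choices are made in the order `r₀`, `ε`, `η`, `ε₁`, `t₀`, each depending on the earlier
ones. The bound `r₀ ≤ (z₀ / 8)² / 2` keeps the real points within `z₀` of the graph; `ε ≤ r₀ / 14`
puts the graph into the image from `r = r₀ / 2` on; the bounds on `ε₁` control the sums over all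
other lattice points. -/
theorem exists_setup (hd : 1 ≤ d) (hZ : IsFullTriangulation d Z) {w : (Fin 3 → ℕ) → ℝ}
    (hw : ConvexityCondition d Z w) {z₀ : ℝ} (hz₀ : 0 < z₀) (hz₀' : z₀ ≤ 1 / 4) :
    ∃ t₀ : ℝ, 0 < t₀ ∧ ∀ t : ℝ, 0 < t → t < t₀ →
      ∃ ε r₀, Setup d Z (fun m => t ^ w m) ε r₀ z₀ := by
  obtain ⟨C, hC1, hC⟩ := exists_bary_bound d Z
  have hN := IsFlag.one_le_card d
  set N : ℝ := ((exponents d).card : ℝ)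
  set r₀ : ℝ := min (1 / 300) ((z₀ / 8) ^ 2 / 2)
  have hr₀ : 0 < r₀ := lt_min (by norm_num) (by positivity)
  have hr₁ : r₀ ≤ 1 / 300 := min_le_left _ _
  have hr₂ : r₀ ≤ (z₀ / 8) ^ 2 / 2 := min_le_right _ _
  set ε : ℝ := min (1 / 1000) (r₀ / 14)
  have hε : 0 < ε := lt_min (by norm_num) (by positivity)
  have hε₁ : ε ≤ 1 / 1000 := min_le_left _ _
  have hε₂ : ε ≤ r₀ / 14 := min_le_right _ _
  set η : ℝ := ε / (60 * C * N) with hη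
  have hη0 : 0 < η := by positivity
  have hηC : η * (60 * C * N) = ε := div_mul_cancel₀ _ (by positivity)
  set B : ℝ := Real.exp (2 * C)
  have hB : 0 < B := Real.exp_pos _
  obtain ⟨ε₁, h0, h1⟩ : ∃ ε₁ : ℝ, 0 < ε₁ ∧ ε₁ ≤ η ^ 2 ∧ ε₁ ≤ 1 / 10000 ∧ ε₁ ≤ ε / 7 ∧
      ε₁ ≤ ε / (2 * N) ∧ ε₁ ≤ 1 / (2 * N * B) := by
    refine ⟨min (min (η ^ 2) (1 / 10000)) (min (min (ε / 7) (ε / (2 * N))) (1 / (2 * N * B))),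
      by positivity, ?_, ?_, ?_, ?_, ?_⟩ <;> simp
  obtain ⟨h1, h2, h3, h4, h5⟩ := h1
  rw [le_div_iff₀ (by positivity)] at h4 h5
  obtain ⟨t₀, ht₀, ht⟩ := exists_isTame hd hZ hw h0
  refine ⟨t₀, ht₀, fun t h6 h7 => ⟨ε, r₀, hd, hZ, rpow_pos_exponents h6 w, fun v hv => ?_,
    by linarith, hr₀, hr₁, hz₀.le, hz₀', by linarith, by nlinarith, fun v hv A hA hA' => ?_⟩⟩
  · refine ⟨hε, hε₁, ε₁, η, C, ht t h6 h7 v hv, h0.le, hη0.le, h1, h2, by linarith, hC v hv, ?_, ?_⟩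
    · change N * (ε₁ + 3 * η * (10 * C)) ≤ ε
      linarith
    · change N * (3 * η) ≤ ε
      have : N * η ≤ N * η * C := le_mul_of_one_le_right (by positivity) hC1
      nlinarith
  · have hT := ht t h6 h7 v hv
    have hterm : ∀ m ∈ others d v, Real.exp (defect (fun m => t ^ w m) v m) * A ^ icoord v m 1 ≤
        ε₁ * B := by
      intro m hm
      have hm' := (mem_others.1 hm).1
      refine mul_le_mul (hT.defect_le m hm) (zpow_le_exp hA hA' ?_)
        (zpow_nonneg (by linarith) _) h0.le
      rw [hv.icoord_cast hd hZ hm']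
      exact hC v hv m hm' 1
    refine (Finset.sum_le_card_nsmul _ _ _ hterm).trans_lt ?_
    rw [nsmul_eq_mul]
    have := mul_le_mul_of_nonneg_right (card_others_le d v) (mul_pos h0 hB).le
    change _ ≤ N * _ at this
    linarith

theorem Setup.isFattening {c : (Fin 3 → ℕ) → ℝ} {ε r₀ z₀ : ℝ} (S : Setup d Z c ε r₀ z₀) {δ : ℝ}
    (hδ : 2 * d * z₀ < δ) : IsFattening d Z δ (momentImage d c) := by
  obtain ⟨h, h1, h2, h3⟩ := S.exists_homeo
  exact ⟨S.closure_interior_eq, h, fun x => (h2 x).trans_lt hδ, h3,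
    S.isStrongDeformationRetract h3 h1, S.inter_boundary_subset h1⟩

end Fattening

end

theorem mainTheorem8 (d : ℕ) (hd : 1 ≤ d)
    (Z : Geometry.SimplicialComplex ℝ (Fin 3 → ℝ)) (hZ : Fattening.IsFullTriangulation d Z)
    (w : (Fin 3 → ℕ) → ℝ) (hw : Fattening.ConvexityCondition d Z w)
    (ε : ℝ) (hε : 0 < ε) :
    ∃ t₀ : ℝ, 0 < t₀ ∧ ∀ t : ℝ, 0 < t → t < t₀ →
      Fattening.IsFattening d Z ε
        (Fattening.momentImage d (fun m => t ^ w m)) := by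
  have hd0 : (0 : ℝ) < d := by exact_mod_cast hd
  -- A displacement `z₀` along the fibres moves points by at most `2 d z₀`, which this choice makes
  -- at most `ε / 2`.
  obtain ⟨t₀, ht₀, h⟩ := Fattening.exists_setup hd hZ hw
    (z₀ := min (1 / 4) (ε / (4 * d))) (by positivity) (min_le_left _ _)
  refine ⟨t₀, ht₀, fun t h1 h2 => ?_⟩
  obtain ⟨δ, r₀, S⟩ := h t h1 h2
  refine S.isFattening ?_
  calc 2 * d * min (1 / 4) (ε / (4 * d)) ≤ 2 * d * (ε / (4 * d)) :=
        mul_le_mul_of_nonneg_left (min_le_right _ _) (by positivity)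
    _ = ε / 2 := by field_simp; norm_num
    _ < ε := by linarith
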